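/- **Setup.** Let $G=PSL_2(\mathbb R)$ with Lie algebra $\mathfrak g=\mathfrak{sl}_2(\mathbb R)$ (isomorphic to $\mathfrak{su}(1,1)$), acting on $\mathbb RP^1=\mathbb R\cup\{\infty\}=\mathbb R/2\pi\mathbb Z$, where $\theta$ corresponds to $\tan(\theta/2)$; let $\tilde G$ be the universal cover of $G$, acting on $\mathbb R$ by lifts. A $\mathfrak g$-valued one-form $A$ stands for the connection $d-A$, with curvature $-dA+\frac12[A,A]$. Its parallel transport along a path is the endpoint $g=\Phi_1$ of the solution of $d\Phi_t/dt=a_t\Phi_t$, $\Phi_0=1$, where $a_t\,dt$ is the pullback of $A$ to $[0,1]$; the path $\Phi_t$ gives a natural lift $\tilde g\in\tilde G$ of $g$. $\mathcal P([0,1])$ is the set of triples $(A,\tilde\lambda_0,\tilde\lambda_1)$ with $A\in\Omega^1([0,1],\mathfrak g)$ and $\tilde\lambda_0,\tilde\lambda_1\in\mathbb R$ such that $\tilde\lambda_0-\tilde g^{-1}(\tilde\lambda_1)\in(0,2\pi)$, where $\tilde g$ is the lifted parallel transport of $A$. For $\tau>2$, $\mathcal P_\tau(S^1)$ is the set of $A\in\Omega^1(S^1,\mathfrak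 g)$, $S^1=\mathbb R/\mathbb Z$, whose holonomy $g$ is hyperbolic with $|\mathrm{tr}(g)|=\tau$, and whose natural lift $\tilde g$ has rotation number $1$ (the limit of $(\tilde g^n(\theta)-\theta)/2\pi n$). Let $l_{\mathrm{small}},l_{\mathrm{big}}\in\mathbb RP^1$ be the eigenlines of $g$ for the eigenvalues of absolute value $<1$ and $>1$, and $(l_{\mathrm{big}},l_{\mathrm{small}})$ the open interval of the circle running from $l_{\mathrm{big}}$ in positive direction to $l_{\mathrm{small}}$. Let $d\ge0$ and $S=\bar S\setminus\{\zeta_0,\dots,\zeta_{d+1}\}$, where $\bar S$ is a closed oriented disc, $\zeta_0,\dots,\zeta_d\in\partial\bar S$ are distinct and numbered in the (counterclockwise) cyclic order of $\partial\bar S$, and $\zeta_{d+1}$ is an interior point. Let $\partial_0S$ be the part of $\partial S$ between $\zeta_0$ and $\zeta_1$ (all of $\partial S$ if $d=0$). Fix ends: proper oriented smooth embeddings with disjoint images $\epsilon_0:\mathbb R^{\le0}\times[0,1]\to S$, $\epsilon_j:\mathbb R^{\ge0}\times[0,1]\to S$ ($1\le j\le d$) and $\epsilon_{d+1}:\mathbb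 R^{\ge0}\times S^1\to S\setminus\partial S$, with $\epsilon_j^{-1}(\partial S)=\{t=0,1\}$ for $j\le d$, converging to $\zeta_j$ as $s\to\pm\infty$. Fix $(A_j,\tilde\lambda_{j,0},\tilde\lambda_{j,1})\in\mathcal P([0,1])$ for $0\le j\le d$, and $A_{d+1}\in\mathcal P_\tau(S^1)$ for some $\tau>2$. $\mathcal P(S,\Sigma)$ is the space of pairs $(A,\tilde\lambda)$, with $A\in\Omega^1(S,\mathfrak g)$ and $\tilde\lambda\in C^\infty(\partial S,\mathbb R)$, such that: $A$ is flat; parallel transport along any part of $\partial S$ preserves the image of $\tilde\lambda$ in $\mathbb RP^1$; $\epsilon_j^*A$ is the pullback of $A_j$ by projection to the second coordinate, for $0\le j\le d+1$; and $\tilde\lambda(\epsilon_j(s,0))=\tilde\lambda_{j,0}$, $\tilde\lambda(\epsilon_j(s,1))=\tilde\lambda_{j,1}$ for $0\le j\le d$. Its weak homotopy type is understood through smooth finite-dimensional families: a map $f:\mathcal P(S,\Sigma)\to\mathbb Z$ is a weak homotopy equivalence if it is continuous on every smooth family of pairs parametrized by an open subset of some $\mathbb R^n$, it is onto, and every smooth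 family in a fibre of $f$ parametrized by the unit sphere in $\mathbb R^n$, $n\geq 0$, extends to a smooth family in the same fibre parametrized by the closed unit ball. **Statement.** 1. There is a weak homotopy equivalence $\mathcal P(S,\Sigma)\to\mathbb Z$. 2. For all $(A,\tilde\lambda)\in\mathcal P(S,\Sigma)$ and $s\ge0$, the holonomy of $A$ along the loop $t\mapsto\epsilon_{d+1}(s,t)$, with its natural lift, is that of $A_{d+1}$; it is hyperbolic, with $|\mathrm{tr}|=\tau$ and rotation number $1$. 3. Choose a base point $\bullet=\epsilon_{d+1}(s,0)$, a smooth path $c_0$ in $S$ from a point of $\partial_0S$ to $\bullet$, and an identification of the set of connected components of the preimage in $\mathbb R$ of $(l_{\mathrm{big}},l_{\mathrm{small}})$ (for the holonomy of $A_{d+1}$) with $\mathbb Z$, such that translation by $2\pi$ corresponds to adding $1$. Such choices exist. For all of them and all $(A,\tilde\lambda)\in\mathcal P(S,\Sigma)$, the image $\tilde\lambda_0^\dagger\in\mathbb R$ of $\tilde\lambda(c_0(0))$ under the lifted parallel transport along $c_0$ lies in the preimage of $(l_{\mathrm{big}},l_{\mathrm{small}})$. The resulting map $\mathcal P(S,\Sigma)\to\mathbb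 Z$, which records the component containing $\tilde\lambda_0^\dagger$, is a weak homotopy equivalence. 4. The maps obtained in 3 from two different choices differ by an additive constant. -/

import Mathlib

open scoped ContDiff Topology

noncomputable section

namespace FlatDisc

/-! ### Projective transformations of the line and their lifts

An element of `PSL₂(ℝ)` is represented by a real `2 × 2` matrix of determinant one (defined up to
sign). -/

/-- Real `2 × 2` matrices. -/
abbrev Mat : Type := Matrix (Fin 2) (Fin 2) ℝ

/-- The Lie algebra `𝔤 = 𝔰𝔩₂(ℝ)` of `PSL₂(ℝ)`, as a vector space with coordinates `(p, q, r)`. -/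
abbrev Lie : Type := ℝ × ℝ × ℝ

/-- The trace-free matrix with coordinates `(p, q, r)`. -/
def toMat (x : Lie) : Mat := !![x.1, x.2.1; x.2.2, -x.1]

/-- A vector spanning the line `[sin (θ/2) : cos (θ/2)]`. Sending `θ` to this line, that is to the
point `tan (θ/2)` of `ℝ ∪ {∞}`, is the covering `ℝ → ℝ/2πℤ = ℝP¹` with `π ↦ ∞`. -/
def dir (θ : ℝ) : Fin 2 → ℝ := ![Real.sin (θ / 2), Real.cos (θ / 2)]

/-- The projective transformation of `g` sends the point of `ℝP¹` below `θ` to the one below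
`θ'`. -/
def Sends (g : Mat) (θ θ' : ℝ) : Prop :=
  ∃ r : ℝ, r ≠ 0 ∧ g.mulVec (dir θ) = r • dir θ'

/-- `Φ` integrates the connection `d - a(t) dt` on `[0,1]`: `Φ 0 = 1` and `dΦ/dt = a Φ`. -/
def Integrates (a : ℝ → Lie) (Φ : ℝ → Mat) : Prop :=
  Φ 0 = 1 ∧ ∀ t ∈ Set.Icc (0 : ℝ) 1, ∀ i j : Fin 2,
    HasDerivWithinAt (fun t' => Φ t' i j) ((toMat (a t) * Φ t) i j) (Set.Icc 0 1) t

/-- `ψ` is the lift of the path `Φ` (which starts at the identity) to the universal cover, an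
element of the universal cover of `PSL₂(ℝ)` being regarded as a transformation of `ℝ` which lifts
a projective transformation of `ℝP¹`. -/
def LiftsPath (Φ : ℝ → Mat) (ψ : ℝ → ℝ → ℝ) : Prop :=
  ∀ θ : ℝ, ψ 0 θ = θ ∧ ContinuousOn (fun t => ψ t θ) (Set.Icc 0 1) ∧
    ∀ t ∈ Set.Icc (0 : ℝ) 1, Sends (Φ t) θ (ψ t θ)

/-- The parallel transport of `d - a(t) dt` along `[0,1]` is (the class of) `g`, and its natural
lift to the universal cover acts on `ℝ` by `g'`. -/
def IsTransport (a : ℝ → Lie) (g : Mat) (g' : ℝ → ℝ) : Prop :=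
  ∃ (Φ : ℝ → Mat) (ψ : ℝ → ℝ → ℝ), Integrates a Φ ∧ LiftsPath Φ ψ ∧ Φ 1 = g ∧ ψ 1 = g'

/-- The rotation number of a lifted transformation (a full turn of `ℝP¹` has length `2π`). -/
def HasRotationNumber (g' : ℝ → ℝ) (ρ : ℝ) : Prop :=
  ∀ θ : ℝ, Filter.Tendsto (fun n : ℕ => (g'^[n] θ - θ) / (2 * Real.pi * n)) Filter.atTop (𝓝 ρ)

/-- `θ` lies over the eigenline of `g` whose eigenvalue has absolute value `< 1`. -/
def OverSmall (g : Mat) (θ : ℝ) : Prop :=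
  ∃ μ : ℝ, |μ| < 1 ∧ g.mulVec (dir θ) = μ • dir θ

/-- `θ` lies over the eigenline of `g` whose eigenvalue has absolute value `> 1`. -/
def OverBig (g : Mat) (θ : ℝ) : Prop :=
  ∃ μ : ℝ, 1 < |μ| ∧ g.mulVec (dir θ) = μ • dir θ

/-- The preimage in `ℝ` of the open interval `(l_big, l_small)` of the circle `ℝP¹`, which starts
at `l_big` and runs in positive direction to `l_small`. -/
def bigSmall (g : Mat) : Set ℝ :=
  {θ | ∃ b s : ℝ, OverBig g b ∧ OverSmall g s ∧ b < θ ∧ θ < s ∧ s < b + 2 * Real.pi}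

/-! ### Data for the ends -/

/-- A point `(A, λ₀, λ₁)` of `𝒫([0,1])`, with `A = a(t) dt`. -/
structure IntervalDatum where
  a : ℝ → Lie
  l0 : ℝ
  l1 : ℝ
  smooth : ContDiffOn ℝ ∞ a (Set.Icc 0 1)
  position : ∃ (g : Mat) (g' : ℝ → ℝ), IsTransport a g g' ∧
    ∃ m : ℝ, g' m = l1 ∧ l0 - m ∈ Set.Ioo 0 (2 * Real.pi)

/-- A point `A = a(t) dt` of `𝒫_τ(S¹)`, where `S¹ = ℝ/ℤ`. -/
structure CircleDatum (τ : ℝ) where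
  a : ℝ → Lie
  smooth : ContDiff ℝ ∞ a
  periodic : ∀ t, a (t + 1) = a t
  holonomy : ∃ (g : Mat) (g' : ℝ → ℝ), IsTransport a g g' ∧ |g.trace| = τ ∧
    HasRotationNumber g' 1

/-! ### The surface -/

/-- The boundary point `e^{iφ}` of the closed unit disc. -/
def bpt (φ : ℝ) : ℂ := Complex.exp (φ * Complex.I)

/-- The range of the first coordinate of a strip-like end: the end with number `0` is negative,
the others are positive. -/
def halfLine {d : ℕ} (j : Fin (d + 1)) : Set ℝ := if j = 0 then Set.Iic 0 else Set.Ici 0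

/-- The direction in which the first coordinate of a strip-like end goes to infinity. -/
def endFilter {d : ℕ} (j : Fin (d + 1)) : Filter ℝ :=
  if j = 0 then Filter.atBot else Filter.atTop

/-- The domain of a strip-like end. -/
def stripDom {d : ℕ} (j : Fin (d + 1)) : Set (ℝ × ℝ) := halfLine j ×ˢ Set.Icc 0 1

/-- The universal cover of the domain `ℝ^{≥0} × ℝ/ℤ` of the interior end. -/
def cylDom : Set (ℝ × ℝ) := Set.Ici 0 ×ˢ Set.univ

/-- The derivative of `e` on `D`, at `p`, is an orientation-preserving isomorphism. -/
def OrientedImmersionAt (e : ℝ × ℝ → ℂ) (D : Set (ℝ × ℝ)) (p : ℝ × ℝ) : Prop :=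
  0 < ((starRingEnd ℂ) (fderivWithin ℝ e D p (1, 0)) * fderivWithin ℝ e D p (0, 1)).im

/-- The closed unit disc `|z| ≤ 1` without the points `ζ_j = e^{i α_j}` (`0 ≤ j ≤ d`) and `ζint`. -/
def surf {d : ℕ} (α : Fin (d + 1) → ℝ) (ζint : ℂ) : Set ℂ :=
  {z | ‖z‖ ≤ 1 ∧ z ≠ ζint ∧ ∀ j, z ≠ bpt (α j)}

/-- A disc with `d + 1` boundary punctures `ζ_j = e^{i α_j}`, numbered in their (counterclockwise)
cyclic order, and one interior puncture, together with a set of ends. -/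
structure PuncturedDisc (d : ℕ) where
  α : Fin (d + 1) → ℝ
  α_mono : StrictMono α
  α_lt : ∀ j, α j < α 0 + 2 * Real.pi
  ζint : ℂ
  ζint_mem : ‖ζint‖ < 1
  /-- the strip-like ends `ε_0, …, ε_d` -/
  ε : Fin (d + 1) → ℝ × ℝ → ℂ
  ε_mem : ∀ j, ∀ p ∈ stripDom j, ε j p ∈ surf α ζint
  ε_smooth : ∀ j, ContDiffOn ℝ ∞ (ε j) (stripDom j)
  ε_inj : ∀ j, Set.InjOn (ε j) (stripDom j)
  ε_oriented : ∀ j, ∀ p ∈ stripDom j, OrientedImmersionAt (ε j) (stripDom j) p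
  ε_boundary : ∀ j, ∀ p ∈ stripDom j, ‖ε j p‖ = 1 ↔ (p.2 = 0 ∨ p.2 = 1)
  ε_lim : ∀ j, TendstoUniformlyOn (fun s t => ε j (s, t)) (fun _ => bpt (α j)) (endFilter j)
    (Set.Icc 0 1)
  /-- the end `ε_{d+1}`, as a function of `s ≥ 0` and `t ∈ ℝ` of period one in `t` -/
  εint : ℝ × ℝ → ℂ
  εint_mem : ∀ p ∈ cylDom, εint p ∈ surf α ζint
  εint_interior : ∀ p ∈ cylDom, ‖εint p‖ < 1
  εint_smooth : ContDiffOn ℝ ∞ εint cylDom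
  εint_inj : ∀ p ∈ cylDom, ∀ q ∈ cylDom,
    εint p = εint q ↔ (p.1 = q.1 ∧ ∃ n : ℤ, q.2 = p.2 + n)
  εint_oriented : ∀ p ∈ cylDom, OrientedImmersionAt εint cylDom p
  εint_lim : TendstoUniformlyOn (fun s t => εint (s, t)) (fun _ => ζint) Filter.atTop Set.univ
  disjoint_strips : ∀ j k, j ≠ k → Disjoint (ε j '' stripDom j) (ε k '' stripDom k)
  disjoint_int : ∀ j, Disjoint (ε j '' stripDom j) (εint '' cylDom)

namespace PuncturedDisc

variable {d : ℕ} (S : PuncturedDisc d)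

/-- The underlying surface `S`, as a subset of `ℂ`. -/
def carrier : Set ℂ := surf S.α S.ζint

/-- The boundary `∂S`. -/
def bdry : Set ℂ := {z | z ∈ S.carrier ∧ ‖z‖ = 1}

/-- The angles `φ` with `e^{iφ} ∈ ∂S`. -/
def bdryAngles : Set ℝ := {φ | bpt φ ∈ S.bdry}

/-- The part `∂₀S` of the boundary lying between `ζ_0` and `ζ_1` (between `ζ_0` and `ζ_0`, if
`d = 0`). -/
def bdry0 : Set ℂ :=
  {z | ∃ φ : ℝ, z = bpt φ ∧ S.α 0 < φ ∧ φ < S.α 0 + 2 * Real.pi ∧ ∀ j, j ≠ 0 → φ < S.α j}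

end PuncturedDisc

/-- The pullback of the one-form `A` by the path `c`, defined on `[0,1]`. -/
def pullPath (A : ℂ → ℂ →L[ℝ] Lie) (c : ℝ → ℂ) (t : ℝ) : Lie :=
  A (c t) (derivWithin c (Set.Icc 0 1) t)

/-- The arc `t ↦ e^{i((1-t) φ₀ + t φ₁)}` of the unit circle. -/
def arc (φ₀ φ₁ : ℝ) (t : ℝ) : ℂ := bpt ((1 - t) * φ₀ + t * φ₁)

/-- `e^* A` is the pullback of `a(t) dt` by projection to the second coordinate. -/
def HasPullback (A : ℂ → ℂ →L[ℝ] Lie) (e : ℝ × ℝ → ℂ) (D : Set (ℝ × ℝ)) (a : ℝ → Lie) : Prop :=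
  ∀ p ∈ D, A (e p) (fderivWithin ℝ e D p (1, 0)) = 0 ∧
    A (e p) (fderivWithin ℝ e D p (0, 1)) = a p.2

/-- The connection `d - A` on `X ⊆ ℂ` has vanishing curvature `-dA + ½[A,A]`. -/
def IsFlatOn (A : ℂ → ℂ →L[ℝ] Lie) (X : Set ℂ) : Prop :=
  ∀ z ∈ X, ∀ u v : ℂ,
    -toMat (fderivWithin ℝ A X z u v - fderivWithin ℝ A X z v u) +
      (toMat (A z u) * toMat (A z v) - toMat (A z v) * toMat (A z u)) = 0

/-- The points `(A, λ)` of `𝒫(S,Σ)`. The one-form `A` on `S` and the function `λ` on `∂S` are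
extended by zero to `ℂ`, so that different points stand for different pairs. -/
structure Pair {d : ℕ} (S : PuncturedDisc d) (B : Fin (d + 1) → IntervalDatum) {τ : ℝ}
    (C : CircleDatum τ) where
  A : ℂ → ℂ →L[ℝ] Lie
  lam : ℂ → ℝ
  A_off : ∀ z, z ∉ S.carrier → A z = 0
  lam_off : ∀ z, z ∉ S.bdry → lam z = 0
  A_smooth : ContDiffOn ℝ ∞ A S.carrier
  lam_smooth : ContDiffOn ℝ ∞ (fun φ => lam (bpt φ)) S.bdryAngles
  flat : IsFlatOn A S.carrier
  /-- parallel transport along any part of `∂S` preserves the image of `lam` in `ℝP¹` -/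
  constant : ∀ φ₀ φ₁ : ℝ, φ₀ ≤ φ₁ → Set.Icc φ₀ φ₁ ⊆ S.bdryAngles →
    ∃ (g : Mat) (g' : ℝ → ℝ), IsTransport (pullPath A (arc φ₀ φ₁)) g g' ∧
      Sends g (lam (bpt φ₀)) (lam (bpt φ₁))
  ends_A : ∀ j, HasPullback A (S.ε j) (stripDom j) (B j).a
  ends_lam0 : ∀ j, ∀ s ∈ halfLine j, lam (S.ε j (s, 0)) = (B j).l0
  ends_lam1 : ∀ j, ∀ s ∈ halfLine j, lam (S.ε j (s, 1)) = (B j).l1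
  end_int : HasPullback A S.εint cylDom C.a

section

variable {d : ℕ} {S : PuncturedDisc d} {B : Fin (d + 1) → IntervalDatum} {τ : ℝ}
  {C : CircleDatum τ}

/-! ### Weak homotopy equivalences to `ℤ` -/

/-- `F` is a smooth map from `T ⊆ ℝⁿ` to `𝒫(S,Σ)`, that is, a smooth family of pairs. -/
def IsSmoothFamily {n : ℕ} (T : Set (EuclideanSpace ℝ (Fin n)))
    (F : EuclideanSpace ℝ (Fin n) → Pair S B C) : Prop :=
  ContDiffOn ℝ ∞ (fun p : EuclideanSpace ℝ (Fin n) × ℂ => (F p.1).A p.2) (T ×ˢ S.carrier) ∧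
  ContDiffOn ℝ ∞ (fun p : EuclideanSpace ℝ (Fin n) × ℝ => (F p.1).lam (bpt p.2))
    (T ×ˢ S.bdryAngles)

/-- `f : 𝒫(S,Σ) → ℤ` is a weak homotopy equivalence, in the sense of smooth families: it is
continuous on smooth families, and its fibres are non-empty and weakly contractible (every smooth
family over a sphere extends to the ball). -/
def IsWeakEquivInt (f : Pair S B C → ℤ) : Prop :=
  (∀ (n : ℕ) (U : Set (EuclideanSpace ℝ (Fin n))) (F : EuclideanSpace ℝ (Fin n) → Pair S B C),
    IsOpen U → IsSmoothFamily U F → ContinuousOn (fun x => f (F x)) U) ∧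
  Function.Surjective f ∧
  ∀ (m : ℤ) (n : ℕ) (F : EuclideanSpace ℝ (Fin n) → Pair S B C),
    IsSmoothFamily (Metric.sphere 0 1) F → (∀ x ∈ Metric.sphere 0 1, f (F x) = m) →
    ∃ F' : EuclideanSpace ℝ (Fin n) → Pair S B C,
      IsSmoothFamily (Metric.closedBall 0 1) F' ∧
      (∀ x ∈ Metric.sphere 0 1, F' x = F x) ∧
      ∀ x ∈ Metric.closedBall 0 1, f (F' x) = m

/-! ### The sheet map -/

/-- The preimage of `(l_big, l_small)`, for the holonomy of the connection on the interior end. -/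
def sheets (C : CircleDatum τ) : Set ℝ :=
  {θ | ∃ (g : Mat) (g' : ℝ → ℝ), IsTransport C.a g g' ∧ θ ∈ bigSmall g}

/-- The choices which enter the sheet map: a base point `ε_{d+1}(s,0)`, a path `c` in `S` from
`∂₀S` to the base point, and an identification of the set of connected components of the preimage
of `(l_big, l_small)` with `ℤ`, compatible with the covering action of `ℤ` by `2πℤ`. -/
structure SheetChoice (S : PuncturedDisc d) (C : CircleDatum τ) where
  s : ℝ
  s_nonneg : 0 ≤ s
  c : ℝ → ℂ
  c_smooth : ContDiffOn ℝ ∞ c (Set.Icc 0 1)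
  c_mem : ∀ t ∈ Set.Icc (0 : ℝ) 1, c t ∈ S.carrier
  c_zero : c 0 ∈ S.bdry0
  c_one : c 1 = S.εint (s, 0)
  ι : ConnectedComponents (sheets C) ≃ ℤ
  ι_shift : ∀ x y : sheets C, (y : ℝ) = x + 2 * Real.pi →
    ι (ConnectedComponents.mk y) = ι (ConnectedComponents.mk x) + 1

/-- `f` is the sheet map: parallel transport along `c` takes the boundary value at `c 0` to a
point of the preimage of `(l_big, l_small)`, and `f` records the component which contains it. -/
def IsSheetMap (K : SheetChoice S C) (f : Pair S B C → ℤ) : Prop :=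
  ∀ p : Pair S B C, ∃ (g : Mat) (g' : ℝ → ℝ), IsTransport (pullPath p.A K.c) g g' ∧
    ∃ h : g' (p.lam (K.c 0)) ∈ sheets C, f p = K.ι (ConnectedComponents.mk ⟨_, h⟩)

end

end FlatDisc

end

/-! A flat connection on the surface is encoded by its developing map on the universal cover, and
the boundary conditions by finitely many real numbers. In suitable coordinates all conditions become
convex or affine, apart from one integer.

The universal cover of SL₂(ℝ) is identified with the vector space `Cov` = ℂ × ℝ in such a way that
right multiplication by a lifted diagonal matrix is a translation (`gmul_gdiag`). The surface is
covered by polar coordinates (r, θ) around the interior puncture, and this cover is star-shaped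
about each point with 0 < r < 1. Hence a flat connection on the cover is the same as a map D to
`Cov`, normalised at a base point (`exists_dev`, `exists_form`).

A hyperbolic holonomy of rotation number one becomes h = `gdiag κ 1` with κ > 0 in a suitable frame
(`exists_diagonalization`); there 0 lies over l_big and π over l_small. The interior end winds once
around the puncture in negative direction (`lift_add_one`), so D comes from the surface when D(r, θ
- 2π) = D(r, θ) + h. On the interior end D is prescribed, and on the j-th strip it is prescribed up
to a right factor g_j (`IsAdapted`). For fixed g these conditions are affine in D, and they have a
solution depending smoothly on g (`exists_model`).

Transporting the boundary values into the base frame gives one real label x_k for each boundary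
component (`label`). Let m_j be the point which transport along the j-th interval takes to λ_{j,1}.
The condition at the end j is that g_j sends U_j to λ_{j,0} and V_j to m_j, where (U_j, V_j) is
(x_{j-1}, x_j) for j > 0 and (x_0, h⁻¹x_d) for j = 0. As λ_{j,0} - m_j lies in (0, 2π), so does U_j
- V_j. Conversely, for such labels the possible g_j form a line, parametrised by a dilation
(`act_twist`, `eq_twist`).

The inequalities say x_0 > … > x_d and h⁻¹x_d < x_0 < h⁻¹x_d + 2π. With y = h⁻¹x_d this gives hy =
x_d ≤ x_0 < y + 2π, so h moves y by less than a full turn, which happens only over (l_big, l_small).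
Consequently all labels lie in a single interval (2πm, 2πm + π), and in the coordinate c = cot(x/2)
they satisfy 0 < c_0 < … < c_d < e^{2κ}c_0 (`exists_conf`). For each m this is a non-empty convex
set. The integer m is `sheet`.

A pair in the sheet m thus amounts to a point of a convex set, d + 1 real dilations and a point of
an affine space. A family over a sphere is extended radially and cut off in each of these data to
fill the ball (`exists_filling`). Finally, parallel transport along any choice of path takes the
label x_0 into the interval of index m up to a shift independent of the pair, so every sheet map is
`sheet` plus a constant (`isSheetMap_iff`). -/

noncomputable section

namespace FlatDisc

/-! ### The universal cover of `SL₂(ℝ)` -/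

/-- A continuous function whose exponential is constant equal to one on a preconnected set is
constant. -/
theorem eq_zero_of_exp_eq_one {X : Type*} [TopologicalSpace X] {s : Set X} (hs : IsPreconnected s)
    {f : X → ℂ} (hf : ContinuousOn f s) (h1 : ∀ x ∈ s, Complex.exp (f x) = 1) {x₀ : X}
    (hx₀ : x₀ ∈ s) (h0 : f x₀ = 0) : ∀ x ∈ s, f x = 0 := by
  have hpi := Real.pi_pos
  have key : ∀ x ∈ s, ∃ n : ℤ, (f x).im / (2 * Real.pi) = n ∧ f x = n * (2 * Real.pi * Complex.I) := by
    intro x hx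
    obtain ⟨n, hn⟩ := Complex.exp_eq_one_iff.1 (h1 x hx)
    refine ⟨n, ?_, hn⟩
    rw [hn]
    simp
  have hc : ContinuousOn (fun x => (f x).im / (2 * Real.pi)) s :=
    (Complex.continuous_im.comp_continuousOn hf).div_const _
  intro x hx
  have himg : IsPreconnected ((fun x => (f x).im / (2 * Real.pi)) '' s) := hs.image _ hc
  have hsub : (fun x => (f x).im / (2 * Real.pi)) '' s ⊆ Set.range ((↑) : ℤ → ℝ) := by
    rintro _ ⟨y, hy, rfl⟩
    obtain ⟨n, hn, -⟩ := key y hy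
    exact ⟨n, hn.symm⟩
  have hss : ((fun x => (f x).im / (2 * Real.pi)) '' s).Subsingleton := by
    have hd : (Set.range ((↑) : ℤ → ℝ)).Countable := Set.countable_range _
    exact (hd.mono hsub).isTotallyDisconnected _ Set.Subset.rfl himg
  have := hss ⟨x, hx, rfl⟩ ⟨x₀, hx₀, rfl⟩
  obtain ⟨n, hn, hn'⟩ := key x hx
  simp only [h0, Complex.zero_im, zero_div] at this
  rw [hn] at this
  have : n = 0 := by exact_mod_cast this
  rw [hn', this]
  simp

/-- Coordinates on the universal cover of `SL₂(ℝ)`, acting on `ℝ² = ℂ`: the element `(L, b)` sends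
`1` to `exp L` and `i` to `(b + i) exp (- conj L)`. -/
abbrev Cov : Type := ℂ × ℝ

/-- The image of `1`. -/
def colOne (D : Cov) : ℂ := Complex.exp D.1

/-- The image of `i`. -/
def colI (D : Cov) : ℂ := (D.2 + Complex.I) * Complex.exp (-(starRingEnd ℂ) D.1)

/-- The linear action on `ℂ = ℝ²`. -/
def mv (D : Cov) (Z : ℂ) : ℂ := Z.re * colOne D + Z.im * colI D

/-- The triangular part of the linear action. -/
def tri (D : Cov) (Z : ℂ) : ℂ :=
  Z.re * Real.exp D.1.re + Z.im * ((D.2 + Complex.I) * Real.exp (-D.1.re))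

/-- An Iwasawa splitting: a triangular map with positive diagonal, followed by the rotation through
Im L. The rotation lifts explicitly, and the triangular factor has a lift near the identity through
the principal logarithm. -/
theorem exp_im_mul_tri (D : Cov) (Z : ℂ) : Complex.exp (D.1.im * Complex.I) * tri D Z = mv D Z := by
  have h1 : Complex.exp D.1 = Complex.exp (D.1.im * Complex.I) * Real.exp D.1.re := by
    rw [Complex.ofReal_exp, ← Complex.exp_add]
    congr 1
    apply Complex.ext <;> simp
  have h2 : Complex.exp (-(starRingEnd ℂ) D.1)
      = Complex.exp (D.1.im * Complex.I) * Real.exp (-D.1.re) := by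
    rw [Complex.ofReal_exp, ← Complex.exp_add]
    congr 1
    apply Complex.ext <;> simp
  rw [mv, tri, colOne, colI, h1, h2]
  ring

theorem mv_add (D : Cov) (Z Z' : ℂ) : mv D (Z + Z') = mv D Z + mv D Z' := by
  simp only [mv, Complex.add_re, Complex.add_im]; push_cast; ring

theorem mv_smul (D : Cov) (r : ℝ) (Z : ℂ) : mv D (r * Z) = r * mv D Z := by
  simp only [mv, Complex.re_ofReal_mul, Complex.im_ofReal_mul]; push_cast; ring

theorem tri_smul (D : Cov) (r : ℝ) (Z : ℂ) : tri D (r * Z) = r * tri D Z := by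
  simp only [tri, Complex.re_ofReal_mul, Complex.im_ofReal_mul]; push_cast; ring

@[simp] theorem mv_one (D : Cov) : mv D 1 = colOne D := by simp [mv]

@[simp] theorem mv_I (D : Cov) : mv D Complex.I = colI D := by simp [mv]

theorem conj_colOne_mul_colI (D : Cov) : (starRingEnd ℂ) (colOne D) * colI D = D.2 + Complex.I := by
  rw [colOne, colI, ← Complex.exp_conj, mul_left_comm, ← Complex.exp_add]
  simp

theorem colOne_ne_zero (D : Cov) : colOne D ≠ 0 := Complex.exp_ne_zero _

/-- The linear action has determinant one. -/
theorem im_conj_mv_mul_mv (D : Cov) (Z Z' : ℂ) :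
    ((starRingEnd ℂ) (mv D Z) * mv D Z').im = ((starRingEnd ℂ) Z * Z').im := by
  have h := conj_colOne_mul_colI D
  have h' := congrArg Complex.im h
  simp only [Complex.mul_im, Complex.conj_re, Complex.conj_im, Complex.add_im, Complex.ofReal_im,
    Complex.I_im, zero_add] at h'
  simp only [mv, Complex.mul_im, Complex.mul_re, Complex.conj_re, Complex.conj_im, Complex.add_re,
    Complex.add_im, Complex.ofReal_re, Complex.ofReal_im]
  linear_combination (Z.re * Z'.im - Z.im * Z'.re) * h'

theorem mv_ne_zero (D : Cov) {Z : ℂ} (hZ : Z ≠ 0) : mv D Z ≠ 0 := by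
  intro h
  have := im_conj_mv_mul_mv D Z (Complex.I * Z)
  rw [h] at this
  simp only [map_zero, zero_mul, Complex.zero_im, Complex.mul_im, Complex.mul_re, Complex.conj_re,
    Complex.conj_im, Complex.I_re, Complex.I_im] at this
  apply hZ
  apply Complex.ext <;> simp <;> nlinarith [sq_nonneg Z.re, sq_nonneg Z.im]

theorem mv_inj (D : Cov) {Z Z' : ℂ} (h : mv D Z = mv D Z') : Z = Z' := by
  by_contra hne
  apply mv_ne_zero D (sub_ne_zero.2 hne)
  have := mv_add D (Z - Z') Z'
  rw [sub_add_cancel, h] at this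
  exact (left_eq_add.1 (this.trans (add_comm _ _)))

/-- The eigenvalues of the triangular factor are positive, so it sends no vector to a non-positive
multiple of itself. Hence the principal logarithm of the quotient is smooth everywhere. -/
theorem tri_mem_slitPlane (D : Cov) (ℓ : ℂ) :
    tri D (Complex.exp ℓ) * Complex.exp (-ℓ) ∈ Complex.slitPlane := by
  rw [Complex.mem_slitPlane_iff]
  by_contra hcon
  push Not at hcon
  set w := tri D (Complex.exp ℓ) * Complex.exp (-ℓ) with hw
  have hw' : tri D (Complex.exp ℓ) = (w.re : ℂ) * Complex.exp ℓ := by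
    have : w = (w.re : ℂ) := by apply Complex.ext <;> simp [hcon.2]
    rw [← this, hw, mul_assoc, ← Complex.exp_add]; simp
  set Z := Complex.exp ℓ with hZ
  have hZ0 : Z ≠ 0 := Complex.exp_ne_zero _
  have him := congrArg Complex.im hw'
  have hre := congrArg Complex.re hw'
  simp only [tri, Complex.add_im, Complex.add_re, Complex.im_ofReal_mul, Complex.re_ofReal_mul,
    Complex.im_mul_ofReal, Complex.re_mul_ofReal, Complex.ofReal_im, Complex.ofReal_re,
    Complex.I_im, Complex.I_re] at him hre
  have e1 := Real.exp_pos D.1.re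
  have e2 := Real.exp_pos (-D.1.re)
  have hy : Z.im = 0 := by
    have : Z.im * (Real.exp (-D.1.re) - w.re) = 0 := by linear_combination him
    rcases mul_eq_zero.1 this with h | h
    · exact h
    · linarith [hcon.1]
  have hx : Z.re = 0 := by
    have : Z.re * (Real.exp D.1.re - w.re) = 0 := by
      rw [hy] at hre; linear_combination hre
    rcases mul_eq_zero.1 this with h | h
    · exact h
    · linarith [hcon.1]
  exact hZ0 (Complex.ext hx hy)

/-- The lift of the linear action through the exponential map. -/
def lift (D : Cov) (ℓ : ℂ) : ℂ :=
  ℓ + D.1.im * Complex.I + Complex.log (tri D (Complex.exp ℓ) * Complex.exp (-ℓ))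

theorem exp_lift (D : Cov) (ℓ : ℂ) : Complex.exp (lift D ℓ) = mv D (Complex.exp ℓ) := by
  rw [lift, Complex.exp_add, Complex.exp_log (Complex.slitPlane_ne_zero (tri_mem_slitPlane D ℓ)),
    ← exp_im_mul_tri, Complex.exp_add, Complex.exp_neg]
  field_simp [Complex.exp_ne_zero]

theorem contDiff_re {n : WithTop ℕ∞} : ContDiff ℝ n Complex.re := Complex.reCLM.contDiff
theorem contDiff_im {n : WithTop ℕ∞} : ContDiff ℝ n Complex.im := Complex.imCLM.contDiff
theorem contDiff_conj {n : WithTop ℕ∞} : ContDiff ℝ n (starRingEnd ℂ) :=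
  Complex.conjCLE.contDiff
theorem contDiff_ofReal {n : WithTop ℕ∞} : ContDiff ℝ n ((↑) : ℝ → ℂ) := Complex.ofRealCLM.contDiff
theorem contDiff_cexp {n : WithTop ℕ∞} : ContDiff ℝ n Complex.exp :=
  (Complex.contDiff_exp (𝕜 := ℂ)).restrict_scalars ℝ
theorem contDiffAt_clog {n : WithTop ℕ∞} {z : ℂ} (hz : z ∈ Complex.slitPlane) :
    ContDiffAt ℝ n Complex.log z := (Complex.contDiffAt_log hz).restrict_scalars ℝ

theorem contDiff_colOne {n : WithTop ℕ∞} : ContDiff ℝ n colOne := contDiff_cexp.comp contDiff_fst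

theorem contDiff_colI {n : WithTop ℕ∞} : ContDiff ℝ n colI :=
  ((contDiff_ofReal.comp contDiff_snd).add contDiff_const).mul
    (contDiff_cexp.comp (contDiff_conj.comp contDiff_fst).neg)

theorem contDiff_mv {n : WithTop ℕ∞} : ContDiff ℝ n (fun p : Cov × ℂ => mv p.1 p.2) :=
  ((contDiff_ofReal.comp (contDiff_re.comp contDiff_snd)).mul (contDiff_colOne.comp contDiff_fst)).add
    ((contDiff_ofReal.comp (contDiff_im.comp contDiff_snd)).mul (contDiff_colI.comp contDiff_fst))

theorem contDiff_tri {n : WithTop ℕ∞} : ContDiff ℝ n (fun p : Cov × ℂ => tri p.1 p.2) := by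
  have hα : ContDiff ℝ n (fun p : Cov × ℂ => p.1.1.re) :=
    contDiff_re.comp (contDiff_fst.comp contDiff_fst)
  exact ((contDiff_ofReal.comp (contDiff_re.comp contDiff_snd)).mul
    (contDiff_ofReal.comp (Real.contDiff_exp.comp hα))).add
    ((contDiff_ofReal.comp (contDiff_im.comp contDiff_snd)).mul
      (((contDiff_ofReal.comp (contDiff_snd.comp contDiff_fst)).add contDiff_const).mul
        (contDiff_ofReal.comp (Real.contDiff_exp.comp hα.neg))))

theorem contDiff_lift {n : WithTop ℕ∞} : ContDiff ℝ n (fun p : Cov × ℂ => lift p.1 p.2) := by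
  have h1 : ContDiff ℝ n (fun p : Cov × ℂ => tri p.1 (Complex.exp p.2) * Complex.exp (-p.2)) :=
    (contDiff_tri.comp (contDiff_fst.prodMk (contDiff_cexp.comp contDiff_snd))).mul
      (contDiff_cexp.comp contDiff_snd.neg)
  refine (contDiff_snd.add ((contDiff_ofReal.comp (contDiff_im.comp
    (contDiff_fst.comp contDiff_fst))).mul contDiff_const)).add ?_
  rw [contDiff_iff_contDiffAt]
  intro p
  exact (contDiffAt_clog (tri_mem_slitPlane p.1 p.2)).comp p h1.contDiffAt

theorem continuous_lift : Continuous (fun p : Cov × ℂ => lift p.1 p.2) :=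
  (contDiff_lift (n := 0)).continuous

theorem lift_add_real (D : Cov) (ℓ : ℂ) (r : ℝ) : lift D (ℓ + r) = lift D ℓ + r := by
  have : tri D (Complex.exp (ℓ + r)) * Complex.exp (-(ℓ + r))
      = tri D (Complex.exp ℓ) * Complex.exp (-ℓ) := by
    have : Complex.exp (ℓ + r) = (Real.exp r : ℝ) * Complex.exp ℓ := by
      rw [Complex.exp_add, Complex.ofReal_exp, mul_comm]
    rw [this, tri_smul, neg_add, Complex.exp_add, Complex.exp_neg (r : ℂ), Complex.ofReal_exp]
    field_simp [Complex.exp_ne_zero]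
  rw [lift, lift, this]; ring

theorem lift_add_pi (D : Cov) (ℓ : ℂ) : lift D (ℓ + Real.pi * Complex.I)
    = lift D ℓ + Real.pi * Complex.I := by
  have : tri D (Complex.exp (ℓ + Real.pi * Complex.I)) * Complex.exp (-(ℓ + Real.pi * Complex.I))
      = tri D (Complex.exp ℓ) * Complex.exp (-ℓ) := by
    have h : Complex.exp (ℓ + Real.pi * Complex.I) = (-1 : ℝ) * Complex.exp ℓ := by
      rw [Complex.exp_add, Complex.exp_pi_mul_I]; push_cast; ring
    rw [h, tri_smul, Complex.exp_neg (ℓ + _), h, Complex.exp_neg]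
    have := Complex.exp_ne_zero ℓ
    push_cast
    field_simp
  rw [lift, lift, this]; ring

theorem lift_add_int_pi (D : Cov) (ℓ : ℂ) (n : ℤ) : lift D (ℓ + n * (Real.pi * Complex.I))
    = lift D ℓ + n * (Real.pi * Complex.I) := by
  induction n using Int.induction_on with
  | zero => simp
  | succ k ih =>
    have := lift_add_pi D (ℓ + ((k : ℤ) : ℂ) * (Real.pi * Complex.I))
    rw [ih] at this
    push_cast at this ⊢
    rw [show ℓ + ((k : ℂ) + 1) * (Real.pi * Complex.I)
      = ℓ + k * (Real.pi * Complex.I) + Real.pi * Complex.I by ring, this]; ring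
  | pred k ih =>
    have := lift_add_pi D (ℓ + ((-(k : ℤ) - 1 : ℤ) : ℂ) * (Real.pi * Complex.I))
    rw [show ℓ + ((-(k : ℤ) - 1 : ℤ) : ℂ) * (Real.pi * Complex.I) + Real.pi * Complex.I
      = ℓ + ((-(k : ℤ) : ℤ) : ℂ) * (Real.pi * Complex.I) by push_cast; ring, ih] at this
    push_cast at this ⊢
    linear_combination -this

theorem tri_one (D : Cov) : tri D 1 = Real.exp D.1.re := by simp [tri]

theorem lift_zero (D : Cov) : lift D 0 = D.1 := by
  rw [lift, neg_zero, Complex.exp_zero, mul_one, tri_one, Complex.ofReal_exp,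
    ← Complex.ofReal_exp, ← Complex.ofReal_log (Real.exp_pos _).le, Real.log_exp]
  apply Complex.ext <;> simp

/-- The identity. -/
def gone : Cov := 0

@[simp] theorem mv_gone (Z : ℂ) : mv gone Z = Z := by
  apply Complex.ext <;> simp [mv, gone, colOne, colI]

@[simp] theorem lift_gone (ℓ : ℂ) : lift gone ℓ = ℓ := by
  have : ∀ Z, tri gone Z = Z := fun Z => by
    have h := exp_im_mul_tri gone Z
    rw [mv_gone, show (gone : Cov).1.im = 0 from rfl] at h
    simpa using h
  rw [lift, this, ← Complex.exp_add]; simp [gone]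

/-- Multiplication. -/
def gmul (D D' : Cov) : Cov :=
  (lift D D'.1, ((starRingEnd ℂ) (mv D (colOne D')) * mv D (colI D')).re)

theorem mv_gmul (D D' : Cov) (Z : ℂ) : mv (gmul D D') Z = mv D (mv D' Z) := by
  have h1 : colOne (gmul D D') = mv D (colOne D') := by
    rw [colOne, gmul, exp_lift]; rfl
  have h2 : colI (gmul D D') = mv D (colI D') := by
    have e : (starRingEnd ℂ) (mv D (colOne D')) * mv D (colI D') = (gmul D D').2 + Complex.I := by
      have him := im_conj_mv_mul_mv D (colOne D') (colI D')
      rw [conj_colOne_mul_colI] at him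
      apply Complex.ext
      · simp [gmul]
      · rw [him]; simp
    have e' := conj_colOne_mul_colI (gmul D D')
    rw [← e, h1] at e'
    refine mul_left_cancel₀ ?_ e'
    rw [← h1]
    exact (map_ne_zero _).2 (colOne_ne_zero _)
  rw [mv, h1, h2]
  conv_rhs => rw [mv.eq_1 D' Z, mv_add, mv_smul, mv_smul]

/-- The second coordinate is the real part of conj(D 1) · D i, so the linear action already
determines it. Only the branch of the logarithm in the first coordinate is extra information. -/
theorem cov_ext {D D' : Cov} (h1 : D.1 = D'.1) (h2 : ∀ Z, mv D Z = mv D' Z) : D = D' := by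
  refine Prod.ext h1 ?_
  have a := conj_colOne_mul_colI D
  have a' := conj_colOne_mul_colI D'
  rw [← mv_one, ← mv_I, h2, h2, mv_one, mv_I, a'] at a
  simpa using (congrArg Complex.re a).symm

theorem contDiff_gmul {n : WithTop ℕ∞} : ContDiff ℝ n (fun p : Cov × Cov => gmul p.1 p.2) := by
  have e1 : ContDiff ℝ n (fun p : Cov × Cov => mv p.1 (colOne p.2)) :=
    contDiff_mv.comp (contDiff_fst.prodMk (contDiff_colOne.comp contDiff_snd))
  have e2 : ContDiff ℝ n (fun p : Cov × Cov => mv p.1 (colI p.2)) :=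
    contDiff_mv.comp (contDiff_fst.prodMk (contDiff_colI.comp contDiff_snd))
  exact (contDiff_lift.comp (contDiff_fst.prodMk (contDiff_fst.comp contDiff_snd))).prodMk
    (contDiff_re.comp ((contDiff_conj.comp e1).mul e2))

/-- Identities between lifted maps reduce through this to identities between linear maps, together
with agreement at one point of a connected parameter space. -/
theorem lift_eq_of_continuous {X : Type*} [TopologicalSpace X] [PreconnectedSpace X]
    {f g : X → ℂ} (hf : Continuous f) (hg : Continuous g)
    (h : ∀ x, Complex.exp (f x) = Complex.exp (g x)) (x₀ : X) (h0 : f x₀ = g x₀) (x : X) :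
    f x = g x := by
  have := eq_zero_of_exp_eq_one (s := Set.univ) isPreconnected_univ (f := fun x => f x - g x)
    (hf.sub hg).continuousOn (fun x _ => by rw [Complex.exp_sub, h, div_self (Complex.exp_ne_zero _)])
    (Set.mem_univ x₀) (sub_eq_zero.2 h0) x (Set.mem_univ x)
  exact sub_eq_zero.1 this

/-- Both sides lift the same linear action. The group elements are allowed to vary as well, so that
the comparison can be made at the identity. -/
theorem lift_gmul (D D' : Cov) (ℓ : ℂ) : lift (gmul D D') ℓ = lift D (lift D' ℓ) := by
  have hc := continuous_lift
  have hm : Continuous (fun p : Cov × Cov => gmul p.1 p.2) := (contDiff_gmul (n := 0)).continuous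
  have h00 : gmul gone gone = gone := by
    refine cov_ext ?_ fun Z => by simp [mv_gmul]
    simp only [gmul, lift_gone]
  refine lift_eq_of_continuous (X := (Cov × Cov) × ℂ)
    (f := fun p => lift (gmul p.1.1 p.1.2) p.2) (g := fun p => lift p.1.1 (lift p.1.2 p.2))
    (hc.comp ((hm.comp continuous_fst).prodMk continuous_snd))
    (hc.comp ((continuous_fst.comp continuous_fst).prodMk
      (hc.comp ((continuous_snd.comp continuous_fst).prodMk continuous_snd))))
    (fun p => ?_) ((gone, gone), 0) ?_ ((D, D'), ℓ)
  · simp only [exp_lift, mv_gmul]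
  · simp [h00]

theorem gmul_assoc (A B C : Cov) : gmul (gmul A B) C = gmul A (gmul B C) := by
  refine cov_ext ?_ fun Z => by simp only [mv_gmul]
  rw [← lift_zero, ← lift_zero (gmul A _)]
  simp only [lift_gmul]

@[simp] theorem gmul_gone (D : Cov) : gmul D gone = D := by
  refine cov_ext ?_ fun Z => by simp [mv_gmul]
  rw [← lift_zero, lift_gmul, lift_gone, lift_zero]

@[simp] theorem gone_gmul (D : Cov) : gmul gone D = D := by
  refine cov_ext ?_ fun Z => by simp [mv_gmul]
  rw [← lift_zero, lift_gmul, lift_gone, lift_zero]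

/-- The inverse. -/
def ginv (D : Cov) : Cov :=
  gmul (((-D.1.re : ℝ) : ℂ), -D.2 * Real.exp (-(2 * D.1.re))) (((-D.1.im : ℝ) : ℂ) * Complex.I, 0)

theorem contDiff_ginv {n : WithTop ℕ∞} : ContDiff ℝ n ginv := by
  have hα : ContDiff ℝ n (fun p : Cov => p.1.re) := contDiff_re.comp contDiff_fst
  have hη : ContDiff ℝ n (fun p : Cov => p.1.im) := contDiff_im.comp contDiff_fst
  refine contDiff_gmul.comp (ContDiff.prodMk (ContDiff.prodMk ?_ ?_) (ContDiff.prodMk ?_ ?_))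
  · exact contDiff_ofReal.comp hα.neg
  · exact contDiff_snd.neg.mul (Real.contDiff_exp.comp (contDiff_const.mul hα).neg)
  · exact (contDiff_ofReal.comp hη.neg).mul contDiff_const
  · exact contDiff_const

/-- The factors of `exp_im_mul_tri` are undone in turn: the inverse first rotates through -Im L,
then applies the inverse triangular matrix. -/
theorem mv_mv_ginv (D : Cov) (Z : ℂ) : mv D (mv (ginv D) Z) = Z := by
  rw [ginv, mv_gmul]
  have h1 : ∀ Z, mv (((-D.1.im : ℝ) : ℂ) * Complex.I, 0) Z
      = Complex.exp (-(D.1.im * Complex.I)) * Z := by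
    intro Z
    rw [← exp_im_mul_tri]
    have : tri (((-D.1.im : ℝ) : ℂ) * Complex.I, 0) Z = Z := by
      apply Complex.ext <;> simp [tri]
    rw [this]; simp
  have h2 : ∀ Z, mv D (mv (((-D.1.re : ℝ) : ℂ), -D.2 * Real.exp (-(2 * D.1.re))) Z)
      = Complex.exp (D.1.im * Complex.I) * Z := by
    intro Z
    rw [← exp_im_mul_tri, ← exp_im_mul_tri (((-D.1.re : ℝ) : ℂ), _)]
    have e1 : Real.exp D.1.re * Real.exp (-D.1.re) = 1 := by rw [← Real.exp_add]; simp
    have e2 : Real.exp (-(2 * D.1.re)) = Real.exp (-D.1.re) * Real.exp (-D.1.re) := by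
      rw [← Real.exp_add]; ring_nf
    have : tri D (tri (((-D.1.re : ℝ) : ℂ), -D.2 * Real.exp (-(2 * D.1.re))) Z) = Z := by
      apply Complex.ext
      · simp only [tri, e2, Complex.ofReal_re, Complex.ofReal_im, neg_neg, Complex.add_re,
          Complex.add_im, Complex.re_ofReal_mul, Complex.im_ofReal_mul, Complex.re_mul_ofReal,
          Complex.im_mul_ofReal, Complex.I_re, Complex.I_im]
        linear_combination (Z.re - Z.im * D.2 * (Real.exp (-D.1.re)) * Real.exp (D.1.re)) * e1
      · simp only [tri, e2, Complex.ofReal_re, Complex.ofReal_im, neg_neg, Complex.add_re,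
          Complex.add_im, Complex.re_ofReal_mul, Complex.im_ofReal_mul, Complex.re_mul_ofReal,
          Complex.im_mul_ofReal, Complex.I_re, Complex.I_im]
        linear_combination Z.im * e1
    simp only [Complex.ofReal_im, Complex.ofReal_zero, zero_mul, Complex.exp_zero, one_mul]
    rw [this]
  rw [h2, h1, ← mul_assoc, ← Complex.exp_add]
  simp

theorem mv_ginv_mv (D : Cov) (Z : ℂ) : mv (ginv D) (mv D Z) = Z :=
  mv_inj D (mv_mv_ginv D _)

theorem ginv_gone : ginv gone = gone := by
  refine cov_ext ?_ fun Z => ?_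
  · rw [← lift_zero, ginv, lift_gmul]
    have h1 : (((-(gone : Cov).1.im : ℝ) : ℂ) * Complex.I, (0 : ℝ)) = gone := by simp [gone]
    have h2 : ((((-(gone : Cov).1.re : ℝ) : ℂ), -(gone : Cov).2 * Real.exp (-(2 * (gone : Cov).1.re)))
      : Cov) = gone := by simp [gone]
    rw [h1, h2, lift_gone, lift_gone]; rfl
  · have := mv_mv_ginv gone Z
    rwa [mv_gone] at this ⊢

theorem lift_lift_ginv (D : Cov) (ℓ : ℂ) : lift D (lift (ginv D) ℓ) = ℓ := by
  have hc := continuous_lift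
  have hi : Continuous ginv := (contDiff_ginv (n := 0)).continuous
  refine lift_eq_of_continuous (X := Cov × ℂ)
    (f := fun p => lift p.1 (lift (ginv p.1) p.2)) (g := fun p => p.2)
    (hc.comp (continuous_fst.prodMk (hc.comp ((hi.comp continuous_fst).prodMk continuous_snd))))
    continuous_snd (fun p => ?_) (gone, 0) ?_ (D, ℓ)
  · simp only [exp_lift, mv_mv_ginv]
  · simp [ginv_gone]

theorem lift_ginv_lift (D : Cov) (ℓ : ℂ) : lift (ginv D) (lift D ℓ) = ℓ := by
  have hc := continuous_lift
  have hi : Continuous ginv := (contDiff_ginv (n := 0)).continuous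
  refine lift_eq_of_continuous (X := Cov × ℂ)
    (f := fun p => lift (ginv p.1) (lift p.1 p.2)) (g := fun p => p.2)
    (hc.comp ((hi.comp continuous_fst).prodMk (hc.comp (continuous_fst.prodMk continuous_snd))))
    continuous_snd (fun p => ?_) (gone, 0) ?_ (D, ℓ)
  · simp only [exp_lift, mv_ginv_mv]
  · simp [ginv_gone]

@[simp] theorem gmul_ginv (D : Cov) : gmul D (ginv D) = gone := by
  refine cov_ext ?_ fun Z => by simp [mv_gmul, mv_mv_ginv]
  rw [← lift_zero, lift_gmul, lift_lift_ginv]; rfl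

@[simp] theorem ginv_gmul (D : Cov) : gmul (ginv D) D = gone := by
  refine cov_ext ?_ fun Z => by simp [mv_gmul, mv_ginv_mv]
  rw [← lift_zero, lift_gmul, lift_ginv_lift]; rfl

/-! ### The action on the line -/

/-- The action on the universal cover of the projective line. -/
def act (D : Cov) (θ : ℝ) : ℝ := 2 * (lift D ((θ / 2 : ℝ) * Complex.I)).im

theorem contDiff_act {n : WithTop ℕ∞} : ContDiff ℝ n (fun p : Cov × ℝ => act p.1 p.2) :=
  contDiff_const.mul (contDiff_im.comp (contDiff_lift.comp (contDiff_fst.prodMk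
    ((contDiff_ofReal.comp (contDiff_snd.div_const 2)).mul contDiff_const))))

theorem continuous_act : Continuous (fun p : Cov × ℝ => act p.1 p.2) :=
  (contDiff_act (n := 0)).continuous

theorem lift_im (D : Cov) (ℓ : ℂ) : (lift D ℓ).im = act D (2 * ℓ.im) / 2 := by
  have h : ℓ = ((2 * ℓ.im / 2 : ℝ) : ℂ) * Complex.I + (ℓ.re : ℝ) := by
    apply Complex.ext <;> simp
  conv_lhs => rw [h, lift_add_real]
  simp [act]

theorem act_gmul (D D' : Cov) (θ : ℝ) : act (gmul D D') θ = act D (act D' θ) := by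
  rw [act, lift_gmul, lift_im, lift_im]
  simp [mul_div_cancel₀]

@[simp] theorem act_gone (θ : ℝ) : act gone θ = θ := by simp [act, mul_div_cancel₀]

@[simp] theorem act_act_ginv (D : Cov) (θ : ℝ) : act D (act (ginv D) θ) = θ := by
  rw [← act_gmul]; simp

@[simp] theorem act_ginv_act (D : Cov) (θ : ℝ) : act (ginv D) (act D θ) = θ := by
  rw [← act_gmul]; simp

theorem act_add_int (D : Cov) (θ : ℝ) (n : ℤ) :
    act D (θ + n * (2 * Real.pi)) = act D θ + n * (2 * Real.pi) := by
  have : (((θ + n * (2 * Real.pi)) / 2 : ℝ) : ℂ) * Complex.I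
      = (θ / 2 : ℝ) * Complex.I + n * (Real.pi * Complex.I) := by push_cast; ring
  rw [act, this, lift_add_int_pi, act]
  simp
  ring

theorem act_zero (D : Cov) : act D 0 = 2 * D.1.im := by simp [act, lift_zero]

/-- The unit vector of angle `θ / 2`. -/
def cdir (θ : ℝ) : ℂ := Complex.exp ((θ / 2 : ℝ) * Complex.I)

theorem cdir_ne_zero (θ : ℝ) : cdir θ ≠ 0 := Complex.exp_ne_zero _

theorem mv_cdir (D : Cov) (θ : ℝ) : ∃ r : ℝ, 0 < r ∧ mv D (cdir θ) = r * cdir (act D θ) := by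
  refine ⟨Real.exp (lift D ((θ / 2 : ℝ) * Complex.I)).re, Real.exp_pos _, ?_⟩
  rw [cdir, ← exp_lift, cdir, Complex.ofReal_exp, ← Complex.exp_add]
  congr 1
  apply Complex.ext <;> simp [act]

/-- Since `cdir` uses the half angle, a unit vector determines the angle modulo 4π, and a line
determines it only modulo 2π. -/
theorem cdir_eq_smul {θ θ' r : ℝ} (hr : 0 < r) (h : cdir θ = r * cdir θ') :
    ∃ n : ℤ, θ = θ' + n * (4 * Real.pi) := by
  have hr1 : r = 1 := by
    have := congrArg norm h
    simp only [cdir, norm_mul, Complex.norm_exp_ofReal_mul_I, Complex.norm_real, Real.norm_eq_abs,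
      abs_of_pos hr] at this
    linarith
  rw [hr1, cdir, cdir, Complex.ofReal_one, one_mul, Complex.exp_eq_exp_iff_exists_int] at h
  obtain ⟨n, hn⟩ := h
  refine ⟨n, ?_⟩
  have := congrArg Complex.im hn
  simp at this
  linarith

theorem cdir_add_int (θ : ℝ) (n : ℤ) : cdir (θ + n * (2 * Real.pi)) = (-1) ^ n * cdir θ := by
  have : (((θ + n * (2 * Real.pi)) / 2 : ℝ) : ℂ) * Complex.I
      = (θ / 2 : ℝ) * Complex.I + n * (Real.pi * Complex.I) := by push_cast; ring
  rw [cdir, this, Complex.exp_add, Complex.exp_int_mul, Complex.exp_pi_mul_I, cdir, mul_comm]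

theorem cdir_eq_smul' {θ θ' r : ℝ} (h : cdir θ = r * cdir θ') :
    ∃ n : ℤ, θ = θ' + n * (2 * Real.pi) := by
  rcases lt_trichotomy r 0 with hr | hr | hr
  · have h2 : cdir (θ + (1 : ℤ) * (2 * Real.pi)) = ((-r : ℝ) : ℂ) * cdir θ' := by
      rw [cdir_add_int, h]; push_cast; ring
    obtain ⟨n, hn⟩ := cdir_eq_smul (neg_pos.2 hr) h2
    refine ⟨2 * n - 1, ?_⟩
    push_cast at hn ⊢
    linarith
  · rw [hr] at h; simp [cdir_ne_zero] at h
  · obtain ⟨n, hn⟩ := cdir_eq_smul hr h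
    refine ⟨2 * n, ?_⟩
    push_cast
    linarith

theorem act_injective (D : Cov) : Function.Injective (act D) := fun θ θ' h => by
  rw [← act_ginv_act D θ, h, act_ginv_act]

/-- A continuous injection of the line is strictly monotone; commuting with translation by 2π rules
out the decreasing case. -/
theorem act_strictMono (D : Cov) : StrictMono (act D) := by
  have hc : Continuous (act D) := continuous_act.comp (Continuous.prodMk_right D)
  rcases hc.strictMono_of_inj (act_injective D) with h | h
  · exact h
  · have h1 := h (show (0 : ℝ) < 0 + (1 : ℤ) * (2 * Real.pi) by simp [Real.pi_pos])
    rw [act_add_int] at h1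
    simp at h1
    linarith [Real.pi_pos]

/-- The element which acts by a diagonal matrix, followed by translation by `2πn`. -/
def gdiag (r : ℝ) (n : ℤ) : Cov := ((r : ℂ) + n * (Real.pi * Complex.I), 0)

theorem mv_gdiag (r : ℝ) (n : ℤ) (Z : ℂ) : mv (gdiag r n) Z =
    (-1) ^ n * (Z.re * Real.exp r + Z.im * Real.exp (-r) * Complex.I) := by
  rw [← exp_im_mul_tri]
  have : (gdiag r n).1.im * Complex.I = n * (Real.pi * Complex.I) := by
    simp [gdiag]; ring
  rw [this, Complex.exp_int_mul, Complex.exp_pi_mul_I, tri]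
  simp [gdiag]
  ring_nf
  simp

/-- This is the reason for the choice of coordinates. Multiplying the column D 1 by ±e^r and D i by
±e^{-r} adds r + nπi to the logarithm and leaves the real coordinate unchanged. Equivariance under a
diagonal holonomy is therefore an affine condition. -/
theorem gmul_gdiag (D : Cov) (r : ℝ) (n : ℤ) : gmul D (gdiag r n) = D + gdiag r n := by
  refine Prod.ext ?_ ?_
  · simp only [gmul, gdiag, Prod.fst_add]
    have := lift_add_int_pi D (0 + r) n
    rw [lift_add_real, lift_zero, zero_add] at this
    rw [this, add_assoc]
  · have h1 : mv D (colOne (gdiag r n)) = (-1) ^ n * (Real.exp r * colOne D) := by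
      rw [← mv_one, mv_gdiag]
      rcases Int.even_or_odd n with h | h
      · simp only [h.neg_one_zpow]
        have := mv_smul D (Real.exp r) 1
        simpa using this
      · simp only [h.neg_one_zpow]
        have := mv_smul D (-Real.exp r) 1
        simpa using this
    have h2 : mv D (colI (gdiag r n)) = (-1) ^ n * (Real.exp (-r) * colI D) := by
      rw [← mv_I, mv_gdiag]
      rcases Int.even_or_odd n with h | h
      · simp only [h.neg_one_zpow]
        have := mv_smul D (Real.exp (-r)) Complex.I
        simpa using this
      · simp only [h.neg_one_zpow]
        have := mv_smul D (-Real.exp (-r)) Complex.I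
        simpa using this
    have hsq : ((-1 : ℂ) ^ n) * (-1) ^ n = 1 := by
      rw [← mul_zpow]; simp
    have hee : (Real.exp r : ℂ) * Real.exp (-r) = 1 := by
      rw [← Complex.ofReal_mul, ← Real.exp_add]; simp
    have : (starRingEnd ℂ) (mv D (colOne (gdiag r n))) * mv D (colI (gdiag r n))
        = D.2 + Complex.I := by
      rw [h1, h2, ← conj_colOne_mul_colI]
      simp only [map_mul, map_zpow₀, map_neg, map_one, Complex.conj_ofReal]
      linear_combination ((Real.exp r : ℂ) * Real.exp (-r) * (starRingEnd ℂ) (colOne D) * colI D) * hsq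
        + ((starRingEnd ℂ) (colOne D) * colI D) * hee
    change ((starRingEnd ℂ) (mv D (colOne (gdiag r n))) * mv D (colI (gdiag r n))).re = D.2 + 0
    rw [this]
    simp

theorem act_gdiag_zero (r : ℝ) (n : ℤ) : act (gdiag r n) 0 = n * (2 * Real.pi) := by
  rw [act_zero]; simp [gdiag]; ring

/-- The point of `(2πm, 2πm + 2π)` over the line spanned by `c + i`. -/
def xof (m : ℤ) (c : ℝ) : ℝ := m * (2 * Real.pi) + Real.pi - 2 * Real.arctan c

theorem cdir_xof (m : ℤ) (c : ℝ) :
    cdir (xof m c) = (-1) ^ m * (((Real.sqrt (1 + c ^ 2))⁻¹ : ℝ) * (c + Complex.I)) := by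
  have : xof m c = (Real.pi - 2 * Real.arctan c) + m * (2 * Real.pi) := by rw [xof]; ring
  rw [this, cdir_add_int, cdir, Complex.exp_mul_I, ← Complex.ofReal_cos, ← Complex.ofReal_sin]
  have h : (Real.pi - 2 * Real.arctan c) / 2 = Real.pi / 2 - Real.arctan c := by ring
  rw [h, Real.cos_pi_div_two_sub, Real.sin_pi_div_two_sub, Real.sin_arctan, Real.cos_arctan]
  push_cast
  ring

theorem continuous_xof (m : ℤ) : Continuous (xof m) :=
  continuous_const.sub (continuous_const.mul Real.continuous_arctan)

theorem contDiff_xof {n : WithTop ℕ∞} (m : ℤ) : ContDiff ℝ n (xof m) :=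
  contDiff_const.sub (contDiff_const.mul Real.contDiff_arctan)

theorem xof_strictAnti (m : ℤ) : StrictAnti (xof m) := fun a b h => by
  have := Real.arctan_strictMono h
  simp only [xof]; linarith

theorem xof_mem (m : ℤ) (c : ℝ) :
    m * (2 * Real.pi) < xof m c ∧ xof m c < m * (2 * Real.pi) + 2 * Real.pi := by
  have h1 := Real.arctan_lt_pi_div_two c
  have h2 := Real.neg_pi_div_two_lt_arctan c
  constructor <;> simp only [xof] <;> linarith

theorem xof_add_one (m : ℤ) (c : ℝ) : xof (m + 1) c = xof m c + 2 * Real.pi := by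
  simp only [xof]; push_cast; ring

/-- The cotangent coordinate. -/
def cof (m : ℤ) (x : ℝ) : ℝ := Real.tan ((m * (2 * Real.pi) + Real.pi - x) / 2)

theorem cof_xof (m : ℤ) (c : ℝ) : cof m (xof m c) = c := by
  have : (m * (2 * Real.pi) + Real.pi - xof m c) / 2 = Real.arctan c := by rw [xof]; ring
  rw [cof, this, Real.tan_arctan]

theorem xof_cof {m : ℤ} {x : ℝ} (h1 : m * (2 * Real.pi) < x)
    (h2 : x < m * (2 * Real.pi) + 2 * Real.pi) : xof m (cof m x) = x := by
  rw [xof, cof, Real.arctan_tan] <;> linarith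

theorem contDiffAt_cof {n : WithTop ℕ∞} {m : ℤ} {x : ℝ} (h1 : m * (2 * Real.pi) < x)
    (h2 : x < m * (2 * Real.pi) + 2 * Real.pi) : ContDiffAt ℝ n (cof m) x := by
  have : Real.cos ((m * (2 * Real.pi) + Real.pi - x) / 2) ≠ 0 :=
    (Real.cos_pos_of_mem_Ioo ⟨by linarith, by linarith⟩).ne'
  exact (Real.contDiffAt_tan.2 this).comp x
    ((contDiffAt_const.sub contDiffAt_id).div_const 2)

theorem exists_act_eq {D : Cov} {θ θ' r : ℝ} (h : mv D (cdir θ) = r * cdir θ') :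
    ∃ n : ℤ, act D θ = θ' + n * (2 * Real.pi) := by
  obtain ⟨s, hs, hs'⟩ := mv_cdir D θ
  apply cdir_eq_smul' (r := s⁻¹ * r)
  rw [h] at hs'
  have : (s : ℂ) ≠ 0 := by exact_mod_cast hs.ne'
  push_cast
  rw [mul_assoc, hs', inv_mul_cancel_left₀ this]

/-- A continuous function with values in `2πℤ` on a preconnected set is constant. -/
theorem const_of_int_mul {X : Type*} [TopologicalSpace X] {s : Set X} (hs : IsPreconnected s)
    {f : X → ℝ} (hf : ContinuousOn f s) (h1 : ∀ x ∈ s, ∃ n : ℤ, f x = n * (2 * Real.pi)) {x₀ : X}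
    (hx₀ : x₀ ∈ s) (h0 : f x₀ = 0) : ∀ x ∈ s, f x = 0 := by
  intro x hx
  have := eq_zero_of_exp_eq_one hs (f := fun x => (f x : ℂ) * Complex.I)
    ((Complex.continuous_ofReal.comp_continuousOn hf).mul continuousOn_const) (fun x hx => by
      obtain ⟨n, hn⟩ := h1 x hx
      rw [Complex.exp_eq_one_iff]
      exact ⟨n, by rw [hn]; push_cast; ring⟩) hx₀ (by rw [h0]; simp) x hx
  simpa using this

/-- The diagonal matrix scales the cotangent coordinate by e^{2r}, which settles the formula modulo
2π. The discrepancy is continuous in r and vanishes at r = 0. -/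
theorem act_gdiag_xof (r : ℝ) (n m : ℤ) (c : ℝ) :
    act (gdiag r n) (xof m c) = xof (m + n) (Real.exp (2 * r) * c) := by
  have hcont : Continuous (fun r : ℝ => act (gdiag r n) (xof m c)
      - xof (m + n) (Real.exp (2 * r) * c)) := by
    have : Continuous (fun r : ℝ => gdiag r n) :=
      (Complex.continuous_ofReal.add continuous_const).prodMk continuous_const
    exact (continuous_act.comp (this.prodMk continuous_const)).sub
      ((continuous_xof _).comp (by fun_prop))
  have h := const_of_int_mul (s := Set.univ) isPreconnected_univ hcont.continuousOn (fun r _ => by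
      have : ∃ k : ℝ, mv (gdiag r n) (cdir (xof m c)) =
          k * cdir (xof (m + n) (Real.exp (2 * r) * c)) := by
        refine ⟨Real.exp (-r) * (Real.sqrt (1 + c ^ 2))⁻¹ *
          Real.sqrt (1 + (Real.exp (2 * r) * c) ^ 2), ?_⟩
        have hs : Real.sqrt (1 + (Real.exp (2 * r) * c) ^ 2) ≠ 0 := by positivity
        have hs' : (Real.sqrt (1 + (Real.exp (2 * r) * c) ^ 2) : ℂ) *
          (Real.sqrt (1 + (Real.exp (2 * r) * c) ^ 2) : ℂ)⁻¹ = 1 :=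
          mul_inv_cancel₀ (by exact_mod_cast hs)
        have e2 : Real.exp (2 * r) * Real.exp (-r) = Real.exp r := by
          rw [← Real.exp_add]; ring_nf
        have e2' : (Real.exp (2 * r) : ℂ) * Real.exp (-r) = Real.exp r := by exact_mod_cast e2
        have e3 : (-1 : ℂ) ^ m = ((-1 : ℝ) ^ m : ℝ) := by push_cast; rfl
        rw [cdir_xof, cdir_xof, mv_gdiag, zpow_add₀ (by norm_num), e3]
        simp only [Complex.re_ofReal_mul, Complex.im_ofReal_mul, Complex.add_re, Complex.add_im,
          Complex.ofReal_re, Complex.ofReal_im, Complex.I_re, Complex.I_im]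
        simp only [Complex.ofReal_mul, Complex.ofReal_inv,
          add_zero, zero_add, mul_one]
        linear_combination (((-1 : ℝ) ^ m : ℝ) : ℂ) * (-1) ^ n * (Real.sqrt (1 + c ^ 2) : ℂ)⁻¹ * (-c * e2' -
          Real.exp (-r) * (Real.exp (2 * r) * c + Complex.I) * hs')
      obtain ⟨k, hk⟩ := this
      obtain ⟨j, hj⟩ := exists_act_eq hk
      exact ⟨j, by rw [hj]; ring⟩) (Set.mem_univ (0 : ℝ)) ?_ r (Set.mem_univ r)
  · exact sub_eq_zero.1 h
  · have : gdiag 0 n = gmul gone (gdiag 0 n) := by simp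
    have h2 : act (gdiag 0 n) (xof m c) = xof m c + n * (2 * Real.pi) := by
      have : lift (gdiag 0 n) ((xof m c / 2 : ℝ) * Complex.I)
          = (xof m c / 2 : ℝ) * Complex.I + n * (Real.pi * Complex.I) := by
        have ht : ∀ Z, tri (gdiag 0 n) Z = Z := fun Z => by
          apply Complex.ext <;> simp [tri, gdiag]
        rw [lift, ht, ← Complex.exp_add]
        simp [gdiag]
        ring
      rw [act, this]
      simp; ring
    rw [h2]
    simp [xof]
    ring

/-- The normalized element which sends `0` to `x'` and `π` to `x`. -/
def gpair (x x' : ℝ) : Cov := (((x' / 2 : ℝ) : ℂ) * Complex.I, Real.tan ((Real.pi - (x - x')) / 2))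

theorem act_gpair_zero (x x' : ℝ) : act (gpair x x') 0 = x' := by
  rw [act_zero]; simp [gpair, mul_div_cancel₀]

/-- Before the rotation by x'/2, the vector i goes to b + i, whose argument is π/2 - arctan b. The
tangent in `gpair` is chosen to make this equal to (x - x')/2. -/
theorem act_gpair_pi {x x' : ℝ} (h1 : 0 < x - x') (h2 : x - x' < 2 * Real.pi) :
    act (gpair x x') Real.pi = x := by
  have hE : Complex.exp ((Real.pi / 2 : ℝ) * Complex.I) = Complex.I := by
    push_cast; exact Complex.exp_pi_div_two_mul_I
  set b := Real.tan ((Real.pi - (x - x')) / 2) with hb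
  have ht : tri (gpair x x') Complex.I * (Complex.I)⁻¹ = ((1 : ℝ) : ℂ) + ((-b : ℝ) : ℂ) * Complex.I := by
    rw [Complex.inv_I]
    apply Complex.ext <;> simp [tri, gpair, ← hb]
  have harg : Complex.arg (((1 : ℝ) : ℂ) + ((-b : ℝ) : ℂ) * Complex.I) = - Real.arctan b := by
    rw [Complex.arg_of_re_nonneg (by simp), Complex.add_im]
    rw [← Real.arctan_neg, Real.arctan_eq_arcsin]
    have hn : ‖((1 : ℝ) : ℂ) + ((-b : ℝ) : ℂ) * Complex.I‖ = Real.sqrt (1 + b ^ 2) := by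
      rw [Complex.norm_add_mul_I]; ring_nf
    rw [hn]
    simp
  rw [act, lift, hE, Complex.exp_neg, hE, ht, Complex.add_im, Complex.log_im, harg, hb,
    Real.arctan_tan (by linarith) (by linarith)]
  simp [gpair]
  ring

theorem contDiffAt_gpair {n : WithTop ℕ∞} {x x' : ℝ} (h1 : 0 < x - x') (h2 : x - x' < 2 * Real.pi) :
    ContDiffAt ℝ n (fun p : ℝ × ℝ => gpair p.1 p.2) (x, x') := by
  have : Real.cos ((Real.pi - (x - x')) / 2) ≠ 0 :=
    (Real.cos_pos_of_mem_Ioo ⟨by linarith, by linarith⟩).ne'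
  refine ContDiffAt.prodMk ?_ ?_
  · exact (contDiff_ofReal.contDiffAt.comp _ (contDiffAt_snd.div_const 2)).mul contDiffAt_const
  · exact (Real.contDiffAt_tan.2 this).comp (x, x') (f := fun p : ℝ × ℝ => (Real.pi - (p.1 - p.2)) / 2)
      ((contDiffAt_const.sub (contDiffAt_fst.sub contDiffAt_snd)).div_const 2)

/-- The stabilizer of `0` and `π`. -/
theorem eq_gdiag_of_act {g : Cov} (h0 : act g 0 = 0) (hpi : act g Real.pi = Real.pi) :
    g = gdiag g.1.re 0 := by
  have him : g.1.im = 0 := by rw [act_zero] at h0; linarith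
  have hb : g.2 = 0 := by
    obtain ⟨r, hr, h⟩ := mv_cdir g Real.pi
    have hE : cdir Real.pi = Complex.I := by
      rw [cdir]; push_cast; exact Complex.exp_pi_div_two_mul_I
    rw [hpi, hE, mv_I] at h
    have h2 := conj_colOne_mul_colI g
    have hone : colOne g = Real.exp g.1.re := by
      rw [colOne, Complex.ofReal_exp]; congr 1; apply Complex.ext <;> simp [him]
    rw [h, hone] at h2
    have := congrArg Complex.re h2
    simpa using this.symm
  refine Prod.ext ?_ hb
  apply Complex.ext <;> simp [gdiag, him]

theorem act_gdiag_zero_pi (r : ℝ) : act (gdiag r 0) Real.pi = Real.pi := by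
  have := act_gdiag_xof r 0 0 0
  simpa [xof] using this

/-! ### Linear differential equations with parameters -/

section Curry

/-- Continuous functions on the unit interval. -/
def CI (F : Type) [NormedAddCommGroup F] : Type := C(unitInterval, F)

namespace CI

variable {F : Type} [NormedAddCommGroup F]

instance : NormedAddCommGroup (CI F) := inferInstanceAs (NormedAddCommGroup C(unitInterval, F))
instance [NormedSpace ℝ F] : NormedSpace ℝ (CI F) := inferInstanceAs (NormedSpace ℝ C(unitInterval, F))
instance [CompleteSpace F] : CompleteSpace (CI F) := inferInstanceAs (CompleteSpace C(unitInterval, F))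
instance : FunLike (CI F) unitInterval F := inferInstanceAs (FunLike C(unitInterval, F) unitInterval F)
instance : ContinuousMapClass (CI F) unitInterval F :=
  inferInstanceAs (ContinuousMapClass C(unitInterval, F) unitInterval F)

/-- A continuous function on the unit interval. -/
def mk (f : unitInterval → F) (hf : Continuous f) : CI F := (⟨f, hf⟩ : C(unitInterval, F))

@[simp] theorem mk_apply (f : unitInterval → F) (hf : Continuous f) (t : unitInterval) :
    mk f hf t = f t := rfl
theorem continuous (g : CI F) : Continuous g := map_continuous g
@[ext] theorem ext {f g : CI F} (h : ∀ t, f t = g t) : f = g := DFunLike.ext _ _ h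
@[simp] theorem add_apply (f g : CI F) (t : unitInterval) : (f + g) t = f t + g t := rfl
@[simp] theorem sub_apply (f g : CI F) (t : unitInterval) : (f - g) t = f t - g t := rfl
@[simp] theorem smul_apply [NormedSpace ℝ F] (c : ℝ) (f : CI F) (t : unitInterval) :
    (c • f) t = c • f t := rfl
theorem norm_le (f : CI F) {C : ℝ} (hC : 0 ≤ C) : ‖f‖ ≤ C ↔ ∀ t, ‖f t‖ ≤ C :=
  ContinuousMap.norm_le (α := unitInterval) (E := F) f hC
theorem norm_coe_le_norm (f : CI F) (t : unitInterval) : ‖f t‖ ≤ ‖f‖ :=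
  ContinuousMap.norm_coe_le_norm (α := unitInterval) (E := F) f t

/-- Evaluation. -/
def evalCLM [NormedSpace ℝ F] (t : unitInterval) : CI F →L[ℝ] F :=
  LinearMap.mkContinuous ⟨⟨fun f => f t, fun _ _ => rfl⟩, fun _ _ => rfl⟩ 1 fun f => by
    rw [one_mul]; exact f.norm_coe_le_norm t

end CI

variable {E : Type} [NormedAddCommGroup E] [NormedSpace ℝ E]

open Classical in
/-- A function on `E × [0,1]`, as a function on `E` with values in continuous functions. -/
def curryI {F : Type} [NormedAddCommGroup F] (f : E × ℝ → F) (p : E) : CI F :=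
  if h : Continuous (fun t : unitInterval => f (p, t)) then CI.mk _ h else 0

omit [NormedSpace ℝ E] in
theorem curryI_apply {F : Type} [NormedAddCommGroup F] {P : Set E} {f : E × ℝ → F}
    (hf : ContinuousOn f (P ×ˢ Set.Icc 0 1)) {p : E} (hp : p ∈ P) (t : unitInterval) :
    curryI f p t = f (p, t) := by
  have h : Continuous (fun t : unitInterval => f (p, t)) :=
    hf.comp_continuous (by fun_prop) fun t => ⟨hp, t.2⟩
  rw [curryI, dif_pos h]; rfl

omit [NormedSpace ℝ E] in
theorem continuousOn_curryI {F : Type} [NormedAddCommGroup F] {P : Set E} {f : E × ℝ → F}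
    (hf : ContinuousOn f (P ×ˢ Set.Icc 0 1)) : ContinuousOn (curryI f) P := by
  rw [continuousOn_iff_continuous_domRestrict]
  let g : C(P × unitInterval, F) := ⟨fun q => f (q.1, q.2),
    hf.comp_continuous (by fun_prop) fun q => ⟨q.1.2, q.2.2⟩⟩
  have : P.domRestrict (curryI f) = fun p => (g.curry p : CI F) := by
    ext p t
    exact curryI_apply hf p.2 t
  rw [this]
  exact g.curry.continuous

variable [FiniteDimensional ℝ E]

/-- Induction on the order, with the target space varying: the derivative of the curried map is the
curried partial derivative. The remainder estimate is uniform in t, by the mean value inequality and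
continuity of the curried derivative in the supremum norm. -/
theorem contDiffOn_curryI {P : Set E} (hP : Convex ℝ P) (hu : UniqueDiffOn ℝ P) (n : ℕ) :
    ∀ {F : Type} [NormedAddCommGroup F] [NormedSpace ℝ F] (f : E × ℝ → F),
      ContDiffOn ℝ n f (P ×ˢ Set.Icc 0 1) → ContDiffOn ℝ n (curryI f) P := by
  have huI : UniqueDiffOn ℝ (P ×ˢ Set.Icc (0 : ℝ) 1) := hu.prod (uniqueDiffOn_Icc zero_lt_one)
  induction n with
  | zero =>
    intro F _ _ f hf
    rw [Nat.cast_zero, contDiffOn_zero] at hf ⊢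
    exact continuousOn_curryI hf
  | succ n ih =>
    intro F _ _ f hf
    set D : E × ℝ → E →L[ℝ] F := fun q =>
      (fderivWithin ℝ f (P ×ˢ Set.Icc 0 1) q).comp (ContinuousLinearMap.inl ℝ E ℝ) with hD
    have hDs : ContDiffOn ℝ n D (P ×ˢ Set.Icc 0 1) := by
      have := hf.fderivWithin huI (m := n) (by norm_cast)
      exact this.clm_comp contDiffOn_const
    have hDd : ∀ t ∈ Set.Icc (0 : ℝ) 1, ∀ q ∈ P, HasFDerivWithinAt (fun q => f (q, t)) (D (q, t)) P q := by
      intro t ht q hq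
      have h1 := (hf.differentiableOn (by simp) (q, t) ⟨hq, ht⟩).hasFDerivWithinAt
      have h2 : Set.MapsTo (fun q : E => (q, t)) P (P ×ˢ Set.Icc (0 : ℝ) 1) := fun x hx => ⟨hx, ht⟩
      exact h1.comp q (hasFDerivAt_prodMk_left q t).hasFDerivWithinAt h2
    let Θ : CI (E →L[ℝ] F) → E →L[ℝ] CI F := fun g =>
      LinearMap.mkContinuous
        { toFun := fun v => CI.mk (fun t => g t v) (g.continuous.clm_apply continuous_const)
          map_add' := fun v w => by ext t; simp
          map_smul' := fun c v => by ext t; simp } ‖g‖ (fun v => by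
            rw [CI.norm_le _ (by positivity)]
            intro t
            exact ((g t).le_opNorm v).trans
              (mul_le_mul_of_nonneg_right (g.norm_coe_le_norm t) (norm_nonneg _)))
    have hΘ : ∀ g v t, Θ g v t = g t v := fun g v t => rfl
    push_cast
    rw [contDiffOn_succ_iff_hasFDerivWithinAt_of_uniqueDiffOn hu]
    refine ⟨by simp, fun p => Θ (curryI D p), ?_, ?_⟩
    · rw [contDiffOn_clm_apply]
      intro v
      refine (ih (fun q => D q v) (hDs.clm_apply contDiffOn_const)).congr fun p hp => ?_
      ext t
      rw [hΘ, curryI_apply hDs.continuousOn hp,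
        curryI_apply (hDs.clm_apply contDiffOn_const).continuousOn hp]
    · intro p hp
      rw [hasFDerivWithinAt_iff_isLittleO, Asymptotics.isLittleO_iff]
      intro ε hε
      have hc := continuousOn_curryI hDs.continuousOn p hp
      obtain ⟨δ, hδ, hδ'⟩ := Metric.continuousWithinAt_iff.1 hc ε hε
      filter_upwards [inter_mem_nhdsWithin P (Metric.ball_mem_nhds p hδ)] with q hq
      rw [CI.norm_le _ (by positivity)]
      intro t
      have hconv : Convex ℝ (P ∩ Metric.ball p δ) := hP.inter (convex_ball _ _)
      have := hconv.norm_image_sub_le_of_norm_hasFDerivWithin_le' (f := fun q => f (q, (t : ℝ)))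
        (f' := fun q => D (q, t)) (φ := D (p, t)) (C := ε) (x := p) (y := q)
        (fun x hx => (hDd t t.2 x hx.1).mono Set.inter_subset_left) (fun x hx => by
          have h2 := (hδ' hx.1 hx.2).le
          rw [dist_eq_norm] at h2
          have h3 := (CI.norm_coe_le_norm _ t).trans h2
          rwa [CI.sub_apply, curryI_apply hDs.continuousOn hx.1,
            curryI_apply hDs.continuousOn hp] at h3) ⟨hp, Metric.mem_ball_self hδ⟩ hq
      simp only [CI.sub_apply, hΘ]
      rwa [curryI_apply hf.continuousOn hq.1, curryI_apply hf.continuousOn hp,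
        curryI_apply hDs.continuousOn hp]

end Curry

/-! ### The Volterra operator and smooth dependence of solutions on the coefficients. -/

section Volterra

set_option linter.unusedSectionVars false

variable {F : Type} [NormedAddCommGroup F] [NormedSpace ℝ F] [CompleteSpace F]

/-- The projection of the real line to the unit interval. -/
abbrev toI (t : ℝ) : unitInterval := Set.projIcc 0 1 zero_le_one t

theorem continuous_toI : Continuous toI := continuous_projIcc

/-- Integration from zero. -/
def primI : CI F →L[ℝ] CI F :=
  LinearMap.mkContinuous
    { toFun := fun g => CI.mk (fun t => ∫ s in (0 : ℝ)..t, g (toI s))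
        ((intervalIntegral.continuous_primitive (fun a b =>
          (g.continuous.comp continuous_toI).intervalIntegrable a b) 0).comp
            continuous_subtype_val)
      map_add' := fun f g => by
        ext t
        exact intervalIntegral.integral_add ((f.continuous.comp continuous_toI).intervalIntegrable _ _)
          ((g.continuous.comp continuous_toI).intervalIntegrable _ _)
      map_smul' := fun c g => by
        ext t
        exact intervalIntegral.integral_smul c _ } 1 (fun g => by
          rw [CI.norm_le _ (by positivity)]
          intro t
          have := intervalIntegral.norm_integral_le_of_norm_le_const (a := 0) (b := t) (C := ‖g‖)
            (f := fun s => g (toI s)) (fun s _ => g.norm_coe_le_norm _)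
          refine this.trans ?_
          rw [sub_zero, abs_of_nonneg t.2.1, one_mul]
          exact mul_le_of_le_one_right (norm_nonneg _) t.2.2)

/-- The Volterra operator of a linear differential equation. -/
def volterra : CI (F →L[ℝ] F) →L[ℝ] CI F →L[ℝ] CI F :=
  LinearMap.mkContinuous₂
    (LinearMap.mk₂ ℝ (fun (a : CI (F →L[ℝ] F)) (y : CI F) =>
        primI (CI.mk (fun t => a t (y t)) (a.continuous.clm_apply y.continuous)))
      (fun a b y => by rw [← map_add]; congr 1)
      (fun c a y => by rw [← map_smul]; congr 1)
      (fun a y z => by rw [← map_add]; congr 1; ext t; simp)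
      (fun c a y => by rw [← map_smul]; congr 1; ext t; simp)) 1 (fun a y => by
        refine (primI.le_opNorm _).trans ?_
        have h1 : ‖(primI : CI F →L[ℝ] CI F)‖ ≤ 1 :=
          LinearMap.mkContinuous_norm_le _ zero_le_one _
        refine (mul_le_mul_of_nonneg_right h1 (norm_nonneg _)).trans ?_
        rw [one_mul, one_mul, CI.norm_le _ (by positivity)]
        intro t
        exact ((a t).le_opNorm _).trans (mul_le_mul (a.norm_coe_le_norm t) (y.norm_coe_le_norm t)
          (norm_nonneg _) (norm_nonneg _)))

theorem volterra_apply (a : CI (F →L[ℝ] F)) (y : CI F) (t : unitInterval) :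
    volterra a y t = ∫ s in (0 : ℝ)..t, a (toI s) (y (toI s)) := rfl

theorem norm_volterra_pow_apply_le (a : CI (F →L[ℝ] F)) (y : CI F) (n : ℕ) :
    ∀ t : unitInterval, ‖(volterra a ^ n) y t‖ ≤ ‖a‖ ^ n * ‖y‖ / n.factorial * (t : ℝ) ^ n := by
  induction n with
  | zero => intro t; simpa using y.norm_coe_le_norm t
  | succ n ih =>
    intro t
    rw [pow_succ', mul_apply_eq_comp, volterra_apply]
    have hb : ∀ s ∈ Set.Ioc (0 : ℝ) t, ‖a (toI s) ((volterra a ^ n) y (toI s))‖ ≤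
        ‖a‖ ^ (n + 1) * ‖y‖ / n.factorial * s ^ n := by
      intro s hs
      have hs1 : s ∈ Set.Icc (0 : ℝ) 1 := ⟨hs.1.le, hs.2.trans t.2.2⟩
      have h := ih (toI s)
      rw [toI, Set.projIcc_of_mem _ hs1] at h ⊢
      refine ((a _).le_opNorm _).trans ((mul_le_mul (a.norm_coe_le_norm _) h (norm_nonneg _)
        (norm_nonneg _)).trans (le_of_eq ?_))
      simp only
      ring
    refine (intervalIntegral.norm_integral_le_of_norm_le t.2.1
      (Filter.Eventually.of_forall hb) (by apply Continuous.intervalIntegrable; fun_prop)).trans ?_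
    rw [intervalIntegral.integral_const_mul, integral_pow, Nat.factorial_succ]
    apply le_of_eq
    have := Nat.factorial_ne_zero n
    push_cast
    field_simp
    simp

/-- The n-th power of the operator V has norm at most ‖a‖ⁿ/n!, which is less than one for some n.
Then 1 - Vⁿ is invertible, and 1 - V divides it with a commuting cofactor. -/
theorem isUnit_one_sub_volterra (a : CI (F →L[ℝ] F)) : IsUnit (1 - volterra a) := by
  have hlim := FloorSemiring.tendsto_pow_div_factorial_atTop ‖a‖
  obtain ⟨n, hn⟩ := (hlim.eventually_lt_const (show (0 : ℝ) < 1 by norm_num)).exists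
  have hnorm : ‖volterra a ^ n‖ < 1 := by
    refine lt_of_le_of_lt (ContinuousLinearMap.opNorm_le_bound _ (by positivity) fun y => ?_) hn
    rw [CI.norm_le _ (by positivity)]
    intro t
    refine (norm_volterra_pow_apply_le a y n t).trans ?_
    have : (t : ℝ) ^ n ≤ 1 := pow_le_one₀ t.2.1 t.2.2
    refine (mul_le_of_le_one_right (by positivity) this).trans (le_of_eq ?_)
    ring
  have h1 : IsUnit (1 - volterra a ^ n) := (Units.oneSub _ hnorm).isUnit
  rw [← mul_neg_geom_sum] at h1
  refine ((Commute.isUnit_mul_iff ?_).1 h1).1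
  exact (Commute.sum_right _ _ _ fun i _ =>
    ((Commute.one_left _).sub_left ((Commute.refl _).pow_right i)))

/-- The solution of a linear differential equation on the unit interval. -/
def odeSol (y₀ : F) (a : CI (F →L[ℝ] F)) : CI F :=
  Ring.inverse (1 - volterra a) (CI.mk (fun _ => y₀) continuous_const)

theorem odeSol_eq (y₀ : F) (a : CI (F →L[ℝ] F)) (t : unitInterval) :
    odeSol y₀ a t = y₀ + ∫ s in (0 : ℝ)..t, a (toI s) (odeSol y₀ a (toI s)) := by
  have h := Ring.mul_inverse_cancel _ (isUnit_one_sub_volterra a)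
  have h2 : (1 - volterra a) (odeSol y₀ a) = CI.mk (fun _ => y₀) continuous_const := by
    rw [odeSol, ← mul_apply_eq_comp, h]; rfl
  have h3 := congrArg (fun g : CI F => g t) h2
  simp only [_root_.sub_apply, one_apply_eq_self,
    CI.sub_apply, CI.mk_apply, volterra_apply] at h3
  exact sub_eq_iff_eq_add.1 h3

theorem odeSol_zero (y₀ : F) (a : CI (F →L[ℝ] F)) : odeSol y₀ a 0 = y₀ := by
  rw [odeSol_eq]; simp

theorem hasDerivWithinAt_odeSol (y₀ : F) (a : CI (F →L[ℝ] F)) {t : ℝ}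
    (ht : t ∈ Set.Icc (0 : ℝ) 1) :
    HasDerivWithinAt (fun t => odeSol y₀ a (toI t)) (a (toI t) (odeSol y₀ a (toI t)))
      (Set.Icc 0 1) t := by
  have hc : Continuous (fun s => a (toI s) (odeSol y₀ a (toI s))) :=
    (a.continuous.comp continuous_toI).clm_apply ((odeSol y₀ a).continuous.comp continuous_toI)
  have h := ((intervalIntegral.integral_hasDerivAt_right (hc.intervalIntegrable 0 t)
    hc.aestronglyMeasurable.stronglyMeasurableAtFilter hc.continuousAt).const_add y₀).hasDerivWithinAt
      (s := Set.Icc 0 1)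
  refine h.congr_of_mem (fun s hs => ?_) ht
  rw [odeSol_eq, toI, Set.projIcc_of_mem _ hs]

/-- The solution is the inverse of 1 - V(a) applied to a constant function. As V is linear in a and
inversion is smooth, so is the dependence on a. -/
theorem contDiff_odeSol (y₀ : F) {n : WithTop ℕ∞} : ContDiff ℝ n (odeSol y₀) := by
  rw [contDiff_iff_contDiffAt]
  intro a
  obtain ⟨u, hu⟩ := isUnit_one_sub_volterra a
  have h1 : ContDiffAt ℝ n Ring.inverse (1 - volterra a) := by
    rw [← hu]; exact contDiffAt_ringInverse ℝ u
  have hv : ContDiff ℝ n (fun a : CI (F →L[ℝ] F) => (volterra a : CI F →L[ℝ] CI F)) :=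
    ContinuousLinearMap.contDiff (volterra (F := F))
  have h2 : ContDiffAt ℝ n (fun a : CI (F →L[ℝ] F) => 1 - volterra a) a :=
    contDiffAt_const.sub hv.contDiffAt
  exact (h1.comp a h2).clm_apply contDiffAt_const

/-- Smooth dependence on parameters, for linear differential equations. -/
theorem exists_odeSol {E : Type} [NormedAddCommGroup E] [NormedSpace ℝ E] [FiniteDimensional ℝ E]
    {P : Set E} (hP : Convex ℝ P) (hu : UniqueDiffOn ℝ P) {a : E × ℝ → F →L[ℝ] F}
    (ha : ContDiffOn ℝ ∞ a (P ×ˢ Set.Icc 0 1)) (y₀ : F) :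
    ContDiffOn ℝ ∞ (fun p => odeSol y₀ (curryI a p) 1) P := by
  rw [contDiffOn_infty]
  intro n
  have h1 := contDiffOn_curryI hP hu n a (contDiffOn_infty.1 ha n)
  have h2 := (contDiff_odeSol y₀ (n := n)).comp_contDiffOn h1
  exact (CI.evalCLM (1 : unitInterval)).contDiff.comp_contDiffOn h2

omit [CompleteSpace F] in
theorem linear_ode_unique {a : ℝ → F →L[ℝ] F} (ha : ContinuousOn a (Set.Icc 0 1)) {y z : ℝ → F}
    (hy : ∀ t ∈ Set.Icc (0 : ℝ) 1, HasDerivWithinAt y (a t (y t)) (Set.Icc 0 1) t)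
    (hz : ∀ t ∈ Set.Icc (0 : ℝ) 1, HasDerivWithinAt z (a t (z t)) (Set.Icc 0 1) t)
    (h0 : y 0 = z 0) : Set.EqOn y z (Set.Icc 0 1) := by
  obtain ⟨C, hC⟩ := isCompact_Icc.exists_bound_of_continuousOn ha
  have hC0 : 0 ≤ C := (norm_nonneg _).trans (hC 0 (by simp))
  refine ODE_solution_unique_of_mem_Icc_right (v := fun t x => a t x) (s := fun _ => Set.univ)
    (K := ⟨C, hC0⟩) (fun t ht => ?_) (fun t ht => (hy t ht).continuousWithinAt) (fun t ht => ?_)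
    (by simp) (fun t ht => (hz t ht).continuousWithinAt) (fun t ht => ?_) (by simp) h0
  · refine ((a t).lipschitz.weaken ?_).lipschitzOnWith
    exact hC t ⟨ht.1, ht.2.le⟩
  · exact (hy t ⟨ht.1, ht.2.le⟩).mono_of_mem_nhdsWithin (Icc_mem_nhdsGE_of_mem ht)
  · exact (hz t ⟨ht.1, ht.2.le⟩).mono_of_mem_nhdsWithin (Icc_mem_nhdsGE_of_mem ht)

end Volterra

/-! ### Logarithms -/

/-- Near a point, a continuous logarithm is a constant plus the principal logarithm of a quotient
close to one. -/
theorem contDiffOn_of_exp {E : Type*} [NormedAddCommGroup E] [NormedSpace ℝ E] {S : Set E}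
    {ℓ : E → ℂ} {n : WithTop ℕ∞} (hc : ContinuousOn ℓ S)
    (he : ContDiffOn ℝ n (fun x => Complex.exp (ℓ x)) S) : ContDiffOn ℝ n ℓ S := by
  intro x hx
  have h1 : ContDiffWithinAt ℝ n (fun y => Complex.exp (ℓ y) * Complex.exp (-ℓ x)) S x :=
    (he x hx).mul contDiffWithinAt_const
  have hval : Complex.exp (ℓ x) * Complex.exp (-ℓ x) = 1 := by rw [← Complex.exp_add]; simp
  have h2 : ContDiffWithinAt ℝ n
      (fun y => ℓ x + Complex.log (Complex.exp (ℓ y) * Complex.exp (-ℓ x))) S x := by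
    refine contDiffWithinAt_const.add (ContDiffAt.comp_contDiffWithinAt x (g := Complex.log) ?_ h1)
    apply contDiffAt_clog
    rw [hval]; exact Complex.one_mem_slitPlane
  refine h2.congr_of_eventuallyEq ?_ (by rw [hval]; simp)
  have h3 : ∀ᶠ y in 𝓝[S] x, |(ℓ y - ℓ x).im| < Real.pi := by
    have : ContinuousWithinAt (fun y => |(ℓ y - ℓ x).im|) S x :=
      (Complex.continuous_im.continuousAt.comp_continuousWithinAt
        ((hc x hx).sub continuousWithinAt_const)).abs
    refine this.eventually_lt_const ?_
    simp [Real.pi_pos]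
  filter_upwards [h3] with y hy
  rw [← Complex.exp_add, ← sub_eq_add_neg, Complex.log_exp (abs_lt.1 hy).1 (abs_lt.1 hy).2.le]
  ring

/-- Logarithms on star-shaped sets, depending continuously on parameters. -/
theorem exists_log_lift {E V : Type*} [TopologicalSpace E] [NormedAddCommGroup V] [NormedSpace ℝ V]
    {T : Set E} {X : Set V} {b : V} (hX : StarConvex ℝ b X) (hb : b ∈ X) {q : E × V → ℂ}
    (hq : ContinuousOn q (T ×ˢ X)) (hq0 : ∀ p ∈ T ×ˢ X, q p ≠ 0) {ℓ₀ : ℂ}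
    (hℓ₀ : ∀ ξ ∈ T, q (ξ, b) = Complex.exp ℓ₀) :
    ∃ ℓ : E × V → ℂ, ContinuousOn ℓ (T ×ˢ X) ∧ (∀ p ∈ T ×ˢ X, Complex.exp (ℓ p) = q p) ∧
      ∀ ξ ∈ T, ℓ (ξ, b) = ℓ₀ := by
  have hmem : ∀ (t : unitInterval) (p : ↥(T ×ˢ X)),
      ((p.1.1, b + (t : ℝ) • (p.1.2 - b)) : E × V) ∈ T ×ˢ X := by
    intro t p
    refine ⟨p.2.1, ?_⟩
    exact hX.add_smul_sub_mem p.2.2 t.2.1 t.2.2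
  have hHc : Continuous (fun x : unitInterval × ↥(T ×ˢ X) =>
      q (x.2.1.1, b + (x.1 : ℝ) • (x.2.1.2 - b))) :=
    hq.comp_continuous (f := fun x : unitInterval × ↥(T ×ˢ X) =>
      ((x.2.1.1, b + (x.1 : ℝ) • (x.2.1.2 - b)) : E × V)) (by fun_prop) fun x => hmem x.1 x.2
  -- The radial contraction of `X` to `b` is composed with `q` and lifted from the constant `ℓ₀`;
  -- the end of the lifted homotopy is the required logarithm.
  let H : C(unitInterval × ↥(T ×ˢ X), {z : ℂ // z ≠ 0}) :=
    ⟨fun x => ⟨q (x.2.1.1, b + (x.1 : ℝ) • (x.2.1.2 - b)), hq0 _ (hmem x.1 x.2)⟩,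
      hHc.subtype_mk _⟩
  let f : C(↥(T ×ˢ X), ℂ) := ContinuousMap.const _ ℓ₀
  have H0 : ∀ a, H (0, a) = (fun z : ℂ => (⟨_, z.exp_ne_zero⟩ : {z : ℂ // z ≠ 0})) (f a) := by
    intro a
    apply Subtype.ext
    have := hℓ₀ _ a.2.1
    simpa [H, f] using this
  have cov := Complex.isCoveringMap_exp
  let G := cov.liftHomotopy H f H0
  have hG := cov.liftHomotopy_lifts H f H0
  classical
  refine ⟨fun p => if h : p ∈ T ×ˢ X then G (1, ⟨p, h⟩) else 0, ?_, ?_, ?_⟩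
  · rw [continuousOn_iff_continuous_domRestrict]
    have : (T ×ˢ X).domRestrict (fun p => if h : p ∈ T ×ˢ X then G (1, ⟨p, h⟩) else 0)
        = fun p => G (1, p) := by
      ext p
      simp only [Set.domRestrict_apply]
      rw [dif_pos p.2]
    rw [this]
    exact G.continuous.comp (by fun_prop)
  · intro p hp
    simp only [dif_pos hp]
    have := congrArg Subtype.val (congrFun hG (1, ⟨p, hp⟩))
    simp only [Function.comp_apply] at this
    refine this.trans ?_
    simp [H]
  · intro ξ hξ
    have hp : (ξ, b) ∈ T ×ˢ X := ⟨hξ, hb⟩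
    simp only [dif_pos hp]
    have hconst : ∀ t : unitInterval, G (t, ⟨(ξ, b), hp⟩) = ℓ₀ := by
      intro t
      have hcont : Continuous fun t : unitInterval => G (t, ⟨(ξ, b), hp⟩) :=
        G.continuous.comp (by fun_prop)
      refine lift_eq_of_continuous hcont continuous_const (fun t => ?_) 0 ?_ t
      · have := congrArg Subtype.val (congrFun hG (t, ⟨(ξ, b), hp⟩))
        simp only [Function.comp_apply] at this
        refine this.trans ?_
        simp [H, hℓ₀ ξ hξ]
      · exact cov.liftHomotopy_zero H f H0 _
    exact hconst 1

/-! ### Flat connections and developing maps -/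

/-- The action of the Lie algebra on `ℂ = ℝ²`. -/
def op : Lie →L[ℝ] ℂ →L[ℝ] ℂ :=
  LinearMap.toContinuousLinearMap
    { toFun := fun x => LinearMap.toContinuousLinearMap
        { toFun := fun Z => ⟨x.2.2 * Z.im - x.1 * Z.re, x.1 * Z.im + x.2.1 * Z.re⟩
          map_add' := fun Z Z' => by apply Complex.ext <;> simp <;> ring
          map_smul' := fun c Z => by apply Complex.ext <;> simp <;> ring }
      map_add' := fun x y => by ext Z <;> apply Complex.ext <;> simp <;> ring
      map_smul' := fun c x => by ext Z <;> apply Complex.ext <;> simp <;> ring }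

theorem op_apply (x : Lie) (Z : ℂ) :
    op x Z = ⟨x.2.2 * Z.im - x.1 * Z.re, x.1 * Z.im + x.2.1 * Z.re⟩ := rfl

theorem op_re (x : Lie) (Z : ℂ) : (op x Z).re = x.2.2 * Z.im - x.1 * Z.re := rfl
theorem op_im (x : Lie) (Z : ℂ) : (op x Z).im = x.1 * Z.im + x.2.1 * Z.re := rfl

theorem op_trace (x : Lie) (Z Z' : ℂ) :
    ((starRingEnd ℂ) (op x Z) * Z' + (starRingEnd ℂ) Z * op x Z').im = 0 := by
  simp [op_re, op_im]; ring

section Dev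

variable {V V' : Type} [NormedAddCommGroup V] [NormedSpace ℝ V] [NormedAddCommGroup V']
  [NormedSpace ℝ V']

/-- The connection `d - A` on a subset of a vector space is flat. -/
def FlatOn (A : V → V →L[ℝ] Lie) (X : Set V) : Prop :=
  ∀ z ∈ X, ∀ u v : V, ∀ Z : ℂ, op (fderivWithin ℝ A X z u v - fderivWithin ℝ A X z v u) Z =
    op (A z u) (op (A z v) Z) - op (A z v) (op (A z u) Z)

/-- `y` is a parallel section of the connection `d - A`. -/
def IsParallel (A : V → V →L[ℝ] Lie) (X : Set V) (y : V → ℂ) : Prop :=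
  ∀ w ∈ X, HasFDerivWithinAt y ((op.flip (y w)).comp (A w)) X w

/-- `D` is a developing map of the connection `d - A`: a trivialization, with values in the
universal cover. -/
def IsDev (A : V → V →L[ℝ] Lie) (X : Set V) (D : V → Cov) : Prop :=
  ContinuousOn D X ∧ ∀ Z : ℂ, IsParallel A X fun w => mv (D w) Z

theorem IsDev.congr_form {A A' : V → V →L[ℝ] Lie} {X : Set V} {D : V → Cov} (h : IsDev A X D)
    (hA : ∀ w ∈ X, A w = A' w) : IsDev A' X D :=
  ⟨h.1, fun Z w hw => by rw [← hA w hw]; exact h.2 Z w hw⟩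

theorem IsDev.congr {A : V → V →L[ℝ] Lie} {X : Set V} {D D' : V → Cov} (h : IsDev A X D)
    (hD : ∀ w ∈ X, D' w = D w) : IsDev A X D' :=
  ⟨h.1.congr hD, fun Z w hw => by
    have h1 : HasFDerivWithinAt (fun w => mv (D w) Z) ((op.flip (mv (D' w) Z)).comp (A w)) X w := by
      rw [hD w hw]; exact h.2 Z w hw
    exact h1.congr (fun x hx => by rw [hD x hx]) (by rw [hD w hw])⟩

theorem IsDev.mono {A : V → V →L[ℝ] Lie} {X X' : Set V} {D : V → Cov} (h : IsDev A X D)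
    (hX : X' ⊆ X) : IsDev A X' D :=
  ⟨h.1.mono hX, fun Z w hw => (h.2 Z w (hX hw)).mono hX⟩

theorem IsDev.gmul {A : V → V →L[ℝ] Lie} {X : Set V} {D : V → Cov} (h : IsDev A X D) (g : Cov) :
    IsDev A X fun w => gmul (D w) g := by
  refine ⟨(contDiff_gmul (n := 0)).continuous.comp_continuousOn (h.1.prodMk continuousOn_const),
    fun Z => ?_⟩
  simp only [mv_gmul]
  exact h.2 _

theorem IsParallel.comp {A : V → V →L[ℝ] Lie} {X : Set V} {y : V → ℂ} (h : IsParallel A X y)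
    {X' : Set V'} {c : V' → V} {c' : V' → V' →L[ℝ] V}
    (hc : ∀ x ∈ X', HasFDerivWithinAt c (c' x) X' x) (hm : Set.MapsTo c X' X) :
    IsParallel (fun x => (A (c x)).comp (c' x)) X' fun x => y (c x) :=
  fun x hx => (h (c x) (hm hx)).comp x (hc x hx) hm

theorem IsDev.comp {A : V → V →L[ℝ] Lie} {X : Set V} {D : V → Cov} (h : IsDev A X D)
    {X' : Set V'} {c : V' → V} {c' : V' → V' →L[ℝ] V}
    (hc : ∀ x ∈ X', HasFDerivWithinAt c (c' x) X' x) (hm : Set.MapsTo c X' X) :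
    IsDev (fun x => (A (c x)).comp (c' x)) X' fun x => D (c x) :=
  ⟨h.1.comp (fun x hx => (hc x hx).continuousWithinAt) hm, fun Z => (h.2 Z).comp hc hm⟩

/-- The one-form `a(t) dt` on the line. -/
def lineForm (a : ℝ → Lie) (t : ℝ) : ℝ →L[ℝ] Lie := ContinuousLinearMap.toSpanSingleton ℝ (a t)

theorem isParallel_lineForm {a : ℝ → Lie} {X : Set ℝ} {y : ℝ → ℂ} :
    IsParallel (lineForm a) X y ↔ ∀ t ∈ X, HasDerivWithinAt y (op (a t) (y t)) X t := by
  refine forall₂_congr fun t _ => ?_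
  rw [hasDerivWithinAt_iff_hasFDerivWithinAt]
  have : (op.flip (y t)).comp (lineForm a t) = ContinuousLinearMap.toSpanSingleton ℝ (op (a t) (y t)) := by
    ext <;> simp [lineForm]
  rw [this]

theorem ray_hasDerivAt (b w : V) (t : ℝ) : HasDerivAt (fun τ : ℝ => b + τ • (w - b)) (w - b) t := by
  have := ((hasDerivAt_id t).smul_const (w - b)).const_add b
  simpa using this

theorem IsParallel.ray {A : V → V →L[ℝ] Lie} {X : Set V} {y : V → ℂ} (h : IsParallel A X y) {b w : V}
    (hX : StarConvex ℝ b X) (hw : w ∈ X) :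
    ∀ t ∈ Set.Icc (0 : ℝ) 1, HasDerivWithinAt (fun τ : ℝ => y (b + τ • (w - b)))
      (op (A (b + t • (w - b)) (w - b)) (y (b + t • (w - b)))) (Set.Icc 0 1) t := by
  intro t ht
  have hm : Set.MapsTo (fun τ : ℝ => b + τ • (w - b)) (Set.Icc 0 1) X :=
    fun τ hτ => hX.add_smul_sub_mem hw hτ.1 hτ.2
  exact (h _ (hm ht)).comp_hasDerivWithinAt t (ray_hasDerivAt b w t).hasDerivWithinAt hm

theorem continuousOn_ray {A : V → V →L[ℝ] Lie} {X : Set V} (hA : ContinuousOn A X) {b w : V}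
    (hX : StarConvex ℝ b X) (hw : w ∈ X) :
    ContinuousOn (fun t : ℝ => op (A (b + t • (w - b)) (w - b))) (Set.Icc 0 1) := by
  have hm : Set.MapsTo (fun τ : ℝ => b + τ • (w - b)) (Set.Icc 0 1) X :=
    fun τ hτ => hX.add_smul_sub_mem hw hτ.1 hτ.2
  have := hA.comp (t := X) (s := Set.Icc 0 1) (f := fun τ : ℝ => b + τ • (w - b))
    (by fun_prop) hm
  exact op.continuous.comp_continuousOn (this.clm_apply continuousOn_const)

theorem IsParallel.eqOn {A : V → V →L[ℝ] Lie} {X : Set V} (hA : ContinuousOn A X) {b : V}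
    (hX : StarConvex ℝ b X) {y z : V → ℂ} (hy : IsParallel A X y) (hz : IsParallel A X z)
    (h0 : y b = z b) : Set.EqOn y z X := by
  intro w hw
  have := linear_ode_unique (continuousOn_ray hA hX hw) (hy.ray hX hw) (hz.ray hX hw) (by simpa)
    (Set.right_mem_Icc.2 zero_le_one)
  simpa using this

/-- Uniqueness for linear equations along rays compares the linear actions. The logarithm
coordinates then differ by a multiple of 2πi which is constant along the ray and zero at its start.
-/
theorem IsDev.eqOn {A : V → V →L[ℝ] Lie} {X : Set V} (hA : ContinuousOn A X) {b : V}
    (hX : StarConvex ℝ b X) {D D' : V → Cov} (hD : IsDev A X D) (hD' : IsDev A X D')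
    (h0 : D b = D' b) : Set.EqOn D D' X := by
  have hmv : ∀ w ∈ X, ∀ Z, mv (D w) Z = mv (D' w) Z := fun w hw Z =>
    (hD.2 Z).eqOn hA hX (hD'.2 Z) (by rw [h0]) hw
  intro w hw
  have hm : Set.MapsTo (fun τ : ℝ => b + τ • (w - b)) (Set.Icc 0 1) X :=
    fun τ hτ => hX.add_smul_sub_mem hw hτ.1 hτ.2
  have hr : ContinuousOn (fun τ : ℝ => b + τ • (w - b)) (Set.Icc 0 1) := by fun_prop
  refine cov_ext ?_ (hmv w hw)
  have := eq_zero_of_exp_eq_one (s := Set.Icc (0 : ℝ) 1) isPreconnected_Icc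
    (f := fun τ => (D (b + τ • (w - b))).1 - (D' (b + τ • (w - b))).1)
    ((continuous_fst.comp_continuousOn (hD.1.comp hr hm)).sub
      (continuous_fst.comp_continuousOn (hD'.1.comp hr hm))) (fun τ hτ => by
        have := hmv _ (hm hτ) 1
        rw [mv_one, mv_one, colOne, colOne] at this
        rw [Complex.exp_sub, this, div_self (Complex.exp_ne_zero _)])
    (x₀ := 0) (by simp) (by simp [h0]) 1 (by simp)
  simpa [sub_eq_zero] using this

/-- Parallel sections of flat connections: the radial solutions are parallel. -/
theorem isParallel_of_radial {A : V → V →L[ℝ] Lie} {X : Set V} (hu : UniqueDiffOn ℝ X)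
    (hcl : X ⊆ closure (interior X)) {b : V} (hX : StarConvex ℝ b X)
    (hA : ContDiffOn ℝ ∞ A X) (hflat : FlatOn A X) {y : V → ℂ} (hy : ContDiffOn ℝ ∞ y X)
    (hrad : ∀ w ∈ X, fderivWithin ℝ y X w (w - b) = op (A w (w - b)) (y w)) : IsParallel A X y := by
  set Dy := fderivWithin ℝ y X with hDy
  have hDys : ContDiffOn ℝ ∞ Dy X := hy.fderivWithin hu (by simp)
  have hd : ∀ w ∈ X, HasFDerivWithinAt y (Dy w) X w := fun w hw =>
    (hy.differentiableOn (by simp) w hw).hasFDerivWithinAt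
  have hdA : ∀ w ∈ X, HasFDerivWithinAt A (fderivWithin ℝ A X w) X w := fun w hw =>
    (hA.differentiableOn (by simp) w hw).hasFDerivWithinAt
  have hdD : ∀ w ∈ X, HasFDerivWithinAt Dy (fderivWithin ℝ Dy X w) X w := fun w hw =>
    (hDys.differentiableOn (by simp) w hw).hasFDerivWithinAt
  have hopA : ∀ w ∈ X, ∀ v, HasFDerivWithinAt (fun w => op (A w v) (y w))
      (((op (A w v)).comp (Dy w)) + ((op.comp ((fderivWithin ℝ A X w).flip v)).flip (y w))) X w := by
    intro w hw v
    have h1 : HasFDerivWithinAt (fun w => op (A w v)) (op.comp ((fderivWithin ℝ A X w).flip v)) X w := by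
      refine op.hasFDerivAt.comp_hasFDerivWithinAt w ?_
      have := (hdA w hw).clm_apply (hasFDerivWithinAt_const v w X)
      simpa using this
    exact h1.clm_apply (hd w hw)
  -- differentiate the radial equation
  have hrad' : ∀ w ∈ X, ∀ v, fderivWithin ℝ Dy X w v (w - b) + Dy w v =
      op (fderivWithin ℝ A X w v (w - b)) (y w) + op (A w v) (y w) + op (A w (w - b)) (Dy w v) := by
    intro w hw v
    have h1 : HasFDerivWithinAt (fun w => Dy w (w - b)) _ X w :=
      (hdD w hw).clm_apply ((hasFDerivWithinAt_id w X).sub_const b)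
    have h2 : HasFDerivWithinAt (fun w => A w (w - b)) _ X w :=
      (hdA w hw).clm_apply ((hasFDerivWithinAt_id w X).sub_const b)
    have h3 : HasFDerivWithinAt (fun w => op (A w (w - b)) (y w)) _ X w :=
      (op.hasFDerivAt.comp_hasFDerivWithinAt w h2).clm_apply (hd w hw)
    have h4 := HasFDerivWithinAt.congr h3 hrad (hrad w hw)
    have h5 := (hu w hw).eq h1 h4
    have h6 := congrArg (fun L : V →L[ℝ] ℂ => L v) h5
    simp only [_root_.add_apply, ContinuousLinearMap.comp_apply, ContinuousLinearMap.flip_apply,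
      ContinuousLinearMap.id_apply, Function.comp_apply, map_add] at h6
    rw [add_comm, h6]
    abel
  have hsymm : ∀ w ∈ X, ∀ u v, fderivWithin ℝ Dy X w u v = fderivWithin ℝ Dy X w v u := by
    intro w hw u v
    have := (hy w hw).isSymmSndFDerivWithinAt (n := ∞) (by simp; exact WithTop.coe_le_coe.2 (le_top (a := (2 : ℕ∞)))) hu (hcl hw) hw
    exact this.eq u v
  intro w hw
  have key : ∀ v, Dy w v = op (A w v) (y w) := by
    intro v
    have hm : Set.MapsTo (fun τ : ℝ => b + τ • (w - b)) (Set.Icc 0 1) X :=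
      fun τ hτ => hX.add_smul_sub_mem hw hτ.1 hτ.2
    -- The defect of parallelism in the direction v. Flatness, symmetry of second derivatives and
    -- the differentiated radial equation show that t·z solves the radial equation along each ray.
    -- It vanishes at t = 0, hence everywhere.
    set z : V → ℂ := fun w => Dy w v - op (A w v) (y w) with hz
    have hzd : ∀ w ∈ X, ∃ L : V →L[ℝ] ℂ, HasFDerivWithinAt z L X w ∧
        L (w - b) = op (A w (w - b)) (z w) - z w := by
      intro w hw
      have h1 : HasFDerivWithinAt (fun w => Dy w v) ((fderivWithin ℝ Dy X w).flip v) X w := by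
        have := (hdD w hw).clm_apply (hasFDerivWithinAt_const v w X)
        simpa using this
      refine ⟨_, h1.sub (hopA w hw v), ?_⟩
      have e1 := hrad' w hw v
      have e2 := hsymm w hw (w - b) v
      have e3 := hrad w hw
      have e4 := hflat w hw v (w - b) (y w)
      rw [map_sub, _root_.sub_apply] at e4
      simp only [_root_.sub_apply, _root_.add_apply, ContinuousLinearMap.flip_apply,
        ContinuousLinearMap.comp_apply, hz, map_sub (op (A w (w - b)))]
      rw [e2, e3]
      linear_combination e1 + e4
    have hZ : ∀ t ∈ Set.Icc (0 : ℝ) 1, HasDerivWithinAt (fun τ : ℝ => τ • z (b + τ • (w - b)))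
        (op (A (b + t • (w - b)) (w - b)) (t • z (b + t • (w - b)))) (Set.Icc 0 1) t := by
      intro t ht
      obtain ⟨L, hL, hL'⟩ := hzd _ (hm ht)
      have h1 := hL.comp_hasDerivWithinAt t (ray_hasDerivAt b w t).hasDerivWithinAt hm
      have h2 := (hasDerivWithinAt_id t (Set.Icc (0 : ℝ) 1)).smul h1
      refine h2.congr_deriv ?_
      rw [add_sub_cancel_left, map_smul, map_smul] at hL'
      simp only [id, Function.comp_apply, one_smul]
      rw [map_smul, hL', map_smul, _root_.smul_apply]
      abel
    have h0 : ∀ t ∈ Set.Icc (0 : ℝ) 1, HasDerivWithinAt (fun _ : ℝ => (0 : ℂ))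
        (op (A (b + t • (w - b)) (w - b)) ((fun _ : ℝ => (0 : ℂ)) t)) (Set.Icc 0 1) t := by
      intro t ht
      simpa using hasDerivWithinAt_const t (Set.Icc (0 : ℝ) 1) (0 : ℂ)
    have := linear_ode_unique (continuousOn_ray hA.continuousOn hX hw) hZ h0 (by simp)
      (Set.right_mem_Icc.2 zero_le_one)
    simpa [hz, sub_eq_zero] using this
  have : (op.flip (y w)).comp (A w) = Dy w := by
    ext v
    simp [key v]
  rw [this]
  exact hd w hw

variable [FiniteDimensional ℝ V] {E : Type} [NormedAddCommGroup E] [NormedSpace ℝ E]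
  [FiniteDimensional ℝ E]

/-- Parallel sections of flat connections on star-shaped sets, with parameters. -/
theorem exists_parallel {T : Set E} (hT : Convex ℝ T) (hTu : UniqueDiffOn ℝ T) {X : Set V}
    (hu : UniqueDiffOn ℝ X) (hcl : X ⊆ closure (interior X)) {b : V} (hX : StarConvex ℝ b X)
    (hb : b ∈ X)
    (hloc : ∀ w ∈ X, ∃ ε > 0, Convex ℝ (X ∩ Metric.ball w ε)) {A : E × V → V →L[ℝ] Lie}
    (hA : ContDiffOn ℝ ∞ A (T ×ˢ X)) (hflat : ∀ ξ ∈ T, FlatOn (fun w => A (ξ, w)) X) (y₀ : ℂ) :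
    ∃ y : E × V → ℂ, ContDiffOn ℝ ∞ y (T ×ˢ X) ∧
      ∀ ξ ∈ T, IsParallel (fun w => A (ξ, w)) X (fun w => y (ξ, w)) ∧ y (ξ, b) = y₀ := by
  set a : (E × V) × ℝ → ℂ →L[ℝ] ℂ := fun q => op (A (q.1.1, b + q.2 • (q.1.2 - b)) (q.1.2 - b)) with ha
  have has : ContDiffOn ℝ ∞ a ((T ×ˢ X) ×ˢ Set.Icc 0 1) := by
    refine op.contDiff.comp_contDiffOn (ContDiffOn.clm_apply (hA.comp ?_ ?_) ?_)
    · exact ContDiff.contDiffOn (by fun_prop)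
    · rintro ⟨⟨ξ, w⟩, t⟩ ⟨⟨hξ, hw⟩, ht⟩
      exact ⟨hξ, hX.add_smul_sub_mem hw ht.1 ht.2⟩
    · exact ContDiff.contDiffOn (by fun_prop)
  -- The value at time one of the solution along the segment from `b` to w; the endpoint w is
  -- treated as another parameter of the equation.
  set y : E × V → ℂ := fun p => odeSol y₀ (curryI a p) 1 with hy
  have hys : ContDiffOn ℝ ∞ y (T ×ˢ X) := by
    refine contDiffOn_of_locally_contDiffOn fun p hp => ?_
    obtain ⟨ε, hε, hconv⟩ := hloc p.2 hp.2
    refine ⟨Set.univ ×ˢ Metric.ball p.2 ε, isOpen_univ.prod Metric.isOpen_ball,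
      ⟨trivial, Metric.mem_ball_self hε⟩, ?_⟩
    have hset : T ×ˢ X ∩ Set.univ ×ˢ Metric.ball p.2 ε = T ×ˢ (X ∩ Metric.ball p.2 ε) := by
      rw [Set.prod_inter_prod, Set.inter_univ]
    rw [hset]
    exact exists_odeSol (hT.prod hconv) (hTu.prod (hu.inter Metric.isOpen_ball))
      (has.mono (Set.prod_mono (Set.prod_mono le_rfl Set.inter_subset_left) le_rfl)) y₀
  refine ⟨y, hys, fun ξ hξ => ?_⟩
  have hAξ : ContDiffOn ℝ ∞ (fun w => A (ξ, w)) X :=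
    hA.comp (ContDiff.contDiffOn (by fun_prop)) fun w hw => ⟨hξ, hw⟩
  have hyξ : ContDiffOn ℝ ∞ (fun w => y (ξ, w)) X :=
    hys.comp (ContDiff.contDiffOn (by fun_prop)) fun w hw => ⟨hξ, hw⟩
  -- the solution along a ray
  have hsol : ∀ w ∈ X, ∀ t ∈ Set.Icc (0 : ℝ) 1, HasDerivWithinAt
      (fun t => odeSol y₀ (curryI a (ξ, w)) (toI t))
      (op (A (ξ, b + t • (w - b)) (w - b)) (odeSol y₀ (curryI a (ξ, w)) (toI t))) (Set.Icc 0 1) t := by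
    intro w hw t ht
    have := hasDerivWithinAt_odeSol y₀ (curryI a (ξ, w)) ht
    rw [curryI_apply has.continuousOn (show (ξ, w) ∈ T ×ˢ X from ⟨hξ, hw⟩)] at this
    have ht' : ((toI t : unitInterval) : ℝ) = t := by rw [toI, Set.projIcc_of_mem _ ht]
    rw [ht'] at this
    exact this
  -- The equation for the endpoint b + τ(w - b) is that for w, run at speed τ. Hence y restricted to
  -- a ray solves the equation of this ray.
  have hscale : ∀ w ∈ X, ∀ τ ∈ Set.Icc (0 : ℝ) 1, y (ξ, b + τ • (w - b)) =
      odeSol y₀ (curryI a (ξ, w)) (toI τ) := by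
    intro w hw τ hτ
    have hwτ := hX.add_smul_sub_mem hw hτ.1 hτ.2
    have h1 := hsol _ hwτ
    have h2 : ∀ t ∈ Set.Icc (0 : ℝ) 1, HasDerivWithinAt
        (fun t => odeSol y₀ (curryI a (ξ, w)) (toI (τ * t)))
        (op (A (ξ, b + t • (b + τ • (w - b) - b)) (b + τ • (w - b) - b))
          (odeSol y₀ (curryI a (ξ, w)) (toI (τ * t)))) (Set.Icc 0 1) t := by
      intro t ht
      have hm : Set.MapsTo (fun t => τ * t) (Set.Icc (0 : ℝ) 1) (Set.Icc 0 1) := fun s hs =>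
        ⟨mul_nonneg hτ.1 hs.1, mul_le_one₀ hτ.2 hs.1 hs.2⟩
      have h3 := (hsol w hw (τ * t) (hm ht)).scomp t
        ((hasDerivAt_id t).const_mul τ).hasDerivWithinAt hm
      refine h3.congr_deriv ?_
      rw [add_sub_cancel_left, map_smul, map_smul, smul_smul, mul_comm t τ, mul_one]
      rfl
    have hcont : ContinuousOn (fun t : ℝ => op (A (ξ, b + t • (b + τ • (w - b) - b))
        (b + τ • (w - b) - b))) (Set.Icc 0 1) := continuousOn_ray hAξ.continuousOn hX hwτ
    have h4 := linear_ode_unique hcont h1 h2 (by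
      have : toI 0 = 0 := Set.projIcc_left ..
      simp only [mul_zero, this, odeSol_zero]) (Set.right_mem_Icc.2 zero_le_one)
    have h5 : toI 1 = 1 := Set.projIcc_right ..
    simp only [mul_one, h5] at h4
    exact h4
  constructor
  · refine isParallel_of_radial hu hcl hX hAξ (hflat ξ hξ) hyξ fun w hw => ?_
    have hm : Set.MapsTo (fun τ : ℝ => b + τ • (w - b)) (Set.Icc 0 1) X :=
      fun τ hτ => hX.add_smul_sub_mem hw hτ.1 hτ.2
    have hone : (1 : ℝ) ∈ Set.Icc (0 : ℝ) 1 := by simp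
    have h1 := ((hyξ.differentiableOn (by simp) _ (hm hone)).hasFDerivWithinAt).comp_hasDerivWithinAt 1
      (ray_hasDerivAt b w 1).hasDerivWithinAt hm
    have h2 := (hsol w hw 1 hone).congr_of_mem (fun t ht => hscale w hw t ht) hone
    have h3 := (uniqueDiffOn_Icc zero_lt_one 1 hone).eq_deriv _ h1 h2
    rw [← hscale w hw 1 hone] at h3
    simpa using h3
  · have h0 := hscale b hb 0 (by simp)
    have : toI 0 = 0 := Set.projIcc_left ..
    rw [this, odeSol_zero] at h0
    simpa using h0

/-- Flat connections on star-shaped sets, with parameters, have developing maps. -/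
theorem exists_dev {T : Set E} (hT : Convex ℝ T) (hTu : UniqueDiffOn ℝ T) {X : Set V}
    (hu : UniqueDiffOn ℝ X) (hcl : X ⊆ closure (interior X)) {b : V} (hX : StarConvex ℝ b X)
    (hb : b ∈ X)
    (hloc : ∀ w ∈ X, ∃ ε > 0, Convex ℝ (X ∩ Metric.ball w ε)) {A : E × V → V →L[ℝ] Lie}
    (hA : ContDiffOn ℝ ∞ A (T ×ˢ X)) (hflat : ∀ ξ ∈ T, FlatOn (fun w => A (ξ, w)) X) (D₀ : Cov) :
    ∃ D : E × V → Cov, ContDiffOn ℝ ∞ D (T ×ˢ X) ∧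
      ∀ ξ ∈ T, IsDev (fun w => A (ξ, w)) X (fun w => D (ξ, w)) ∧ D (ξ, b) = D₀ := by
  obtain ⟨y, hys, hy⟩ := exists_parallel hT hTu hu hcl hX hb hloc hA hflat (colOne D₀)
  obtain ⟨z, hzs, hz⟩ := exists_parallel hT hTu hu hcl hX hb hloc hA hflat (colI D₀)
  -- The form is trace-free, so the area spanned by two parallel sections is constant along rays.
  have hdet : ∀ ξ ∈ T, ∀ w ∈ X, ((starRingEnd ℂ) (y (ξ, w)) * z (ξ, w)).im = 1 := by
    intro ξ hξ w hw
    have h1 := (hy ξ hξ).1.ray hX hw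
    have h2 := (hz ξ hξ).1.ray hX hw
    have h3 : ∀ t ∈ Set.Icc (0 : ℝ) 1, HasDerivWithinAt
        (fun t : ℝ => ((starRingEnd ℂ) (y (ξ, b + t • (w - b))) * z (ξ, b + t • (w - b))).im)
        ((fun _ : ℝ => (0 : ℝ →L[ℝ] ℝ)) t
          ((starRingEnd ℂ) (y (ξ, b + t • (w - b))) * z (ξ, b + t • (w - b))).im) (Set.Icc 0 1) t := by
      intro t ht
      have h4 := Complex.conjCLE.toContinuousLinearMap.hasFDerivAt.comp_hasDerivWithinAt t (h1 t ht)
      have h5 := Complex.imCLM.hasFDerivAt.comp_hasDerivWithinAt t (h4.mul (h2 t ht))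
      refine h5.congr_deriv ?_
      have := op_trace (A (ξ, b + t • (w - b)) (w - b)) (y (ξ, b + t • (w - b)))
        (z (ξ, b + t • (w - b)))
      simpa using this
    have h6 : ∀ t ∈ Set.Icc (0 : ℝ) 1, HasDerivWithinAt (fun _ : ℝ => (1 : ℝ))
        ((fun _ : ℝ => (0 : ℝ →L[ℝ] ℝ)) t 1) (Set.Icc 0 1) t := fun t _ => by
      simpa using hasDerivWithinAt_const t (Set.Icc (0 : ℝ) 1) (1 : ℝ)
    have := linear_ode_unique continuousOn_const h3 h6 (by
      simp [(hy ξ hξ).2, (hz ξ hξ).2, ← mv_one, ← mv_I, im_conj_mv_mul_mv, -Complex.mul_im])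
      (Set.right_mem_Icc.2 zero_le_one)
    simpa [-Complex.mul_im] using this
  have hy0 : ∀ p ∈ T ×ˢ X, y p ≠ 0 := by
    rintro ⟨ξ, w⟩ ⟨hξ, hw⟩ h
    have := hdet ξ hξ w hw
    rw [h] at this
    simp at this
  obtain ⟨ℓ, hℓc, hℓe, hℓb⟩ := exists_log_lift hX hb hys.continuousOn hy0
    (fun ξ hξ => (hy ξ hξ).2.trans rfl)
  have hℓs : ContDiffOn ℝ ∞ ℓ (T ×ˢ X) := contDiffOn_of_exp hℓc (hys.congr hℓe)
  set D : E × V → Cov := fun p => (ℓ p, ((starRingEnd ℂ) (y p) * z p).re) with hD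
  have hDs : ContDiffOn ℝ ∞ D (T ×ˢ X) := hℓs.prodMk
    (contDiff_re.comp_contDiffOn ((contDiff_conj.comp_contDiffOn hys).mul hzs))
  have h1 : ∀ p ∈ T ×ˢ X, colOne (D p) = y p := fun p hp => hℓe p hp
  have h2 : ∀ p ∈ T ×ˢ X, colI (D p) = z p := by
    intro p hp
    have e1 := conj_colOne_mul_colI (D p)
    have e2 : (starRingEnd ℂ) (y p) * z p = (D p).2 + Complex.I := by
      apply Complex.ext
      · simp [hD]
      · rw [hdet p.1 hp.1 p.2 hp.2]; simp
    rw [← e2, h1 p hp] at e1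
    exact mul_left_cancel₀ ((map_ne_zero _).2 (hy0 p hp)) e1
  refine ⟨D, hDs, fun ξ hξ => ⟨⟨?_, fun Z w hw => ?_⟩, ?_⟩⟩
  · exact hDs.continuousOn.comp (by fun_prop) fun w hw => ⟨hξ, hw⟩
  · have e : ∀ w ∈ X, mv (D (ξ, w)) Z = Z.re • y (ξ, w) + Z.im • z (ξ, w) := fun w hw => by
      rw [mv, h1 _ ⟨hξ, hw⟩, h2 _ ⟨hξ, hw⟩]; simp
    have h3 := (((hy ξ hξ).1 w hw).const_smul Z.re).add (((hz ξ hξ).1 w hw).const_smul Z.im)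
    refine (HasFDerivWithinAt.congr h3 e (e w hw)).congr_fderiv ?_
    ext v
    simp [e w hw, -Complex.real_smul]
  · have hp : (ξ, b) ∈ T ×ˢ X := ⟨hξ, hb⟩
    refine cov_ext (hℓb ξ hξ) fun Z => ?_
    rw [mv, mv, h1 _ hp, h2 _ hp, (hy ξ hξ).2, (hz ξ hξ).2]

end Dev

theorem _root_.ContinuousOn.act {X : Type*} [TopologicalSpace X] {s : Set X} {D : X → Cov} {θ : X → ℝ}
    (hD : ContinuousOn D s) (hθ : ContinuousOn θ s) : ContinuousOn (fun x => act (D x) (θ x)) s :=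
  continuous_act.comp_continuousOn (f := fun x => (D x, θ x)) (hD.prodMk hθ)

theorem _root_.ContDiffOn.act {X : Type*} [NormedAddCommGroup X] [NormedSpace ℝ X] {s : Set X}
    {D : X → Cov} {θ : X → ℝ} {n : WithTop ℕ∞} (hD : ContDiffOn ℝ n D s) (hθ : ContDiffOn ℝ n θ s) :
    ContDiffOn ℝ n (fun x => act (D x) (θ x)) s :=
  contDiff_act.comp_contDiffOn (f := fun x => (D x, θ x)) (hD.prodMk hθ)

theorem _root_.ContDiffOn.gmul {X : Type*} [NormedAddCommGroup X] [NormedSpace ℝ X] {s : Set X}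
    {D D' : X → Cov} {n : WithTop ℕ∞} (hD : ContDiffOn ℝ n D s) (hD' : ContDiffOn ℝ n D' s) :
    ContDiffOn ℝ n (fun x => gmul (D x) (D' x)) s :=
  contDiff_gmul.comp_contDiffOn (f := fun x => (D x, D' x)) (hD.prodMk hD')

theorem _root_.ContDiffOn.ginv {X : Type*} [NormedAddCommGroup X] [NormedSpace ℝ X] {s : Set X}
    {D : X → Cov} {n : WithTop ℕ∞} (hD : ContDiffOn ℝ n D s) :
    ContDiffOn ℝ n (fun x => ginv (D x)) s :=
  contDiff_ginv.comp_contDiffOn hD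

/-! ### Parallel transport -/

/-- The identification of `ℂ` with `ℝ²` used for matrices. -/
def vec (Z : ℂ) : Fin 2 → ℝ := ![Z.im, Z.re]

theorem vec_injective : Function.Injective vec := fun Z Z' h => by
  have h0 := congrFun h 0
  have h1 := congrFun h 1
  exact Complex.ext h1 h0

theorem vec_smul (r : ℝ) (Z : ℂ) : vec (r * Z) = r • vec Z := by
  ext i; fin_cases i <;> simp [vec]

theorem dir_eq (θ : ℝ) : dir θ = vec (cdir θ) := by
  ext i
  fin_cases i
  · simp only [dir, vec, cdir]; simp [Complex.exp_ofReal_mul_I_im, -Complex.ofReal_div]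
  · simp only [dir, vec, cdir]; simp [Complex.exp_ofReal_mul_I_re, -Complex.ofReal_div]

/-- The matrix of the linear action. -/
def matOf (D : Cov) : Mat := !![(colI D).im, (colOne D).im; (colI D).re, (colOne D).re]

theorem matOf_mulVec (D : Cov) (Z : ℂ) : (matOf D).mulVec (vec Z) = vec (mv D Z) := by
  ext i
  fin_cases i <;> simp [matOf, vec, mv, Matrix.mulVec, dotProduct, Fin.sum_univ_two] <;> ring

theorem toMat_mulVec (x : Lie) (Z : ℂ) : (toMat x).mulVec (vec Z) = vec (op x Z) := by
  ext i
  fin_cases i <;> simp [toMat, vec, op_re, op_im, Matrix.mulVec, dotProduct, Fin.sum_univ_two] <;> ring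

theorem matOf_gone : matOf gone = 1 := by
  ext i j
  fin_cases i <;> fin_cases j <;> simp [matOf, gone, colOne, colI]

theorem sends_matOf_act (D : Cov) (θ : ℝ) : Sends (matOf D) θ (act D θ) := by
  obtain ⟨r, hr, h⟩ := mv_cdir D θ
  exact ⟨r, hr.ne', by rw [dir_eq, dir_eq, matOf_mulVec, h, vec_smul]⟩

theorem sends_matOf {D : Cov} {θ θ' : ℝ} (h : Sends (matOf D) θ θ') :
    ∃ n : ℤ, act D θ = θ' + n * (2 * Real.pi) := by
  obtain ⟨r, hr, h⟩ := h
  rw [dir_eq, dir_eq, matOf_mulVec, ← vec_smul] at h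
  exact exists_act_eq (vec_injective h)

theorem dir_add_int (θ : ℝ) (n : ℤ) : dir (θ + n * (2 * Real.pi)) = (-1 : ℝ) ^ n • dir θ := by
  rw [dir_eq, dir_eq, cdir_add_int, ← vec_smul]
  push_cast
  rfl

theorem sends_of_act {D : Cov} {θ θ' : ℝ} {n : ℤ} (h : act D θ = θ' + n * (2 * Real.pi)) :
    Sends (matOf D) θ θ' := by
  obtain ⟨r, hr, h'⟩ := sends_matOf_act D θ
  rw [h, dir_add_int, smul_smul] at h'
  exact ⟨_, mul_ne_zero hr (zpow_ne_zero _ (by norm_num)), h'⟩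

theorem isTransport_of_dev {a : ℝ → Lie} {D : ℝ → Cov} (hD : IsDev (lineForm a) (Set.Icc 0 1) D)
    (h0 : D 0 = gone) : IsTransport a (matOf (D 1)) (act (D 1)) := by
  refine ⟨fun t => matOf (D t), fun t => act (D t), ⟨by simp only [h0, matOf_gone], ?_⟩, ?_, rfl, rfl⟩
  · intro t ht i j
    have h1 := isParallel_lineForm.1 (hD.2 1) t ht
    have hI := isParallel_lineForm.1 (hD.2 Complex.I) t ht
    rw [mv_one] at h1
    simp only [mv_one] at h1
    rw [mv_I] at hI
    simp only [mv_I] at hI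
    have hre : ∀ {f : ℝ → ℂ} {f' : ℂ}, HasDerivWithinAt f f' (Set.Icc 0 1) t →
        HasDerivWithinAt (fun t => (f t).re) f'.re (Set.Icc 0 1) t := fun h =>
      Complex.reCLM.hasFDerivAt.comp_hasDerivWithinAt t h
    have him : ∀ {f : ℝ → ℂ} {f' : ℂ}, HasDerivWithinAt f f' (Set.Icc 0 1) t →
        HasDerivWithinAt (fun t => (f t).im) f'.im (Set.Icc 0 1) t := fun h =>
      Complex.imCLM.hasFDerivAt.comp_hasDerivWithinAt t h
    have e00 : (toMat (a t) * matOf (D t)) 0 0 = (op (a t) (colI (D t))).im := by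
      simp [toMat, matOf, Matrix.mul_apply, Fin.sum_univ_two, op_im]
    have e01 : (toMat (a t) * matOf (D t)) 0 1 = (op (a t) (colOne (D t))).im := by
      simp [toMat, matOf, Matrix.mul_apply, Fin.sum_univ_two, op_im]
    have e10 : (toMat (a t) * matOf (D t)) 1 0 = (op (a t) (colI (D t))).re := by
      simp [toMat, matOf, Matrix.mul_apply, Fin.sum_univ_two, op_re]; ring
    have e11 : (toMat (a t) * matOf (D t)) 1 1 = (op (a t) (colOne (D t))).re := by
      simp [toMat, matOf, Matrix.mul_apply, Fin.sum_univ_two, op_re]; ring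
    have m00 : ∀ D, matOf D 0 0 = (colI D).im := fun _ => rfl
    have m01 : ∀ D, matOf D 0 1 = (colOne D).im := fun _ => rfl
    have m10 : ∀ D, matOf D 1 0 = (colI D).re := fun _ => rfl
    have m11 : ∀ D, matOf D 1 1 = (colOne D).re := fun _ => rfl
    revert i j
    rw [Fin.forall_fin_two, Fin.forall_fin_two, Fin.forall_fin_two]
    refine ⟨⟨?_, ?_⟩, ?_, ?_⟩
    · simp only [e00, m00]; exact him hI
    · simp only [e01, m01]; exact him h1
    · simp only [e10, m10]; exact hre hI
    · simp only [e11, m11]; exact hre h1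
  · intro θ
    refine ⟨by simp [h0, act_gone], ?_, fun t _ => sends_matOf_act _ _⟩
    exact hD.1.act continuousOn_const

/-- The columns of Φ solve the same linear equation as those of the development. Both lifts then
cover the same path of projective maps and start at the identity, so they agree by continuity. -/
theorem IsTransport.eq_of_dev {a : ℝ → Lie} (ha : ContinuousOn a (Set.Icc 0 1)) {g : Mat} {g' : ℝ → ℝ}
    (h : IsTransport a g g') {D : ℝ → Cov} (hD : IsDev (lineForm a) (Set.Icc 0 1) D)
    (h0 : D 0 = gone) : g = matOf (D 1) ∧ g' = act (D 1) := by
  obtain ⟨Φ, ψ, ⟨hΦ0, hΦ⟩, hψ, rfl, rfl⟩ := h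
  have hop : ContinuousOn (fun t => op (a t)) (Set.Icc 0 1) := op.continuous.comp_continuousOn ha
  have hcol : ∀ j : Fin 2, ∀ t ∈ Set.Icc (0 : ℝ) 1, HasDerivWithinAt
      (fun t => (⟨Φ t 1 j, Φ t 0 j⟩ : ℂ)) (op (a t) ⟨Φ t 1 j, Φ t 0 j⟩) (Set.Icc 0 1) t := by
    intro j t ht
    have h1 := (hΦ t ht 1 j).ofReal_comp.add ((hΦ t ht 0 j).ofReal_comp.mul_const Complex.I)
    have e : (fun t => (⟨Φ t 1 j, Φ t 0 j⟩ : ℂ)) =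
        (fun t => (Φ t 1 j : ℂ)) + fun t => (Φ t 0 j : ℂ) * Complex.I := by
      ext t; apply Complex.ext <;> simp
    rw [e]
    refine h1.congr_deriv ?_
    apply Complex.ext
    · simp [toMat, Matrix.mul_apply, Fin.sum_univ_two, op_re]; ring
    · simp [toMat, Matrix.mul_apply, Fin.sum_univ_two, op_im]
  have hΦD : ∀ t ∈ Set.Icc (0 : ℝ) 1, Φ t = matOf (D t) := by
    intro t ht
    have e1 := linear_ode_unique hop (hcol 1) (isParallel_lineForm.1 (hD.2 1))
      (by rw [hΦ0, h0]; apply Complex.ext <;> simp [gone, colOne]) ht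
    have e0 := linear_ode_unique hop (hcol 0) (isParallel_lineForm.1 (hD.2 Complex.I))
      (by rw [hΦ0, h0]; apply Complex.ext <;> simp [gone, colI]) ht
    simp only [mv_one, mv_I] at e1 e0
    ext i j
    fin_cases i <;> fin_cases j
    · simp [matOf, ← e0]
    · simp [matOf, ← e1]
    · simp [matOf, ← e0]
    · simp [matOf, ← e1]
  refine ⟨hΦD 1 (by simp), funext fun θ => ?_⟩
  obtain ⟨hψ0, hψc, hψs⟩ := hψ θ
  have := const_of_int_mul (s := Set.Icc (0 : ℝ) 1) isPreconnected_Icc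
    (f := fun t => act (D t) θ - ψ t θ)
    ((hD.1.act continuousOn_const).sub hψc) (fun t ht => by
      have h1 := hψs t ht
      rw [hΦD t ht] at h1
      obtain ⟨n, hn⟩ := sends_matOf h1
      exact ⟨n, by rw [hn]; ring⟩) (x₀ := 0) (by simp) (by simp [h0, act_gone, hψ0]) 1 (by simp)
  simp only [sub_eq_zero] at this
  exact this.symm

theorem flatOn_lineForm {a : ℝ → Lie} {X : Set ℝ} : FlatOn (lineForm a) X := by
  intro z _ u v Z
  have hu : ∀ L : ℝ →L[ℝ] Lie, ∀ u : ℝ, L u = u • L 1 := fun L u => by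
    rw [← map_smul, smul_eq_mul, mul_one]
  have h1 : fderivWithin ℝ (lineForm a) X z u v - fderivWithin ℝ (lineForm a) X z v u = 0 := by
    have e1 : ∀ u v : ℝ, fderivWithin ℝ (lineForm a) X z u v =
        (v * u) • fderivWithin ℝ (lineForm a) X z 1 1 := by
      intro u v
      have : fderivWithin ℝ (lineForm a) X z u = u • fderivWithin ℝ (lineForm a) X z 1 := by
        rw [← map_smul, smul_eq_mul, mul_one]
      rw [this, _root_.smul_apply, hu _ v, smul_smul, mul_comm]
    rw [e1 u v, e1 v u, mul_comm, sub_self]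
  rw [h1, hu _ u, hu _ v]
  simp only [map_zero, map_smul, _root_.smul_apply, _root_.zero_apply]
  rw [smul_comm, sub_self]

theorem contDiffOn_lineForm {a : ℝ → Lie} {X : Set ℝ} (ha : ContDiffOn ℝ ∞ a X) :
    ContDiffOn ℝ ∞ (lineForm a) X :=
  (ContinuousLinearMap.toSpanSingletonCLE (𝕜 := ℝ) (E := Lie)).contDiff.comp_contDiffOn ha

theorem exists_line_dev {a : ℝ → Lie} {X : Set ℝ} (hX : Convex ℝ X) (hcl : X ⊆ closure (interior X))
    (hu : UniqueDiffOn ℝ X) (ha : ContDiffOn ℝ ∞ a X) {b : ℝ} (hb : b ∈ X) (D₀ : Cov) :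
    ∃ D : ℝ → Cov, ContDiffOn ℝ ∞ D X ∧ IsDev (lineForm a) X D ∧ D b = D₀ := by
  obtain ⟨D, hD, hD'⟩ := exists_dev (E := ℝ) (T := Set.univ) convex_univ uniqueDiffOn_univ hu hcl
    (hX.starConvex hb) hb
    (fun w _ => ⟨1, one_pos, hX.inter (convex_ball w 1)⟩) (A := fun p => lineForm a p.2)
    ((contDiffOn_lineForm ha).comp contDiffOn_snd fun p hp => hp.2) (fun _ _ => flatOn_lineForm) D₀
  exact ⟨fun t => D (0, t), hD.comp (ContDiff.contDiffOn (by fun_prop)) fun t ht => ⟨trivial, ht⟩,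
    hD' 0 trivial⟩

/-! ### Flatness -/

theorem toMat_eq_zero_iff {M : Mat} : M = 0 ↔ ∀ Z, M.mulVec (vec Z) = 0 := by
  refine ⟨fun h Z => by rw [h, Matrix.zero_mulVec], fun h => ?_⟩
  have h1 := h 1
  have hI := h Complex.I
  ext i j
  fin_cases j
  · simpa [vec, Matrix.mulVec, dotProduct, Fin.sum_univ_two] using congrFun hI i
  · simpa [vec, Matrix.mulVec, dotProduct, Fin.sum_univ_two] using congrFun h1 i

theorem isFlatOn_iff {A : ℂ → ℂ →L[ℝ] Lie} {X : Set ℂ} : IsFlatOn A X ↔ FlatOn A X := by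
  refine forall₂_congr fun z _ => forall₂_congr fun u v => ?_
  rw [toMat_eq_zero_iff]
  refine forall_congr' fun Z => ?_
  rw [Matrix.add_mulVec, Matrix.neg_mulVec, Matrix.sub_mulVec, ← Matrix.mulVec_mulVec,
    ← Matrix.mulVec_mulVec, toMat_mulVec, toMat_mulVec, toMat_mulVec, toMat_mulVec, toMat_mulVec]
  have hs : ∀ Z Z' : ℂ, vec Z - vec Z' = vec (Z - Z') := fun Z Z' => by
    ext i; fin_cases i <;> simp [vec]
  rw [hs, neg_add_eq_zero]
  exact vec_injective.eq_iff

section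

variable {V V' : Type} [NormedAddCommGroup V] [NormedSpace ℝ V] [NormedAddCommGroup V']
  [NormedSpace ℝ V']

/-- Symmetry of the second derivative of a parallel section is the curvature equation applied to
that section, and the values of parallel sections at a point exhaust ℂ. -/
theorem flatOn_of_dev {A : V → V →L[ℝ] Lie} {X : Set V} (hu : UniqueDiffOn ℝ X)
    (hcl : X ⊆ closure (interior X)) (hA : ContDiffOn ℝ ∞ A X)
    (h : ∀ z ∈ X, ∃ U : Set V, IsOpen U ∧ z ∈ U ∧ ∃ D : V → Cov, ContDiffOn ℝ ∞ D (X ∩ U) ∧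
      IsDev A (X ∩ U) D) : FlatOn A X := by
  intro z hz u v Z
  obtain ⟨U, hU, hzU, D, hDs, hD⟩ := h z hz
  have hzX : z ∈ X ∩ U := ⟨hz, hzU⟩
  have hu' : UniqueDiffOn ℝ (X ∩ U) := hu.inter hU
  have hcl' : z ∈ closure (interior (X ∩ U)) := by
    rw [interior_inter, hU.interior_eq]
    exact hU.closure_inter ⟨hcl hz, hzU⟩
  have hA' : ContDiffOn ℝ ∞ A (X ∩ U) := hA.mono Set.inter_subset_left
  have hdA : HasFDerivWithinAt A (fderivWithin ℝ A X z) (X ∩ U) z :=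
    (hA.differentiableOn (by simp) z hz).hasFDerivWithinAt.mono Set.inter_subset_left
  have key : ∀ Z₀, op (fderivWithin ℝ A X z u v - fderivWithin ℝ A X z v u) (mv (D z) Z₀) =
      op (A z u) (op (A z v) (mv (D z) Z₀)) - op (A z v) (op (A z u) (mv (D z) Z₀)) := by
    intro Z₀
    set y : V → ℂ := fun w => mv (D w) Z₀ with hy
    have hys : ContDiffOn ℝ ∞ y (X ∩ U) :=
      contDiff_mv.comp_contDiffOn (hDs.prodMk contDiffOn_const)
    have hp := hD.2 Z₀
    have hsymm := ((hys z hzX).isSymmSndFDerivWithinAt (n := ∞)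
      (by simp; exact WithTop.coe_le_coe.2 (le_top (a := (2 : ℕ∞)))) hu' hcl' hzX).eq u v
    have hfd : ∀ w ∈ X ∩ U, fderivWithin ℝ y (X ∩ U) w = (op.flip (y w)).comp (A w) := fun w hw =>
      (hp w hw).fderivWithin (hu' w hw)
    have h2 : ∀ u v, fderivWithin ℝ (fderivWithin ℝ y (X ∩ U)) (X ∩ U) z u v =
        op (fderivWithin ℝ A X z u v) (y z) + op (A z v) (op (A z u) (y z)) := by
      intro u v
      have hd1 : HasFDerivWithinAt (fderivWithin ℝ y (X ∩ U))
          (fderivWithin ℝ (fderivWithin ℝ y (X ∩ U)) (X ∩ U) z) (X ∩ U) z :=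
        ((hys.fderivWithin hu' (m := ∞) (by simp)).differentiableOn (by simp) z hzX).hasFDerivWithinAt
      have hd2 : HasFDerivWithinAt (fun w => fderivWithin ℝ y (X ∩ U) w v) _ (X ∩ U) z :=
        hd1.clm_apply (hasFDerivWithinAt_const v z _)
      have hd3 : HasFDerivWithinAt (fun w => A w v) _ (X ∩ U) z :=
        hdA.clm_apply (hasFDerivWithinAt_const v z _)
      have hd4 : HasFDerivWithinAt (fun w => op (A w v) (y w)) _ (X ∩ U) z :=
        (op.hasFDerivAt.comp_hasFDerivWithinAt z hd3).clm_apply (hp z hzX)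
      have hd5 := HasFDerivWithinAt.congr hd4 (f₁ := fun w => fderivWithin ℝ y (X ∩ U) w v)
        (fun w hw => by simp only [hfd w hw]; rfl) (by simp only [hfd z hzX]; rfl)
      have := congrArg (fun L : V →L[ℝ] ℂ => L u) ((hu' z hzX).eq hd2 hd5)
      simp at this
      rw [this]
      abel
    rw [h2, h2] at hsymm
    rw [map_sub, _root_.sub_apply]
    linear_combination hsymm
  have := key (mv (ginv (D z)) Z)
  rwa [mv_mv_ginv] at this

/-- The second derivative of the map c is symmetric, so it cancels in the antisymmetrised derivative
of the pullback. -/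
theorem FlatOn.comp {A : V → V →L[ℝ] Lie} {X : Set V} (h : FlatOn A X)
    (hA : ContDiffOn ℝ ∞ A X) {X' : Set V'} (hu : UniqueDiffOn ℝ X') {c : V' → V}
    (hc : ContDiff ℝ ∞ c) (hm : Set.MapsTo c X' X) :
    FlatOn (fun x => (A (c x)).comp (fderiv ℝ c x)) X' := by
  intro z hz u v Z
  have hdA : HasFDerivWithinAt A (fderivWithin ℝ A X (c z)) X (c z) :=
    (hA.differentiableOn (by simp) _ (hm hz)).hasFDerivWithinAt
  have hdc : HasFDerivWithinAt c (fderiv ℝ c z) X' z :=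
    (hc.differentiable (by simp) z).hasFDerivAt.hasFDerivWithinAt
  have hddc : HasFDerivWithinAt (fderiv ℝ c) (fderiv ℝ (fderiv ℝ c) z) X' z :=
    ((hc.fderiv_right (m := ∞) (by simp)).differentiable (by simp) z).hasFDerivAt.hasFDerivWithinAt
  have hsymm := (hc.contDiffAt (x := z)).isSymmSndFDerivAt (n := ∞)
    (by simp; exact WithTop.coe_le_coe.2 (le_top (a := (2 : ℕ∞))))
  have h1 : HasFDerivWithinAt (fun x => (A (c x)).comp (fderiv ℝ c x)) _ X' z :=
    (hdA.comp z hdc hm).clm_comp hddc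
  rw [HasFDerivWithinAt.fderivWithin h1 (hu z hz)]
  have h2 := h (c z) (hm hz) (fderiv ℝ c z u) (fderiv ℝ c z v) Z
  simp only [Function.comp_apply, _root_.add_apply, ContinuousLinearMap.comp_apply,
    ContinuousLinearMap.compL_apply, ContinuousLinearMap.flip_apply] at h2 ⊢
  rw [← h2, hsymm.eq u v]
  congr 2
  abel

end

/-! ### Local inverses of plane maps -/

theorem exists_equiv_of_jacobian {L : ℝ × ℝ →L[ℝ] ℂ}
    (hJ : 0 < ((starRingEnd ℂ) (L (1, 0)) * L (0, 1)).im) :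
    ∃ L' : (ℝ × ℝ) ≃L[ℝ] ℂ, (L' : ℝ × ℝ →L[ℝ] ℂ) = L := by
  have hinj : Function.Injective (L : ℝ × ℝ →ₗ[ℝ] ℂ) := by
    rw [injective_iff_map_eq_zero]
    rintro ⟨a, b⟩ hab
    have e : L (a, b) = a • L (1, 0) + b • L (0, 1) := by
      rw [← map_smul, ← map_smul, ← map_add]; simp
    have h0 : a • L (1, 0) + b • L (0, 1) = 0 := e.symm.trans hab
    have hre := congrArg Complex.re h0
    have him := congrArg Complex.im h0
    simp only [Complex.add_re, Complex.add_im, Complex.real_smul, Complex.mul_re, Complex.mul_im,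
      Complex.ofReal_re, Complex.ofReal_im, Complex.conj_re, Complex.conj_im, Complex.zero_re,
      Complex.zero_im] at hre him hJ
    have ha : a * (-(L (1, 0)).im * (L (0, 1)).re + (L (1, 0)).re * (L (0, 1)).im) = 0 := by
      linear_combination (L (0, 1)).im * hre - (L (0, 1)).re * him
    have hb : b * (-(L (1, 0)).im * (L (0, 1)).re + (L (1, 0)).re * (L (0, 1)).im) = 0 := by
      linear_combination (L (1, 0)).re * him - (L (1, 0)).im * hre
    have hne : -(L (1, 0)).im * (L (0, 1)).re + (L (1, 0)).re * (L (0, 1)).im ≠ 0 := by linarith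
    rw [(mul_eq_zero.1 ha).resolve_right hne, (mul_eq_zero.1 hb).resolve_right hne]
    rfl
  refine ⟨(LinearMap.linearEquivOfInjective (L : ℝ × ℝ →ₗ[ℝ] ℂ) hinj
    (by simp [Complex.finrank_real_complex])).toContinuousLinearEquiv, ?_⟩
  ext <;> simp

theorem exists_smooth_inverse {f : ℝ × ℝ → ℂ} {O : Set (ℝ × ℝ)} (hO : IsOpen O)
    (hf : ContDiffOn ℝ ∞ f O) {p : ℝ × ℝ} (hp : p ∈ O)
    (hJ : 0 < ((starRingEnd ℂ) (fderiv ℝ f p (1, 0)) * fderiv ℝ f p (0, 1)).im) :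
    ∃ (U : Set ℂ) (g : ℂ → ℝ × ℝ), IsOpen U ∧ f p ∈ U ∧ ContDiffOn ℝ ∞ g U ∧ g (f p) = p ∧
      (∀ z ∈ U, g z ∈ O ∧ f (g z) = z) ∧ ∀ᶠ q in 𝓝 p, g (f q) = q := by
  have hfp := hf.contDiffAt (hO.mem_nhds hp)
  obtain ⟨L, hL⟩ := exists_equiv_of_jacobian hJ
  have hd : HasFDerivAt f (L : ℝ × ℝ →L[ℝ] ℂ) p := by
    rw [hL]; exact (hfp.differentiableAt (by simp)).hasFDerivAt
  set e := hfp.toOpenPartialHomeomorph f hd (by simp) with he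
  have hcoe : (e : ℝ × ℝ → ℂ) = f := hfp.toOpenPartialHomeomorph_coe hd (by simp)
  have hps : p ∈ e.source := hfp.mem_toOpenPartialHomeomorph_source hd (by simp)
  set J : ℝ × ℝ → ℝ := fun q => ((starRingEnd ℂ) (fderiv ℝ f q (1, 0)) * fderiv ℝ f q (0, 1)).im with hJd
  have hJc : ContinuousOn J O := by
    have h1 := hf.continuousOn_fderiv_of_isOpen hO (by simp)
    exact Complex.continuous_im.comp_continuousOn
      ((Complex.continuous_conj.comp_continuousOn (h1.clm_apply continuousOn_const)).mul
        (h1.clm_apply continuousOn_const))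
  -- Restricting to positive Jacobian makes the inverse smooth on the whole of the neighbourhood,
  -- not just at the image of p.
  have hO' : IsOpen (O ∩ J ⁻¹' Set.Ioi 0) := hJc.isOpen_inter_preimage hO isOpen_Ioi
  refine ⟨e.target ∩ e.symm ⁻¹' (O ∩ J ⁻¹' Set.Ioi 0), e.symm, e.symm.isOpen_inter_preimage hO',
    ?_, ?_, ?_, ?_, ?_⟩
  · have h1 : e p ∈ e.target := e.map_source hps
    have h2 : e.symm (e p) = p := e.left_inv hps
    rw [hcoe] at h1 h2
    exact ⟨h1, by rw [Set.mem_preimage, h2]; exact ⟨hp, hJ⟩⟩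
  · rintro z ⟨hz1, hz2, hz3⟩
    obtain ⟨L', hL'⟩ := exists_equiv_of_jacobian hz3
    have hfz := hf.contDiffAt (hO.mem_nhds hz2)
    have hd' : HasFDerivAt f (L' : ℝ × ℝ →L[ℝ] ℂ) (e.symm z) := by
      rw [hL']; exact (hfz.differentiableAt (by simp)).hasFDerivAt
    exact (e.contDiffAt_symm hz1 (by rw [hcoe]; exact hd') (by rw [hcoe]; exact hfz)).contDiffWithinAt
  · have := e.left_inv hps
    rwa [hcoe] at this
  · rintro z ⟨hz1, hz2, hz3⟩
    have := e.right_inv hz1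
    rw [hcoe] at this
    exact ⟨hz2, this⟩
  · filter_upwards [e.open_source.mem_nhds hps] with q hq
    have := e.left_inv hq
    rwa [hcoe] at this

/-! ### Polar coordinates around the interior puncture -/

theorem norm_bpt (φ : ℝ) : ‖bpt φ‖ = 1 := Complex.norm_exp_ofReal_mul_I φ

theorem contDiff_bpt {n : WithTop ℕ∞} : ContDiff ℝ n bpt :=
  contDiff_cexp.comp (contDiff_ofReal.mul contDiff_const)

theorem bpt_eq_iff {φ φ' : ℝ} : bpt φ = bpt φ' ↔ ∃ n : ℤ, φ = φ' + n * (2 * Real.pi) := by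
  rw [bpt, bpt, Complex.exp_eq_exp_iff_exists_int]
  refine exists_congr fun n => ?_
  rw [show (φ' : ℂ) * Complex.I + n * (2 * Real.pi * Complex.I)
    = ((φ' + n * (2 * Real.pi) : ℝ) : ℂ) * Complex.I by push_cast; ring]
  rw [mul_left_inj' Complex.I_ne_zero, Complex.ofReal_inj]

theorem exists_bpt {z : ℂ} (hz : ‖z‖ = 1) : ∃ φ, bpt φ = z :=
  ⟨z.arg, by have := Complex.norm_mul_exp_arg_mul_I z; rwa [hz, Complex.ofReal_one, one_mul] at this⟩

theorem bpt_add_int (φ : ℝ) (n : ℤ) : bpt (φ + n * (2 * Real.pi)) = bpt φ :=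
  bpt_eq_iff.2 ⟨n, rfl⟩

/-- Polar coordinates: the point at relative distance `r` on the segment from `ζ` to `e^{iφ}`. -/
def polar (ζ : ℂ) (w : ℝ × ℝ) : ℂ := ζ + w.1 * (bpt w.2 - ζ)

theorem contDiff_polar {n : WithTop ℕ∞} (ζ : ℂ) : ContDiff ℝ n (polar ζ) :=
  contDiff_const.add ((contDiff_ofReal.comp contDiff_fst).mul
    ((contDiff_bpt.comp contDiff_snd).sub contDiff_const))

theorem polar_one (ζ : ℂ) (φ : ℝ) : polar ζ (1, φ) = bpt φ := by simp [polar]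

theorem polar_add_int (ζ : ℂ) (r φ : ℝ) (n : ℤ) :
    polar ζ (r, φ + n * (2 * Real.pi)) = polar ζ (r, φ) := by
  simp only [polar, bpt_add_int]

section

variable {ζ : ℂ} (hζ : ‖ζ‖ < 1)

include hζ

theorem bpt_ne (φ : ℝ) : bpt φ ≠ ζ := fun h => by
  rw [← h, norm_bpt] at hζ; exact lt_irrefl _ hζ

theorem polar_ne {w : ℝ × ℝ} (hw : 0 < w.1) : polar ζ w ≠ ζ := fun h => by
  have h1 : (w.1 : ℂ) * (bpt w.2 - ζ) = 0 := by simpa [polar] using h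
  rcases mul_eq_zero.1 h1 with h2 | h2
  · exact hw.ne' (Complex.ofReal_eq_zero.1 h2)
  · exact bpt_ne hζ _ (sub_eq_zero.1 h2)

theorem norm_polar_lt {w : ℝ × ℝ} (h0 : 0 < w.1) (h1 : w.1 < 1) : ‖polar ζ w‖ < 1 := by
  have e : polar ζ w = ((1 - w.1 : ℝ) : ℂ) * ζ + (w.1 : ℂ) * bpt w.2 := by
    simp only [polar]; push_cast; ring
  rw [e]
  refine (norm_add_le _ _).trans_lt ?_
  rw [norm_mul, norm_mul, norm_bpt, Complex.norm_of_nonneg (by linarith), Complex.norm_of_nonneg h0.le]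
  nlinarith [norm_nonneg ζ]

theorem lt_norm_polar {w : ℝ × ℝ} (h1 : 1 < w.1) : 1 < ‖polar ζ w‖ := by
  have e : polar ζ w = (w.1 : ℂ) * bpt w.2 - ((w.1 - 1 : ℝ) : ℂ) * ζ := by
    simp only [polar]; push_cast; ring
  rw [e]
  refine lt_of_lt_of_le ?_ (norm_sub_norm_le _ _)
  rw [norm_mul, norm_mul, norm_bpt, Complex.norm_of_nonneg (by linarith), Complex.norm_of_nonneg (by linarith)]
  nlinarith [norm_nonneg ζ]

theorem norm_polar_le_one_iff {w : ℝ × ℝ} (h0 : 0 < w.1) : ‖polar ζ w‖ ≤ 1 ↔ w.1 ≤ 1 := by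
  refine ⟨fun h => not_lt.1 fun h' => (lt_norm_polar hζ h').not_ge h, fun h => ?_⟩
  rcases h.lt_or_eq with h | h
  · exact (norm_polar_lt hζ h0 h).le
  · rw [show w = (1, w.2) from Prod.ext h rfl, polar_one, norm_bpt]

theorem norm_polar_eq_one_iff {w : ℝ × ℝ} (h0 : 0 < w.1) : ‖polar ζ w‖ = 1 ↔ w.1 = 1 := by
  refine ⟨fun h => ?_, fun h => ?_⟩
  · refine le_antisymm ((norm_polar_le_one_iff hζ h0).1 h.le) (not_lt.1 fun h' => ?_)
    exact (norm_polar_lt hζ h0 h').ne h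
  · rw [show w = (1, w.2) from Prod.ext h rfl, polar_one, norm_bpt]

/-- Push z away from ζ until it meets the unit circle. The factor 2/‖z - ζ‖ suffices for the
intermediate value theorem, since the norm is then at least 2 - ‖ζ‖ ≥ 1. -/
theorem exists_polar {z : ℂ} (hz : ‖z‖ ≤ 1) (hz' : z ≠ ζ) : ∃ w : ℝ × ℝ, 0 < w.1 ∧ polar ζ w = z := by
  have hpos : 0 < ‖z - ζ‖ := norm_pos_iff.2 (sub_ne_zero.2 hz')
  have hle : ‖z - ζ‖ ≤ 2 := (norm_sub_le _ _).trans (by linarith)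
  have h1 : (1 : ℝ) ≤ 2 / ‖z - ζ‖ := by rw [le_div_iff₀ hpos]; linarith
  have hc : ContinuousOn (fun ρ : ℝ => ‖ζ + ρ * (z - ζ)‖) (Set.Icc 1 (2 / ‖z - ζ‖)) := by fun_prop
  have hmem : (1 : ℝ) ∈ Set.Icc ‖ζ + (1 : ℝ) * (z - ζ)‖ ‖ζ + (2 / ‖z - ζ‖ : ℝ) * (z - ζ)‖ := by
    constructor
    · simpa using hz
    · have h2 := norm_sub_norm_le ((2 / ‖z - ζ‖ : ℝ) * (z - ζ) : ℂ) (-ζ)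
      rw [norm_mul, Complex.norm_of_nonneg (by positivity), div_mul_cancel₀ _ hpos.ne', norm_neg,
        sub_neg_eq_add, add_comm _ ζ] at h2
      linarith
  obtain ⟨ρ, hρ, hρ'⟩ := intermediate_value_Icc h1 hc hmem
  obtain ⟨φ, hφ⟩ := exists_bpt hρ'
  have hρ0 : 0 < ρ := lt_of_lt_of_le one_pos hρ.1
  refine ⟨(ρ⁻¹, φ), inv_pos.2 hρ0, ?_⟩
  simp only [polar, hφ]
  have : (ρ : ℂ) ≠ 0 := Complex.ofReal_ne_zero.2 hρ0.ne'
  push_cast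
  field_simp
  ring

/-- Rescaling by the inverse radius of one point puts the common image on the unit circle, which
bounds the ratio of the radii by one. By symmetry the radii agree. -/
theorem polar_inj {w w' : ℝ × ℝ} (h0 : 0 < w.1) (h0' : 0 < w'.1) (h : polar ζ w = polar ζ w') :
    w.1 = w'.1 ∧ ∃ n : ℤ, w.2 = w'.2 + n * (2 * Real.pi) := by
  have key : ∀ {w w' : ℝ × ℝ}, 0 < w.1 → 0 < w'.1 → polar ζ w = polar ζ w' → w'.1 ≤ w.1 := by
    intro w w' h0 h0' h
    have h1 : polar ζ (w'.1 / w.1, w'.2) = bpt w.2 := by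
      have hw : (w.1 : ℂ) ≠ 0 := Complex.ofReal_ne_zero.2 h0.ne'
      simp only [polar] at h ⊢
      push_cast
      field_simp
      linear_combination -h
    have h2 := (norm_polar_le_one_iff hζ (w := (w'.1 / w.1, w'.2)) (div_pos h0' h0)).1
      (by rw [h1, norm_bpt])
    rwa [div_le_one h0] at h2
  have h1 : w.1 = w'.1 := le_antisymm (key h0' h0 h.symm) (key h0 h0' h)
  refine ⟨h1, bpt_eq_iff.1 ?_⟩
  have hw : (w'.1 : ℂ) ≠ 0 := Complex.ofReal_ne_zero.2 h0'.ne'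
  simp only [polar, h1] at h
  have := mul_left_cancel₀ hw (add_left_cancel h)
  exact sub_left_injective this

omit hζ in
theorem hasFDerivAt_bpt (φ : ℝ) : HasDerivAt bpt (bpt φ * Complex.I) φ := by
  have := ((Complex.ofRealCLM.hasDerivAt (x := φ)).mul_const Complex.I).cexp
  simp only [Complex.ofRealCLM_apply, Complex.ofReal_one, one_mul] at this
  exact this

/-- The Jacobian is r(1 - Re(conj ζ · e^{iφ})), and ‖ζ‖ < 1. -/
theorem jacobian_polar {w : ℝ × ℝ} (h0 : 0 < w.1) :
    0 < ((starRingEnd ℂ) (fderiv ℝ (polar ζ) w (1, 0)) * fderiv ℝ (polar ζ) w (0, 1)).im := by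
  have hd := ((contDiff_polar (n := 1) ζ).differentiable (by simp) w).hasFDerivAt
  have h1 : fderiv ℝ (polar ζ) w (1, 0) = bpt w.2 - ζ := by
    have hl : HasDerivAt (fun t : ℝ => ((t, w.2) : ℝ × ℝ)) (1, 0) w.1 :=
      (hasDerivAt_id w.1).prodMk (hasDerivAt_const w.1 w.2)
    have h2 := HasFDerivAt.comp_hasDerivAt w.1 (f := fun t : ℝ => ((t, w.2) : ℝ × ℝ)) hd hl
    have h3 : HasDerivAt (fun t : ℝ => polar ζ (t, w.2)) (bpt w.2 - ζ) w.1 := by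
      have := ((Complex.ofRealCLM.hasDerivAt (x := w.1)).mul_const (bpt w.2 - ζ)).const_add ζ
      simpa [polar] using this
    exact h2.unique h3
  have h2 : fderiv ℝ (polar ζ) w (0, 1) = w.1 * (bpt w.2 * Complex.I) := by
    have hl : HasDerivAt (fun t : ℝ => ((w.1, t) : ℝ × ℝ)) (0, 1) w.2 :=
      (hasDerivAt_const w.2 w.1).prodMk (hasDerivAt_id w.2)
    have h2 := HasFDerivAt.comp_hasDerivAt w.2 (f := fun t : ℝ => ((w.1, t) : ℝ × ℝ)) hd hl
    have h3 : HasDerivAt (fun t : ℝ => polar ζ (w.1, t)) (w.1 * (bpt w.2 * Complex.I)) w.2 := by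
      have := (((hasFDerivAt_bpt w.2).sub_const ζ).const_mul (w.1 : ℂ)).const_add ζ
      simpa [polar] using this
    exact h2.unique h3
  rw [h1, h2]
  have e1 : (starRingEnd ℂ) (bpt w.2) * bpt w.2 = 1 := by
    rw [← Complex.normSq_eq_conj_mul_self, Complex.normSq_eq_norm_sq, norm_bpt]; simp
  have e2 : (starRingEnd ℂ) (bpt w.2 - ζ) * (w.1 * (bpt w.2 * Complex.I)) =
      w.1 * ((1 - (starRingEnd ℂ) ζ * bpt w.2) * Complex.I) := by
    rw [map_sub, ← e1]; ring
  rw [e2, Complex.im_ofReal_mul, Complex.mul_I_im]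
  refine mul_pos h0 ?_
  have h3 : ((starRingEnd ℂ) ζ * bpt w.2).re ≤ ‖ζ‖ := by
    refine (Complex.re_le_norm _).trans ?_
    rw [norm_mul, norm_bpt, mul_one, Complex.norm_conj]
  simp only [Complex.sub_re, Complex.one_re]
  linarith

theorem exists_polar_inverse {w : ℝ × ℝ} (h0 : 0 < w.1) :
    ∃ (U : Set ℂ) (g : ℂ → ℝ × ℝ), IsOpen U ∧ polar ζ w ∈ U ∧ ContDiffOn ℝ ∞ g U ∧ g (polar ζ w) = w ∧
      ∀ z ∈ U, 0 < (g z).1 ∧ polar ζ (g z) = z := by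
  obtain ⟨U, g, h1, h2, h3, h4, h5, -⟩ := exists_smooth_inverse (O := {w : ℝ × ℝ | 0 < w.1})
    (isOpen_lt continuous_const continuous_fst) (contDiff_polar ζ).contDiffOn h0 (jacobian_polar hζ h0)
  exact ⟨U, g, h1, h2, h3, h4, h5⟩

end

/-! ### The surface and its universal cover in polar coordinates. -/

namespace PuncturedDisc

variable {d : ℕ} (S : PuncturedDisc d)

/-- The universal cover of the surface, in polar coordinates. -/
def cover : Set (ℝ × ℝ) := {w | 0 < w.1 ∧ w.1 ≤ 1 ∧ (w.1 = 1 → w.2 ∈ S.bdryAngles)}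

theorem mem_bdryAngles {φ : ℝ} : φ ∈ S.bdryAngles ↔ ∀ j, bpt φ ≠ bpt (S.α j) := by
  refine ⟨fun h => h.1.2.2, fun h => ⟨⟨(norm_bpt φ).le, bpt_ne S.ζint_mem φ, h⟩, norm_bpt φ⟩⟩

theorem isOpen_bdryAngles : IsOpen S.bdryAngles := by
  have : S.bdryAngles = ⋂ j, {φ | bpt φ ≠ bpt (S.α j)} := by
    ext φ; simp [mem_bdryAngles]
  rw [this]
  exact isOpen_iInter_of_finite fun j =>
    isOpen_ne_fun (contDiff_bpt (n := 0)).continuous continuous_const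

theorem mem_bdryAngles_add_int {φ : ℝ} (n : ℤ) :
    φ + n * (2 * Real.pi) ∈ S.bdryAngles ↔ φ ∈ S.bdryAngles := by
  simp only [mem_bdryAngles, bpt_add_int]

theorem polar_mem_iff {w : ℝ × ℝ} (h0 : 0 < w.1) : polar S.ζint w ∈ S.carrier ↔ w ∈ S.cover := by
  constructor
  · intro h
    refine ⟨h0, (norm_polar_le_one_iff S.ζint_mem h0).1 h.1, fun h1 => ?_⟩
    rw [mem_bdryAngles]
    intro j
    rw [show w = (1, w.2) from Prod.ext h1 rfl, polar_one] at h
    exact h.2.2 j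
  · rintro ⟨-, h1, h2⟩
    refine ⟨(norm_polar_le_one_iff S.ζint_mem h0).2 h1, polar_ne S.ζint_mem h0, fun j hj => ?_⟩
    have h3 := (norm_polar_eq_one_iff S.ζint_mem h0).1 (by rw [hj, norm_bpt])
    rw [show w = (1, w.2) from Prod.ext h3 rfl, polar_one] at hj
    exact (S.mem_bdryAngles).1 (h2 h3) j hj

theorem polar_mem {w : ℝ × ℝ} (h : w ∈ S.cover) : polar S.ζint w ∈ S.carrier :=
  (S.polar_mem_iff h.1).2 h

theorem exists_cover {z : ℂ} (hz : z ∈ S.carrier) : ∃ w ∈ S.cover, polar S.ζint w = z := by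
  obtain ⟨w, h0, rfl⟩ := exists_polar S.ζint_mem hz.1 hz.2.1
  exact ⟨w, (S.polar_mem_iff h0).1 hz, rfl⟩

theorem cover_add_int {w : ℝ × ℝ} (n : ℤ) (h : w ∈ S.cover) :
    (w.1, w.2 + n * (2 * Real.pi)) ∈ S.cover :=
  ⟨h.1, h.2.1, fun h1 => (S.mem_bdryAngles_add_int n).2 (h.2.2 h1)⟩

theorem mem_cover_of_lt {w : ℝ × ℝ} (h0 : 0 < w.1) (h1 : w.1 < 1) : w ∈ S.cover :=
  ⟨h0, h1.le, fun h => absurd h h1.ne⟩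

theorem mem_cover_one {φ : ℝ} : ((1, φ) : ℝ × ℝ) ∈ S.cover ↔ φ ∈ S.bdryAngles :=
  ⟨fun h => h.2.2 rfl, fun h => ⟨one_pos, le_rfl, fun _ => h⟩⟩

/-- The cover is not convex, since points are missing from the edge r = 1. A segment which starts at
a point with r < 1 can meet this edge only at its other endpoint. -/
theorem cover_starConvex {b : ℝ × ℝ} (h0 : 0 < b.1) (h1 : b.1 < 1) : StarConvex ℝ b S.cover := by
  intro w hw s t hs ht hst
  rcases hs.eq_or_lt with rfl | hs
  · have : t = 1 := by linarith
    simpa [this] using hw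
  · have e : (s • b + t • w).1 = s * b.1 + t * w.1 := rfl
    refine S.mem_cover_of_lt ?_ ?_
    · rw [e]; exact add_pos_of_pos_of_nonneg (mul_pos hs h0) (mul_nonneg ht hw.1.le)
    · rw [e]; nlinarith [hw.2.1]

theorem strip_subset : Set.Ioo 0 1 ×ˢ Set.univ ⊆ S.cover := fun _ hw =>
  S.mem_cover_of_lt hw.1.1 hw.1.2

theorem cover_subset_closure_strip : S.cover ⊆ closure (Set.Ioo 0 1 ×ˢ Set.univ) := fun w hw => by
  rw [closure_prod_eq, closure_Ioo (by norm_num), closure_univ]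
  exact ⟨⟨hw.1.le, hw.2.1⟩, trivial⟩

theorem isOpen_strip : IsOpen ((Set.Ioo 0 1 : Set ℝ) ×ˢ (Set.univ : Set ℝ)) :=
  isOpen_Ioo.prod isOpen_univ

theorem uniqueDiffOn_cover : UniqueDiffOn ℝ S.cover := fun w hw =>
  (uniqueDiffWithinAt_convex ((convex_Ioo 0 1).prod convex_univ)
    (by rw [isOpen_strip.interior_eq]; exact ⟨(1 / 2, 0), by norm_num⟩)
    (S.cover_subset_closure_strip hw)).mono S.strip_subset

theorem cover_subset_closure : S.cover ⊆ closure (interior S.cover) :=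
  S.cover_subset_closure_strip.trans
    (closure_mono (interior_maximal S.strip_subset isOpen_strip))

/-- The missing points of the edge form a closed set, so a small ball around a point of the cover
avoids them. Smooth dependence of radial solutions on their endpoint is proved on such convex
pieces. -/
theorem cover_locally_convex {w : ℝ × ℝ} (hw : w ∈ S.cover) :
    ∃ ε > 0, Convex ℝ (S.cover ∩ Metric.ball w ε) := by
  have key : ∃ ε > 0, ∀ v ∈ Metric.ball w ε, v.1 = 1 → v.2 ∈ S.bdryAngles := by
    rcases hw.2.1.lt_or_eq with h | h
    · refine ⟨1 - w.1, by linarith, fun v hv h1 => ?_⟩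
      have h2 : dist v.1 w.1 < 1 - w.1 := (le_max_left _ _).trans_lt hv
      rw [Real.dist_eq, h1] at h2
      exact absurd h2 (not_lt.2 (le_abs_self _))
    · obtain ⟨ε, hε, hb⟩ := Metric.isOpen_iff.1 S.isOpen_bdryAngles _ (hw.2.2 h)
      exact ⟨ε, hε, fun v hv _ => hb (show dist v.2 w.2 < ε from (le_max_right _ _).trans_lt hv)⟩
  obtain ⟨ε, hε, hb⟩ := key
  refine ⟨ε, hε, ?_⟩
  have : S.cover ∩ Metric.ball w ε = (Set.Ioc 0 1 ×ˢ Set.univ) ∩ Metric.ball w ε := by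
    ext v
    exact ⟨fun h => ⟨⟨⟨h.1.1, h.1.2.1⟩, trivial⟩, h.2⟩,
      fun h => ⟨⟨h.1.1.1, h.1.1.2, hb v h.2⟩, h.2⟩⟩
  rw [this]
  exact ((convex_Ioc 0 1).prod convex_univ).inter (convex_ball w ε)

theorem ball_diff_subset : Metric.ball 0 1 \ {S.ζint} ⊆ S.carrier := fun z hz => by
  have hz1 : ‖z‖ < 1 := by simpa using hz.1
  exact ⟨hz1.le, hz.2, fun j hj => by rw [hj, norm_bpt] at hz1; exact lt_irrefl _ hz1⟩

theorem carrier_aux {z : ℂ} (hz : z ∈ S.carrier) :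
    z ∈ closure (Metric.ball 0 1 ∩ Metric.ball z (dist z S.ζint)) := by
  have h1 : z ∈ closure (Metric.ball (0 : ℂ) 1) := by
    rw [closure_ball _ one_ne_zero]; simpa using hz.1
  exact Metric.isOpen_ball.closure_inter ⟨h1, Metric.mem_ball_self (dist_pos.2 hz.2.1)⟩

theorem uniqueDiffOn_carrier : UniqueDiffOn ℝ S.carrier := fun z hz => by
  have ho : IsOpen (Metric.ball (0 : ℂ) 1 ∩ Metric.ball z (dist z S.ζint)) :=
    Metric.isOpen_ball.inter Metric.isOpen_ball
  refine (uniqueDiffWithinAt_convex ((convex_ball 0 1).inter (convex_ball z (dist z S.ζint))) ?_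
    (S.carrier_aux hz)).mono fun v hv => S.ball_diff_subset ⟨hv.1, fun h => ?_⟩
  · rw [ho.interior_eq]
    exact closure_nonempty_iff.1 ⟨_, S.carrier_aux hz⟩
  · rw [Set.mem_singleton_iff] at h
    have := hv.2
    rw [h, Metric.mem_ball, dist_comm] at this
    exact lt_irrefl _ this

theorem carrier_subset_closure : S.carrier ⊆ closure (interior S.carrier) := fun z hz => by
  refine closure_mono (interior_maximal (fun v hv => S.ball_diff_subset ⟨hv.1, fun h => ?_⟩)
    (Metric.isOpen_ball.inter Metric.isOpen_ball)) (S.carrier_aux hz)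
  rw [Set.mem_singleton_iff] at h
  have := hv.2
  rw [h, Metric.mem_ball, dist_comm] at this
  exact lt_irrefl _ this

theorem exists_branch {w : ℝ × ℝ} (hw : w ∈ S.cover) :
    ∃ (U : Set ℂ) (g : ℂ → ℝ × ℝ), IsOpen U ∧ polar S.ζint w ∈ U ∧ ContDiffOn ℝ ∞ g U ∧
      g (polar S.ζint w) = w ∧ (∀ z ∈ U, polar S.ζint (g z) = z) ∧
      ∀ z ∈ S.carrier ∩ U, g z ∈ S.cover := by
  obtain ⟨U, g, h1, h2, h3, h4, h5⟩ := exists_polar_inverse S.ζint_mem hw.1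
  refine ⟨U, g, h1, h2, h3, h4, fun z hz => (h5 z hz).2, fun z hz => ?_⟩
  rw [← S.polar_mem_iff (h5 z hz.2).1, (h5 z hz.2).2]
  exact hz.1

/-- Maps from star-shaped sets to the surface lift to the universal cover. -/
theorem exists_lift {V : Type} [NormedAddCommGroup V] [NormedSpace ℝ V] {X : Set V} {b : V}
    (hX : StarConvex ℝ b X) (hb : b ∈ X) {f : V → ℂ} (hf : ContDiffOn ℝ ∞ f X)
    (hm : Set.MapsTo f X S.carrier) {w : ℝ × ℝ} (hw : 0 < w.1) (hfb : f b = polar S.ζint w) :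
    ∃ F : V → ℝ × ℝ, ContDiffOn ℝ ∞ F X ∧ Set.MapsTo F X S.cover ∧
      (∀ x ∈ X, polar S.ζint (F x) = f x) ∧ F b = w := by
  have hex : ∀ z, ∃ w : ℝ × ℝ, z ∈ S.carrier → w ∈ S.cover ∧ polar S.ζint w = z := fun z => by
    by_cases hz : z ∈ S.carrier
    · obtain ⟨w, h1, h2⟩ := S.exists_cover hz
      exact ⟨w, fun _ => ⟨h1, h2⟩⟩
    · exact ⟨0, fun h => absurd h hz⟩
  choose σ hσ using hex
  have hN : ContDiffOn ℝ ∞ (fun z => bpt (σ z).2) S.carrier ∧ ContDiffOn ℝ ∞ (fun z => (σ z).1) S.carrier := by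
    have key : ∀ z ∈ S.carrier, ∃ (U : Set ℂ) (g : ℂ → ℝ × ℝ), IsOpen U ∧ z ∈ U ∧ ContDiffOn ℝ ∞ g U ∧
        ∀ z ∈ S.carrier ∩ U, bpt (σ z).2 = bpt (g z).2 ∧ (σ z).1 = (g z).1 := by
      intro z hz
      obtain ⟨h1, h2⟩ := hσ z hz
      obtain ⟨U, g, hU, hzU, hg, -, hg1, hg2⟩ := S.exists_branch h1
      rw [h2] at hzU
      refine ⟨U, g, hU, hzU, hg, fun z hz => ?_⟩
      have h3 := polar_inj S.ζint_mem (hσ z hz.1).1.1 (hg2 z hz).1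
        ((hσ z hz.1).2.trans (hg1 z hz.2).symm)
      exact ⟨bpt_eq_iff.2 h3.2, h3.1⟩
    constructor
    · refine contDiffOn_of_locally_contDiffOn fun z hz => ?_
      obtain ⟨U, g, hU, hzU, hg, hg'⟩ := key z hz
      exact ⟨U, hU, hzU, ((contDiff_bpt.comp contDiff_snd).comp_contDiffOn
        (hg.mono Set.inter_subset_right)).congr fun z hz => (hg' z hz).1⟩
    · refine contDiffOn_of_locally_contDiffOn fun z hz => ?_
      obtain ⟨U, g, hU, hzU, hg, hg'⟩ := key z hz
      exact ⟨U, hU, hzU, (contDiff_fst.comp_contDiffOn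
        (hg.mono Set.inter_subset_right)).congr fun z hz => (hg' z hz).2⟩
  have hqs : ContDiffOn ℝ ∞ (fun x => bpt (σ (f x)).2) X := hN.1.comp hf hm
  have hinj := polar_inj S.ζint_mem (hσ _ (hm hb)).1.1 hw ((hσ _ (hm hb)).2.trans hfb)
  obtain ⟨ℓ, hℓc, hℓe, hℓ0⟩ := exists_log_lift (E := Unit) (T := Set.univ) hX hb
    (q := fun p : Unit × V => bpt (σ (f p.2)).2) (hqs.continuousOn.comp continuousOn_snd fun p hp => hp.2)
    (fun p _ => Complex.exp_ne_zero _) (ℓ₀ := (w.2 : ℂ) * Complex.I)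
    (fun _ _ => bpt_eq_iff.2 hinj.2)
  have hℓe' : ∀ x ∈ X, Complex.exp (ℓ ((), x)) = bpt (σ (f x)).2 := fun x hx => hℓe ((), x) ⟨trivial, hx⟩
  have hℓs : ContDiffOn ℝ ∞ (fun x => ℓ ((), x)) X := by
    refine contDiffOn_of_exp (hℓc.comp (by fun_prop) fun x hx => ⟨trivial, hx⟩) (hqs.congr hℓe')
  have hb' : ∀ x ∈ X, bpt (ℓ ((), x)).im = bpt (σ (f x)).2 := by
    intro x hx
    rw [← hℓe' x hx]
    have hre : (ℓ ((), x)).re = 0 := by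
      have := congrArg norm (hℓe' x hx)
      rw [Complex.norm_exp, norm_bpt] at this
      exact Real.exp_eq_one_iff _ |>.1 this
    rw [bpt]
    congr 1
    apply Complex.ext <;> simp [hre]
  have hE : ∀ x ∈ X, polar S.ζint ((σ (f x)).1, (ℓ ((), x)).im) = f x := fun x hx => by
    conv_rhs => rw [← (hσ _ (hm hx)).2]
    simp only [polar, hb' x hx]
  refine ⟨fun x => ((σ (f x)).1, (ℓ ((), x)).im), (hN.2.comp hf hm).prodMk
    (contDiff_im.comp_contDiffOn hℓs), fun x hx => ?_, hE, ?_⟩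
  · have : polar S.ζint ((σ (f x)).1, (ℓ ((), x)).im) ∈ S.carrier := by rw [hE x hx]; exact hm hx
    exact (S.polar_mem_iff (w := ((σ (f x)).1, (ℓ ((), x)).im)) (hσ _ (hm hx)).1.1).1 this
  · refine Prod.ext hinj.1 ?_
    simp [hℓ0 () trivial]

end PuncturedDisc

/-! ### Winding numbers of periodic functions -/

/-- The function has a continuous logarithm with the same period. -/
def PeriodicLog (f : ℝ → ℂ) : Prop :=
  ∃ ℓ : ℝ → ℂ, Continuous ℓ ∧ (∀ t, ℓ (t + 1) = ℓ t) ∧ ∀ t, f t = Complex.exp (ℓ t)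

theorem PeriodicLog.ne_zero {f : ℝ → ℂ} (hf : PeriodicLog f) (t : ℝ) : f t ≠ 0 := by
  obtain ⟨ℓ, -, -, h⟩ := hf
  rw [h]
  exact Complex.exp_ne_zero _

theorem PeriodicLog.mul {f g : ℝ → ℂ} (hf : PeriodicLog f) (hg : PeriodicLog g) :
    PeriodicLog fun t => f t * g t := by
  obtain ⟨ℓ, h1, h2, h3⟩ := hf
  obtain ⟨m, k1, k2, k3⟩ := hg
  exact ⟨fun t => ℓ t + m t, h1.add k1, fun t => by simp only [h2, k2], fun t => by
    simp only [h3, k3, Complex.exp_add]⟩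

theorem PeriodicLog.div {f g : ℝ → ℂ} (hf : PeriodicLog f) (hg : PeriodicLog g) :
    PeriodicLog fun t => f t / g t := by
  obtain ⟨ℓ, h1, h2, h3⟩ := hf
  obtain ⟨m, k1, k2, k3⟩ := hg
  exact ⟨fun t => ℓ t - m t, h1.sub k1, fun t => by simp only [h2, k2], fun t => by
    simp only [h3, k3, Complex.exp_sub]⟩

theorem PeriodicLog.conj {f : ℝ → ℂ} (hf : PeriodicLog f) :
    PeriodicLog fun t => (starRingEnd ℂ) (f t) := by
  obtain ⟨ℓ, h1, h2, h3⟩ := hf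
  exact ⟨fun t => (starRingEnd ℂ) (ℓ t), Complex.continuous_conj.comp h1, fun t => by simp only [h2],
    fun t => by simp only [h3, Complex.exp_conj]⟩

theorem periodicLog_of_slitPlane {f : ℝ → ℂ} (hf : Continuous f) (hp : ∀ t, f (t + 1) = f t)
    (h : ∀ t, f t ∈ Complex.slitPlane) : PeriodicLog f :=
  ⟨fun t => Complex.log (f t), hf.clog h, fun t => by simp only [hp], fun t => by
    rw [Complex.exp_log (Complex.slitPlane_ne_zero (h t))]⟩

theorem periodicLog_const {c : ℂ} (hc : c ≠ 0) : PeriodicLog fun _ => c :=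
  ⟨fun _ => Complex.log c, continuous_const, fun _ => rfl, fun _ => (Complex.exp_log hc).symm⟩

theorem mem_slitPlane_one_add {z : ℂ} (h : ‖z‖ < 1) : 1 + z ∈ Complex.slitPlane := by
  left
  have := (abs_le.1 (Complex.abs_re_le_norm z)).1
  simp only [Complex.add_re, Complex.one_re]
  linarith

/-- Rouché's principle. -/
theorem PeriodicLog.add {f g : ℝ → ℂ} (hf : PeriodicLog f) (hg : Continuous g)
    (hgp : ∀ t, g (t + 1) = g t) (h : ∀ t, ‖g t‖ < ‖f t‖) : PeriodicLog fun t => f t + g t := by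
  obtain ⟨ℓ, h1, h2, h3⟩ := id hf
  have hne : ∀ t, f t ≠ 0 := fun t => by rw [h3]; exact Complex.exp_ne_zero _
  have hfc : Continuous f := by
    have : f = fun t => Complex.exp (ℓ t) := funext h3
    rw [this]; exact Complex.continuous_exp.comp h1
  have h4 : PeriodicLog fun t => 1 + g t / f t := by
    refine periodicLog_of_slitPlane (continuous_const.add (hg.div hfc hne)) (fun t => ?_) fun t => ?_
    · rw [hgp, h3, h3, h2]
    · refine mem_slitPlane_one_add ?_
      rw [norm_div, div_lt_one (norm_pos_iff.2 (hne t))]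
      exact h t
  convert hf.mul h4 using 2 with t
  rw [mul_add, mul_one, mul_div_cancel₀ _ (hne t)]

/-- The increment of a logarithm over one period is continuous on the half cylinder with values in
2πiℤ. It vanishes on the circle s = s₁, so it vanishes on s = 0. -/
theorem periodicLog_of_homotopy {P : ℝ × ℝ → ℂ} (hP : ContinuousOn P cylDom)
    (h0 : ∀ p ∈ cylDom, P p ≠ 0) (hp : ∀ s t, 0 ≤ s → P (s, t + 1) = P (s, t)) {s₁ : ℝ} (hs₁ : 0 ≤ s₁)
    (h1 : PeriodicLog fun t => P (s₁, t)) : PeriodicLog fun t => P (0, t) := by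
  have hb : ((0, 0) : ℝ × ℝ) ∈ cylDom := ⟨Set.self_mem_Ici, trivial⟩
  have hconv : Convex ℝ cylDom := (convex_Ici 0).prod convex_univ
  obtain ⟨ℓ', hℓc', hℓe', -⟩ := exists_log_lift (E := Unit) (T := Set.univ) (hconv.starConvex hb) hb
    (q := fun x : Unit × (ℝ × ℝ) => P x.2) (hP.comp continuousOn_snd fun x hx => hx.2)
    (fun x hx => h0 _ hx.2) (ℓ₀ := Complex.log (P (0, 0))) (fun _ _ => (Complex.exp_log (h0 _ hb)).symm)
  set ℓ : ℝ × ℝ → ℂ := fun p => ℓ' ((), p) with hℓ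
  have hℓc : ContinuousOn ℓ cylDom := hℓc'.comp (by fun_prop) fun x hx => ⟨trivial, hx⟩
  have hℓe : ∀ p ∈ cylDom, Complex.exp (ℓ p) = P p := fun p hp => hℓe' ((), p) ⟨trivial, hp⟩
  obtain ⟨m, hm1, hm2, hm3⟩ := h1
  have hmem : ∀ {s : ℝ} (t : ℝ), 0 ≤ s → ((s, t) : ℝ × ℝ) ∈ cylDom := fun t hs => ⟨hs, trivial⟩
  have hrow : ∀ {s : ℝ}, 0 ≤ s → Continuous fun t => ℓ (s, t) := fun hs =>
    hℓc.comp_continuous (by fun_prop) fun t => hmem t hs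
  -- the increment over a period vanishes at `s₁`
  have hs1 : ℓ (s₁, 1) = ℓ (s₁, 0) := by
    have h2 := lift_eq_of_continuous (X := ℝ) (f := fun t => ℓ (s₁, t) - ℓ (s₁, 0))
      (g := fun t => m t - m 0) ((hrow hs₁).sub continuous_const) (hm1.sub continuous_const)
      (fun t => by
        rw [Complex.exp_sub, Complex.exp_sub, hℓe _ (hmem t hs₁), hℓe _ (hmem 0 hs₁), ← hm3, ← hm3])
      0 (by simp) 1
    have h3 := hm2 0
    rw [zero_add] at h3
    rw [h3, sub_self, sub_eq_zero] at h2
    exact h2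
  have hinc := eq_zero_of_exp_eq_one (s := cylDom) hconv.isPreconnected
    (f := fun p => (ℓ (p.1, p.2 + 1) - ℓ p))
    ((hℓc.comp (by fun_prop) fun p hp => hmem _ hp.1).sub hℓc) (fun p hp' => by
      rw [Complex.exp_sub, hℓe _ (hmem _ hp'.1), hℓe _ hp', hp _ _ hp'.1, div_self (h0 _ hp')])
    (x₀ := (s₁, 0)) (hmem 0 hs₁) (by simp only [zero_add, hs1, sub_self])
  exact ⟨fun t => ℓ (0, t), hrow le_rfl, fun t => sub_eq_zero.1 (hinc (0, t) (hmem t le_rfl)),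
    fun t => (hℓe _ (hmem t le_rfl)).symm⟩

/-! ### The orientation of the interior end -/

/-- The comparison function `e^{-2π(s + it)} - 1`, with simple zeros at `s = 0`, `t ∈ ℤ`. -/
def expFun (p : ℝ × ℝ) : ℂ := Complex.exp (-(2 * Real.pi) * (p.1 + p.2 * Complex.I)) - 1

theorem continuous_expFun : Continuous expFun := by unfold expFun; fun_prop

theorem expFun_add_one (s t : ℝ) : expFun (s, t + 1) = expFun (s, t) := by
  simp only [expFun]
  congr 1
  rw [Complex.exp_eq_exp_iff_exists_int]
  exact ⟨-1, by push_cast; ring⟩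

theorem expFun_eq_zero {p : ℝ × ℝ} (h : expFun p = 0) : p.1 = 0 ∧ ∃ n : ℤ, p.2 = n := by
  have h1 : Complex.exp (-(2 * Real.pi) * (p.1 + p.2 * Complex.I)) = 1 := sub_eq_zero.1 h
  obtain ⟨n, hn⟩ := Complex.exp_eq_one_iff.1 h1
  have hpi := Real.pi_pos
  have hre := congrArg Complex.re hn
  have him := congrArg Complex.im hn
  simp at hre him
  refine ⟨hre, -n, ?_⟩
  have : (p.2 + n) * (2 * Real.pi) = 0 := by linarith
  have := (mul_eq_zero.1 this).resolve_right (by positivity)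
  push_cast; linarith

theorem hasFDerivAt_expFun :
    HasFDerivAt expFun ((-(2 * Real.pi) : ℝ) • (Complex.equivRealProdCLM.symm : ℝ × ℝ →L[ℝ] ℂ)) 0 := by
  have h1 : HasFDerivAt (fun p : ℝ × ℝ => Complex.equivRealProdCLM.symm p)
    (Complex.equivRealProdCLM.symm : ℝ × ℝ →L[ℝ] ℂ) 0 := Complex.equivRealProdCLM.symm.hasFDerivAt
  have h2 := ((h1.const_smul (-(2 * Real.pi) : ℝ)).cexp).sub_const 1
  have e : expFun = fun p => Complex.exp (((-(2 * Real.pi) : ℝ) •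
      fun p : ℝ × ℝ => Complex.equivRealProdCLM.symm p) p) - 1 := by
    funext p
    simp [expFun, Complex.equivRealProdCLM_symm_apply, mul_add]
  rw [e]
  refine h2.congr_fderiv ?_
  ext <;> simp

/-- The complex number of a point of the plane. -/
def toC (p : ℝ × ℝ) : ℂ := p.1 + p.2 * Complex.I

theorem norm_le_norm_toC (p : ℝ × ℝ) : ‖p‖ ≤ ‖toC p‖ := by
  have h1 := Complex.abs_re_le_norm (toC p)
  have h2 := Complex.abs_im_le_norm (toC p)
  simp only [toC, Complex.add_re, Complex.add_im, Complex.mul_re, Complex.mul_im, Complex.ofReal_re,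
    Complex.ofReal_im, Complex.I_re, Complex.I_im, mul_zero, mul_one, sub_zero, zero_add, add_zero] at h1 h2
  exact max_le h1 h2

/-- An orientation-preserving map is a small perturbation of a half-plane valued multiple of the
comparison function. -/
theorem eventually_re_nonpos {e : ℝ × ℝ → ℂ} {L : ℝ × ℝ →L[ℝ] ℂ} {p₀ : ℝ × ℝ} (he : HasFDerivAt e L p₀)
    (hL : 0 < ((starRingEnd ℂ) (L (1, 0)) * L (0, 1)).im) :
    ∃ c : ℂ, c ≠ 0 ∧ ∀ᶠ p in 𝓝 p₀,
      0 ≤ ((starRingEnd ℂ) c * ((e p - e p₀) * (starRingEnd ℂ) (expFun (p - p₀)))).re := by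
  -- Wirtinger coefficients: L v = aV + b·conj V, where V is the complex number of v. The difference
  -- ‖a‖² - ‖b‖² is the Jacobian, so preserving orientation means ‖b‖ < ‖a‖.
  set a : ℂ := (L (1, 0) - Complex.I * L (0, 1)) / 2 with ha
  set b : ℂ := (L (1, 0) + Complex.I * L (0, 1)) / 2 with hb
  have hLv : ∀ v : ℝ × ℝ, L v = a * toC v + b * (starRingEnd ℂ) (toC v) := by
    intro v
    have e1 : L v = v.1 • L (1, 0) + v.2 • L (0, 1) := by
      rw [← map_smul, ← map_smul, ← map_add]; simp
    rw [e1, ha, hb, toC]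
    simp only [Complex.real_smul, map_add, map_mul, Complex.conj_ofReal, Complex.conj_I]
    linear_combination ((v.2 : ℂ) * L (0, 1)) * Complex.I_sq
  have hab : ‖a‖ ^ 2 - ‖b‖ ^ 2 = ((starRingEnd ℂ) (L (1, 0)) * L (0, 1)).im := by
    rw [← Complex.normSq_eq_norm_sq, ← Complex.normSq_eq_norm_sq, Complex.normSq_apply,
      Complex.normSq_apply, ha, hb]
    simp
    ring
  have hlt : ‖b‖ < ‖a‖ := by
    refine lt_of_pow_lt_pow_left₀ 2 (norm_nonneg a) ?_
    linarith
  have hapos : 0 < ‖a‖ := (norm_nonneg b).trans_lt hlt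
  have hpi := Real.pi_pos
  set C : ℝ := 2 * Real.pi + 1 + ‖a‖ + ‖b‖ with hC
  have hCpos : 0 < C := by positivity
  -- With this choice the linearisation errors contribute at most ‖a‖·ηC‖V‖², which is absorbed by
  -- the main term 2π‖a‖(‖a‖ - ‖b‖)‖V‖².
  set η : ℝ := min 1 (2 * Real.pi * (‖a‖ - ‖b‖) / C) with hη
  have hηpos : 0 < η := lt_min one_pos (div_pos (mul_pos (by positivity) (sub_pos.2 hlt)) hCpos)
  have hη1 : η ≤ 1 := min_le_left _ _
  have hη2 : η * C ≤ 2 * Real.pi * (‖a‖ - ‖b‖) := by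
    rw [← le_div_iff₀ hCpos]; exact min_le_right _ _
  -- The sign comes from the comparison function, whose linear part is -2πV.
  refine ⟨-a, neg_ne_zero.2 (norm_pos_iff.1 hapos), ?_⟩
  have h1 := he.isLittleO.def hηpos
  have h2 : ∀ᶠ p in 𝓝 p₀, ‖expFun (p - p₀) + 2 * Real.pi * toC (p - p₀)‖ ≤ η * ‖p - p₀‖ := by
    have h3 := hasFDerivAt_expFun.isLittleO.def hηpos
    have h4 : Filter.Tendsto (fun p : ℝ × ℝ => p - p₀) (𝓝 p₀) (𝓝 0) := by
      have : ContinuousAt (fun p : ℝ × ℝ => p - p₀) p₀ := by fun_prop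
      simpa [ContinuousAt] using this
    filter_upwards [h4.eventually h3] with p hp
    have e0 : expFun 0 = 0 := by simp [expFun]
    rw [e0, sub_zero, sub_zero] at hp
    refine le_trans (le_of_eq ?_) hp
    congr 1
    simp [toC, Complex.equivRealProdCLM_symm_apply]
    ring
  filter_upwards [h1, h2] with p hp1 hp2
  set V := toC (p - p₀) with hV
  have hn := norm_le_norm_toC (p - p₀)
  rw [hLv] at hp1
  set r₁ := e p - e p₀ - (a * V + b * (starRingEnd ℂ) V) with hr1
  set r₂ := expFun (p - p₀) + 2 * Real.pi * V with hr2
  have hb1 : ‖r₁‖ ≤ η * ‖V‖ := hp1.trans (mul_le_mul_of_nonneg_left hn hηpos.le)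
  have hb2 : ‖r₂‖ ≤ η * ‖V‖ := hp2.trans (mul_le_mul_of_nonneg_left hn hηpos.le)
  have eq1 : e p - e p₀ = a * V + b * (starRingEnd ℂ) V + r₁ := by rw [hr1]; ring
  have eq2 : expFun (p - p₀) = r₂ - 2 * Real.pi * V := by rw [hr2]; ring
  set R := (a * V + b * (starRingEnd ℂ) V) * (starRingEnd ℂ) r₂ + r₁ * (starRingEnd ℂ) (expFun (p - p₀)) with hR
  have hRb : ‖R‖ ≤ η * C * ‖V‖ ^ 2 := by
    have f1 : ‖a * V + b * (starRingEnd ℂ) V‖ ≤ (‖a‖ + ‖b‖) * ‖V‖ := by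
      refine (norm_add_le _ _).trans (le_of_eq ?_)
      rw [norm_mul, norm_mul, Complex.norm_conj]; ring
    have f2 : ‖expFun (p - p₀)‖ ≤ (2 * Real.pi + 1) * ‖V‖ := by
      rw [eq2]
      refine (norm_sub_le _ _).trans ?_
      have : ‖(2 * Real.pi * V : ℂ)‖ = 2 * Real.pi * ‖V‖ := by
        rw [norm_mul, norm_mul, Complex.norm_of_nonneg hpi.le]; simp
      rw [this]
      nlinarith [norm_nonneg V]
    rw [hR]
    refine (norm_add_le _ _).trans ?_
    rw [norm_mul, norm_mul, Complex.norm_conj, Complex.norm_conj]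
    calc _ ≤ (‖a‖ + ‖b‖) * ‖V‖ * (η * ‖V‖) + η * ‖V‖ * ((2 * Real.pi + 1) * ‖V‖) := by gcongr
      _ = _ := by rw [hC]; ring
  have hbV : |((starRingEnd ℂ) a * b * (starRingEnd ℂ) V ^ 2).re| ≤ ‖a‖ * ‖b‖ * ‖V‖ ^ 2 := by
    refine (Complex.abs_re_le_norm _).trans (le_of_eq ?_)
    simp
  have haR : |((starRingEnd ℂ) a * R).re| ≤ ‖a‖ * (η * C * ‖V‖ ^ 2) := by
    refine (Complex.abs_re_le_norm _).trans ?_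
    rw [norm_mul, Complex.norm_conj]
    gcongr
  have hVV : V * (starRingEnd ℂ) V = ((‖V‖ ^ 2 : ℝ) : ℂ) := by
    rw [Complex.mul_conj, Complex.normSq_eq_norm_sq]
  have haa : (starRingEnd ℂ) a * a = ((‖a‖ ^ 2 : ℝ) : ℂ) := by
    rw [mul_comm, Complex.mul_conj, Complex.normSq_eq_norm_sq]
  have eq3 : (starRingEnd ℂ) (-a) * ((e p - e p₀) * (starRingEnd ℂ) (expFun (p - p₀))) =
      ((2 * Real.pi * (‖a‖ ^ 2 * ‖V‖ ^ 2) : ℝ) : ℂ) +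
        ((2 * Real.pi : ℝ) : ℂ) * ((starRingEnd ℂ) a * b * (starRingEnd ℂ) V ^ 2) -
        (starRingEnd ℂ) a * R := by
    have : (starRingEnd ℂ) (expFun (p - p₀)) = (starRingEnd ℂ) r₂ - 2 * Real.pi * (starRingEnd ℂ) V := by
      rw [eq2, map_sub, map_mul, map_mul, Complex.conj_ofReal, map_ofNat]
    have e4 : ((2 * Real.pi * (‖a‖ ^ 2 * ‖V‖ ^ 2) : ℝ) : ℂ) =
        2 * Real.pi * (((starRingEnd ℂ) a * a) * (V * (starRingEnd ℂ) V)) := by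
      rw [haa, hVV]; push_cast; ring
    rw [hR, e4, eq1, this, map_neg]
    push_cast
    ring
  rw [eq3, Complex.sub_re, Complex.add_re, Complex.ofReal_re, Complex.re_ofReal_mul]
  have g1 := (abs_le.1 hbV).1
  have g2 := (abs_le.1 haR).2
  have g3 : ‖a‖ * (η * C * ‖V‖ ^ 2) ≤ ‖a‖ * (2 * Real.pi * (‖a‖ - ‖b‖) * ‖V‖ ^ 2) := by gcongr
  nlinarith [mul_le_mul_of_nonneg_left g1 (by positivity : (0 : ℝ) ≤ 2 * Real.pi)]

namespace PuncturedDisc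

variable {d : ℕ} (S : PuncturedDisc d)

theorem εint_add_int {s t : ℝ} (hs : 0 ≤ s) (n : ℤ) : S.εint (s, t + n) = S.εint (s, t) :=
  ((S.εint_inj (s, t) ⟨hs, trivial⟩ (s, t + n) ⟨hs, trivial⟩).2 ⟨rfl, n, rfl⟩).symm

theorem mem_cylDom {s : ℝ} (t : ℝ) (hs : 0 ≤ s) : ((s, t) : ℝ × ℝ) ∈ cylDom := ⟨hs, trivial⟩

/-- A degree argument. Each factor has one zero per period, at the same point and, before
conjugation, with the same orientation. By `eventually_re_nonpos` a small constant pushes the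
product off zero. It then has a periodic logarithm for large s, hence also for s = 0, where the two
winding numbers must agree. -/
theorem periodicLog_sub {s₀ : ℝ} (hs₀ : 0 < s₀) : PeriodicLog fun t =>
    (S.εint (0, t) - S.εint (s₀, 0)) * (starRingEnd ℂ) (expFun (-s₀, t)) := by
  set p₀ : ℝ × ℝ := (s₀, 0) with hp₀
  have hp₀m : p₀ ∈ cylDom := mem_cylDom 0 hs₀.le
  have hnhds : cylDom ∈ 𝓝 p₀ := prod_mem_nhds (Ici_mem_nhds hs₀) Filter.univ_mem
  have hd : HasFDerivAt S.εint (fderivWithin ℝ S.εint cylDom p₀) p₀ :=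
    ((S.εint_smooth.differentiableOn (by simp) p₀ hp₀m).hasFDerivWithinAt).hasFDerivAt hnhds
  obtain ⟨c, hc, hnear⟩ := eventually_re_nonpos hd (S.εint_oriented p₀ hp₀m)
  obtain ⟨δ', hδ', hball⟩ := Metric.eventually_nhds_iff.1 hnear
  -- The bound by s₀ keeps the circle s = 0 outside the ball around p₀.
  set δ := min δ' s₀ with hδd
  have hδ : 0 < δ := lt_min hδ' hs₀
  set f : ℝ × ℝ → ℂ := fun p => (S.εint p - S.εint p₀) * (starRingEnd ℂ) (expFun (p - p₀)) with hf
  have hfc : ContinuousOn f cylDom :=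
    (S.εint_smooth.continuousOn.sub continuousOn_const).mul
      ((Complex.continuous_conj.comp (continuous_expFun.comp
        (continuous_id.sub continuous_const))).continuousOn)
  have hexpint : ∀ (s t : ℝ) (n : ℤ), expFun (s, t + n) = expFun (s, t) := by
    intro s t n
    have hper : Function.Periodic (fun t => expFun (s, t)) 1 := fun t => expFun_add_one s t
    simpa using hper.int_mul n t
  have hfper : ∀ (s t : ℝ) (n : ℤ), 0 ≤ s → f (s, t + n) = f (s, t) := by
    intro s t n hs
    have h1 : ((s, t + n) : ℝ × ℝ) - p₀ = (s - s₀, t + n) := by simp [hp₀]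
    have h2 : ((s, t) : ℝ × ℝ) - p₀ = (s - s₀, t) := by simp [hp₀]
    simp only [hf, h1, h2, hexpint, S.εint_add_int hs]
  -- the behaviour for large `s`
  set M : ℝ := ‖S.ζint - S.εint p₀‖ with hM
  have hMpos : 0 < M := norm_pos_iff.2 (sub_ne_zero.2 (S.εint_mem p₀ hp₀m).2.1.symm)
  obtain ⟨s₁, hs₁, hlim⟩ : ∃ s₁, s₀ + 1 ≤ s₁ ∧ ∀ s ≥ s₁, ∀ t, ‖S.εint (s, t) - S.ζint‖ < M / 2 := by
    have h1 := (Metric.tendstoUniformlyOn_iff.1 S.εint_lim (M / 2) (by positivity))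
    obtain ⟨s₁, h2⟩ := Filter.eventually_atTop.1 h1
    exact ⟨max s₁ (s₀ + 1), le_max_right _ _, fun s hs t => by
      have := h2 s ((le_max_left _ _).trans hs) t trivial
      rwa [dist_comm, dist_eq_norm] at this⟩
  have hs₁0 : 0 ≤ s₁ := by linarith
  have hkl : ∀ s ≥ s₁, ∀ t, ‖expFun ((s, t) - p₀) - (-1)‖ ≤ 1 / 2 := by
    intro s hs t
    have e1 : expFun ((s, t) - p₀) - (-1) =
        Complex.exp (-(2 * Real.pi) * (((s - s₀ : ℝ) : ℂ) + (t : ℂ) * Complex.I)) := by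
      simp [expFun, hp₀]
    rw [e1, Complex.norm_exp]
    have e2 : (-(2 * Real.pi) * (((s - s₀ : ℝ) : ℂ) + (t : ℂ) * Complex.I)).re = -(2 * Real.pi * (s - s₀)) := by
      simp
    rw [e2, Real.exp_neg, one_div]
    refine inv_anti₀ two_pos ?_
    have h3 := Real.add_one_le_exp (2 * Real.pi * (s - s₀))
    nlinarith [Real.pi_gt_three]
  have hfl : ∀ s ≥ s₁, ∀ t, M / 4 ≤ ‖f (s, t)‖ := by
    intro s hs t
    have h1 : M / 2 ≤ ‖S.εint (s, t) - S.εint p₀‖ := by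
      have h2 := norm_sub_norm_le (S.ζint - S.εint p₀) (S.ζint - S.εint (s, t))
      rw [sub_sub_sub_cancel_left, norm_sub_rev S.ζint (S.εint (s, t))] at h2
      linarith [hlim s hs t]
    have h3 : 1 / 2 ≤ ‖expFun ((s, t) - p₀)‖ := by
      have h4 := norm_sub_norm_le (-1 : ℂ) (-1 - expFun ((s, t) - p₀))
      rw [sub_sub_cancel, norm_sub_rev (-1 : ℂ) (expFun ((s, t) - p₀)), norm_neg, norm_one] at h4
      linarith [hkl s hs t]
    simp only [hf, norm_mul, Complex.norm_conj]
    calc M / 4 = M / 2 * (1 / 2) := by ring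
      _ ≤ _ := by gcongr
  -- the compact part
  set K : Set (ℝ × ℝ) := (Set.Icc 0 s₁ ×ˢ Set.Icc (-(1 / 2)) (1 / 2)) \ Metric.ball p₀ δ with hK
  have hKc : IsCompact K := (isCompact_Icc.prod isCompact_Icc).diff Metric.isOpen_ball
  have hKs : K ⊆ cylDom := fun p hp => ⟨hp.1.1.1, trivial⟩
  have hint : ∀ {t : ℝ} {n : ℤ}, t ∈ Set.Icc (-(1 / 2) : ℝ) (1 / 2) → t = n → t = 0 := by
    intro t n ht hn
    have h1 : (-1 : ℝ) < n := by rw [← hn]; linarith [ht.1]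
    have h2 : (n : ℝ) < 1 := by rw [← hn]; linarith [ht.2]
    have h3 : -1 < n := by exact_mod_cast h1
    have h4 : n < 1 := by exact_mod_cast h2
    have : n = 0 := by omega
    rw [hn, this, Int.cast_zero]
  have hK0 : ∀ p ∈ K, f p ≠ 0 := by
    intro p hp h0
    have hpp : p = p₀ := by
      rcases mul_eq_zero.1 h0 with h1 | h1
      · obtain ⟨h2, n, h3⟩ := (S.εint_inj p₀ hp₀m p (hKs hp)).1 (sub_eq_zero.1 h1).symm
        exact Prod.ext h2.symm (hint (n := n) hp.1.2 (by rw [h3]; simp [hp₀]))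
      · obtain ⟨h2, n, h3⟩ := expFun_eq_zero ((map_eq_zero _).1 h1)
        have h4 : p.2 = n := by simpa [hp₀] using h3
        exact Prod.ext (sub_eq_zero.1 h2) (hint hp.1.2 h4)
    exact hp.2 (by rw [hpp]; exact Metric.mem_ball_self hδ)
  obtain ⟨C, hC⟩ := hKc.exists_bound_of_continuousOn ((hfc.mono hKs).inv₀ hK0)
  have hCm : ∀ p ∈ K, (max C 1)⁻¹ ≤ ‖f p‖ := by
    intro p hp
    have h1 := (hC p hp).trans (le_max_left C 1)
    rw [Pi.inv_apply, norm_inv] at h1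
    exact inv_le_of_inv_le₀ (norm_pos_iff.2 (hK0 p hp)) h1
  set m : ℝ := min (M / 4) (max C 1)⁻¹ with hm
  have hmpos : 0 < m := lt_min (by positivity) (by positivity)
  have hfar : ∀ p ∈ cylDom, p.2 ∈ Set.Icc (-(1 / 2) : ℝ) (1 / 2) → p ∉ Metric.ball p₀ δ → m ≤ ‖f p‖ := by
    intro p hp hp2 hpb
    rcases le_total s₁ p.1 with h | h
    · exact (min_le_left _ _).trans (hfl p.1 h p.2)
    · exact (min_le_right _ _).trans (hCm p ⟨⟨⟨hp.1, h⟩, hp2⟩, hpb⟩)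
  have hround : ∀ t : ℝ, t - round t ∈ Set.Icc (-(1 / 2) : ℝ) (1 / 2) := fun t =>
    abs_le.1 (abs_sub_round t)
  -- Its norm m/4 is below the lower bound for f outside the ball. Its direction is that of c, so
  -- inside the ball the half-plane estimate excludes zeros of f + c'.
  set c' : ℂ := ((m / (4 * ‖c‖) : ℝ) : ℂ) * c with hc'
  have hcpos : 0 < ‖c‖ := norm_pos_iff.2 hc
  have hc'n : ‖c'‖ = m / 4 := by
    rw [hc', norm_mul, Complex.norm_of_nonneg (by positivity)]; field_simp
  have hper1 : ∀ s t, 0 ≤ s → f (s, t + 1) = f (s, t) := fun s t hs => by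
    simpa using hfper s t 1 hs
  have hrow : ∀ {s}, 0 ≤ s → Continuous fun t => f (s, t) := fun hs =>
    hfc.comp_continuous (by fun_prop) fun t => mem_cylDom t hs
  -- the perturbation has no zeros
  have hP0 : ∀ p ∈ cylDom, f p + c' ≠ 0 := by
    have key : ∀ p ∈ cylDom, p.2 ∈ Set.Icc (-(1 / 2) : ℝ) (1 / 2) → f p + c' ≠ 0 := by
      intro p hp hp2 h0
      by_cases hb : p ∈ Metric.ball p₀ δ
      · have h1 := hball (hb.trans_le (min_le_left _ _))
        have h2 : ((starRingEnd ℂ) c * (f p + c')).re = 0 := by rw [h0]; simp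
        have h3 : (starRingEnd ℂ) c * c' = ((m / (4 * ‖c‖) * ‖c‖ ^ 2 : ℝ) : ℂ) := by
          have : (starRingEnd ℂ) c * c = ((‖c‖ ^ 2 : ℝ) : ℂ) := by
            rw [mul_comm, Complex.mul_conj, Complex.normSq_eq_norm_sq]
          rw [hc', mul_left_comm, this]; push_cast; ring
        rw [mul_add, Complex.add_re, h3, Complex.ofReal_re] at h2
        have h4 : 0 < m / (4 * ‖c‖) * ‖c‖ ^ 2 := by positivity
        have h5 : 0 ≤ ((starRingEnd ℂ) c * f p).re := h1
        linarith
      · have h1 := hfar p hp hp2 hb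
        have h2 : ‖f p‖ = m / 4 := by rw [← hc'n, eq_neg_of_add_eq_zero_left h0, norm_neg]
        linarith
    rintro ⟨s, t⟩ hp
    have h1 := key (s, t - round t) (mem_cylDom _ hp.1) (hround t)
    have h2 := hfper s (t - round t) (round t) hp.1
    rw [sub_add_cancel] at h2
    rwa [h2]
  have hstart : PeriodicLog fun t => f (s₁, t) + c' := by
    refine PeriodicLog.add (PeriodicLog.mul ?_ (PeriodicLog.conj ?_)) continuous_const (fun _ => rfl) fun t => ?_
    · have h1 := (periodicLog_const (c := S.ζint - S.εint p₀) (norm_pos_iff.1 hMpos)).add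
        (g := fun t => S.εint (s₁, t) - S.ζint) ((S.εint_smooth.continuousOn.comp_continuous (by fun_prop)
          fun t => mem_cylDom t hs₁0).sub continuous_const) (fun t => by
            have := S.εint_add_int (t := t) hs₁0 1
            rw [Int.cast_one] at this
            simp only [this]) (fun t => by
            have := hlim s₁ le_rfl t
            rw [← hM]; linarith)
      simpa using h1
    · have h1 := (periodicLog_const (c := -1) (by simp)).add
        (g := fun t => expFun ((s₁, t) - p₀) - (-1)) ((continuous_expFun.comp (by fun_prop)).sub continuous_const)
        (fun t => by
          have : expFun ((s₁, t + 1) - p₀) = expFun ((s₁, t) - p₀) := by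
            simpa [hp₀] using expFun_add_one (s₁ - s₀) t
          simp only [this]) (fun t => by
          have := hkl s₁ le_rfl t
          rw [norm_neg, norm_one]; linarith)
      simpa using h1
    · have h1 := hfl s₁ le_rfl t
      have h2 : m ≤ M / 4 := min_le_left _ _
      have h3 : ‖c'‖ < ‖f (s₁, t)‖ := by rw [hc'n]; linarith
      exact h3
  have hend := periodicLog_of_homotopy (P := fun p => f p + c') (hfc.add continuousOn_const) hP0
    (fun s t hs => by simp only [hper1 s t hs]) hs₁0 hstart
  have hfar0 : ∀ t, m ≤ ‖f (0, t)‖ := by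
    intro t
    have h1 := hfar (0, t - round t) (mem_cylDom _ le_rfl) (hround t) (fun hb => by
      have h2 : dist (0 : ℝ) s₀ < δ := (le_max_left _ _).trans_lt hb
      rw [Real.dist_eq, zero_sub, abs_neg, abs_of_pos hs₀] at h2
      exact absurd (h2.trans_le (min_le_right _ _)) (lt_irrefl _))
    have h2 := hfper 0 (t - round t) (round t) le_rfl
    rw [sub_add_cancel] at h2
    rwa [h2]
  have hfin := hend.add (g := fun _ => -c') continuous_const (fun _ => rfl) (fun t => by
    have h1 := norm_sub_norm_le (f (0, t)) (-c')
    rw [sub_neg_eq_add, norm_neg, hc'n] at h1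
    rw [norm_neg, hc'n]
    linarith [hfar0 t])
  simpa [hf, hp₀] using hfin

/-- For large s₀ the point `S.εint (s₀, 0)` is so close to the puncture that Rouché's principle
allows one to replace it by the puncture. The comparison circle e^{2πs₀}e^{-2πit} - 1 has winding
number -1, its first term being dominant. -/
theorem periodicLog_εint : PeriodicLog fun t => (S.εint (0, t) - S.ζint) * bpt (2 * Real.pi * t) := by
  have hrow : Continuous fun t => S.εint (0, t) :=
    S.εint_smooth.continuousOn.comp_continuous (by fun_prop) fun t => mem_cylDom t le_rfl
  have hne : ∀ t, S.εint (0, t) - S.ζint ≠ 0 := fun t =>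
    sub_ne_zero.2 (S.εint_mem _ (mem_cylDom t le_rfl)).2.1
  obtain ⟨t₀, -, ht₀⟩ := (isCompact_Icc (a := (0 : ℝ)) (b := 1)).exists_isMinOn ⟨0, by simp⟩
    (f := fun t => ‖S.εint (0, t) - S.ζint‖) (hrow.sub continuous_const).norm.continuousOn
  set M := ‖S.εint (0, t₀) - S.ζint‖ with hM
  have hMpos : 0 < M := norm_pos_iff.2 (hne t₀)
  have hMle : ∀ t, M ≤ ‖S.εint (0, t) - S.ζint‖ := by
    intro t
    have h1 : M ≤ ‖S.εint (0, Int.fract t) - S.ζint‖ :=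
      ht₀ ⟨Int.fract_nonneg t, (Int.fract_lt_one t).le⟩
    have h2 := S.εint_add_int (t := Int.fract t) (s := 0) le_rfl ⌊t⌋
    rw [Int.fract_add_floor] at h2
    rwa [h2]
  obtain ⟨s₀, hs₀, hlim⟩ : ∃ s₀, 0 < s₀ ∧ ‖S.εint (s₀, 0) - S.ζint‖ < M / 2 := by
    have h1 := (Metric.tendstoUniformlyOn_iff.1 S.εint_lim (M / 2) (by positivity))
    obtain ⟨s₁, h2⟩ := Filter.eventually_atTop.1 h1
    refine ⟨max s₁ 1, lt_of_lt_of_le one_pos (le_max_right _ _), ?_⟩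
    have := h2 _ (le_max_left s₁ 1) 0 trivial
    rwa [dist_comm, dist_eq_norm] at this
  have hA := S.periodicLog_sub hs₀
  have hpi := Real.pi_pos
  -- the comparison function
  have hk : PeriodicLog fun t => (starRingEnd ℂ) (Real.exp (2 * Real.pi * s₀) *
      (1 + -(Complex.exp (-(2 * Real.pi) * s₀ + 2 * Real.pi * t * Complex.I)))) := by
    refine PeriodicLog.conj (PeriodicLog.mul (periodicLog_const (by
      rw [Complex.ofReal_ne_zero]; exact (Real.exp_pos _).ne')) (periodicLog_of_slitPlane ?_ ?_ ?_))
    · fun_prop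
    · intro t
      congr 2
      rw [Complex.exp_eq_exp_iff_exists_int]
      exact ⟨1, by push_cast; ring⟩
    · intro t
      refine mem_slitPlane_one_add ?_
      rw [norm_neg, Complex.norm_exp, Real.exp_lt_one_iff]
      simp
      positivity
  have hq : PeriodicLog fun t => (S.εint (0, t) - S.εint (s₀, 0)) * bpt (2 * Real.pi * t) := by
    convert hA.div hk using 2 with t
    have hne' : (starRingEnd ℂ) (Real.exp (2 * Real.pi * s₀) *
        (1 + -(Complex.exp (-(2 * Real.pi) * s₀ + 2 * Real.pi * t * Complex.I)))) ≠ 0 := hk.ne_zero t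
    rw [eq_div_iff hne', mul_assoc]
    congr 1
    have e1 : bpt (2 * Real.pi * t) = (starRingEnd ℂ) (Complex.exp (-(2 * Real.pi * t * Complex.I))) := by
      rw [← Complex.exp_conj, bpt]
      congr 1
      simp only [map_neg, map_mul, Complex.conj_ofReal, Complex.conj_I, map_ofNat, Complex.ofReal_mul,
        Complex.ofReal_ofNat]
      ring
    rw [e1, ← map_mul]
    congr 1
    rw [Complex.ofReal_exp, mul_add, mul_add, mul_one, ← Complex.exp_add, mul_neg, mul_neg, ← Complex.exp_add,
      ← Complex.exp_add, expFun, sub_eq_add_neg]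
    congr 2
    · push_cast; ring
    · rw [Complex.exp_eq_one_iff]
      exact ⟨0, by push_cast; ring⟩
  have hfin := hq.add (g := fun t => (S.εint (s₀, 0) - S.ζint) * bpt (2 * Real.pi * t))
    (continuous_const.mul ((contDiff_bpt (n := 0)).continuous.comp (by fun_prop))) (fun t => by
      have := bpt_add_int (2 * Real.pi * t) 1
      rw [Int.cast_one, one_mul] at this
      rw [mul_add, mul_one, this]) (fun t => by
      rw [norm_mul, norm_mul, norm_bpt, mul_one, mul_one]
      have h1 := norm_sub_norm_le (S.εint (0, t) - S.ζint) (S.εint (s₀, 0) - S.ζint)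
      rw [sub_sub_sub_cancel_right] at h1
      linarith [hMle t])
  convert hfin using 2 with t
  ring

/-- The interior end winds once around the puncture, in negative direction. -/
theorem lift_add_one {F : ℝ × ℝ → ℝ × ℝ} (hF : ContinuousOn F cylDom) (hm : Set.MapsTo F cylDom S.cover)
    (hE : ∀ p ∈ cylDom, polar S.ζint (F p) = S.εint p) {s t : ℝ} (hs : 0 ≤ s) :
    F (s, t + 1) = ((F (s, t)).1, (F (s, t)).2 - 2 * Real.pi) := by
  have hper : ∀ {s} (t), 0 ≤ s → polar S.ζint (F (s, t + 1)) = polar S.ζint (F (s, t)) := by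
    intro s t hs
    have := S.εint_add_int (t := t) hs 1
    rw [Int.cast_one] at this
    rw [hE _ (mem_cylDom _ hs), hE _ (mem_cylDom _ hs), this]
  have hinj : ∀ {s} (t), 0 ≤ s → (F (s, t + 1)).1 = (F (s, t)).1 ∧
      ∃ n : ℤ, (F (s, t + 1)).2 = (F (s, t)).2 + n * (2 * Real.pi) := fun t hs =>
    polar_inj S.ζint_mem (hm (mem_cylDom _ hs)).1 (hm (mem_cylDom _ hs)).1 (hper t hs)
  have hrow : Continuous fun t => F (0, t) :=
    hF.comp_continuous (by fun_prop) fun t => mem_cylDom t le_rfl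
  -- the base case
  have hbase : (F (0, 1)).2 = (F (0, 0)).2 - 2 * Real.pi := by
    have h1 := S.periodicLog_εint
    have hbc : Continuous fun t => bpt (F (0, t)).2 :=
      (contDiff_bpt (n := 0)).continuous.comp (continuous_snd.comp hrow)
    have hbp : ∀ t, bpt (F (0, t + 1)).2 = bpt (F (0, t)).2 := fun t =>
      bpt_eq_iff.2 (hinj t le_rfl).2
    have hu : ∀ t, bpt (F (0, t)).2 * (starRingEnd ℂ) (bpt (F (0, t)).2) = 1 := fun t => by
      rw [Complex.mul_conj, Complex.normSq_eq_norm_sq, norm_bpt]; simp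
    have h2 : PeriodicLog fun t => (((F (0, t)).1 : ℝ) : ℂ) := by
      refine periodicLog_of_slitPlane (Complex.continuous_ofReal.comp (continuous_fst.comp hrow))
        (fun t => by rw [(hinj t le_rfl).1]) fun t => ?_
      left
      exact (hm (mem_cylDom t le_rfl)).1
    have h3 : PeriodicLog fun t => 1 + -(S.ζint * (starRingEnd ℂ) (bpt (F (0, t)).2)) := by
      refine periodicLog_of_slitPlane (by fun_prop) (fun t => by rw [hbp]) fun t =>
        mem_slitPlane_one_add ?_
      rw [norm_neg, norm_mul, Complex.norm_conj, norm_bpt, mul_one]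
      exact S.ζint_mem
    -- With polar coordinates (r, φ), the difference from the puncture is r·e^{iφ}·(1 - ζ·e^{-iφ}).
    -- The first and last factors have periodic logarithms, so e^{i(φ + 2πt)} has one as well, which
    -- means that φ + 2πt is periodic.
    obtain ⟨ℓ, hℓc, hℓp, hℓe⟩ := h1.div (h2.mul h3)
    have h4 : ∀ t, Complex.exp (((F (0, t)).2 + 2 * Real.pi * t : ℝ) * Complex.I) = Complex.exp (ℓ t) := by
      intro t
      refine Eq.trans ?_ (hℓe t)
      have hne : (((F (0, t)).1 : ℝ) : ℂ) * (1 + -(S.ζint * (starRingEnd ℂ) (bpt (F (0, t)).2))) ≠ 0 :=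
        (h2.mul h3).ne_zero t
      rw [eq_div_iff hne, ← hE _ (mem_cylDom t le_rfl), polar, Complex.ofReal_add, add_mul, Complex.exp_add,
        show Complex.exp ((F (0, t)).2 * Complex.I) = bpt (F (0, t)).2 from rfl,
        show Complex.exp ((2 * Real.pi * t : ℝ) * Complex.I) = bpt (2 * Real.pi * t) from rfl]
      linear_combination (-bpt (2 * Real.pi * t) * (F (0, t)).1 * S.ζint) * hu t
    have h5 := lift_eq_of_continuous (X := ℝ)
      (f := fun t => ((F (0, t)).2 + 2 * Real.pi * t : ℝ) * Complex.I - ((F (0, 0)).2 + 2 * Real.pi * 0 : ℝ) * Complex.I)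
      (g := fun t => ℓ t - ℓ 0) (((Complex.continuous_ofReal.comp ((continuous_snd.comp hrow).add
        (continuous_const.mul continuous_id))).mul continuous_const).sub continuous_const)
      (hℓc.sub continuous_const)
      (fun t => by rw [Complex.exp_sub, Complex.exp_sub, h4, h4]) 0 (by simp) 1
    have h6 := hℓp 0
    rw [zero_add] at h6
    rw [h6, sub_self, sub_eq_zero] at h5
    have h7 := mul_right_cancel₀ Complex.I_ne_zero h5
    have h8 := Complex.ofReal_injective h7
    linarith
  refine Prod.ext (hinj t hs).1 ?_
  have h1 := const_of_int_mul (s := cylDom) ((convex_Ici (0 : ℝ)).prod convex_univ).isPreconnected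
    (f := fun p => (F (p.1, p.2 + 1)).2 - (F p).2 + 2 * Real.pi)
    (((continuous_snd.comp_continuousOn (hF.comp (by fun_prop) fun p hp => mem_cylDom _ hp.1)).sub
      (continuous_snd.comp_continuousOn hF)).add continuousOn_const) (fun p hp => by
        obtain ⟨n, hn⟩ := (hinj p.2 hp.1).2
        exact ⟨n + 1, by rw [hn]; push_cast; ring⟩) (x₀ := (0, 0)) (mem_cylDom _ le_rfl)
    (by simp only [zero_add, hbase]; ring) (s, t) (mem_cylDom _ hs)
  simp only at h1 ⊢
  linarith

end PuncturedDisc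

/-! ### Lifts of the strip-like ends -/

section

variable {d : ℕ}

theorem halfLine_convex (j : Fin (d + 1)) : Convex ℝ (halfLine j) := by
  unfold halfLine; split_ifs
  · exact convex_Iic 0
  · exact convex_Ici 0

theorem halfLine_uniqueDiffOn (j : Fin (d + 1)) : UniqueDiffOn ℝ (halfLine j) := by
  unfold halfLine; split_ifs
  · exact uniqueDiffOn_Iic 0
  · exact uniqueDiffOn_Ici 0

theorem zero_mem_halfLine (j : Fin (d + 1)) : (0 : ℝ) ∈ halfLine j := by
  unfold halfLine; split_ifs <;> simp

theorem halfLine_mem_endFilter (j : Fin (d + 1)) : halfLine j ∈ endFilter j := by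
  unfold halfLine endFilter; split_ifs
  · exact Filter.Iic_mem_atBot 0
  · exact Filter.Ici_mem_atTop 0

instance (j : Fin (d + 1)) : (endFilter j).NeBot := by
  unfold endFilter; split_ifs <;> infer_instance

theorem stripDom_convex (j : Fin (d + 1)) : Convex ℝ (stripDom j) :=
  (halfLine_convex j).prod (convex_Icc 0 1)

theorem stripDom_uniqueDiffOn (j : Fin (d + 1)) : UniqueDiffOn ℝ (stripDom j) :=
  (halfLine_uniqueDiffOn j).prod (uniqueDiffOn_Icc zero_lt_one)

theorem mem_stripDom {j : Fin (d + 1)} {s t : ℝ} (hs : s ∈ halfLine j) (ht : t ∈ Set.Icc (0 : ℝ) 1) :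
    ((s, t) : ℝ × ℝ) ∈ stripDom j := ⟨hs, ht⟩

theorem exists_convex_tail {j : Fin (d + 1)} {P : ℝ → Prop} (h : ∀ᶠ s in endFilter j, P s) :
    ∃ T : Set ℝ, T ∈ endFilter j ∧ T ⊆ halfLine j ∧ Convex ℝ T ∧ ∀ s ∈ T, P s := by
  unfold endFilter halfLine at *
  split_ifs at * with hj
  · obtain ⟨R, hR⟩ := Filter.eventually_atBot.1 h
    exact ⟨Set.Iic (min R 0), Filter.Iic_mem_atBot _, Set.Iic_subset_Iic.2 (min_le_right _ _),
      convex_Iic _, fun s hs => hR s (le_trans hs (min_le_left _ _))⟩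
  · obtain ⟨R, hR⟩ := Filter.eventually_atTop.1 h
    exact ⟨Set.Ici (max R 0), Filter.Ici_mem_atTop _, Set.Ici_subset_Ici.2 (le_max_right _ _),
      convex_Ici _, fun s hs => hR s (le_trans (le_max_left _ _) hs)⟩

end

namespace PuncturedDisc

variable {d : ℕ} (S : PuncturedDisc d)

/-- A lift of a strip-like end to the universal cover of the surface, converging to `α j`. -/
structure IsStripLift (j : Fin (d + 1)) (F : ℝ × ℝ → ℝ × ℝ) : Prop where
  smooth : ContDiffOn ℝ ∞ F (stripDom j)
  mapsTo : Set.MapsTo F (stripDom j) S.cover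
  polar_eq : ∀ p ∈ stripDom j, polar S.ζint (F p) = S.ε j p
  tendsto : ∀ t ∈ Set.Icc (0 : ℝ) 1, Filter.Tendsto (fun s => (F (s, t)).2) (endFilter j) (𝓝 (S.α j))

theorem exists_stripLift (j : Fin (d + 1)) : ∃ F, S.IsStripLift j F := by
  have h00 : ((0, 0) : ℝ × ℝ) ∈ stripDom j := mem_stripDom (zero_mem_halfLine j) (by simp)
  obtain ⟨w₀, hw₀, hw₀'⟩ := S.exists_cover (S.ε_mem j _ h00)
  obtain ⟨F, hF, hFm, hFE, -⟩ := S.exists_lift ((stripDom_convex j).starConvex h00) h00 (S.ε_smooth j)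
    (S.ε_mem j) hw₀.1 hw₀'.symm
  obtain ⟨U, g, hU, hUm, hg, hg0, hgE⟩ := exists_polar_inverse S.ζint_mem (w := (1, S.α j)) one_pos
  rw [polar_one] at hUm hg0
  have hev : ∀ᶠ s in endFilter j, ∀ t ∈ Set.Icc (0 : ℝ) 1, S.ε j (s, t) ∈ U := by
    obtain ⟨δ, hδ, hb⟩ := Metric.isOpen_iff.1 hU _ hUm
    filter_upwards [Metric.tendstoUniformlyOn_iff.1 (S.ε_lim j) δ hδ] with s hs t ht
    exact hb (by rw [Metric.mem_ball, dist_comm]; exact hs t ht)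
  obtain ⟨T, hT, hTs, hTc, hTU⟩ := exists_convex_tail hev
  obtain ⟨s₀, hs₀⟩ := Filter.nonempty_of_mem hT
  have hsub : T ×ˢ Set.Icc (0 : ℝ) 1 ⊆ stripDom j := Set.prod_mono hTs le_rfl
  have hn : ∀ p ∈ T ×ˢ Set.Icc (0 : ℝ) 1, ∃ n : ℤ, (F p).2 = (g (S.ε j p)).2 + n * (2 * Real.pi) := by
    intro p hp
    have h1 := hgE _ (hTU p.1 hp.1 p.2 hp.2)
    exact (polar_inj S.ζint_mem (hFm (hsub hp)).1 h1.1 ((hFE p (hsub hp)).trans h1.2.symm)).2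
  have hp₀ : ((s₀, 0) : ℝ × ℝ) ∈ T ×ˢ Set.Icc (0 : ℝ) 1 := ⟨hs₀, by simp⟩
  obtain ⟨n, hn0⟩ := hn _ hp₀
  have hgc : ContinuousOn (fun p => g (S.ε j p)) (T ×ˢ Set.Icc (0 : ℝ) 1) :=
    hg.continuousOn.comp ((S.ε_smooth j).continuousOn.mono hsub) fun p hp => hTU p.1 hp.1 p.2 hp.2
  -- Close to the boundary puncture, the lift differs from the local branch of `polar` at (1, α j)
  -- by a constant multiple of 2π. Subtracting it produces the required limit.
  have hconst := const_of_int_mul (hTc.prod (convex_Icc (0 : ℝ) 1)).isPreconnected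
    (f := fun p => (F p).2 - (g (S.ε j p)).2 - n * (2 * Real.pi))
    (((continuous_snd.comp_continuousOn (hF.continuousOn.mono hsub)).sub
      (continuous_snd.comp_continuousOn hgc)).sub continuousOn_const) (fun p hp => by
        obtain ⟨k, hk⟩ := hn p hp
        exact ⟨k - n, by rw [hk]; push_cast; ring⟩) hp₀ (by rw [hn0]; ring)
  refine ⟨fun p => ((F p).1, (F p).2 + (-n : ℤ) * (2 * Real.pi)), ?_, ?_, ?_, ?_⟩
  · exact (contDiff_fst.comp_contDiffOn hF).prodMk ((contDiff_snd.comp_contDiffOn hF).add contDiffOn_const)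
  · exact fun p hp => S.cover_add_int (-n) (hFm hp)
  · intro p hp
    rw [polar_add_int]
    exact hFE p hp
  · intro t ht
    have h1 : Filter.Tendsto (fun s => (g (S.ε j (s, t))).2) (endFilter j) (𝓝 (S.α j)) := by
      have h2 : Filter.Tendsto (fun z => (g z).2) (𝓝 (bpt (S.α j))) (𝓝 (S.α j)) := by
        have := (continuous_snd.continuousAt.comp
          (hg.continuousOn.continuousAt (hU.mem_nhds hUm))).tendsto
        rw [Function.comp_apply, hg0] at this
        exact this
      exact h2.comp ((S.ε_lim j).tendsto_at ht)
    refine h1.congr' ?_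
    filter_upwards [hT] with s hs
    have := hconst (s, t) ⟨hs, ht⟩
    push_cast
    linarith

variable {S} in
theorem IsStripLift.fst_eq_one {j : Fin (d + 1)} {F : ℝ × ℝ → ℝ × ℝ} (h : S.IsStripLift j F) {p : ℝ × ℝ}
    (hp : p ∈ stripDom j) (ht : p.2 = 0 ∨ p.2 = 1) : (F p).1 = 1 := by
  rw [← norm_polar_eq_one_iff S.ζint_mem (h.mapsTo hp).1, h.polar_eq p hp]
  exact (S.ε_boundary j p hp).2 ht

variable {S} in
theorem IsStripLift.mem_bdryAngles {j : Fin (d + 1)} {F : ℝ × ℝ → ℝ × ℝ} (h : S.IsStripLift j F) {p : ℝ × ℝ}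
    (hp : p ∈ stripDom j) (ht : p.2 = 0 ∨ p.2 = 1) : (F p).2 ∈ S.bdryAngles :=
  (h.mapsTo hp).2.2 (h.fst_eq_one hp ht)

variable {S} in
theorem IsStripLift.bpt_eq {j : Fin (d + 1)} {F : ℝ × ℝ → ℝ × ℝ} (h : S.IsStripLift j F) {p : ℝ × ℝ}
    (hp : p ∈ stripDom j) (ht : p.2 = 0 ∨ p.2 = 1) : bpt (F p).2 = S.ε j p := by
  rw [← h.polar_eq p hp, ← polar_one S.ζint, ← h.fst_eq_one hp ht]

-- On the sides t = 0, 1 the radius attains its maximum, so its derivative into the strip, in the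
-- direction 1 - 2t, is not positive; along the side its derivative is zero. Since orientation is
-- preserved, the angle must increase with s on t = 0 and decrease on t = 1.
variable {S} in
theorem IsStripLift.strictMono_aux {j : Fin (d + 1)} {F : ℝ × ℝ → ℝ × ℝ} (h : S.IsStripLift j F) {s t : ℝ}
    (hs : s ∈ halfLine j) (ht : t = 0 ∨ t = 1) :
    0 < (1 - 2 * t) * (fderivWithin ℝ F (stripDom j) (s, t) (1, 0)).2 ∧
    HasDerivWithinAt (fun s => (F (s, t)).2) (fderivWithin ℝ F (stripDom j) (s, t) (1, 0)).2
      (halfLine j) s := by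
  have htI : t ∈ Set.Icc (0 : ℝ) 1 := by rcases ht with rfl | rfl <;> simp
  have hp : ((s, t) : ℝ × ℝ) ∈ stripDom j := mem_stripDom hs htI
  set L := fderivWithin ℝ F (stripDom j) (s, t) with hL
  have hd : HasFDerivWithinAt F L (stripDom j) (s, t) :=
    (h.smooth.differentiableOn (by simp) _ hp).hasFDerivWithinAt
  have hline : HasDerivWithinAt (fun s => F (s, t)) (L (1, 0)) (halfLine j) s :=
    HasFDerivWithinAt.comp_hasDerivWithinAt (f := fun s => ((s, t) : ℝ × ℝ)) s hd
      ((hasDerivAt_id s).prodMk (hasDerivAt_const s t)).hasDerivWithinAt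
      fun s' hs' => mem_stripDom hs' htI
  have hline1 : HasDerivWithinAt (fun s => (F (s, t)).1) (L (1, 0)).1 (halfLine j) s :=
    (ContinuousLinearMap.fst ℝ ℝ ℝ).hasFDerivAt.comp_hasDerivWithinAt s hline
  have hline2 : HasDerivWithinAt (fun s => (F (s, t)).2) (L (1, 0)).2 (halfLine j) s :=
    (ContinuousLinearMap.snd ℝ ℝ ℝ).hasFDerivAt.comp_hasDerivWithinAt s hline
  have h10 : (L (1, 0)).1 = 0 := by
    have h1 : HasDerivWithinAt (fun s => (F (s, t)).1) 0 (halfLine j) s :=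
      (hasDerivWithinAt_const s _ (1 : ℝ)).congr_of_mem
        (fun s' hs' => h.fst_eq_one (mem_stripDom hs' htI) ht) hs
    exact UniqueDiffWithinAt.eq_deriv _ (halfLine_uniqueDiffOn j s hs) hline1 h1
  -- the radial coordinate is maximal
  have hmax : IsLocalMaxOn (fun p => (F p).1) (stripDom j) (s, t) := by
    refine IsMaxOn.localize fun p hp' => ?_
    show (F p).1 ≤ (F (s, t)).1
    rw [h.fst_eq_one hp ht]
    exact (h.mapsTo hp').2.1
  have hrt : (1 - 2 * t) * (L (0, 1)).1 ≤ 0 := by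
    have hd1 : HasFDerivWithinAt (fun p => (F p).1) ((ContinuousLinearMap.fst ℝ ℝ ℝ).comp L) (stripDom j) (s, t) :=
      (ContinuousLinearMap.fst ℝ ℝ ℝ).hasFDerivAt.comp_hasFDerivWithinAt _ hd
    have hseg : segment ℝ ((s, t) : ℝ × ℝ) ((s, t) + (0, 1 - 2 * t)) ⊆ stripDom j := by
      refine (stripDom_convex j).segment_subset hp ?_
      rw [Prod.mk_add_mk, add_zero]
      refine mem_stripDom hs ?_
      rcases ht with rfl | rfl <;> norm_num
    have h2 := hmax.hasFDerivWithinAt_nonpos hd1 (mem_posTangentConeAt_of_segment_subset hseg)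
    have h3 : L (0, 1 - 2 * t) = (1 - 2 * t) • L (0, 1) := by rw [← map_smul]; simp
    simpa [h3] using h2
  have hor : 0 < (L (1, 0)).1 * (L (0, 1)).2 - (L (0, 1)).1 * (L (1, 0)).2 := by
    have h1 : 0 < ((starRingEnd ℂ) (fderivWithin ℝ (S.ε j) (stripDom j) (s, t) (1, 0)) *
      fderivWithin ℝ (S.ε j) (stripDom j) (s, t) (0, 1)).im := S.ε_oriented j _ hp
    set P := fderiv ℝ (polar S.ζint) (F (s, t)) with hP
    have h2 : fderivWithin ℝ (S.ε j) (stripDom j) (s, t) = P.comp L := by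
      have h3 := (((contDiff_polar (n := 1) S.ζint).differentiable (by simp)
        (F (s, t))).hasFDerivAt).comp_hasFDerivWithinAt _ hd
      exact (HasFDerivWithinAt.congr h3 (fun p hp => (h.polar_eq p hp).symm)
        (h.polar_eq _ hp).symm).fderivWithin (stripDom_uniqueDiffOn j _ hp)
    have hJ := jacobian_polar S.ζint_mem (h.mapsTo hp).1
    rw [← hP] at hJ
    have hPv : ∀ v : ℝ × ℝ, P v = v.1 * P (1, 0) + v.2 * P (0, 1) := by
      intro v
      rw [← Complex.real_smul, ← Complex.real_smul, ← map_smul, ← map_smul, ← map_add]; simp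
    rw [h2, ContinuousLinearMap.comp_apply, ContinuousLinearMap.comp_apply, hPv (L (1, 0)), hPv (L (0, 1))] at h1
    have h4 : ((starRingEnd ℂ) ((L (1, 0)).1 * P (1, 0) + (L (1, 0)).2 * P (0, 1)) *
        ((L (0, 1)).1 * P (1, 0) + (L (0, 1)).2 * P (0, 1))).im =
        ((L (1, 0)).1 * (L (0, 1)).2 - (L (0, 1)).1 * (L (1, 0)).2) *
          ((starRingEnd ℂ) (P (1, 0)) * P (0, 1)).im := by
      simp; ring
    rw [h4] at h1
    exact (pos_iff_pos_of_mul_pos h1).2 hJ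
  refine ⟨?_, hline2⟩
  rw [h10] at hor
  rcases ht with rfl | rfl
  · have : (L (0, 1)).1 < 0 := lt_of_le_of_ne (by linarith) fun h0 => by rw [h0] at hor; linarith
    nlinarith
  · have : 0 < (L (0, 1)).1 := lt_of_le_of_ne (by linarith) fun h0 => by rw [← h0] at hor; linarith
    nlinarith

theorem Ico_subset_of_tendsto {D : Set ℝ} (hD : IsPreconnected D) {u : ℝ → ℝ} (hu : ContinuousOn u D)
    {l : Filter ℝ} [l.NeBot] (hl : D ∈ l) {a : ℝ} (ha : Filter.Tendsto u l (𝓝 a)) {B : Set ℝ}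
    (hB : ∀ s ∈ D, u s ∈ B) {s : ℝ} (hs : s ∈ D) : Set.Ico (u s) a ⊆ B := by
  intro φ hφ
  obtain ⟨s', hs', hD'⟩ := ((ha.eventually (lt_mem_nhds hφ.2)).and hl).exists
  have := (hD.image u hu).ordConnected.out (Set.mem_image_of_mem u hs) (Set.mem_image_of_mem u hD')
    ⟨hφ.1, hs'.le⟩
  obtain ⟨s'', h1, rfl⟩ := this
  exact hB _ h1

theorem Ioc_subset_of_tendsto {D : Set ℝ} (hD : IsPreconnected D) {u : ℝ → ℝ} (hu : ContinuousOn u D)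
    {l : Filter ℝ} [l.NeBot] (hl : D ∈ l) {a : ℝ} (ha : Filter.Tendsto u l (𝓝 a)) {B : Set ℝ}
    (hB : ∀ s ∈ D, u s ∈ B) {s : ℝ} (hs : s ∈ D) : Set.Ioc a (u s) ⊆ B := by
  intro φ hφ
  obtain ⟨s', hs', hD'⟩ := ((ha.eventually (gt_mem_nhds hφ.1)).and hl).exists
  have := (hD.image u hu).ordConnected.out (Set.mem_image_of_mem u hD') (Set.mem_image_of_mem u hs)
    ⟨hs'.le, hφ.2⟩
  obtain ⟨s'', h1, rfl⟩ := this
  exact hB _ h1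

theorem lt_of_strictMonoOn {j : Fin (d + 1)} {u : ℝ → ℝ} (hu : StrictMonoOn u (halfLine j)) {a : ℝ}
    (ha : Filter.Tendsto u (endFilter j) (𝓝 a)) {s : ℝ} (hs : s ∈ halfLine j) :
    if j = 0 then a < u s else u s < a := by
  unfold halfLine endFilter at *
  split_ifs at * with hj
  · have h1 : s - 1 ∈ Set.Iic (0 : ℝ) := by simp only [Set.mem_Iic] at *; linarith
    refine lt_of_le_of_lt (le_of_tendsto ha ?_) (hu h1 hs (by linarith))
    filter_upwards [Filter.Iic_mem_atBot (s - 1)] with x hx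
    exact hu.monotoneOn (Set.mem_Iic.2 (le_trans hx h1)) h1 hx
  · have h1 : s + 1 ∈ Set.Ici (0 : ℝ) := by simp only [Set.mem_Ici] at *; linarith
    refine lt_of_lt_of_le (hu hs h1 (by linarith)) (ge_of_tendsto ha ?_)
    filter_upwards [Filter.Ici_mem_atTop (s + 1)] with x hx
    exact hu.monotoneOn h1 (Set.mem_Ici.2 (le_trans h1 hx)) hx

variable {S} in
/-- The boundary sides of an end lie on the expected sides of its limit point. -/
theorem IsStripLift.side {j : Fin (d + 1)} {F : ℝ × ℝ → ℝ × ℝ} (h : S.IsStripLift j F) {s : ℝ}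
    (hs : s ∈ halfLine j) :
    (if j = 0 then S.α j < (F (s, 0)).2 else (F (s, 0)).2 < S.α j) ∧
    (if j = 0 then (F (s, 1)).2 < S.α j else S.α j < (F (s, 1)).2) := by
  constructor
  · refine lt_of_strictMonoOn (u := fun s => (F (s, 0)).2) ?_ (h.tendsto 0 (by simp)) hs
    refine strictMonoOn_of_hasDerivWithinAt_pos (halfLine_convex j)
      (fun s hs => (h.strictMono_aux hs (.inl rfl)).2.continuousWithinAt)
      (fun s hs => (h.strictMono_aux (interior_subset hs) (.inl rfl)).2.mono interior_subset) fun s hs => ?_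
    have := (h.strictMono_aux (interior_subset hs) (.inl rfl)).1
    linarith
  · have h1 := lt_of_strictMonoOn (u := fun s => -(F (s, 1)).2) (j := j) (a := -S.α j) ?_
      (h.tendsto 1 (by simp)).neg hs
    · split_ifs at h1 ⊢ with hj
      · exact neg_lt_neg_iff.1 h1
      · exact neg_lt_neg_iff.1 h1
    refine strictMonoOn_of_hasDerivWithinAt_pos (halfLine_convex j)
      (fun s hs => (h.strictMono_aux hs (.inr rfl)).2.neg.continuousWithinAt)
      (fun s hs => ((h.strictMono_aux (interior_subset hs) (.inr rfl)).2.neg).mono interior_subset) fun s hs => ?_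
    have := (h.strictMono_aux (interior_subset hs) (.inr rfl)).1
    linarith

-- The side of an end sweeps out, in the boundary, an interval of angles which reaches up to the
-- limit: no other puncture lies in between.
variable {S} in
theorem IsStripLift.Ico_subset {j : Fin (d + 1)} {F : ℝ × ℝ → ℝ × ℝ} (h : S.IsStripLift j F) {s t : ℝ}
    (hs : s ∈ halfLine j) (ht : t = 0 ∨ t = 1) :
    Set.Ico (F (s, t)).2 (S.α j) ⊆ S.bdryAngles ∧ Set.Ioc (S.α j) (F (s, t)).2 ⊆ S.bdryAngles := by
  have htI : t ∈ Set.Icc (0 : ℝ) 1 := by rcases ht with rfl | rfl <;> simp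
  have hc : ContinuousOn (fun s => (F (s, t)).2) (halfLine j) := fun s hs =>
    (h.strictMono_aux hs ht).2.continuousWithinAt
  have hB : ∀ s ∈ halfLine j, (F (s, t)).2 ∈ S.bdryAngles := fun s hs =>
    h.mem_bdryAngles (mem_stripDom hs htI) ht
  exact ⟨Ico_subset_of_tendsto (halfLine_convex j).isPreconnected hc (halfLine_mem_endFilter j)
      (h.tendsto t htI) hB hs, Ioc_subset_of_tendsto (halfLine_convex j).isPreconnected hc
      (halfLine_mem_endFilter j) (h.tendsto t htI) hB hs⟩

end PuncturedDisc

/-! ### Series of smooth functions on convex sets -/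

section Series

variable {E F : Type} [NormedAddCommGroup E] [NormedSpace ℝ E] [NormedAddCommGroup F] [NormedSpace ℝ F]

/-- All derivatives of the functions are bounded by summable sequences. -/
def SumBound (s : Set E) (f : ℕ → E → F) : Prop :=
  ∀ n : ℕ, ∃ v : ℕ → ℝ, Summable v ∧ ∀ i, ∀ x ∈ s, ‖iteratedFDerivWithin ℝ n (f i) s x‖ ≤ v i

variable {s : Set E} {f : ℕ → E → F}

theorem SumBound.fderivWithin (hu : UniqueDiffOn ℝ s) (h : SumBound s f) :
    SumBound s fun i => fderivWithin ℝ (f i) s := fun n => by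
  obtain ⟨v, hv, hb⟩ := h (n + 1)
  exact ⟨v, hv, fun i x hx => by rw [norm_iteratedFDerivWithin_fderivWithin hu hx]; exact hb i x hx⟩

theorem SumBound.clm_apply {F' : Type} [NormedAddCommGroup F'] [NormedSpace ℝ F'] {f : ℕ → E → F' →L[ℝ] F}
    (hu : UniqueDiffOn ℝ s) (hf : ∀ i, ContDiffOn ℝ ∞ (f i) s) (h : SumBound s f) (c : F') :
    SumBound s fun i x => f i x c := fun n => by
  obtain ⟨v, hv, hb⟩ := h n
  refine ⟨fun i => ‖c‖ * v i, hv.mul_left _, fun i x hx => ?_⟩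
  refine (norm_iteratedFDerivWithin_clm_apply_const (hf i x hx) hu hx (by exact_mod_cast le_top)).trans ?_
  exact mul_le_mul_of_nonneg_left (hb i x hx) (norm_nonneg c)

variable [CompleteSpace F]

theorem SumBound.summable (h : SumBound s f) {x : E} (hx : x ∈ s) : Summable fun i => f i x := by
  obtain ⟨v, hv, hb⟩ := h 0
  exact Summable.of_norm_bounded hv fun i => by
    have := hb i x hx
    rwa [norm_iteratedFDerivWithin_zero] at this

/-- The first N terms are differentiable. The tail minus its linearisation is estimated by the mean
value inequality on the convex set, with twice the tail of the bounding series, whence the ε/4. -/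
theorem SumBound.hasFDerivWithinAt (hs : Convex ℝ s) (hu : UniqueDiffOn ℝ s)
    (hf : ∀ i, DifferentiableOn ℝ (f i) s) (h : SumBound s f) {x : E} (hx : x ∈ s) :
    HasFDerivWithinAt (fun x => ∑' i, f i x) (∑' i, _root_.fderivWithin ℝ (f i) s x) s x := by
  obtain ⟨v, hv, hb⟩ := h 1
  have hb1 : ∀ i, ∀ x ∈ s, ‖_root_.fderivWithin ℝ (f i) s x‖ ≤ v i := fun i x hx => by
    rw [← norm_iteratedFDerivWithin_one (f i) (hu x hx)]; exact hb i x hx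
  have hv0 : ∀ i, 0 ≤ v i := fun i => (norm_nonneg _).trans (hb1 i x hx)
  have hs' : Summable fun i => _root_.fderivWithin ℝ (f i) s x := (h.fderivWithin hu).summable hx
  rw [hasFDerivWithinAt_iff_isLittleO, Asymptotics.isLittleO_iff]
  intro ε hε
  have htail := (tendsto_sum_nat_add v).eventually (gt_mem_nhds (show (0 : ℝ) < ε / 4 by positivity))
  obtain ⟨N, hN⟩ := htail.exists
  have hfin : HasFDerivWithinAt (fun y => ∑ i ∈ Finset.range N, f i y)
      (∑ i ∈ Finset.range N, _root_.fderivWithin ℝ (f i) s x) s x :=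
    HasFDerivWithinAt.fun_sum fun i _ => (hf i x hx).hasFDerivWithinAt
  rw [hasFDerivWithinAt_iff_isLittleO, Asymptotics.isLittleO_iff] at hfin
  filter_upwards [hfin (half_pos hε), self_mem_nhdsWithin] with y hy hys
  have hsum : ∀ y ∈ s, ∑' i, f i y = ∑ i ∈ Finset.range N, f i y + ∑' i, f (i + N) y := fun y hy =>
    ((h.summable hy).sum_add_tsum_nat_add N).symm
  have hsum' : ∑' i, _root_.fderivWithin ℝ (f i) s x = ∑ i ∈ Finset.range N, _root_.fderivWithin ℝ (f i) s x +
      ∑' i, _root_.fderivWithin ℝ (f (i + N)) s x := (hs'.sum_add_tsum_nat_add N).symm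
  have ht1 : Summable fun i => f (i + N) y := (summable_nat_add_iff N).2 (h.summable hys)
  have ht2 : Summable fun i => f (i + N) x := (summable_nat_add_iff N).2 (h.summable hx)
  have ht3 : Summable fun i => _root_.fderivWithin ℝ (f (i + N)) s x := (summable_nat_add_iff N).2 hs'
  have ht4 : Summable fun i => v (i + N) := (summable_nat_add_iff N).2 hv
  have ht5 : (∑' i, _root_.fderivWithin ℝ (f (i + N)) s x) (y - x) =
      ∑' i, _root_.fderivWithin ℝ (f (i + N)) s x (y - x) :=
    (ContinuousLinearMap.apply ℝ F (y - x)).map_tsum ht3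
  have ht6 : Summable fun i => _root_.fderivWithin ℝ (f (i + N)) s x (y - x) :=
    (ContinuousLinearMap.apply ℝ F (y - x)).summable ht3
  have htl : ‖∑' i, f (i + N) y - ∑' i, f (i + N) x - (∑' i, _root_.fderivWithin ℝ (f (i + N)) s x) (y - x)‖ ≤
      ε / 2 * ‖y - x‖ := by
    rw [ht5, ← ht1.tsum_sub ht2, ← (ht1.sub ht2).tsum_sub ht6]
    refine (tsum_of_norm_bounded ((ht4.hasSum.mul_left 2).mul_right ‖y - x‖) fun i => ?_).trans ?_
    · refine hs.norm_image_sub_le_of_norm_fderivWithin_le' (hf _) (fun z hz => ?_) hx hys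
      refine (norm_sub_le _ _).trans ?_
      linarith [hb1 (i + N) z hz, hb1 (i + N) x hx]
    · gcongr
      linarith
  rw [hsum y hys, hsum x hx, hsum']
  calc _ = ‖(∑ i ∈ Finset.range N, f i y - ∑ i ∈ Finset.range N, f i x -
        (∑ i ∈ Finset.range N, _root_.fderivWithin ℝ (f i) s x) (y - x)) +
        (∑' i, f (i + N) y - ∑' i, f (i + N) x - (∑' i, _root_.fderivWithin ℝ (f (i + N)) s x) (y - x))‖ := by
        rw [_root_.add_apply]; congr 1; abel
    _ ≤ ε / 2 * ‖y - x‖ + ε / 2 * ‖y - x‖ := (norm_add_le _ _).trans (add_le_add hy htl)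
    _ = _ := by ring

theorem SumBound.contDiffOn (hs : Convex ℝ s) (hu : UniqueDiffOn ℝ s)
    (hf : ∀ i, ContDiffOn ℝ ∞ (f i) s) (h : SumBound s f) : ContDiffOn ℝ ∞ (fun x => ∑' i, f i x) s := by
  rw [contDiffOn_infty]
  intro m
  induction m generalizing F with
  | zero =>
    rw [Nat.cast_zero, contDiffOn_zero]
    obtain ⟨v, hv, hb⟩ := h 0
    exact continuousOn_tsum (fun i => (hf i).continuousOn) hv fun i x hx => by
      have := hb i x hx
      rwa [norm_iteratedFDerivWithin_zero] at this
  | succ m ih =>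
    rw [Nat.cast_succ, contDiffOn_succ_iff_hasFDerivWithinAt_of_uniqueDiffOn hu]
    exact ⟨by simp, _, ih (fun i => (hf i).fderivWithin hu (by simp)) (h.fderivWithin hu),
      fun x hx => h.hasFDerivWithinAt hs hu (fun i => (hf i).differentiableOn (by simp)) hx⟩

end Series

/-! ### Normal derivatives -/

section Normal

variable {F : Type} [NormedAddCommGroup F] [NormedSpace ℝ F]

/-- The derivative in a given direction. -/
def dirD (v : ℝ × ℝ) (X : Set (ℝ × ℝ)) (g : ℝ × ℝ → F) (p : ℝ × ℝ) : F := fderivWithin ℝ g X p v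

variable {X : Set (ℝ × ℝ)} {g g' : ℝ × ℝ → F} {v w : ℝ × ℝ}

theorem dirD_congr (h : Set.EqOn g g' X) : Set.EqOn (dirD v X g) (dirD v X g') X := fun p hp => by
  rw [dirD, dirD, fderivWithin_congr h (h hp)]

theorem dirD_smooth (hu : UniqueDiffOn ℝ X) (h : ContDiffOn ℝ ∞ g X) : ContDiffOn ℝ ∞ (dirD v X g) X :=
  (h.fderivWithin hu (by simp)).clm_apply contDiffOn_const

theorem dirD_iterate_smooth (hu : UniqueDiffOn ℝ X) (h : ContDiffOn ℝ ∞ g X) (k : ℕ) :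
    ContDiffOn ℝ ∞ ((dirD v X)^[k] g) X := by
  induction k with
  | zero => exact h
  | succ k ih => simp only [Function.iterate_succ', Function.comp_apply]; exact dirD_smooth hu ih

theorem dirD_clm {F' : Type} [NormedAddCommGroup F'] [NormedSpace ℝ F'] {L : ℝ × ℝ → F' →L[ℝ] F}
    (hu : UniqueDiffOn ℝ X) (h : ContDiffOn ℝ ∞ L X) (c : F') :
    Set.EqOn (fun p => dirD v X L p c) (dirD v X fun p => L p c) X := fun p hp => by
  have h1 : HasFDerivWithinAt (fun p => L p c) _ X p :=
    ((h.differentiableOn (by simp) p hp).hasFDerivWithinAt).clm_apply (hasFDerivWithinAt_const c p X)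
  simp only [dirD]
  rw [h1.fderivWithin (hu p hp)]
  simp

theorem dirD_iterate_clm {F' : Type} [NormedAddCommGroup F'] [NormedSpace ℝ F'] {L : ℝ × ℝ → F' →L[ℝ] F}
    (hu : UniqueDiffOn ℝ X) (h : ContDiffOn ℝ ∞ L X) (c : F') (k : ℕ) :
    Set.EqOn (fun p => (dirD v X)^[k] L p c) ((dirD v X)^[k] fun p => L p c) X := by
  induction k with
  | zero => exact fun _ _ => rfl
  | succ k ih =>
    simp only [Function.iterate_succ', Function.comp_apply]
    exact (dirD_clm hu (dirD_iterate_smooth hu h k) c).trans (dirD_congr ih)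

theorem dirD_comm (hu : UniqueDiffOn ℝ X) (hcl : X ⊆ closure (interior X)) (h : ContDiffOn ℝ ∞ g X) :
    Set.EqOn (dirD v X (dirD w X g)) (dirD w X (dirD v X g)) X := fun p hp => by
  have hs := h.fderivWithin hu (m := ∞) (by simp)
  have h1 : ∀ v w, dirD v X (dirD w X g) p = fderivWithin ℝ (fderivWithin ℝ g X) X p v w := fun v w =>
    (dirD_clm (v := v) hu hs w hp).symm
  rw [h1, h1]
  exact ((h p hp).isSymmSndFDerivWithinAt (n := ∞)
    (by simp; exact WithTop.coe_le_coe.2 (le_top (a := (2 : ℕ∞)))) hu (hcl hp) hp).eq v w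

theorem dirD_iterate_comm (hu : UniqueDiffOn ℝ X) (hcl : X ⊆ closure (interior X)) (h : ContDiffOn ℝ ∞ g X)
    (k : ℕ) : Set.EqOn ((dirD v X)^[k] (dirD w X g)) (dirD w X ((dirD v X)^[k] g)) X := by
  induction k with
  | zero => exact fun _ _ => rfl
  | succ k ih =>
    simp only [Function.iterate_succ', Function.comp_apply]
    exact (dirD_congr ih).trans (dirD_comm hu hcl (dirD_iterate_smooth hu h k))

theorem dirD_iterate_sub (hu : UniqueDiffOn ℝ X) (h : ContDiffOn ℝ ∞ g X) (h' : ContDiffOn ℝ ∞ g' X) (k : ℕ) :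
    Set.EqOn ((dirD v X)^[k] (fun p => g p - g' p)) (fun p => (dirD v X)^[k] g p - (dirD v X)^[k] g' p) X := by
  induction k with
  | zero => exact fun _ _ => rfl
  | succ k ih =>
    simp only [Function.iterate_succ', Function.comp_apply]
    refine (dirD_congr ih).trans fun p hp => ?_
    have h1 := ((dirD_iterate_smooth (v := v) hu h k).differentiableOn (by simp) p hp).hasFDerivWithinAt
    have h2 := ((dirD_iterate_smooth (v := v) hu h' k).differentiableOn (by simp) p hp).hasFDerivWithinAt
    simp only [dirD]
    rw [(h1.fun_sub h2).fderivWithin (hu p hp)]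
    rfl

theorem dirD_iterate_mono {X' : Set (ℝ × ℝ)} (hu : UniqueDiffOn ℝ X) (hu' : UniqueDiffOn ℝ X') (hX : X ⊆ X')
    (h : ContDiffOn ℝ ∞ g X') (k : ℕ) : Set.EqOn ((dirD v X)^[k] g) ((dirD v X')^[k] g) X := by
  induction k with
  | zero => exact fun _ _ => rfl
  | succ k ih =>
    simp only [Function.iterate_succ', Function.comp_apply]
    refine (dirD_congr ih).trans fun p hp => ?_
    have h1 := ((dirD_iterate_smooth (v := v) hu' h k).differentiableOn (by simp) p (hX hp)).hasFDerivWithinAt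
    simp only [dirD]
    rw [(h1.mono hX).fderivWithin (hu p hp)]

end Normal

/-! ### Extension of flat functions by zero -/

section Flat

variable {F : Type} [NormedAddCommGroup F] [NormedSpace ℝ F] {δ c e : ℝ}

/-- All normal derivatives along the edge `0 × [c, e]` vanish. -/
def FlatEdge (δ c e : ℝ) (g : ℝ × ℝ → F) : Prop :=
  ∀ k : ℕ, ∀ v ∈ Set.Icc c e, (dirD (1, 0) (Set.Ico 0 δ ×ˢ Set.Icc c e))^[k] g (0, v) = 0

theorem uniqueDiffOn_strip (hce : c < e) : UniqueDiffOn ℝ (Set.Ico 0 δ ×ˢ Set.Icc c e) :=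
  (uniqueDiffOn_Ico 0 δ).prod (uniqueDiffOn_Icc hce)

theorem strip_subset_closure (hδ : 0 < δ) (hce : c < e) :
    Set.Ico 0 δ ×ˢ Set.Icc c e ⊆ closure (interior (Set.Ico 0 δ ×ˢ Set.Icc c e)) := by
  rw [interior_prod_eq, interior_Ico, interior_Icc, closure_prod_eq, closure_Ioo hδ.ne, closure_Ioo hce.ne]
  exact Set.prod_mono Set.Ico_subset_Icc_self le_rfl

/-- For the normal component the number of normal derivatives goes up by one. The tangential
derivative commutes with normal derivatives, and differentiates a function which is zero along the
edge. -/
theorem FlatEdge.fderivWithin (hδ : 0 < δ) (hce : c < e) {g : ℝ × ℝ → F}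
    (hg : ContDiffOn ℝ ∞ g (Set.Ico 0 δ ×ˢ Set.Icc c e)) (h : FlatEdge δ c e g) :
    FlatEdge δ c e (fderivWithin ℝ g (Set.Ico 0 δ ×ˢ Set.Icc c e)) := by
  set X := Set.Ico 0 δ ×ˢ Set.Icc c e with hX
  have hu : UniqueDiffOn ℝ X := uniqueDiffOn_strip hce
  have hcl : X ⊆ closure (interior X) := strip_subset_closure hδ hce
  have hgs := hg.fderivWithin hu (m := ∞) (by simp)
  intro k v hv
  have hp : ((0, v) : ℝ × ℝ) ∈ X := ⟨⟨le_rfl, hδ⟩, hv⟩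
  have h10 : ((dirD (1, 0) X)^[k] (_root_.fderivWithin ℝ g X) (0, v)) (1, 0) = 0 := by
    refine (dirD_iterate_clm hu hgs (1, 0) k hp).trans ?_
    have := h (k + 1) v hv
    rwa [Function.iterate_succ_apply] at this
  have h01 : ((dirD (1, 0) X)^[k] (_root_.fderivWithin ℝ g X) (0, v)) (0, 1) = 0 := by
    refine (dirD_iterate_clm hu hgs (0, 1) k hp).trans ?_
    refine (dirD_iterate_comm (w := (0, 1)) hu hcl hg k hp).trans ?_
    have h1 := ((dirD_iterate_smooth (v := (1, 0)) hu hg k).differentiableOn (by simp) _ hp).hasFDerivWithinAt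
    have h2 : HasDerivWithinAt (fun v => ((0, v) : ℝ × ℝ)) (0, 1) (Set.Icc c e) v :=
      ((hasDerivAt_const v (0 : ℝ)).prodMk (hasDerivAt_id v)).hasDerivWithinAt
    have h3 := HasFDerivWithinAt.comp_hasDerivWithinAt (f := fun v => ((0, v) : ℝ × ℝ)) v h1 h2
      fun v' hv' => ⟨⟨le_rfl, hδ⟩, hv'⟩
    have h4 : HasDerivWithinAt (((dirD (1, 0) X)^[k] g) ∘ fun v => ((0, v) : ℝ × ℝ)) 0 (Set.Icc c e) v :=
      (hasDerivWithinAt_const v _ (0 : F)).congr_of_mem (fun v' hv' => h k v' hv') hv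
    exact UniqueDiffWithinAt.eq_deriv _ (uniqueDiffOn_Icc hce v hv) h3 h4
  ext
  · simpa using h10
  · simpa using h01

/-- The derivative of the extension by zero is the extension by zero of the derivative, which is
again flat. This gives an induction on the order of differentiability. -/
theorem FlatEdge.contDiffOn (hδ : 0 < δ) (hce : c < e) {g : ℝ × ℝ → F}
    (hg : ContDiffOn ℝ ∞ g (Set.Ico 0 δ ×ˢ Set.Icc c e)) (h : FlatEdge δ c e g) :
    ContDiffOn ℝ ∞ (fun p => if 0 ≤ p.1 then g p else 0) (Set.Iio δ ×ˢ Set.Icc c e) := by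
  have hu' : UniqueDiffOn ℝ (Set.Iio δ ×ˢ Set.Icc c e) := (uniqueDiffOn_Iio δ).prod (uniqueDiffOn_Icc hce)
  set X := Set.Ico 0 δ ×ˢ Set.Icc c e with hX
  have hu : UniqueDiffOn ℝ X := uniqueDiffOn_strip hce
  -- the derivative
  have key : ∀ {F : Type} [NormedAddCommGroup F] [NormedSpace ℝ F] {g : ℝ × ℝ → F},
      ContDiffOn ℝ ∞ g X → FlatEdge δ c e g → ∀ p ∈ Set.Iio δ ×ˢ Set.Icc c e,
      HasFDerivWithinAt (fun p => if 0 ≤ p.1 then g p else 0)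
        (if 0 ≤ p.1 then _root_.fderivWithin ℝ g X p else 0) (Set.Iio δ ×ˢ Set.Icc c e) p := by
    intro F _ _ g hg h p hp
    have hL : 0 ≤ p.1 → HasFDerivWithinAt (fun p => if 0 ≤ p.1 then g p else 0)
        (_root_.fderivWithin ℝ g X p) X p := fun h0 =>
      HasFDerivWithinAt.congr ((hg.differentiableOn (by simp) p ⟨⟨h0, hp.1⟩, hp.2⟩).hasFDerivWithinAt)
        (fun q hq => if_pos hq.1.1) (if_pos h0)
    rcases lt_trichotomy 0 p.1 with h0 | h0 | h0
    · rw [if_pos h0.le]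
      refine (hL h0.le).mono_of_mem_nhdsWithin ?_
      have : {q : ℝ × ℝ | 0 < q.1} ∈ 𝓝 p := (isOpen_lt continuous_const continuous_fst).mem_nhds h0
      filter_upwards [mem_nhdsWithin_of_mem_nhds this, self_mem_nhdsWithin] with q hq hq'
      exact ⟨⟨le_of_lt hq, hq'.1⟩, hq'.2⟩
    · have hz : ∀ v ∈ Set.Icc c e, g (0, v) = 0 := fun v hv => h 0 v hv
      have hp0 : p = (0, p.2) := Prod.ext h0.symm rfl
      have h1 : _root_.fderivWithin ℝ g X p = 0 := by
        rw [hp0]; exact h.fderivWithin hδ hce hg 0 p.2 hp.2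
      rw [if_pos h0.le]
      have h2 : HasFDerivWithinAt (fun p : ℝ × ℝ => if 0 ≤ p.1 then g p else 0)
          (_root_.fderivWithin ℝ g X p) (Set.Iic 0 ×ˢ Set.Icc c e) p := by
        rw [h1]
        have hq0 : ∀ q ∈ Set.Iic (0 : ℝ) ×ˢ Set.Icc c e, (if 0 ≤ q.1 then g q else 0) = 0 := by
          intro q hq
          split_ifs with h3
          · rw [show q = (0, q.2) from Prod.ext (le_antisymm hq.1 h3) rfl]
            exact hz _ hq.2
          · rfl
        exact HasFDerivWithinAt.congr (hasFDerivWithinAt_const (0 : F) p _) hq0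
          (hq0 p ⟨h0.ge, hp.2⟩)
      refine ((hL h0.le).union h2).mono fun q hq => ?_
      rcases le_total 0 q.1 with h3 | h3
      · exact .inl ⟨⟨h3, hq.1⟩, hq.2⟩
      · exact .inr ⟨h3, hq.2⟩
    · rw [if_neg (not_le.2 h0)]
      have h1 : (fun p : ℝ × ℝ => if 0 ≤ p.1 then g p else 0) =ᶠ[𝓝 p] fun _ => 0 := by
        have : {q : ℝ × ℝ | q.1 < 0} ∈ 𝓝 p := (isOpen_lt continuous_fst continuous_const).mem_nhds h0
        filter_upwards [this] with q hq
        exact if_neg (not_le.2 hq)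
      exact ((hasFDerivAt_const (0 : F) p).congr_of_eventuallyEq h1).hasFDerivWithinAt
  rw [contDiffOn_infty]
  intro m
  induction m generalizing F with
  | zero =>
    rw [Nat.cast_zero, contDiffOn_zero]
    exact fun p hp => (key hg h p hp).continuousWithinAt
  | succ m ih =>
    rw [Nat.cast_succ, contDiffOn_succ_iff_hasFDerivWithinAt_of_uniqueDiffOn hu']
    exact ⟨by simp, _, ih (h.fderivWithin hδ hce hg) (hg.fderivWithin hu (by simp)), key hg h⟩

end Flat

/-! ### Functions with prescribed normal derivatives -/

section Borel

variable {F : Type} [NormedAddCommGroup F] [NormedSpace ℝ F] {c e : ℝ}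

/-- The monomial `w ^ k / k!`, cut off outside `[-2, 2]`. -/
def bumpMon (k : ℕ) (w : ℝ) : ℝ := (⟨1, 2, one_pos, one_lt_two⟩ : ContDiffBump (0 : ℝ)) w * (w ^ k / k.factorial)

theorem contDiff_bumpMon (k : ℕ) : ContDiff ℝ ∞ (bumpMon k) :=
  (ContDiffBump.contDiff _).mul ((contDiff_id.pow k).div_const _)

theorem bumpMon_eventuallyEq (k : ℕ) : bumpMon k =ᶠ[𝓝 0] fun w => w ^ k / k.factorial := by
  filter_upwards [Metric.closedBall_mem_nhds (0 : ℝ) one_pos] with w hw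
  rw [bumpMon, ContDiffBump.one_of_mem_closedBall _ hw, one_mul]

theorem bumpMon_eq_zero (k : ℕ) {w : ℝ} (hw : 2 ≤ |w|) : bumpMon k w = 0 := by
  rw [bumpMon, ContDiffBump.zero_of_le_dist _ (by simpa [Real.dist_eq] using hw), zero_mul]

theorem uniqueDiffOn_univ_Icc (hce : c < e) : UniqueDiffOn ℝ ((Set.univ : Set ℝ) ×ˢ Set.Icc c e) :=
  uniqueDiffOn_univ.prod (uniqueDiffOn_Icc hce)

theorem contDiffOn_bumpMon_smul (k : ℕ) {f : ℝ → F} (hf : ContDiffOn ℝ ∞ f (Set.Icc c e)) :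
    ContDiffOn ℝ ∞ (fun p : ℝ × ℝ => bumpMon k p.1 • f p.2) (Set.univ ×ˢ Set.Icc c e) :=
  ((contDiff_bumpMon k).comp contDiff_fst).contDiffOn.smul (hf.comp contDiffOn_snd fun _ hp => hp.2)

theorem bumpMon_smul_bound (hce : c < e) (k n : ℕ) {f : ℝ → F} (hf : ContDiffOn ℝ ∞ f (Set.Icc c e)) :
    ∃ M, 0 ≤ M ∧ ∀ p ∈ (Set.univ : Set ℝ) ×ˢ Set.Icc c e,
      ‖iteratedFDerivWithin ℝ n (fun p : ℝ × ℝ => bumpMon k p.1 • f p.2) (Set.univ ×ˢ Set.Icc c e) p‖ ≤ M := by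
  have hc : ContinuousOn (iteratedFDerivWithin ℝ n (fun p : ℝ × ℝ => bumpMon k p.1 • f p.2)
      (Set.univ ×ˢ Set.Icc c e)) (Set.Icc (-2) 2 ×ˢ Set.Icc c e) :=
    ((contDiffOn_bumpMon_smul k hf).continuousOn_iteratedFDerivWithin (by exact_mod_cast le_top)
      (uniqueDiffOn_univ_Icc hce)).mono (Set.prod_mono (Set.subset_univ _) le_rfl)
  obtain ⟨M, hM⟩ := (isCompact_Icc.prod isCompact_Icc).exists_bound_of_continuousOn hc
  refine ⟨max M 0, le_max_right _ _, fun p hp => ?_⟩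
  by_cases h : p.1 ∈ Set.Icc (-2 : ℝ) 2
  · exact (hM p ⟨h, hp.2⟩).trans (le_max_left _ _)
  · have h2 : 2 < |p.1| := not_le.1 fun h' => h (abs_le.1 h')
    have hz : (fun p : ℝ × ℝ => bumpMon k p.1 • f p.2) =ᶠ[𝓝 p] fun _ => (0 : F) := by
      have : {q : ℝ × ℝ | 2 < |q.1|} ∈ 𝓝 p := (isOpen_lt continuous_const continuous_fst.abs).mem_nhds h2
      filter_upwards [this] with q hq
      rw [bumpMon_eq_zero k (le_of_lt hq), zero_smul]
    rw [(hz.filter_mono nhdsWithin_le_nhds).iteratedFDerivWithin_eq hz.self_of_nhds]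
    have : iteratedFDerivWithin ℝ n (fun _ : ℝ × ℝ => (0 : F)) (Set.univ ×ˢ Set.Icc c e) p = 0 := by
      have := congrFun (iteratedFDerivWithin_fun_zero (𝕜 := ℝ) (E := ℝ × ℝ) (F := F)
        (s := Set.univ ×ˢ Set.Icc c e) (i := n)) p
      exact this
    rw [this, norm_zero]
    exact le_max_right _ _

/-- Scaling of the first coordinate. -/
def scaleFst (l : ℝ) : ℝ × ℝ →L[ℝ] ℝ × ℝ :=
  (l • ContinuousLinearMap.id ℝ ℝ).prodMap (ContinuousLinearMap.id ℝ ℝ)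

theorem norm_scaleFst_le {l : ℝ} (hl : 1 ≤ l) : ‖scaleFst l‖ ≤ l := by
  refine ContinuousLinearMap.opNorm_le_bound _ (by linarith) fun p => ?_
  have h0 : 0 ≤ l := by linarith
  refine max_le ?_ ?_
  · change ‖l * p.1‖ ≤ _
    rw [norm_mul, Real.norm_of_nonneg h0]
    exact mul_le_mul_of_nonneg_left (norm_fst_le p) h0
  · change ‖p.2‖ ≤ _
    exact (norm_snd_le p).trans (le_mul_of_one_le_left (norm_nonneg p) hl)

theorem scaled_bound (hce : c < e) (k n : ℕ) {f : ℝ → F} (hf : ContDiffOn ℝ ∞ f (Set.Icc c e)) {M : ℝ}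
    (hM : ∀ p ∈ (Set.univ : Set ℝ) ×ˢ Set.Icc c e,
      ‖iteratedFDerivWithin ℝ n (fun p : ℝ × ℝ => bumpMon k p.1 • f p.2) (Set.univ ×ˢ Set.Icc c e) p‖ ≤ M)
    {l : ℝ} (hl : 1 ≤ l) (p : ℝ × ℝ) (hp : p ∈ (Set.univ : Set ℝ) ×ˢ Set.Icc c e) :
    ‖iteratedFDerivWithin ℝ n (fun p : ℝ × ℝ => (l ^ k)⁻¹ • bumpMon k (l * p.1) • f p.2)
      (Set.univ ×ˢ Set.Icc c e) p‖ ≤ (l ^ k)⁻¹ * (M * l ^ n) := by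
  have hu := uniqueDiffOn_univ_Icc hce
  have hs := contDiffOn_bumpMon_smul k hf
  have h0 : 0 < l := by linarith
  have hpre : scaleFst l ⁻¹' (Set.univ ×ˢ Set.Icc c e) = Set.univ ×ˢ Set.Icc c e := by
    ext q; simp [scaleFst]
  have hcomp := (scaleFst l).iteratedFDerivWithin_comp_right (i := n) hs hu (by rw [hpre]; exact hu) (x := p)
    (by exact ⟨trivial, hp.2⟩) (by exact_mod_cast le_top)
  rw [hpre] at hcomp
  have hs2 : ContDiffOn ℝ ∞ ((fun p : ℝ × ℝ => bumpMon k p.1 • f p.2) ∘ scaleFst l) (Set.univ ×ˢ Set.Icc c e) :=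
    hs.comp (scaleFst l).contDiff.contDiffOn fun q hq => ⟨trivial, hq.2⟩
  have h1 := iteratedFDerivWithin_const_smul_apply (a := (l ^ k)⁻¹) (i := n)
    ((hs2.of_le (by exact_mod_cast le_top)) p hp) hu hp
  change ‖iteratedFDerivWithin ℝ n ((l ^ k)⁻¹ • ((fun p : ℝ × ℝ => bumpMon k p.1 • f p.2) ∘ scaleFst l)) _ p‖ ≤ _
  rw [h1, norm_smul, norm_inv, norm_pow, Real.norm_of_nonneg h0.le, hcomp]
  refine mul_le_mul_of_nonneg_left ?_ (by positivity)
  refine (ContinuousMultilinearMap.norm_compContinuousLinearMap_le _ _).trans ?_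
  rw [Finset.prod_const, Finset.card_univ, Fintype.card_fin]
  have := hM (scaleFst l p) ⟨trivial, hp.2⟩
  exact mul_le_mul this (pow_le_pow_left₀ (norm_nonneg _) (norm_scaleFst_le hl) n) (by positivity)
    ((norm_nonneg _).trans this)

theorem exists_sumBound (hce : c < e) {f : ℕ → ℝ → F} (hf : ∀ k, ContDiffOn ℝ ∞ (f k) (Set.Icc c e)) :
    ∃ l : ℕ → ℝ, (∀ k, 1 ≤ l k) ∧ SumBound ((Set.univ : Set ℝ) ×ˢ Set.Icc c e)
      fun k p => ((l k) ^ k)⁻¹ • bumpMon k (l k * p.1) • f k p.2 := by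
  choose M hM0 hM using fun k n => bumpMon_smul_bound hce k n (hf k)
  -- The scale l_k exceeds 2^k times each bound M(k, n) with n < k. The n-th derivatives of the
  -- scaled k-th term are then at most M(k, n)·l_k^{n-k} ≤ M(k, n)/l_k ≤ 2^{-k}.
  have hl1 : ∀ k, 1 ≤ 1 + 2 ^ k * ∑ n ∈ Finset.range k, M k n := fun k =>
    le_add_of_nonneg_right (mul_nonneg (by positivity) (Finset.sum_nonneg fun n _ => hM0 k n))
  refine ⟨fun k => 1 + 2 ^ k * ∑ n ∈ Finset.range k, M k n, hl1, fun n => ?_⟩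
  set l : ℕ → ℝ := fun k => 1 + 2 ^ k * ∑ n ∈ Finset.range k, M k n with hl
  refine ⟨fun k => if n < k then (1 / 2) ^ k else ((l k) ^ k)⁻¹ * (M k n * l k ^ n), ?_, fun k p hp => ?_⟩
  · refine (summable_nat_add_iff (n + 1)).1 ?_
    have : (fun k => if n < k + (n + 1) then ((1 : ℝ) / 2) ^ (k + (n + 1)) else
        ((l (k + (n + 1))) ^ (k + (n + 1)))⁻¹ * (M (k + (n + 1)) n * l (k + (n + 1)) ^ n)) =
        fun k => (1 / 2) ^ (k + (n + 1)) := by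
      funext k; exact if_pos (by omega)
    rw [this]
    exact (summable_nat_add_iff (n + 1)).2 summable_geometric_two
  · refine (scaled_bound hce k n (hf k) (hM k n) (hl1 k) p hp).trans ?_
    change (l k ^ k)⁻¹ * (M k n * l k ^ n) ≤ if n < k then (1 / 2) ^ k else (l k ^ k)⁻¹ * (M k n * l k ^ n)
    split_ifs with h
    · have h0 : 0 < l k := lt_of_lt_of_le one_pos (hl1 k)
      have h2 : M k n * 2 ^ k ≤ l k := by
        have : M k n ≤ ∑ n ∈ Finset.range k, M k n :=
          Finset.single_le_sum (f := fun n => M k n) (fun n _ => hM0 k n) (Finset.mem_range.2 h)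
        have h3 := mul_le_mul_of_nonneg_left this (show (0 : ℝ) ≤ 2 ^ k by positivity)
        simp only [hl]
        linarith
      rw [one_div, inv_pow, inv_mul_le_iff₀ (by positivity), ← div_eq_mul_inv, le_div_iff₀ (by positivity)]
      calc M k n * l k ^ n * 2 ^ k = (M k n * 2 ^ k) * l k ^ n := by ring
        _ ≤ l k * l k ^ n := mul_le_mul_of_nonneg_right h2 (by positivity)
        _ = l k ^ (n + 1) := (pow_succ' _ _).symm
        _ ≤ l k ^ k := pow_le_pow_right₀ (hl1 k) h
    · exact le_rfl

theorem dirD_iterate_smul (hce : c < e) {a : ℝ → ℝ} (ha : ContDiff ℝ ∞ a) {f : ℝ → F}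
    (hf : ContDiffOn ℝ ∞ f (Set.Icc c e)) (j : ℕ) :
    Set.EqOn ((dirD (1, 0) (Set.univ ×ˢ Set.Icc c e))^[j] fun p => a p.1 • f p.2)
      (fun p => iteratedDeriv j a p.1 • f p.2) (Set.univ ×ˢ Set.Icc c e) := by
  induction j with
  | zero => intro p _; simp
  | succ j ih =>
    simp only [Function.iterate_succ', Function.comp_apply]
    refine (dirD_congr ih).trans fun p hp => ?_
    have h1 : HasFDerivWithinAt (fun p : ℝ × ℝ => f p.2) _ (Set.univ ×ˢ Set.Icc c e) p :=
      HasFDerivWithinAt.comp (g := f) (f := Prod.snd) p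
        ((hf.differentiableOn (by simp) p.2 hp.2).hasFDerivWithinAt) hasFDerivWithinAt_snd fun q hq => hq.2
    have h2 : HasFDerivAt (fun p : ℝ × ℝ => iteratedDeriv j a p.1) _ p :=
      HasFDerivAt.comp (g := iteratedDeriv j a) (f := Prod.fst) p
        (((ha.differentiable_iteratedDeriv j (by exact_mod_cast WithTop.coe_lt_top _)) p.1).hasFDerivAt)
        hasFDerivAt_fst
    simp only [dirD]
    rw [(h2.hasFDerivWithinAt.fun_smul h1).fderivWithin (uniqueDiffOn_univ_Icc hce p hp)]
    simp [iteratedDeriv_succ]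

theorem dirD_iterate_tsum {s : Set (ℝ × ℝ)} [CompleteSpace F] (hs : Convex ℝ s) (hu : UniqueDiffOn ℝ s)
    {f : ℕ → ℝ × ℝ → F} (hf : ∀ i, ContDiffOn ℝ ∞ (f i) s) (h : SumBound s f) (v : ℝ × ℝ) (j : ℕ) :
    Set.EqOn ((dirD v s)^[j] fun p => ∑' i, f i p) (fun p => ∑' i, (dirD v s)^[j] (f i) p) s := by
  have hS : ∀ j, SumBound s fun i => (dirD v s)^[j] (f i) := by
    intro j
    induction j with
    | zero => exact h
    | succ j ih =>
      simp only [Function.iterate_succ', Function.comp_apply]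
      exact (ih.fderivWithin hu).clm_apply hu
        (fun i => (dirD_iterate_smooth hu (hf i) j).fderivWithin hu (by simp)) v
  induction j with
  | zero => exact fun _ _ => rfl
  | succ j ih =>
    simp only [Function.iterate_succ', Function.comp_apply]
    refine (dirD_congr ih).trans fun p hp => ?_
    have hd := (hS j).hasFDerivWithinAt hs hu
      (fun i => (dirD_iterate_smooth hu (hf i) j).differentiableOn (by simp)) hp
    simp only [dirD]
    rw [hd.fderivWithin (hu p hp)]
    exact (ContinuousLinearMap.apply ℝ F v).map_tsum (((hS j).fderivWithin hu).summable hp)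

/-- Borel's lemma, along an edge. -/
theorem exists_normal_derivatives [CompleteSpace F] (hce : c < e) {f : ℕ → ℝ → F}
    (hf : ∀ k, ContDiffOn ℝ ∞ (f k) (Set.Icc c e)) :
    ∃ G : ℝ × ℝ → F, ContDiffOn ℝ ∞ G (Set.univ ×ˢ Set.Icc c e) ∧ ∀ j, ∀ v ∈ Set.Icc c e,
      (dirD (1, 0) (Set.univ ×ˢ Set.Icc c e))^[j] G (0, v) = f j v := by
  obtain ⟨l, hl, hS⟩ := exists_sumBound hce hf
  have hu := uniqueDiffOn_univ_Icc hce
  have ha : ∀ k, ContDiff ℝ ∞ fun u => (l k ^ k)⁻¹ * bumpMon k (l k * u) := fun k =>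
    contDiff_const.mul ((contDiff_bumpMon k).comp (contDiff_const.mul contDiff_id))
  have hT : ∀ k, (fun p : ℝ × ℝ => ((l k) ^ k)⁻¹ • bumpMon k (l k * p.1) • f k p.2) =
      fun p => ((l k ^ k)⁻¹ * bumpMon k (l k * p.1)) • f k p.2 := fun k => by
    funext p; rw [smul_smul]
  have hs : ∀ k, ContDiffOn ℝ ∞ (fun p : ℝ × ℝ => ((l k) ^ k)⁻¹ • bumpMon k (l k * p.1) • f k p.2)
      (Set.univ ×ˢ Set.Icc c e) := fun k => by
    rw [hT]
    exact ((ha k).comp contDiff_fst).contDiffOn.smul ((hf k).comp contDiffOn_snd fun _ hp => hp.2)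
  have hcv : Convex ℝ ((Set.univ : Set ℝ) ×ˢ Set.Icc c e) := convex_univ.prod (convex_Icc c e)
  refine ⟨_, hS.contDiffOn hcv hu hs, fun j v hv => ?_⟩
  have hp : ((0, v) : ℝ × ℝ) ∈ (Set.univ : Set ℝ) ×ˢ Set.Icc c e := ⟨trivial, hv⟩
  refine (dirD_iterate_tsum hcv hu hs hS (1, 0) j hp).trans ?_
  have hterm : ∀ k, (dirD (1, 0) (Set.univ ×ˢ Set.Icc c e))^[j]
      (fun p => ((l k) ^ k)⁻¹ • bumpMon k (l k * p.1) • f k p.2) (0, v) = if k = j then f j v else 0 := by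
    intro k
    have h0 : l k ≠ 0 := (lt_of_lt_of_le one_pos (hl k)).ne'
    -- Near u = 0 the cut-off equals one and the scaling cancels, which leaves the monomial u^k/k!.
    have hev : (fun u => (l k ^ k)⁻¹ * bumpMon k (l k * u)) =ᶠ[𝓝 0] fun u => (k.factorial : ℝ)⁻¹ * u ^ k := by
      have ht : Filter.Tendsto (fun u : ℝ => l k * u) (𝓝 0) (𝓝 0) := by
        have : Continuous fun u : ℝ => l k * u := by fun_prop
        simpa only [mul_zero] using this.tendsto 0
      filter_upwards [ht.eventually (bumpMon_eventuallyEq k)] with u hu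
      rw [hu, mul_pow]
      field_simp
    rw [hT]
    refine (dirD_iterate_smul hce (ha k) (hf k) j hp).trans ?_
    simp only []
    rw [hev.iteratedDeriv_eq, iteratedDeriv_const_mul_field, iteratedDeriv_fun_pow_zero]
    split_ifs with h1 h2 h2
    · subst h1; rw [inv_mul_cancel₀ (by positivity), one_smul]
    · exact absurd h1.symm h2
    · exact absurd h2.symm h1
    · simp
  simp only [hterm]
  rw [tsum_ite_eq]

/-- Subtract a function with the same normal derivatives on the edge; the difference is flat there
and extends by zero. -/
theorem exists_extension_left [CompleteSpace F] {δ : ℝ} (hδ : 0 < δ) (hce : c < e) {f : ℝ × ℝ → F}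
    (hf : ContDiffOn ℝ ∞ f (Set.Ico 0 δ ×ˢ Set.Icc c e)) :
    ∃ G : ℝ × ℝ → F, ContDiffOn ℝ ∞ G (Set.Iio δ ×ˢ Set.Icc c e) ∧
      Set.EqOn G f (Set.Ico 0 δ ×ˢ Set.Icc c e) := by
  have hu : UniqueDiffOn ℝ (Set.Ico 0 δ ×ˢ Set.Icc c e) := uniqueDiffOn_strip hce
  obtain ⟨G, hG, hGd⟩ := exists_normal_derivatives hce
    (f := fun k v => (dirD (1, 0) (Set.Ico 0 δ ×ˢ Set.Icc c e))^[k] f (0, v)) fun k =>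
      (dirD_iterate_smooth hu hf k).comp (contDiffOn_const.prodMk contDiffOn_id) fun v hv => ⟨⟨le_rfl, hδ⟩, hv⟩
  have hsub : Set.Ico 0 δ ×ˢ Set.Icc c e ⊆ (Set.univ : Set ℝ) ×ˢ Set.Icc c e :=
    Set.prod_mono (Set.subset_univ _) le_rfl
  have hflat : FlatEdge δ c e fun p => f p - G p := fun k v hv => by
    have hp : ((0, v) : ℝ × ℝ) ∈ Set.Ico 0 δ ×ˢ Set.Icc c e := ⟨⟨le_rfl, hδ⟩, hv⟩
    refine (dirD_iterate_sub hu hf (hG.mono hsub) k hp).trans ?_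
    simp only []
    rw [dirD_iterate_mono hu (uniqueDiffOn_univ_Icc hce) hsub hG k hp, hGd k v hv, sub_self]
  refine ⟨fun p => G p + if 0 ≤ p.1 then f p - G p else 0,
    (hG.mono (Set.prod_mono (Set.subset_univ _) le_rfl)).add
      (hflat.contDiffOn hδ hce (hf.sub (hG.mono hsub))), fun p hp => ?_⟩
  simp only []
  rw [if_pos hp.1.1, add_sub_cancel]

/-- Extend across either side separately. Both extensions equal f in between, so one may switch from
one to the other at the midpoint. -/
theorem exists_extension_strip [CompleteSpace F] {a b : ℝ} (hab : a < b) (hce : c < e) {f : ℝ × ℝ → F}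
    (hf : ContDiffOn ℝ ∞ f (Set.Icc a b ×ˢ Set.Icc c e)) :
    ∃ G : ℝ × ℝ → F, ContDiffOn ℝ ∞ G (Set.univ ×ˢ Set.Icc c e) ∧ Set.EqOn G f (Set.Icc a b ×ˢ Set.Icc c e) := by
  have hc1 : ContDiff ℝ ∞ fun p : ℝ × ℝ => (a + p.1, p.2) := (contDiff_const.add contDiff_fst).prodMk contDiff_snd
  have hc2 : ContDiff ℝ ∞ fun p : ℝ × ℝ => (b - p.1, p.2) := (contDiff_const.sub contDiff_fst).prodMk contDiff_snd
  have hc1' : ContDiff ℝ ∞ fun p : ℝ × ℝ => (p.1 - a, p.2) := (contDiff_fst.sub contDiff_const).prodMk contDiff_snd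
  obtain ⟨G₁, hG₁, h₁⟩ := exists_extension_left (sub_pos.2 hab) hce (f := fun p => f (a + p.1, p.2))
    (hf.comp hc1.contDiffOn fun p hp => ⟨⟨by linarith [hp.1.1], by linarith [hp.1.2]⟩, hp.2⟩)
  obtain ⟨G₂, hG₂, h₂⟩ := exists_extension_left (sub_pos.2 hab) hce (f := fun p => f (b - p.1, p.2))
    (hf.comp hc2.contDiffOn fun p hp => ⟨⟨by linarith [hp.1.2], by linarith [hp.1.1]⟩, hp.2⟩)
  have e₁ : ∀ p ∈ Set.Ico a b ×ˢ Set.Icc c e, G₁ (p.1 - a, p.2) = f p := fun p hp => by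
    have := h₁ (x := (p.1 - a, p.2)) ⟨⟨by linarith [hp.1.1], by linarith [hp.1.2]⟩, hp.2⟩
    simpa using this
  have e₂ : ∀ p ∈ Set.Ioc a b ×ˢ Set.Icc c e, G₂ (b - p.1, p.2) = f p := fun p hp => by
    have := h₂ (x := (b - p.1, p.2)) ⟨⟨by linarith [hp.1.2], by linarith [hp.1.1]⟩, hp.2⟩
    simpa using this
  refine ⟨fun p => if p.1 < (a + b) / 2 then G₁ (p.1 - a, p.2) else G₂ (b - p.1, p.2), fun p hp => ?_, fun p hp => ?_⟩
  · rcases lt_or_ge p.1 b with h | h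
    · have hs : ContDiffOn ℝ ∞ (fun p : ℝ × ℝ => G₁ (p.1 - a, p.2)) (Set.Iio b ×ˢ Set.Icc c e) :=
        hG₁.comp hc1'.contDiffOn fun p hp => ⟨by simpa using hp.1, hp.2⟩
      have hs' : ContDiffWithinAt ℝ ∞ (fun p : ℝ × ℝ => G₁ (p.1 - a, p.2)) (Set.univ ×ˢ Set.Icc c e) p := by
        refine (hs p ⟨h, hp.2⟩).mono_of_mem_nhdsWithin ?_
        filter_upwards [self_mem_nhdsWithin, mem_nhdsWithin_of_mem_nhds
          ((isOpen_lt continuous_fst continuous_const).mem_nhds h)] with q hq hq'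
        exact ⟨hq', hq.2⟩
      refine hs'.congr_of_eventuallyEq_of_mem ?_ hp
      filter_upwards [self_mem_nhdsWithin, mem_nhdsWithin_of_mem_nhds
          ((isOpen_lt continuous_fst continuous_const).mem_nhds h)] with q hq hq'
      split_ifs with h3
      · rfl
      · have h4 : a < q.1 := by linarith
        rw [e₁ q ⟨⟨h4.le, hq'⟩, hq.2⟩, e₂ q ⟨⟨h4, le_of_lt hq'⟩, hq.2⟩]
    · have hp2 : (a + b) / 2 < p.1 := by linarith
      have hs : ContDiffOn ℝ ∞ (fun p : ℝ × ℝ => G₂ (b - p.1, p.2)) (Set.Ioi a ×ˢ Set.Icc c e) :=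
        hG₂.comp hc2.contDiffOn fun p hp => ⟨by simpa using hp.1, hp.2⟩
      have hs' : ContDiffWithinAt ℝ ∞ (fun p : ℝ × ℝ => G₂ (b - p.1, p.2)) (Set.univ ×ˢ Set.Icc c e) p := by
        refine (hs p ⟨show a < p.1 by linarith, hp.2⟩).mono_of_mem_nhdsWithin ?_
        filter_upwards [self_mem_nhdsWithin, mem_nhdsWithin_of_mem_nhds
          ((isOpen_lt continuous_const continuous_fst).mem_nhds hp2)] with q hq hq'
        exact ⟨show a < q.1 by linarith [show (a + b) / 2 < q.1 from hq'], hq.2⟩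
      refine hs'.congr_of_eventuallyEq_of_mem ?_ hp
      filter_upwards [mem_nhdsWithin_of_mem_nhds
          ((isOpen_lt continuous_const continuous_fst).mem_nhds hp2)] with q hq'
      exact if_neg (not_lt.2 (le_of_lt hq'))
  · simp only []
    split_ifs with h
    · exact e₁ p ⟨⟨hp.1.1, by linarith⟩, hp.2⟩
    · exact e₂ p ⟨⟨by linarith, hp.1.2⟩, hp.2⟩

/-- Smooth functions on a closed box extend to a neighbourhood. -/
theorem exists_extension_box [CompleteSpace F] {a b : ℝ} (hab : a < b) (hce : c < e) {f : ℝ × ℝ → F}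
    (hf : ContDiffOn ℝ ∞ f (Set.Icc a b ×ˢ Set.Icc c e)) :
    ∃ (O : Set (ℝ × ℝ)) (G : ℝ × ℝ → F), IsOpen O ∧ Set.Icc a b ×ˢ Set.Icc c e ⊆ O ∧ ContDiffOn ℝ ∞ G O ∧
      Set.EqOn G f (Set.Icc a b ×ˢ Set.Icc c e) := by
  obtain ⟨G, hG, hGf⟩ := exists_extension_strip hab hce hf
  obtain ⟨G', hG', hGf'⟩ := exists_extension_strip hce (show a - 1 < b + 1 by linarith) (f := G ∘ Prod.swap)
    (hG.comp (contDiff_snd.prodMk contDiff_fst).contDiffOn fun p hp => ⟨trivial, hp.1⟩)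
  refine ⟨Set.Ioo (a - 1) (b + 1) ×ˢ Set.univ, G' ∘ Prod.swap, isOpen_Ioo.prod isOpen_univ, ?_, ?_, ?_⟩
  · exact fun p hp => ⟨⟨by linarith [hp.1.1], by linarith [hp.1.2]⟩, trivial⟩
  · exact hG'.comp (contDiff_snd.prodMk contDiff_fst).contDiffOn fun p hp => ⟨trivial, Set.Ioo_subset_Icc_self hp.1⟩
  · intro p hp
    have : p.swap ∈ Set.Icc c e ×ˢ Set.Icc (a - 1) (b + 1) :=
      ⟨hp.2, ⟨by have := hp.1.1; simp only [Prod.snd_swap]; linarith, by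
        have := hp.1.2; simp only [Prod.snd_swap]; linarith⟩⟩
    rw [Function.comp_apply, hGf' this, Function.comp_apply, Prod.swap_swap, hGf hp]

end Borel

/-! ### Functions on the surface with prescribed restrictions to the ends -/

open scoped Manifold in
/-- Smooth local solutions of convex constraints can be glued. -/
theorem exists_glue {F : Type} [NormedAddCommGroup F] [NormedSpace ℝ F] [FiniteDimensional ℝ F] {O : Set ℂ}
    (hO : IsOpen O) {t : ℂ → Set F} (ht : ∀ z, Convex ℝ (t z))
    (hloc : ∀ z ∈ O, ∃ g : ℂ → F, (∀ᶠ y in 𝓝 z, ContDiffAt ℝ ∞ g y) ∧ ∀ᶠ y in 𝓝 z, g y ∈ t y) :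
    ∃ g : ℂ → F, ContDiffOn ℝ ∞ g O ∧ ∀ z ∈ O, g z ∈ t z := by
  classical
  let M : TopologicalSpace.Opens ℂ := ⟨O, hO⟩
  have : LocallyCompactSpace M := hO.locallyCompactSpace
  obtain ⟨g, hg⟩ := exists_contMDiffMap_forall_mem_convex_of_local (M := M) (n := ⊤) 𝓘(ℝ, ℂ) (t := fun z => t z)
    (fun z => ht z) fun z => by
      obtain ⟨g, hg, hgt⟩ := hloc z z.2
      have h2 := continuous_subtype_val.continuousAt.eventually (hg.and hgt)
      refine ⟨{y : M | ContDiffAt ℝ ∞ g y ∧ g y ∈ t y}, h2, fun y : M => g y, fun y hy => ?_, fun y hy => hy.2⟩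
      exact (contMDiffAt_subtype_iff.2 hy.1.contMDiffAt).contMDiffWithinAt
  set G : ℂ → F := fun z => if h : z ∈ O then g ⟨z, h⟩ else 0 with hG
  have hGg : ∀ y : M, G y = g y := fun y => dif_pos y.2
  refine ⟨G, fun z hz => ?_, fun z hz => ?_⟩
  · have h1 : ContMDiffAt 𝓘(ℝ, ℂ) 𝓘(ℝ, F) ∞ (fun y : M => G y) (⟨z, hz⟩ : M) := by
      rw [funext hGg]
      exact g.contMDiff _
    have h2 : ContMDiffAt 𝓘(ℝ, ℂ) 𝓘(ℝ, F) ∞ G z := contMDiffAt_subtype_iff.1 h1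
    exact (contMDiffAt_iff_contDiffAt.1 h2).contDiffWithinAt
  · rw [hGg ⟨z, hz⟩]
    exact hg ⟨z, hz⟩

/-- A map of a half strip which converges at infinity is closed away from the limit. -/
theorem eventually_notMem_image {e : ℝ × ℝ → ℂ} {H : Set ℝ} {l : Filter ℝ} {ζ z : ℂ} (hz : z ≠ ζ)
    (he : ContinuousOn e (H ×ˢ Set.Icc 0 1))
    (hlim : TendstoUniformlyOn (fun s t => e (s, t)) (fun _ => ζ) l (Set.Icc 0 1))
    (hl : ∀ u ∈ l, ∃ K, IsCompact K ∧ H \ u ⊆ K) {C : Set (ℝ × ℝ)} (hC : IsClosed C)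
    (hCH : C ⊆ H ×ˢ Set.Icc 0 1) (hzC : ∀ p ∈ C, e p ≠ z) : ∀ᶠ y in 𝓝 z, ∀ p ∈ C, e p ≠ y := by
  have hr : 0 < dist z ζ / 2 := half_pos (dist_pos.2 hz)
  obtain ⟨K, hK, hKu⟩ := hl _ (Metric.tendstoUniformlyOn_iff.1 hlim _ hr)
  have hcomp : IsCompact (C ∩ (K ×ˢ Set.Icc 0 1)) := (hK.prod isCompact_Icc).inter_left hC
  have hcl := (hcomp.image_of_continuousOn (he.mono (Set.inter_subset_left.trans hCH))).isClosed
  have hz' : z ∉ e '' (C ∩ (K ×ˢ Set.Icc 0 1)) := fun ⟨p, hp, h⟩ => hzC p hp.1 h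
  filter_upwards [hcl.isOpen_compl.mem_nhds hz', Metric.ball_mem_nhds z hr] with y hy hy' p hp h
  -- The part of C over K has compact image, which misses a neighbourhood of z. The rest is mapped
  -- closer to ζ than half the distance from z.
  by_cases hpK : p.1 ∈ K
  · exact hy ⟨p, ⟨hp, hpK, (hCH hp).2⟩, h⟩
  · have h1 : ∀ t ∈ Set.Icc (0 : ℝ) 1, dist ζ (e (p.1, t)) < dist z ζ / 2 := by
      by_contra h2
      exact hpK (hKu ⟨(hCH hp).1, h2⟩)
    have h2 := h1 p.2 (hCH hp).2
    rw [Prod.mk.eta, h] at h2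
    have := dist_triangle z y ζ
    rw [Metric.mem_ball, dist_comm] at hy'
    rw [dist_comm ζ y] at h2
    linarith

/-- Local extension of a function given on the image of an immersion of a domain with corners. -/
theorem exists_local_extension {F : Type} [NormedAddCommGroup F] [NormedSpace ℝ F] [CompleteSpace F]
    {e : ℝ × ℝ → ℂ} {φ : ℝ × ℝ → F} {D : Set (ℝ × ℝ)} (he : ContDiffOn ℝ ∞ e D) (hφ : ContDiffOn ℝ ∞ φ D)
    {p : ℝ × ℝ} (hJ : OrientedImmersionAt e D p) {a b c d : ℝ} (hab : a < b) (hcd : c < d)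
    (hBD : Set.Icc a b ×ˢ Set.Icc c d ⊆ D) (hp : p ∈ Set.Icc a b ×ˢ Set.Icc c d)
    (hB : Set.Icc a b ×ˢ Set.Icc c d ∈ 𝓝[D] p) :
    ∃ g : ℂ → F, (∀ᶠ z in 𝓝 (e p), ContDiffAt ℝ ∞ g z) ∧ ∀ᶠ q in 𝓝 p, q ∈ D → g (e q) = φ q := by
  -- Both the immersion and the function are extended across the edges of the box, so that the
  -- extended immersion can be inverted on an open set.
  obtain ⟨O, E, hO, hBO, hE, hEe⟩ := exists_extension_box hab hcd (he.mono hBD)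
  obtain ⟨O', ψ, hO', hBO', hψ, hψφ⟩ := exists_extension_box hab hcd (hφ.mono hBD)
  have hu : UniqueDiffOn ℝ (Set.Icc a b ×ˢ Set.Icc c d) := (uniqueDiffOn_Icc hab).prod (uniqueDiffOn_Icc hcd)
  have hd : fderiv ℝ E p = fderivWithin ℝ e D p := by
    have h1 : HasFDerivWithinAt e (fderivWithin ℝ e D p) (Set.Icc a b ×ˢ Set.Icc c d) p :=
      ((he.differentiableOn (by simp) p (hBD hp)).hasFDerivWithinAt).mono hBD
    have h2 := ((hE.differentiableOn (by simp)).differentiableAt (hO.mem_nhds (hBO hp))).hasFDerivAt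
    exact UniqueDiffWithinAt.eq (hu p hp) (h2.hasFDerivWithinAt) (h1.congr hEe (hEe hp))
  obtain ⟨U, g, hU, hpU, hg, hgp, -, hinv⟩ := exists_smooth_inverse hO hE (hBO hp) (by rw [hd]; exact hJ)
  rw [hEe hp] at hpU hgp
  refine ⟨ψ ∘ g, ?_, ?_⟩
  · have h1 : ∀ᶠ z in 𝓝 (e p), g z ∈ O' := (hg.contDiffAt (hU.mem_nhds hpU)).continuousAt.eventually
      (by rw [hgp]; exact hO'.mem_nhds (hBO' hp))
    filter_upwards [h1, hU.mem_nhds hpU] with z hz hzU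
    exact ContDiffAt.comp (g := ψ) z (hψ.contDiffAt (hO'.mem_nhds hz)) (hg.contDiffAt (hU.mem_nhds hzU))
  filter_upwards [hinv, mem_nhdsWithin_iff_eventually.1 hB] with q hq hqB hqD
  rw [Function.comp_apply, ← hEe (hqB hqD), hq, hψφ (hqB hqD)]

namespace PuncturedDisc

variable {d : ℕ} (S : PuncturedDisc d)

theorem strip_eventually (j : Fin (d + 1)) {z : ℂ} (hz : z ≠ bpt (S.α j)) {C : Set (ℝ × ℝ)} (hC : IsClosed C)
    (hzC : ∀ p ∈ C, p ∈ stripDom j → S.ε j p ≠ z) : ∀ᶠ y in 𝓝 z, ∀ p ∈ C, p ∈ stripDom j → S.ε j p ≠ y := by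
  have hcl : IsClosed (halfLine j) := by
    unfold halfLine; split_ifs
    · exact isClosed_Iic
    · exact isClosed_Ici
  have := eventually_notMem_image hz (S.ε_smooth j).continuousOn (S.ε_lim j) (fun u hu => ?_)
    (hC.inter (hcl.prod isClosed_Icc)) Set.inter_subset_right fun p hp => hzC p hp.1 hp.2
  · filter_upwards [this] with y hy p hp hp'
    exact hy p ⟨hp, hp'⟩
  · unfold endFilter at hu
    unfold halfLine
    split_ifs at hu ⊢
    · obtain ⟨b, hb⟩ := Filter.mem_atBot_sets.1 hu
      exact ⟨Set.Icc b 0, isCompact_Icc, fun s hs => ⟨(not_le.1 fun h => hs.2 (hb s h)).le, hs.1⟩⟩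
    · obtain ⟨b, hb⟩ := Filter.mem_atTop_sets.1 hu
      exact ⟨Set.Icc 0 b, isCompact_Icc, fun s hs => ⟨hs.1, (not_le.1 fun h => hs.2 (hb s h)).le⟩⟩

/-- As C is invariant under integer translations, it is enough to consider one period, which is a
half strip. -/
theorem cyl_eventually {z : ℂ} (hz : z ≠ S.ζint) {C : Set (ℝ × ℝ)} (hC : IsClosed C)
    (hper : ∀ p ∈ C, ∀ n : ℤ, (p.1, p.2 + n) ∈ C)
    (hzC : ∀ p ∈ C, p ∈ cylDom → S.εint p ≠ z) : ∀ᶠ y in 𝓝 z, ∀ p ∈ C, p ∈ cylDom → S.εint p ≠ y := by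
  have hsub : (Set.Ici (0 : ℝ)) ×ˢ Set.Icc (0 : ℝ) 1 ⊆ cylDom := Set.prod_mono le_rfl (Set.subset_univ _)
  have := eventually_notMem_image hz (S.εint_smooth.continuousOn.mono hsub) (S.εint_lim.mono (Set.subset_univ _))
    (fun u hu => ?_) (hC.inter (isClosed_Ici.prod isClosed_Icc)) Set.inter_subset_right
    fun p hp => hzC p hp.1 (hsub hp.2)
  · filter_upwards [this] with y hy p hp hp'
    have h1 := hy (p.1, p.2 + ((-⌊p.2⌋ : ℤ) : ℝ)) ⟨hper p hp _, hp'.1, by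
      push_cast; exact ⟨by linarith [Int.floor_le p.2], by linarith [Int.lt_floor_add_one p.2]⟩⟩
    rwa [(S.εint_inj p hp' (p.1, p.2 + ((-⌊p.2⌋ : ℤ) : ℝ)) ⟨hp'.1, trivial⟩).2 ⟨rfl, _, rfl⟩]
  · obtain ⟨b, hb⟩ := Filter.mem_atTop_sets.1 hu
    exact ⟨Set.Icc 0 b, isCompact_Icc, fun s hs => ⟨hs.1, (not_le.1 fun h => hs.2 (hb s h)).le⟩⟩

variable {F : Type} [NormedAddCommGroup F] [NormedSpace ℝ F] [FiniteDimensional ℝ F]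

theorem isOpen_plane_diff : IsOpen {z : ℂ | z ≠ S.ζint ∧ ∀ j, z ≠ bpt (S.α j)} := by
  simp only [Set.ofPred_and, Set.ofPred_forall]
  exact isOpen_ne.inter (isOpen_iInter_of_finite fun j => isOpen_ne)

/-- Functions on the ends extend to the surface. -/
theorem exists_extension {φ : Fin (d + 1) → ℝ × ℝ → F} (hφ : ∀ j, ContDiffOn ℝ ∞ (φ j) (stripDom j))
    {φint : ℝ × ℝ → F} (hφint : ContDiffOn ℝ ∞ φint cylDom)
    (hper : ∀ p ∈ cylDom, ∀ n : ℤ, φint (p.1, p.2 + n) = φint p) :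
    ∃ Φ : ℂ → F, ContDiffOn ℝ ∞ Φ S.carrier ∧ (∀ j, ∀ p ∈ stripDom j, Φ (S.ε j p) = φ j p) ∧
      ∀ p ∈ cylDom, Φ (S.εint p) = φint p := by
  have : CompleteSpace F := FiniteDimensional.complete ℝ F
  have hsubΩ : S.carrier ⊆ {z : ℂ | z ≠ S.ζint ∧ ∀ j, z ≠ bpt (S.α j)} := fun z hz => hz.2
  -- Prescribing the value at a point is an affine condition, and no condition at all outside the
  -- ends. By convexity it suffices to satisfy the conditions locally.
  suffices h : ∃ Φ : ℂ → F, ContDiffOn ℝ ∞ Φ {z : ℂ | z ≠ S.ζint ∧ ∀ j, z ≠ bpt (S.α j)} ∧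
      ∀ z ∈ {z : ℂ | z ≠ S.ζint ∧ ∀ j, z ≠ bpt (S.α j)}, Φ z ∈ {y : F |
        (∀ j, ∀ p ∈ stripDom j, S.ε j p = z → y = φ j p) ∧ ∀ p ∈ cylDom, S.εint p = z → y = φint p} by
    obtain ⟨Φ, hΦ, hΦt⟩ := h
    refine ⟨Φ, hΦ.mono hsubΩ, fun j p hp => ?_, fun p hp => ?_⟩
    · exact (hΦt _ (hsubΩ (S.ε_mem j p hp))).1 j p hp rfl
    · exact (hΦt _ (hsubΩ (S.εint_mem p hp))).2 p hp rfl
  refine exists_glue (t := fun z => {y : F | (∀ j, ∀ p ∈ stripDom j, S.ε j p = z → y = φ j p) ∧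
    ∀ p ∈ cylDom, S.εint p = z → y = φint p}) S.isOpen_plane_diff (fun z => ?_) (fun z hz => ?_)
  · rintro x ⟨hx, hx'⟩ y ⟨hy, hy'⟩ a b ha hb hab
    refine ⟨fun j p hp h => ?_, fun p hp h => ?_⟩
    · rw [hx j p hp h, hy j p hp h, ← add_smul, hab, one_smul]
    · rw [hx' p hp h, hy' p hp h, ← add_smul, hab, one_smul]
  · have hstrip : ∀ j, (∀ p ∈ stripDom j, S.ε j p ≠ z) → ∀ᶠ y in 𝓝 z, ∀ p ∈ stripDom j, S.ε j p ≠ y := fun j h => by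
      filter_upwards [S.strip_eventually j (hz.2 j) isClosed_univ fun p _ => h p] with y hy p hp
      exact hy p trivial hp
    have hcyl : (∀ p ∈ cylDom, S.εint p ≠ z) → ∀ᶠ y in 𝓝 z, ∀ p ∈ cylDom, S.εint p ≠ y := fun h => by
      filter_upwards [S.cyl_eventually hz.1 isClosed_univ (fun _ _ _ => trivial) fun p _ => h p] with y hy p hp
      exact hy p trivial hp
    by_cases h1 : ∃ j, ∃ p ∈ stripDom j, S.ε j p = z
    · obtain ⟨j, p, hp, rfl⟩ := h1
      have hothers : ∀ k, k ≠ j → ∀ᶠ y in 𝓝 (S.ε j p), ∀ q ∈ stripDom k, S.ε k q ≠ y := fun k hk =>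
        hstrip k fun q hq h => (S.disjoint_strips k j hk).le_bot ⟨⟨q, hq, h⟩, ⟨p, hp, rfl⟩⟩
      have hother : ∀ᶠ y in 𝓝 (S.ε j p), ∀ q ∈ cylDom, S.εint q ≠ y :=
        hcyl fun q hq h => (S.disjoint_int j).le_bot ⟨⟨p, hp, rfl⟩, ⟨q, hq, h⟩⟩
      have hbox : ∃ a b : ℝ, a < b ∧ Set.Icc a b ⊆ halfLine j ∧ p.1 ∈ Set.Icc a b ∧
          ∀ᶠ s in 𝓝 p.1, s ∈ halfLine j → s ∈ Set.Icc a b := by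
        have hp1 := hp.1
        unfold halfLine at hp1 ⊢
        split_ifs at hp1 ⊢ with h0
        · refine ⟨p.1 - 1, 0, by linarith [Set.mem_Iic.1 hp1], Set.Icc_subset_Iic_self, ⟨by linarith, hp1⟩, ?_⟩
          filter_upwards [lt_mem_nhds (show p.1 - 1 < p.1 by linarith)] with s hs hs'
          exact ⟨hs.le, hs'⟩
        · refine ⟨0, p.1 + 1, by linarith [Set.mem_Ici.1 hp1], Set.Icc_subset_Ici_self, ⟨hp1, by linarith⟩, ?_⟩
          filter_upwards [gt_mem_nhds (show p.1 < p.1 + 1 by linarith)] with s hs hs'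
          exact ⟨hs', hs.le⟩
      obtain ⟨a, b, hab, habH, hpab, hnear⟩ := hbox
      obtain ⟨g, hg, hgφ⟩ := exists_local_extension (S.ε_smooth j) (hφ j) (S.ε_oriented j p hp) hab zero_lt_one
        (Set.prod_mono habH le_rfl) ⟨hpab, hp.2⟩ (by
          rw [mem_nhdsWithin_iff_eventually]
          filter_upwards [continuous_fst.continuousAt.eventually hnear] with q hq hqD
          exact ⟨hq hqD.1, hqD.2⟩)
      obtain ⟨V, hV, hVo, hpV⟩ := eventually_nhds_iff.1 hgφ
      refine ⟨g, hg, ?_⟩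
      -- Because the end is injective and closed away from its puncture, nearby points of its image
      -- come from parameters close to p, where g has the right values.
      have hown := S.strip_eventually j (hz.2 j) hVo.isClosed_compl fun q hq hqD h =>
        hq (by rw [S.ε_inj j hqD hp h]; exact hpV)
      filter_upwards [Filter.eventually_all.2 fun k => Filter.eventually_imp_distrib_left.2 (hothers k), hother, hown]
        with y hy1 hy2 hy3
      refine ⟨fun k q hq h => ?_, fun q hq h => absurd h (hy2 q hq)⟩
      by_cases hk : k = j
      · subst hk
        have hqV : q ∈ V := by by_contra hqV; exact hy3 q hqV hq h
        rw [← h]; exact hV q hqV hq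
      · exact absurd h (hy1 k hk q hq)
    · push Not at h1
      by_cases h2 : ∃ p ∈ cylDom, S.εint p = z
      · obtain ⟨p, hp, rfl⟩ := h2
        obtain ⟨g, hg, hgφ⟩ := exists_local_extension S.εint_smooth hφint (S.εint_oriented p hp)
          (a := 0) (b := p.1 + 1) (c := p.2 - 1) (d := p.2 + 1) (by linarith [Set.mem_Ici.1 hp.1]) (by linarith)
          (Set.prod_mono Set.Icc_subset_Ici_self (Set.subset_univ _))
          ⟨⟨hp.1, by linarith⟩, ⟨by linarith, by linarith⟩⟩ (by
            rw [mem_nhdsWithin_iff_eventually]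
            filter_upwards [continuous_fst.continuousAt.eventually (gt_mem_nhds (show p.1 < p.1 + 1 by linarith)),
              continuous_snd.continuousAt.eventually (gt_mem_nhds (show p.2 < p.2 + 1 by linarith)),
              continuous_snd.continuousAt.eventually (lt_mem_nhds (show p.2 - 1 < p.2 by linarith))] with q h1 h2 h3 hq
            exact ⟨⟨hq.1, h1.le⟩, h3.le, h2.le⟩)
        obtain ⟨V, hV, hVo, hpV⟩ := eventually_nhds_iff.1 hgφ
        refine ⟨g, hg, ?_⟩
        have hopen : IsOpen {q : ℝ × ℝ | ∃ n : ℤ, (q.1, q.2 + n) ∈ V} := by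
          rw [Set.ofPred_exists]
          exact isOpen_iUnion fun n => hVo.preimage (by fun_prop)
        have hown := S.cyl_eventually hz.1 hopen.isClosed_compl (fun q hq n ⟨m, hm⟩ => hq ⟨n + m, by
            push_cast; rwa [← add_assoc]⟩) fun q hq hqD h => hq (by
            obtain ⟨h3, n, hn⟩ := (S.εint_inj q hqD p hp).1 h
            exact ⟨n, by rw [h3, ← hn]; exact hpV⟩)
        filter_upwards [Filter.eventually_all.2 fun j => hstrip j (h1 j), hown] with y hy1 hy2
        refine ⟨fun k q hq h => absurd h (hy1 k q hq), fun q hq h => ?_⟩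
        by_contra hne
        refine hy2 q (fun ⟨n, hn⟩ => hne ?_) hq h
        have hq' : (q.1, q.2 + (n : ℝ)) ∈ cylDom := ⟨hq.1, trivial⟩
        have := hV _ hn hq'
        rwa [hper q hq n, ← (S.εint_inj q hq _ hq').2 ⟨rfl, n, rfl⟩, h] at this
      · push Not at h2
        refine ⟨0, .of_forall fun _ => contDiffAt_const, ?_⟩
        filter_upwards [Filter.eventually_all.2 fun j => hstrip j (h1 j), hcyl h2] with y hy1 hy2
        exact ⟨fun k q hq h => absurd h (hy1 k q hq), fun q hq h => absurd h (hy2 q hq)⟩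

end PuncturedDisc

/-! ### Normal forms of the data on the ends -/

theorem IsTransport.congr {a a' : ℝ → Lie} {g : Mat} {g' : ℝ → ℝ} (h : IsTransport a g g')
    (ha : ∀ t ∈ Set.Icc (0 : ℝ) 1, a t = a' t) : IsTransport a' g g' := by
  obtain ⟨Φ, ψ, hΦ, hψ, h1, h2⟩ := h
  exact ⟨Φ, ψ, ⟨hΦ.1, fun t ht => ha t ht ▸ hΦ.2 t ht⟩, hψ, h1, h2⟩

/-- A development of an interval datum. -/
structure IntervalFrame (B : IntervalDatum) where
  D : ℝ → Cov
  m : ℝ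
  smooth : ContDiffOn ℝ ∞ D (Set.Icc 0 1)
  dev : IsDev (lineForm B.a) (Set.Icc 0 1) D
  D_zero : D 0 = gone
  act_m : act (D 1) m = B.l1
  lt : B.l0 - m ∈ Set.Ioo 0 (2 * Real.pi)

theorem Icc_subset_closure_interior : Set.Icc (0 : ℝ) 1 ⊆ closure (interior (Set.Icc (0 : ℝ) 1)) := by
  rw [interior_Icc, closure_Ioo zero_ne_one]

theorem nonempty_intervalFrame (B : IntervalDatum) : Nonempty (IntervalFrame B) := by
  obtain ⟨D, hs, hD, h0⟩ := exists_line_dev (convex_Icc (0 : ℝ) 1) Icc_subset_closure_interior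
    (uniqueDiffOn_Icc zero_lt_one) B.smooth (b := 0) ⟨le_rfl, zero_le_one⟩ gone
  obtain ⟨g, g', hT, m, hm, hl⟩ := B.position
  obtain ⟨-, rfl⟩ := hT.eq_of_dev B.smooth.continuousOn hD h0
  exact ⟨⟨D, m, hs, hD, h0, hm, hl⟩⟩

theorem det_matOf (M : Cov) : (matOf M).det = 1 := by
  have h := congrArg Complex.im (conj_colOne_mul_colI M)
  simp only [Complex.mul_im, Complex.conj_re, Complex.conj_im, Complex.add_im, Complex.ofReal_im,
    Complex.I_im, zero_add] at h
  rw [matOf, Matrix.det_fin_two_of]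
  linarith

theorem exists_cdir (Z : ℂ) : ∃ θ : ℝ, Z = (‖Z‖ : ℝ) * cdir θ := by
  refine ⟨2 * Z.arg, ?_⟩
  rw [cdir, mul_div_cancel_left₀ _ two_ne_zero]
  exact (Complex.norm_mul_exp_arg_mul_I Z).symm

theorem mv_ofReal_mul (D : Cov) (r : ℝ) (Z : ℂ) : mv D ((r : ℂ) * Z) = r * mv D Z := mv_smul D r Z

theorem mulVec_dir_iff {M : Cov} {θ μ : ℝ} :
    (matOf M).mulVec (dir θ) = μ • dir θ ↔ mv M (cdir θ) = μ * cdir θ := by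
  rw [dir_eq, matOf_mulVec, ← vec_smul, vec_injective.eq_iff]

theorem exists_eigenangle {M : Cov} {μ : ℝ} (hμ : μ ^ 2 - (matOf M).trace * μ + 1 = 0) :
    ∃ θ, mv M (cdir θ) = μ * cdir θ := by
  have hdet : (matOf M - μ • (1 : Mat)).det = 0 := by
    have h1 := det_matOf M
    rw [Matrix.det_fin_two] at h1
    rw [Matrix.trace_fin_two] at hμ
    rw [Matrix.det_fin_two]
    simp only [Matrix.sub_apply, Matrix.smul_apply, Matrix.one_apply_eq, smul_eq_mul, mul_one,
      Matrix.one_apply_ne (show (0 : Fin 2) ≠ 1 by decide), Matrix.one_apply_ne (show (1 : Fin 2) ≠ 0 by decide),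
      mul_zero, sub_zero]
    linarith
  obtain ⟨v, hv, hv0⟩ := Matrix.exists_mulVec_eq_zero_iff.2 hdet
  have hvec : v = vec ⟨v 1, v 0⟩ := by
    funext i; fin_cases i <;> rfl
  have hZ : (⟨v 1, v 0⟩ : ℂ) ≠ 0 := fun h => hv (by
    rw [hvec, h]; funext i; fin_cases i <;> rfl)
  obtain ⟨θ, hθ⟩ := exists_cdir ⟨v 1, v 0⟩
  have h2 : mv M ⟨v 1, v 0⟩ = μ * ⟨v 1, v 0⟩ := by
    rw [Matrix.sub_mulVec, sub_eq_zero, Matrix.smul_mulVec, Matrix.one_mulVec, hvec, matOf_mulVec,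
      ← vec_smul] at hv0
    exact vec_injective hv0
  refine ⟨θ, ?_⟩
  rw [hθ, mv_ofReal_mul] at h2
  have h3 : ((‖(⟨v 1, v 0⟩ : ℂ)‖ : ℝ) : ℂ) ≠ 0 := by exact_mod_cast norm_ne_zero_iff.2 hZ
  refine mul_left_cancel₀ h3 (h2.trans ?_)
  ring

theorem exists_big_root {t : ℝ} (ht : 2 < |t|) : ∃ μ : ℝ, 1 < |μ| ∧ μ ^ 2 - t * μ + 1 = 0 := by
  have h4 : 0 ≤ t ^ 2 - 4 := by nlinarith [sq_abs t]
  have hs := Real.sq_sqrt h4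
  have hs0 := Real.sqrt_nonneg (t ^ 2 - 4)
  rcases le_total 0 t with h | h
  · rw [abs_of_nonneg h] at ht
    exact ⟨(t + Real.sqrt (t ^ 2 - 4)) / 2, lt_of_lt_of_le (by linarith) (le_abs_self _), by nlinarith⟩
  · rw [abs_of_nonpos h] at ht
    exact ⟨(t - Real.sqrt (t ^ 2 - 4)) / 2, lt_of_lt_of_le (by linarith) (neg_le_abs _), by nlinarith⟩

/-- A point moved by exactly n full turns is moved by kn turns under the k-th iterate, so the limit
defining the rotation number is n. -/
theorem HasRotationNumber.eq_int {g' : ℝ → ℝ} (h : HasRotationNumber g' 1) {θ : ℝ} {n : ℤ}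
    (hg : ∀ k : ℤ, g' (θ + k * (2 * Real.pi)) = θ + (k + n : ℤ) * (2 * Real.pi)) : n = 1 := by
  have hit : ∀ k : ℕ, g'^[k] θ = θ + (k * n : ℤ) * (2 * Real.pi) := fun k => by
    induction k with
    | zero => simp
    | succ k ih =>
      rw [Function.iterate_succ_apply', ih, hg]
      push_cast; ring
  have hlim : Filter.Tendsto (fun k : ℕ => (g'^[k] θ - θ) / (2 * Real.pi * k)) Filter.atTop (𝓝 (n : ℝ)) := by
    refine tendsto_const_nhds.congr' ?_
    filter_upwards [Filter.eventually_gt_atTop 0] with k hk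
    have hk' : (k : ℝ) ≠ 0 := by exact_mod_cast hk.ne'
    rw [hit]
    push_cast
    field_simp
    ring
  exact_mod_cast tendsto_nhds_unique hlim (h θ)

theorem exists_int_Ioc (b θ : ℝ) : ∃ n : ℤ, b < θ + n * (2 * Real.pi) ∧ θ + n * (2 * Real.pi) ≤ b + 2 * Real.pi := by
  obtain ⟨n, hn, -⟩ := existsUnique_add_zsmul_mem_Ioc Real.two_pi_pos θ b
  exact ⟨n, by simpa [zsmul_eq_mul] using hn.1, by simpa [zsmul_eq_mul] using hn.2⟩

/-- Normal form of a hyperbolic element of rotation number one. -/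
theorem exists_diagonalization {M : Cov} (htr : 2 < |(matOf M).trace|) (hrot : HasRotationNumber (act M) 1) :
    ∃ (P : Cov) (κ : ℝ), 0 < κ ∧ gmul M P = P + gdiag κ 1 := by
  obtain ⟨μ, hμ1, hμ⟩ := exists_big_root htr
  have hμ0 : μ ≠ 0 := fun h => by rw [h, abs_zero] at hμ1; linarith
  obtain ⟨b, hb⟩ := exists_eigenangle hμ
  obtain ⟨s₀, hs₀⟩ := exists_eigenangle (M := M) (μ := μ⁻¹) (by field_simp; linarith)
  -- The small eigenangle is moved into the turn following b. It cannot be b + 2π, since the two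
  -- eigenvalues are different.
  obtain ⟨k, hk1, hk2⟩ := exists_int_Ioc b s₀
  set s := s₀ + k * (2 * Real.pi) with hs
  have hsM : mv M (cdir s) = (μ⁻¹ : ℝ) * cdir s := by
    rw [hs, cdir_add_int]
    have : ((-1 : ℂ) ^ k) = (((-1 : ℝ) ^ k : ℝ) : ℂ) := by push_cast; rfl
    rw [this, mv_ofReal_mul, hs₀]; ring
  have hne : s ≠ b + 2 * Real.pi := fun h => by
    have h1 := cdir_add_int b 1
    rw [Int.cast_one, one_mul, ← h, zpow_one, neg_one_mul] at h1
    have h2 : mv M (cdir s) = μ * cdir s := by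
      have := mv_ofReal_mul M (-1) (cdir b)
      push_cast at this
      rw [h1, ← neg_one_mul, this, hb]; ring
    rw [h2] at hsM
    have h3 := Complex.ofReal_injective (mul_right_cancel₀ (cdir_ne_zero s) hsM)
    rw [h3, abs_inv] at hμ1
    have h4 : |μ| ≤ 1 := by
      by_contra h5
      exact absurd hμ1 (not_lt.2 (inv_le_one_of_one_le₀ (not_le.1 h5).le))
    rw [h3, abs_inv] at h4
    linarith
  have hs2 : s < b + 2 * Real.pi := lt_of_le_of_ne hk2 hne
  obtain ⟨n, hn⟩ := exists_act_eq hb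
  obtain ⟨n', hn'⟩ := exists_act_eq hsM
  have hn1 : n = 1 := hrot.eq_int (θ := b) fun k => by
    rw [act_add_int, hn]; push_cast; ring
  have hn1' : n' = 1 := hrot.eq_int (θ := s) fun k => by
    rw [act_add_int, hn']; push_cast; ring
  rw [hn1, Int.cast_one, one_mul] at hn
  rw [hn1', Int.cast_one, one_mul] at hn'
  set P := gpair s b with hP
  have hP0 : act P 0 = b := act_gpair_zero s b
  have hPpi : act P Real.pi = s := act_gpair_pi (by linarith) (by linarith)
  -- Both eigenangles advance by exactly one turn. Conjugating them to 0 and π and removing that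
  -- turn leaves an element fixing 0 and π, which must be diagonal.
  set g₂ := gmul (gmul (ginv P) (gmul M P)) (gdiag 0 (-1)) with hg₂
  have hneg : ∀ x : ℝ, act (gmul (ginv P) (gmul M P)) (x + (-1 : ℤ) * (2 * Real.pi)) =
      act (gmul (ginv P) (gmul M P)) x - 2 * Real.pi := fun x => by
    rw [act_add_int]; push_cast; ring
  have hinv : ∀ x : ℝ, act (ginv P) (act P x + 2 * Real.pi) = x + 2 * Real.pi := fun x => by
    have := act_add_int (ginv P) (act P x) 1
    rw [Int.cast_one, one_mul] at this
    rw [this, act_ginv_act]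
  have h0 : act g₂ 0 = 0 := by
    rw [hg₂, act_gmul, act_gdiag_zero, ← zero_add (((-1 : ℤ) : ℝ) * _), hneg, act_gmul, act_gmul, hP0, hn, ← hP0, hinv]
    ring
  have hpi : act g₂ Real.pi = Real.pi := by
    have h1 : act (gdiag 0 (-1)) Real.pi = Real.pi + (-1 : ℤ) * (2 * Real.pi) := by
      have := act_gdiag_xof 0 (-1) 0 0
      simp only [xof, Real.arctan_zero, mul_zero, Int.cast_zero, zero_mul, zero_add, sub_zero] at this
      rw [this]; ring
    rw [hg₂, act_gmul, h1, hneg, act_gmul, act_gmul, hPpi, hn', ← hPpi, hinv]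
    ring
  have hg := eq_gdiag_of_act h0 hpi
  set κ := g₂.1.re with hκ
  have hgg : gmul (ginv P) (gmul M P) = gdiag κ 1 := by
    have h1 : gmul g₂ (gdiag 0 1) = gdiag κ 1 := by
      rw [hg, gmul_gdiag]; simp [gdiag]
    have h2 : gmul (gdiag 0 (-1)) (gdiag 0 1) = gone := by
      rw [gmul_gdiag]; simp [gdiag, gone]
    rw [← h1, hg₂, gmul_assoc, h2, gmul_gone]
  have hMP : gmul M P = gmul P (gdiag κ 1) := by
    rw [← hgg, ← gmul_assoc, gmul_ginv, gone_gmul]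
  refine ⟨P, κ, ?_, by rw [hMP, gmul_gdiag]⟩
  -- The sign of κ: the angle 0 corresponds to the big eigenline, where the eigenvalue is -e^κ.
  obtain ⟨r, hr, hrb⟩ := mv_cdir P 0
  rw [hP0] at hrb
  have h1 : mv M (mv P (cdir 0)) = mv P (mv (gdiag κ 1) (cdir 0)) := by rw [← mv_gmul, hMP, mv_gmul]
  have hc0 : cdir 0 = 1 := by simp [cdir]
  have h2 : mv (gdiag κ 1) (cdir 0) = ((-Real.exp κ : ℝ) : ℂ) * cdir 0 := by
    rw [hc0, mv_gdiag]; push_cast; simp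
  rw [h2, mv_ofReal_mul, hrb, mv_ofReal_mul, hb] at h1
  have h3 : μ = -Real.exp κ := by
    have h4 : ((r : ℂ) * cdir b) ≠ 0 := mul_ne_zero (by exact_mod_cast hr.ne') (cdir_ne_zero b)
    have h5 : (μ : ℂ) = ((-Real.exp κ : ℝ) : ℂ) := mul_right_cancel₀ h4 (by rw [← h1]; ring)
    exact_mod_cast h5
  rw [h3, abs_neg, abs_of_pos (Real.exp_pos κ)] at hμ1
  exact Real.one_lt_exp_iff.1 hμ1

/-- A development of a circle datum, which diagonalizes the holonomy. -/
structure CircleFrame {τ : ℝ} (C : CircleDatum τ) where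
  κ : ℝ
  κ_pos : 0 < κ
  D : ℝ → Cov
  smooth : ContDiff ℝ ∞ D
  dev : IsDev (lineForm C.a) Set.univ D
  D_add_one : ∀ t, D (t + 1) = D t + gdiag κ 1

variable {τ : ℝ} {C : CircleDatum τ}

/-- The development starting at the identity satisfies D(t + 1) = D(t)D(1), by periodicity of the
form. Right multiplication by the diagonalising element turns the factor D(1) into a translation. -/
theorem nonempty_circleFrame (hτ : 2 < τ) (C : CircleDatum τ) : Nonempty (CircleFrame C) := by
  obtain ⟨D, hs, hD, h0⟩ := exists_line_dev convex_univ (by simp) uniqueDiffOn_univ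
    C.smooth.contDiffOn (b := 0) trivial gone
  obtain ⟨g, g', hT, htr, hrot⟩ := C.holonomy
  obtain ⟨rfl, rfl⟩ := hT.eq_of_dev C.smooth.continuous.continuousOn (hD.mono (Set.subset_univ _)) h0
  obtain ⟨P, κ, hκ, hP⟩ := exists_diagonalization (by rw [htr]; exact hτ) hrot
  have hshift : ∀ t, D (t + 1) = gmul (D t) (D 1) := fun t => by
    have h1 : IsDev (lineForm C.a) Set.univ fun t => D (t + 1) :=
      (hD.comp (c := fun t => t + 1) (c' := fun _ => ContinuousLinearMap.id ℝ ℝ)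
        (fun t _ => ((hasFDerivAt_id t).add_const 1).hasFDerivWithinAt) (Set.mapsTo_univ _ _)).congr_form
        fun t _ => by rw [ContinuousLinearMap.comp_id, lineForm, lineForm, C.periodic]
    refine IsDev.eqOn (contDiffOn_lineForm C.smooth.contDiffOn).continuousOn (b := (0 : ℝ))
      (convex_univ.starConvex trivial) h1 (hD.gmul (D 1)) ?_ (Set.mem_univ t)
    rw [h0, gone_gmul, zero_add]
  refine ⟨⟨κ, hκ, fun t => gmul (D t) P, contDiffOn_univ.1 (hs.gmul contDiffOn_const), hD.gmul P, fun t => ?_⟩⟩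
  rw [hshift, gmul_assoc, hP, ← gmul_gdiag P, ← gmul_assoc, gmul_gdiag]

/-! ### Eigenlines and the preimage of (l_big, l_small) in the diagonal frame. -/

namespace CircleFrame

variable (H : CircleFrame C)

/-- The normal form of the holonomy. -/
def h : Cov := gdiag H.κ 1

theorem mv_eigen {κ η μ : ℝ} (h : mv (gdiag κ 1) (cdir η) = μ * cdir η) :
    -Real.exp κ * Real.cos (η / 2) = μ * Real.cos (η / 2) ∧
      -Real.exp (-κ) * Real.sin (η / 2) = μ * Real.sin (η / 2) := by
  have h1 : cdir η = ⟨Real.cos (η / 2), Real.sin (η / 2)⟩ := by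
    apply Complex.ext
    · rw [cdir, Complex.exp_ofReal_mul_I_re]
    · rw [cdir, Complex.exp_ofReal_mul_I_im]
  rw [mv_gdiag, h1] at h
  have hre := congrArg Complex.re h
  have him := congrArg Complex.im h
  rw [zpow_one] at hre him
  simp only [Complex.mul_re, Complex.mul_im, Complex.add_re, Complex.add_im, Complex.neg_re, Complex.neg_im,
    Complex.one_re, Complex.one_im, Complex.ofReal_re, Complex.ofReal_im, Complex.I_re, Complex.I_im] at hre him
  constructor <;> linarith

/-- The holonomy, in the given frame. -/
theorem isTransport : IsTransport C.a (matOf (gmul (gmul (D H 0) H.h) (ginv (D H 0))))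
    (act (gmul (gmul (H.D 0) H.h) (ginv (H.D 0)))) := by
  have h1 := isTransport_of_dev ((H.dev.mono (Set.subset_univ _)).gmul (ginv (H.D 0))) (gmul_ginv _)
  have h2 : H.D 1 = gmul (H.D 0) H.h := by rw [h, gmul_gdiag, ← H.D_add_one, zero_add]
  rwa [h2] at h1

theorem mv_conj_iff (P g : Cov) (η μ : ℝ) : mv (gmul (gmul P g) (ginv P)) (cdir (act P η)) = μ * cdir (act P η) ↔
    mv g (cdir η) = μ * cdir η := by
  obtain ⟨r, hr, hrη⟩ := mv_cdir P η
  have hr0 : (r : ℂ) ≠ 0 := by exact_mod_cast hr.ne'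
  have h1 : (r : ℂ) * mv (gmul (gmul P g) (ginv P)) (cdir (act P η)) = mv P (mv g (cdir η)) := by
    rw [← mv_ofReal_mul, ← hrη, mv_gmul, mv_ginv_mv, mv_gmul]
  have h2 : (r : ℂ) * (μ * cdir (act P η)) = mv P (μ * cdir η) := by
    rw [mv_ofReal_mul, hrη]; ring
  rw [← mul_right_inj' hr0, h1, h2]
  exact ⟨fun h => mv_inj P h, fun h => by rw [h]⟩

/-- In the diagonal frame the eigenlines are spanned by 1 and i, with eigenvalues -e^κ and -e^{-κ}.
An eigenvalue of absolute value above one excludes an imaginary component. -/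
theorem overBig_iff {η : ℝ} : OverBig (matOf (gmul (gmul (H.D 0) H.h) (ginv (H.D 0)))) (act (H.D 0) η) ↔
    ∃ n : ℤ, η = n * (2 * Real.pi) := by
  have hκ := Real.exp_lt_one_iff.2 (show -H.κ < 0 by linarith [H.κ_pos])
  have hκ1 := Real.one_lt_exp_iff.2 H.κ_pos
  constructor
  · rintro ⟨μ, hμ, h⟩
    obtain ⟨-, h2⟩ := mv_eigen ((mv_conj_iff _ _ _ _).1 (mulVec_dir_iff.1 h))
    have h3 : Real.sin (η / 2) = 0 := by
      by_contra h4
      rw [← mul_right_cancel₀ h4 h2, abs_neg, abs_of_pos (Real.exp_pos _)] at hμ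
      linarith
    obtain ⟨n, hn⟩ := Real.sin_eq_zero_iff.1 h3
    exact ⟨n, by linarith⟩
  · rintro ⟨n, rfl⟩
    refine ⟨-Real.exp H.κ, by rw [abs_neg, abs_of_pos (Real.exp_pos _)]; exact hκ1, mulVec_dir_iff.2
      ((mv_conj_iff _ _ _ _).2 ?_)⟩
    have h1 : cdir ((n : ℝ) * (2 * Real.pi)) = (((-1) ^ n : ℝ) : ℂ) := by
      have := cdir_add_int 0 n
      rw [zero_add] at this
      rw [this, cdir]; simp
    rw [h1, h, mv_gdiag, zpow_one, Complex.ofReal_re, Complex.ofReal_im]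
    push_cast; ring

theorem overSmall_iff {η : ℝ} : OverSmall (matOf (gmul (gmul (H.D 0) H.h) (ginv (H.D 0)))) (act (H.D 0) η) ↔
    ∃ n : ℤ, η = n * (2 * Real.pi) + Real.pi := by
  have hκ := Real.exp_lt_one_iff.2 (show -H.κ < 0 by linarith [H.κ_pos])
  have hκ1 := Real.one_lt_exp_iff.2 H.κ_pos
  constructor
  · rintro ⟨μ, hμ, h⟩
    obtain ⟨h2, -⟩ := mv_eigen ((mv_conj_iff _ _ _ _).1 (mulVec_dir_iff.1 h))
    have h3 : Real.cos (η / 2) = 0 := by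
      by_contra h4
      rw [← mul_right_cancel₀ h4 h2, abs_neg, abs_of_pos (Real.exp_pos _)] at hμ
      linarith
    obtain ⟨n, hn⟩ := Real.cos_eq_zero_iff.1 h3
    exact ⟨n, by linarith⟩
  · rintro ⟨n, rfl⟩
    refine ⟨-Real.exp (-H.κ), by rw [abs_neg, abs_of_pos (Real.exp_pos _)]; exact hκ, mulVec_dir_iff.2
      ((mv_conj_iff _ _ _ _).2 ?_)⟩
    have h1 : cdir ((n : ℝ) * (2 * Real.pi) + Real.pi) = (((-1) ^ n : ℝ) : ℂ) * Complex.I := by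
      have := cdir_add_int Real.pi n
      rw [add_comm] at this
      rw [this, cdir]; push_cast; rw [Complex.exp_pi_div_two_mul_I]
    rw [h1, h, mv_gdiag, zpow_one, Complex.re_ofReal_mul, Complex.im_ofReal_mul, Complex.I_re, Complex.I_im]
    push_cast; ring

/-- The preimage of `(l_big, l_small)`, in the frame of the holonomy. -/
theorem mem_sheets_iff {η : ℝ} : act (H.D 0) η ∈ sheets C ↔ ∃ (n : ℤ) (c : ℝ), 0 < c ∧ η = xof n c := by
  have hmono := act_strictMono (H.D 0)
  have hadd : ∀ x, act (H.D 0) (x + 2 * Real.pi) = act (H.D 0) x + 2 * Real.pi := fun x => by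
    have := act_add_int (H.D 0) x 1
    rwa [Int.cast_one, one_mul] at this
  have hpos := Real.pi_pos
  constructor
  · rintro ⟨g, g', hT, b, s, hb, hs, h1, h2, h3⟩
    obtain ⟨rfl, rfl⟩ := hT.eq_of_dev C.smooth.continuous.continuousOn
      ((H.dev.mono (Set.subset_univ _)).gmul (ginv (H.D 0))) (gmul_ginv _)
    have hD1 : H.D 1 = gmul (H.D 0) H.h := by rw [h, gmul_gdiag, ← H.D_add_one, zero_add]
    rw [hD1] at hb hs
    rw [← act_act_ginv (H.D 0) b] at hb h1 h3
    rw [← act_act_ginv (H.D 0) s] at hs h2 h3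
    obtain ⟨n, hn⟩ := H.overBig_iff.1 hb
    obtain ⟨n', hn'⟩ := H.overSmall_iff.1 hs
    rw [hn] at h1 h3
    rw [hn'] at h2 h3
    rw [← hadd] at h3
    have k1 := hmono.lt_iff_lt.1 h1
    have k2 := hmono.lt_iff_lt.1 h2
    have k3 := hmono.lt_iff_lt.1 h3
    -- In the frame, b = 2πn and s = 2πn' + π; the inequalities b < s < b + 2π leave only n' = n.
    have hnn : n' = n := by
      have e1 : (n' : ℝ) < n + 1 := by
        by_contra h; push Not at h; nlinarith
      have e2 : (n : ℝ) < n' + 1 := by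
        by_contra h; push Not at h; nlinarith
      have e1' : n' < n + 1 := by exact_mod_cast e1
      have e2' : n < n' + 1 := by exact_mod_cast e2
      omega
    rw [hnn] at k2
    have hx : xof n (cof n η) = η := xof_cof k1 (by linarith)
    refine ⟨n, cof n η, ?_, hx.symm⟩
    rw [← (xof_strictAnti n).lt_iff_gt, hx]
    simp only [xof, Real.arctan_zero]
    linarith
  · rintro ⟨n, c, hc, rfl⟩
    refine ⟨_, _, H.isTransport, _, _, H.overBig_iff.2 ⟨n, rfl⟩, H.overSmall_iff.2 ⟨n, rfl⟩,
      hmono (xof_mem n c).1, hmono ?_, ?_⟩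
    · have := xof_strictAnti n hc
      simp only [xof, Real.arctan_zero] at this ⊢
      linarith
    · rw [← hadd]
      exact hmono (by linarith)

end CircleFrame

/-! ### Developments of flat pairs -/

variable {d : ℕ} {S : PuncturedDisc d} {B : Fin (d + 1) → IntervalDatum} {τ : ℝ} {C : CircleDatum τ}

variable (S B C) in
/-- Developments of the data on the ends, and lifts of the ends to the universal cover. -/
structure Frames where
  I : ∀ j, IntervalFrame (B j)
  H : CircleFrame C
  G : Fin (d + 1) → ℝ × ℝ → ℝ × ℝ
  G_lift : ∀ j, S.IsStripLift j (G j)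
  Gi : ℝ × ℝ → ℝ × ℝ
  Gi_smooth : ContDiffOn ℝ ∞ Gi cylDom
  Gi_mapsTo : Set.MapsTo Gi cylDom S.cover
  Gi_polar : ∀ p ∈ cylDom, polar S.ζint (Gi p) = S.εint p

theorem cylDom_convex : Convex ℝ cylDom := (convex_Ici 0).prod convex_univ

theorem cylDom_uniqueDiffOn : UniqueDiffOn ℝ cylDom := (uniqueDiffOn_Ici 0).prod uniqueDiffOn_univ

theorem zero_mem_cylDom : ((0, 0) : ℝ × ℝ) ∈ cylDom := ⟨Set.mem_Ici.2 le_rfl, trivial⟩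

variable (S B) in
theorem nonempty_frames (hτ : 2 < τ) (C : CircleDatum τ) : Nonempty (Frames S B C) := by
  obtain ⟨w, hw, hwp⟩ := S.exists_cover (S.εint_mem _ zero_mem_cylDom)
  obtain ⟨Gi, h1, h2, h3, -⟩ := S.exists_lift (cylDom_convex.starConvex zero_mem_cylDom) zero_mem_cylDom
    S.εint_smooth S.εint_mem hw.1 hwp.symm
  exact ⟨⟨fun j => (nonempty_intervalFrame (B j)).some, (nonempty_circleFrame hτ C).some,
    fun j => (S.exists_stripLift j).choose, fun j => (S.exists_stripLift j).choose_spec, Gi, h1, h2, h3⟩⟩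

variable (S) in
/-- The pullback of a one-form to the universal cover. -/
def pullForm (A : ℂ → ℂ →L[ℝ] Lie) (w : ℝ × ℝ) : ℝ × ℝ →L[ℝ] Lie :=
  (A (polar S.ζint w)).comp (fderiv ℝ (polar S.ζint) w)

/-- The pullback of the connection to the universal cover. -/
abbrev devForm (p : Pair S B C) : ℝ × ℝ → ℝ × ℝ →L[ℝ] Lie := pullForm S p.A

theorem contDiffOn_devForm {n : ℕ} {T : Set (EuclideanSpace ℝ (Fin n))} {F : EuclideanSpace ℝ (Fin n) → Pair S B C}
    (hF : IsSmoothFamily T F) : ContDiffOn ℝ ∞ (fun p : EuclideanSpace ℝ (Fin n) × (ℝ × ℝ) => devForm (F p.1) p.2)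
      (T ×ˢ S.cover) := by
  have h1 : ContDiffOn ℝ ∞ (fun p : EuclideanSpace ℝ (Fin n) × (ℝ × ℝ) => (F p.1).A (polar S.ζint p.2))
      (T ×ˢ S.cover) :=
    hF.1.comp (t := T ×ˢ S.carrier) (f := fun p : EuclideanSpace ℝ (Fin n) × (ℝ × ℝ) => (p.1, polar S.ζint p.2))
      (contDiff_fst.prodMk ((contDiff_polar _).comp contDiff_snd)).contDiffOn
      fun p hp => ⟨hp.1, S.polar_mem hp.2⟩
  have h2 : ContDiff ℝ ∞ (fun p : EuclideanSpace ℝ (Fin n) × (ℝ × ℝ) => fderiv ℝ (polar S.ζint) p.2) :=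
    ((contDiff_polar (n := ∞) S.ζint).fderiv_right (by simp)).comp contDiff_snd
  exact h1.clm_comp h2.contDiffOn

theorem isSmoothFamily_const (n : ℕ) (p : Pair S B C) (T : Set (EuclideanSpace ℝ (Fin n))) :
    IsSmoothFamily T fun _ => p :=
  ⟨p.A_smooth.comp contDiffOn_snd fun _ h => h.2,
    p.lam_smooth.comp (f := fun q : EuclideanSpace ℝ (Fin n) × ℝ => q.2) contDiffOn_snd fun _ h => h.2⟩

theorem continuousOn_devForm (p : Pair S B C) : ContinuousOn (devForm p) S.cover := by
  have := (contDiffOn_devForm (isSmoothFamily_const 0 p Set.univ)).continuousOn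
  exact this.comp (f := fun w => ((0 : EuclideanSpace ℝ (Fin 0)), w)) (by fun_prop) fun w hw => ⟨trivial, hw⟩

theorem flatOn_devForm (p : Pair S B C) : FlatOn (devForm p) S.cover :=
  (isFlatOn_iff.1 p.flat).comp p.A_smooth S.uniqueDiffOn_cover (contDiff_polar _) fun _ hw => S.polar_mem hw

theorem fderiv_polar_add_int (ζ : ℂ) (w : ℝ × ℝ) (n : ℤ) :
    fderiv ℝ (polar ζ) (w.1, w.2 + n * (2 * Real.pi)) = fderiv ℝ (polar ζ) w := by
  have h1 : (fun w : ℝ × ℝ => polar ζ (w + (0, n * (2 * Real.pi)))) = polar ζ := by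
    funext w
    rw [show w + (0, (n : ℝ) * (2 * Real.pi)) = (w.1, w.2 + n * (2 * Real.pi)) by ext <;> simp, polar_add_int]
  rw [show ((w.1, w.2 + n * (2 * Real.pi)) : ℝ × ℝ) = w + (0, n * (2 * Real.pi)) by ext <;> simp,
    ← fderiv_comp_add_right, h1]

theorem pullForm_add_int (A : ℂ → ℂ →L[ℝ] Lie) (w : ℝ × ℝ) (n : ℤ) :
    pullForm S A (w.1, w.2 + n * (2 * Real.pi)) = pullForm S A w := by
  rw [pullForm, pullForm, fderiv_polar_add_int, polar_add_int]

/-! ### The normalised development of a pair, and its behaviour on the ends. -/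

namespace Frames

variable (Fr : Frames S B C)

/-- The base point of the universal cover. -/
def base : ℝ × ℝ := Fr.Gi (0, 0)

theorem base_mem : Fr.base ∈ S.cover := Fr.Gi_mapsTo zero_mem_cylDom

theorem Gi_fst_lt {p : ℝ × ℝ} (hp : p ∈ cylDom) : (Fr.Gi p).1 < 1 := by
  have h0 := (Fr.Gi_mapsTo hp).1
  have h1 := S.εint_interior p hp
  rw [← Fr.Gi_polar p hp] at h1
  by_contra h
  have h2 : (Fr.Gi p).1 = 1 := le_antisymm
    ((norm_polar_le_one_iff S.ζint_mem h0).1 h1.le) (not_lt.1 h)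
  exact h1.ne ((norm_polar_eq_one_iff S.ζint_mem h0).2 h2)

theorem starConvex : StarConvex ℝ Fr.base S.cover :=
  S.cover_starConvex Fr.base_mem.1 (Fr.Gi_fst_lt zero_mem_cylDom)

theorem exists_dev_family {n : ℕ} {T : Set (EuclideanSpace ℝ (Fin n))} (hT : Convex ℝ T) (hTu : UniqueDiffOn ℝ T)
    {F : EuclideanSpace ℝ (Fin n) → Pair S B C} (hF : IsSmoothFamily T F) :
    ∃ D : EuclideanSpace ℝ (Fin n) × (ℝ × ℝ) → Cov, ContDiffOn ℝ ∞ D (T ×ˢ S.cover) ∧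
      ∀ ξ ∈ T, IsDev (devForm (F ξ)) S.cover (fun w => D (ξ, w)) ∧ D (ξ, Fr.base) = Fr.H.D 0 :=
  exists_dev hT hTu S.uniqueDiffOn_cover S.cover_subset_closure Fr.starConvex Fr.base_mem
    (fun _ => S.cover_locally_convex) (contDiffOn_devForm hF) (fun ξ _ => flatOn_devForm (F ξ)) _

theorem exists_dev_pair (p : Pair S B C) : ∃ D : ℝ × ℝ → Cov, IsDev (devForm p) S.cover D ∧ D Fr.base = Fr.H.D 0 := by
  obtain ⟨D, -, hD⟩ := Fr.exists_dev_family convex_univ uniqueDiffOn_univ (isSmoothFamily_const 0 p Set.univ)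
  exact ⟨_, hD 0 trivial⟩

/-- The development of a pair, as a function on the universal cover. -/
def dev (p : Pair S B C) : ℝ × ℝ → Cov := (Fr.exists_dev_pair p).choose

theorem isDev_dev (p : Pair S B C) : IsDev (devForm p) S.cover (Fr.dev p) := (Fr.exists_dev_pair p).choose_spec.1

theorem dev_base (p : Pair S B C) : Fr.dev p Fr.base = Fr.H.D 0 := (Fr.exists_dev_pair p).choose_spec.2

theorem eq_dev {p : Pair S B C} {D : ℝ × ℝ → Cov} (h : IsDev (devForm p) S.cover D) (h0 : D Fr.base = Fr.H.D 0) :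
    Set.EqOn D (Fr.dev p) S.cover :=
  h.eqOn (continuousOn_devForm p) Fr.starConvex (Fr.isDev_dev p) (h0.trans (Fr.dev_base p).symm)

/-- The development is chosen separately for each pair, but its normalisation makes it unique, so it
agrees with a smooth family of developments. -/
theorem contDiffOn_dev {n : ℕ} {T : Set (EuclideanSpace ℝ (Fin n))} (hT : Convex ℝ T) (hTu : UniqueDiffOn ℝ T)
    {F : EuclideanSpace ℝ (Fin n) → Pair S B C} (hF : IsSmoothFamily T F) :
    ContDiffOn ℝ ∞ (fun q : EuclideanSpace ℝ (Fin n) × (ℝ × ℝ) => Fr.dev (F q.1) q.2) (T ×ˢ S.cover) := by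
  obtain ⟨D, hD, hDd⟩ := Fr.exists_dev_family hT hTu hF
  exact hD.congr fun q hq => (Fr.eq_dev (hDd q.1 hq.1).1 (hDd q.1 hq.1).2 hq.2).symm

theorem continuousOn_dev (p : Pair S B C) : ContinuousOn (Fr.dev p) S.cover := (Fr.isDev_dev p).1

/-- Restriction of a pulled back connection along a lift. -/
theorem pullForm_comp {A : ℂ → ℂ →L[ℝ] Lie} {V : Type} [NormedAddCommGroup V] [NormedSpace ℝ V] {X : Set V}
    (hu : UniqueDiffOn ℝ X) {G : V → ℝ × ℝ} {e : V → ℂ} {G' : V →L[ℝ] ℝ × ℝ} {x : V} (hG : HasFDerivWithinAt G G' X x)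
    (he : ∀ x ∈ X, polar S.ζint (G x) = e x) (hx : x ∈ X) :
    (pullForm S A (G x)).comp G' = (A (e x)).comp (fderivWithin ℝ e X x) := by
  have h1 : HasFDerivAt (polar S.ζint) (fderiv ℝ (polar S.ζint) (G x)) (G x) :=
    ((contDiff_polar (n := 1) S.ζint).differentiable (by simp) _).hasFDerivAt
  have h2 : HasFDerivWithinAt e ((fderiv ℝ (polar S.ζint) (G x)).comp G') X x :=
    (h1.comp_hasFDerivWithinAt x hG).congr (fun y hy => (he y hy).symm) (he x hx).symm
  rw [h2.fderivWithin (hu x hx), pullForm, he x hx]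
  rfl

/-- On an end the connection is pulled back from one variable. The development therefore agrees with
the one-variable development up to a constant right factor, which is determined at a single point.
-/
theorem dev_lift (p : Pair S B C) {X : Set (ℝ × ℝ)} (hX : Convex ℝ X) (hu : UniqueDiffOn ℝ X) {G : ℝ × ℝ → ℝ × ℝ}
    (hG : ContDiffOn ℝ ∞ G X) (hm : Set.MapsTo G X S.cover) {e : ℝ × ℝ → ℂ} (he : ∀ x ∈ X, polar S.ζint (G x) = e x)
    {a : ℝ → Lie} (hA : HasPullback p.A e X a) {Y : Set ℝ} (hY : Set.MapsTo Prod.snd X Y) {D : ℝ → Cov}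
    (hD : IsDev (lineForm a) Y D) (ha : ContinuousOn a Y) {g : Cov} {x₀ : ℝ × ℝ} (hx₀ : x₀ ∈ X)
    (h0 : Fr.dev p (G x₀) = gmul (D x₀.2) g) : ∀ x ∈ X, Fr.dev p (G x) = gmul (D x.2) g := by
  have hform : ∀ x ∈ X, (devForm p (G x)).comp (fderivWithin ℝ G X x) =
      (lineForm a x.2).comp (ContinuousLinearMap.snd ℝ ℝ ℝ) := fun x hx => by
    rw [pullForm_comp hu ((hG.differentiableOn (by simp) x hx).hasFDerivWithinAt) he hx]
    obtain ⟨h1, h2⟩ := hA x hx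
    refine ContinuousLinearMap.ext fun v => ?_
    have hv : v = v.1 • ((1, 0) : ℝ × ℝ) + v.2 • ((0, 1) : ℝ × ℝ) := by ext <;> simp
    rw [ContinuousLinearMap.comp_apply, hv, map_add, map_smul, map_smul, map_add, map_smul, map_smul, h1, h2]
    simp [lineForm]
  have d1 := ((Fr.isDev_dev p).comp (c := G) (c' := fun x => fderivWithin ℝ G X x)
    (fun x hx => (hG.differentiableOn (by simp) x hx).hasFDerivWithinAt) hm).congr_form hform
  have d2 := (hD.comp (X' := X) (c := Prod.snd) (c' := fun _ => ContinuousLinearMap.snd ℝ ℝ ℝ)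
    (fun x _ => hasFDerivWithinAt_snd) hY).gmul g
  have hcont : ContinuousOn (fun x : ℝ × ℝ => (lineForm a x.2).comp (ContinuousLinearMap.snd ℝ ℝ ℝ)) X := by
    have : ContinuousOn (fun x : ℝ × ℝ => a x.2) X := ha.comp continuousOn_snd hY
    unfold lineForm
    exact (((ContinuousLinearMap.toSpanSingletonCLE (𝕜 := ℝ) (E := Lie)).continuous.comp_continuousOn this)).clm_comp
      continuousOn_const
  exact fun x hx => d1.eqOn hcont (hX.starConvex hx₀) d2 h0 hx

theorem dev_Gi (p : Pair S B C) {x : ℝ × ℝ} (hx : x ∈ cylDom) : Fr.dev p (Fr.Gi x) = Fr.H.D x.2 := by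
  have := Fr.dev_lift p cylDom_convex cylDom_uniqueDiffOn Fr.Gi_smooth Fr.Gi_mapsTo Fr.Gi_polar p.end_int
    (Set.mapsTo_univ _ _) Fr.H.dev C.smooth.continuous.continuousOn (g := gone) zero_mem_cylDom
    (by rw [gmul_gone]; exact Fr.dev_base p) x hx
  rwa [gmul_gone] at this

/-- The value of a development at the start of an end. -/
def start (p : Pair S B C) (j : Fin (d + 1)) : Cov := Fr.dev p (Fr.G j (0, 0))

theorem zero_mem_stripDom (j : Fin (d + 1)) : ((0, 0) : ℝ × ℝ) ∈ stripDom j :=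
  mem_stripDom (zero_mem_halfLine j) ⟨le_rfl, zero_le_one⟩

theorem dev_G (p : Pair S B C) (j : Fin (d + 1)) {x : ℝ × ℝ} (hx : x ∈ stripDom j) :
    Fr.dev p (Fr.G j x) = gmul ((Fr.I j).D x.2) (Fr.start p j) :=
  Fr.dev_lift p (stripDom_convex j) (stripDom_uniqueDiffOn j) (Fr.G_lift j).smooth (Fr.G_lift j).mapsTo
    (Fr.G_lift j).polar_eq (p.ends_A j) (fun x hx => hx.2) (Fr.I j).dev (B j).smooth.continuousOn
    (zero_mem_stripDom j) (by rw [(Fr.I j).D_zero, gone_gmul]; rfl) x hx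

theorem Gi_add_one {s t : ℝ} (hs : 0 ≤ s) : Fr.Gi (s, t + 1) = ((Fr.Gi (s, t)).1, (Fr.Gi (s, t)).2 - 2 * Real.pi) :=
  S.lift_add_one Fr.Gi_smooth.continuousOn Fr.Gi_mapsTo Fr.Gi_polar hs

/-- Both sides develop the same connection, so it is enough to compare them at the base point. There
one follows the interior end from t = 0 to t = 1, which lowers the angle by 2π and adds the
holonomy. -/
theorem dev_sub (p : Pair S B C) {w : ℝ × ℝ} (hw : w ∈ S.cover) :
    Fr.dev p (w.1, w.2 - 2 * Real.pi) = Fr.dev p w + Fr.H.h := by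
  have hsub : ∀ w : ℝ × ℝ, (w.1, w.2 - 2 * Real.pi) = (w.1, w.2 + ((-1 : ℤ) : ℝ) * (2 * Real.pi)) := fun w => by
    push_cast; ring_nf
  have d1 : IsDev (devForm p) S.cover fun w => Fr.dev p (w.1, w.2 - 2 * Real.pi) :=
    ((Fr.isDev_dev p).comp (c := fun w => (w.1, w.2 - 2 * Real.pi)) (c' := fun _ => ContinuousLinearMap.id ℝ (ℝ × ℝ))
      (fun w _ => (((hasFDerivAt_id w).sub_const ((0, 2 * Real.pi) : ℝ × ℝ)).congr_of_eventuallyEq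
        (.of_forall fun y => by ext <;> simp)).hasFDerivWithinAt)
      (fun w hw => by simp only [hsub]; exact S.cover_add_int (-1) hw)).congr_form fun w _ => by
        rw [ContinuousLinearMap.comp_id, hsub]; exact pullForm_add_int _ _ _
  have h0 : Fr.dev p (Fr.base.1, Fr.base.2 - 2 * Real.pi) = gmul (Fr.dev p Fr.base) Fr.H.h := by
    have h1 := Fr.Gi_add_one (t := 0) le_rfl
    have h2 := Fr.dev_Gi p (PuncturedDisc.mem_cylDom (0 + 1) (le_refl (0 : ℝ)))
    rw [h1] at h2
    rw [Fr.dev_base, CircleFrame.h, gmul_gdiag, ← Fr.H.D_add_one]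
    exact h2
  have := d1.eqOn (continuousOn_devForm p) Fr.starConvex ((Fr.isDev_dev p).gmul Fr.H.h) h0 hw
  rw [CircleFrame.h, ← gmul_gdiag]
  exact this

/-- The conditions on a development which correspond to the data prescribed on the ends. -/
structure IsAdapted (D : ℝ × ℝ → Cov) (g : Fin (d + 1) → Cov) : Prop where
  shift : ∀ w ∈ S.cover, D (w.1, w.2 - 2 * Real.pi) = D w + Fr.H.h
  int : ∀ x ∈ cylDom, D (Fr.Gi x) = Fr.H.D x.2
  strip : ∀ j, ∀ x ∈ stripDom j, D (Fr.G j x) = gmul ((Fr.I j).D x.2) (g j)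

variable {Fr} in
theorem IsAdapted.add_int {D : ℝ × ℝ → Cov} {g : Fin (d + 1) → Cov} (h : Fr.IsAdapted D g) {w : ℝ × ℝ}
    (hw : w ∈ S.cover) (n : ℤ) : D (w.1, w.2 + n * (2 * Real.pi)) = gmul (D w) (gdiag (-(n * Fr.H.κ)) (-n)) := by
  rw [gmul_gdiag]
  have hg : ∀ n : ℤ, gdiag (-((n + 1 : ℤ) * Fr.H.κ)) (-(n + 1)) + Fr.H.h = gdiag (-(n * Fr.H.κ)) (-n) := fun n => by
    rw [CircleFrame.h, gdiag, gdiag, gdiag]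
    ext
    · push_cast; simp; ring
    · push_cast; simp
  have step : ∀ n : ℤ, D (w.1, w.2 + n * (2 * Real.pi)) = D (w.1, w.2 + (n + 1 : ℤ) * (2 * Real.pi)) + Fr.H.h :=
    fun n => by
      rw [← h.shift _ (S.cover_add_int (n + 1) hw)]
      congr 2
      push_cast; ring
  induction n with
  | zero => simp [gdiag]
  | succ n ih =>
    have := step n
    rw [ih, ← hg, ← add_assoc] at this
    exact (add_right_cancel this).symm
  | pred n ih =>
    have := step (-n - 1)
    rw [sub_add_cancel, ih, add_assoc] at this
    rw [this, ← hg (-n - 1), sub_add_cancel]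

theorem isAdapted_dev (p : Pair S B C) : Fr.IsAdapted (Fr.dev p) (Fr.start p) :=
  ⟨fun _ => Fr.dev_sub p, fun _ => Fr.dev_Gi p, fun j _ => Fr.dev_G p j⟩

end Frames

/-! ### Boundary values -/

namespace PuncturedDisc

variable {d : ℕ} (S : PuncturedDisc d)

/-- The angles between `α k` and the next puncture. -/
def gap (k : Fin (d + 1)) : Set ℝ := {y | S.α k < y ∧ y < S.α 0 + 2 * Real.pi ∧ ∀ j, k < j → y < S.α j}

variable {S}

theorem ne_of_mem_bdryAngles {φ : ℝ} (h : φ ∈ S.bdryAngles) (j : Fin (d + 1)) (n : ℤ) :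
    φ ≠ S.α j + n * (2 * Real.pi) := fun h' => S.mem_bdryAngles.1 h j (bpt_eq_iff.2 ⟨n, h'⟩)

theorem gap_ordConnected (k : Fin (d + 1)) : (S.gap k).OrdConnected :=
  ⟨fun _ hx _ hy _ hz => ⟨hx.1.trans_le hz.1, hz.2.trans_lt hy.2.1, fun j hj => hz.2.trans_lt (hy.2.2 j hj)⟩⟩

theorem isOpen_gap (k : Fin (d + 1)) : IsOpen (S.gap k) := by
  have : S.gap k = Set.Ioi (S.α k) ∩ (Set.Iio (S.α 0 + 2 * Real.pi) ∩ ⋂ j, ⋂ _ : k < j, Set.Iio (S.α j)) := by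
    ext y; simp [gap]
  rw [this]
  exact isOpen_Ioi.inter (isOpen_Iio.inter (isOpen_iInter_of_finite fun j => isOpen_iInter_of_finite fun _ => isOpen_Iio))

theorem α_zero_le (k : Fin (d + 1)) : S.α 0 ≤ S.α k := S.α_mono.monotone (Fin.zero_le k)

theorem gap_lower {k : Fin (d + 1)} {y : ℝ} (hy : y ∈ S.gap k) : S.α 0 < y := (α_zero_le k).trans_lt hy.1

theorem gap_subset (k : Fin (d + 1)) : S.gap k ⊆ S.bdryAngles := fun y hy => by
  refine S.mem_bdryAngles.2 fun j h => ?_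
  obtain ⟨n, hn⟩ := bpt_eq_iff.1 h
  have hpos := Real.two_pi_pos
  have h0 := S.α_lt j
  have h0' := α_zero_le (S := S) j
  have h1 := gap_lower hy
  rcases lt_or_ge k j with hj | hj
  · have h2 := hy.2.2 j hj
    have e1 : (n : ℝ) < 0 := by by_contra h; push Not at h; nlinarith
    have e2 : (-1 : ℝ) < n := by by_contra h; push Not at h; nlinarith
    have e1' : n < 0 := by exact_mod_cast e1
    have e2' : -1 < n := by exact_mod_cast e2
    omega
  · have h2 := (S.α_mono.monotone hj).trans_lt hy.1
    have h3 := hy.2.1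
    have e1 : (0 : ℝ) < n := by by_contra h; push Not at h; nlinarith
    have e2 : (n : ℝ) < 1 := by by_contra h; push Not at h; nlinarith
    have e1' : 0 < n := by exact_mod_cast e1
    have e2' : n < 1 := by exact_mod_cast e2
    omega

theorem gap_unique {k k' : Fin (d + 1)} {y y' : ℝ} (hy : y ∈ S.gap k) (hy' : y' ∈ S.gap k') (h : bpt y = bpt y') :
    k = k' ∧ y = y' := by
  obtain ⟨n, hn⟩ := bpt_eq_iff.1 h
  have h1 := gap_lower hy
  have h1' := gap_lower hy'
  have h2 := hy.2.1
  have h2' := hy'.2.1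
  have hpos := Real.two_pi_pos
  have e1 : (n : ℝ) < 1 := by by_contra h; push Not at h; nlinarith
  have e2 : (-1 : ℝ) < n := by by_contra h; push Not at h; nlinarith
  have e1' : n < 1 := by exact_mod_cast e1
  have e2' : -1 < n := by exact_mod_cast e2
  obtain rfl : n = 0 := by omega
  rw [Int.cast_zero, zero_mul, add_zero] at hn
  refine ⟨?_, hn⟩
  subst hn
  rcases lt_trichotomy k k' with h | h | h
  · exact absurd (hy.2.2 k' h) (not_lt.2 hy'.1.le)
  · exact h
  · exact absurd (hy'.2.2 k h) (not_lt.2 hy.1.le)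

theorem exists_gap {φ : ℝ} (hφ : φ ∈ S.bdryAngles) : ∃ (k : Fin (d + 1)) (n : ℤ), φ + n * (2 * Real.pi) ∈ S.gap k := by
  obtain ⟨n, hn1, hn2⟩ := exists_int_Ioc (S.α 0) φ
  have hne : φ + n * (2 * Real.pi) < S.α 0 + 2 * Real.pi := lt_of_le_of_ne hn2 fun h =>
    ne_of_mem_bdryAngles hφ 0 (1 - n) (by push_cast; linarith)
  -- The gap is indexed by the last puncture before the angle, once the angle has been moved into
  -- the turn which starts at α 0.
  have hfin : (Finset.univ.filter fun k : Fin (d + 1) => S.α k < φ + n * (2 * Real.pi)).Nonempty :=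
    ⟨0, by simpa using hn1⟩
  refine ⟨Finset.max' _ hfin, n, (Finset.mem_filter.1 (Finset.max'_mem _ hfin)).2, hne, fun j hj => ?_⟩
  by_contra h
  rcases (not_lt.1 h).lt_or_eq with h1 | h1
  · exact absurd (Finset.le_max' _ j (Finset.mem_filter.2 ⟨Finset.mem_univ _, h1⟩)) (not_le.2 hj)
  · exact ne_of_mem_bdryAngles hφ j (-n) (by push_cast; linarith)

/-- The preceding boundary puncture, or the first one. -/
def prv (j : Fin (d + 1)) : Fin (d + 1) := ⟨j.1 - 1, by omega⟩

/-- The truncation of 0 - 1 is what is needed: for the negative end the side t = 0 lies after α 0,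
hence in the gap of index zero. -/
theorem prv_zero : prv (0 : Fin (d + 1)) = 0 := rfl

variable {F : ℝ × ℝ → ℝ × ℝ} {j : Fin (d + 1)} {s : ℝ}

theorem Ioc_subset_gap {y : ℝ} (hy : S.α j < y) (h : Set.Ioc (S.α j) y ⊆ S.bdryAngles) : y ∈ S.gap j := by
  refine ⟨hy, ?_, fun i hi => ?_⟩
  · by_contra h'
    have h1 := h (a := S.α 0 + 2 * Real.pi) ⟨S.α_lt j, not_lt.1 h'⟩
    exact ne_of_mem_bdryAngles h1 0 1 (by push_cast; ring)
  · by_contra h'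
    have h1 := h (a := S.α i) ⟨S.α_mono hi, not_lt.1 h'⟩
    exact ne_of_mem_bdryAngles h1 i 0 (by push_cast; ring)

theorem Ico_subset_gap {y : ℝ} (hy : y < S.α j) (hj : j ≠ 0) (h : Set.Ico y (S.α j) ⊆ S.bdryAngles) :
    y ∈ S.gap (prv j) := by
  have hj0 : 0 < j.1 := Nat.pos_of_ne_zero fun h => hj (Fin.ext h)
  refine ⟨?_, hy.trans (S.α_lt j), fun i hi => hy.trans_le (S.α_mono.monotone ?_)⟩
  · by_contra h'
    have h1 := h (a := S.α (prv j)) ⟨not_lt.1 h', S.α_mono (by rw [Fin.lt_def, prv]; simp only []; omega)⟩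
    exact ne_of_mem_bdryAngles h1 _ 0 (by push_cast; ring)
  · rw [Fin.lt_def, prv] at hi
    simp only [] at hi
    rw [Fin.le_def]; omega

theorem Ico_subset_gap_last {y : ℝ} (hy : y < S.α 0) (h : Set.Ico y (S.α 0) ⊆ S.bdryAngles) :
    y + 2 * Real.pi ∈ S.gap (Fin.last d) := by
  refine ⟨?_, by linarith, fun i hi => absurd hi (not_lt.2 (Fin.le_last i))⟩
  by_contra h'
  have h2 := S.α_lt (Fin.last d)
  have h1 := h (a := S.α (Fin.last d) - 2 * Real.pi) ⟨by linarith, by linarith⟩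
  exact ne_of_mem_bdryAngles h1 (Fin.last d) (-1) (by push_cast; ring)

theorem IsStripLift.mem_gap_zero (h : S.IsStripLift j F) (hs : s ∈ halfLine j) : (F (s, 0)).2 ∈ S.gap (prv j) := by
  have h1 := (h.side hs).1
  split_ifs at h1 with hj
  · subst hj
    exact Ioc_subset_gap h1 (h.Ico_subset hs (.inl rfl)).2
  · exact Ico_subset_gap h1 hj (h.Ico_subset hs (.inl rfl)).1

theorem IsStripLift.mem_gap_one (h : S.IsStripLift j F) (hs : s ∈ halfLine j) (hj : j ≠ 0) : (F (s, 1)).2 ∈ S.gap j := by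
  have h1 := (h.side hs).2
  rw [if_neg hj] at h1
  exact Ioc_subset_gap h1 (h.Ico_subset hs (.inr rfl)).2

/-- The side t = 1 of the negative end lies just before α 0, one full turn below the last gap. This
turn is the origin of the inverse holonomy in `sideV`. -/
theorem IsStripLift.mem_gap_last (h : S.IsStripLift 0 F) (hs : s ∈ halfLine (0 : Fin (d + 1))) :
    (F (s, 1)).2 + 2 * Real.pi ∈ S.gap (Fin.last d) := by
  have h1 := (h.side hs).2
  rw [if_pos rfl] at h1
  exact Ico_subset_gap_last h1 (h.Ico_subset hs (.inr rfl)).1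

end PuncturedDisc

open PuncturedDisc

/-! ### Configurations -/

section Conf

variable {d : ℕ}

/-- The labels on the sides `t = 0` of the ends, given those on the boundary components. -/
def sideU (x : Fin (d + 1) → ℝ) (j : Fin (d + 1)) : ℝ := x (prv j)

/-- The labels on the sides `t = 1` of the ends, given those on the boundary components. -/
def sideV (h : Cov) (x : Fin (d + 1) → ℝ) (j : Fin (d + 1)) : ℝ :=
  if j = 0 then act (ginv h) (x (Fin.last d)) else x j

/-- Configurations of points on a ray, with respect to a scaling by `e^{2κ}`. -/
def IsConf (κ : ℝ) (c : Fin (d + 1) → ℝ) : Prop :=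
  0 < c 0 ∧ StrictMono c ∧ c (Fin.last d) < Real.exp (2 * κ) * c 0

theorem act_ginv_gdiag_xof (κ : ℝ) (m : ℤ) (c : ℝ) :
    act (ginv (gdiag κ 1)) (xof m c) = xof (m - 1) (Real.exp (-(2 * κ)) * c) := by
  have h : act (gdiag κ 1) (xof (m - 1) (Real.exp (-(2 * κ)) * c)) = xof m c := by
    rw [act_gdiag_xof, ← mul_assoc, ← Real.exp_add, add_neg_cancel, Real.exp_zero, one_mul, sub_add_cancel]
  rw [← h, act_ginv_act]

/-- The conditions are strict linear inequalities. This convexity is what makes the space of labels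
in one sheet contractible. -/
theorem IsConf.convex {κ a b : ℝ} (ha : 0 ≤ a) (hb : 0 ≤ b) (hab : a + b = 1) {c c' : Fin (d + 1) → ℝ}
    (h : IsConf κ c) (h' : IsConf κ c') : IsConf κ fun k => a * c k + b * c' k := by
  have key : ∀ u v u' v' : ℝ, u < v → u' < v' → a * u + b * u' < a * v + b * v' := fun u v u' v' h1 h2 => by
    rcases ha.eq_or_lt with h0 | h0
    · subst h0
      rw [zero_add] at hab; subst hab; linarith
    · have := mul_lt_mul_of_pos_left h1 h0
      have := mul_le_mul_of_nonneg_left h2.le hb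
      linarith
  refine ⟨?_, fun i j hij => key _ _ _ _ (h.2.1 hij) (h'.2.1 hij), ?_⟩
  · have := key 0 (c 0) 0 (c' 0) h.1 h'.1
    linarith
  · have := key _ _ _ _ h.2.2 h'.2.2
    linarith

theorem exists_isConf {κ : ℝ} (hκ : 0 < κ) : ∃ c : Fin (d + 1) → ℝ, IsConf κ c := by
  have hd : (0 : ℝ) < d + 1 := by positivity
  have hE := Real.add_one_lt_exp (show 2 * κ ≠ 0 by positivity)
  -- Equally spaced points below 1 + 2κ, which is less than e^{2κ}.
  refine ⟨fun k => 1 + 2 * κ * (k.1 / (d + 1)), by simp, fun i j hij => ?_, ?_⟩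
  · have h1 : (i.1 : ℝ) < j.1 := by exact_mod_cast hij
    have h2 : (i.1 : ℝ) / (d + 1) < j.1 / (d + 1) := div_lt_div_of_pos_right h1 hd
    have := mul_lt_mul_of_pos_left h2 (show 0 < 2 * κ by positivity)
    simp only []
    linarith
  · have h2 : (d : ℝ) / (d + 1) < 1 := (div_lt_one hd).2 (by linarith)
    have := mul_lt_mul_of_pos_left h2 (show 0 < 2 * κ by positivity)
    simp only [Fin.val_last, Fin.val_zero, Nat.cast_zero, zero_div, mul_zero, add_zero, mul_one]
    linarith

theorem prv_lt {j : Fin (d + 1)} (hj : j ≠ 0) : prv j < j := by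
  have hj0 : 0 < j.1 := Nat.pos_of_ne_zero fun h => hj (Fin.ext h)
  rw [Fin.lt_def, prv]; simp only []; omega

/-- Labels in one interval of length 2π automatically differ by less than 2π. For j = 0 the inverse
holonomy lowers the interval by one turn, and c_d < e^{2κ}c_0 becomes x_0 < h⁻¹x_d + 2π. -/
theorem IsConf.sides {κ : ℝ} {c : Fin (d + 1) → ℝ} (h : IsConf κ c) (m : ℤ) (j : Fin (d + 1)) :
    sideU (fun k => xof m (c k)) j - sideV (gdiag κ 1) (fun k => xof m (c k)) j ∈ Set.Ioo 0 (2 * Real.pi) := by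
  simp only [sideU, sideV]
  split_ifs with hj
  · subst hj
    rw [prv_zero, act_ginv_gdiag_xof]
    have h1 : Real.exp (-(2 * κ)) * c (Fin.last d) < c 0 := by
      rw [Real.exp_neg, inv_mul_lt_iff₀ (Real.exp_pos _)]; exact h.2.2
    have h2 := xof_strictAnti m h1
    have h3 := xof_add_one (m - 1) (Real.exp (-(2 * κ)) * c (Fin.last d))
    rw [sub_add_cancel] at h3
    have h4 := (xof_mem m (c 0)).1
    have h5 : xof (m - 1) (Real.exp (-(2 * κ)) * c (Fin.last d)) < m * (2 * Real.pi) := by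
      have := (xof_mem (m - 1) (Real.exp (-(2 * κ)) * c (Fin.last d))).2
      push_cast at this; linarith
    constructor <;> linarith
  · have h1 := xof_strictAnti m (h.2.1 (prv_lt hj))
    have h2 := xof_mem m (c (prv j))
    have h3 := xof_mem m (c j)
    constructor <;> linarith

theorem xof_lt_iff {m : ℤ} {c c' : ℝ} : xof m c < xof m c' ↔ c' < c := (xof_strictAnti m).lt_iff_gt

/-- Configurations are determined by inequalities between labels. -/
theorem exists_conf {κ : ℝ} (hκ : 0 < κ) {x : Fin (d + 1) → ℝ}
    (h : ∀ j, sideU x j - sideV (gdiag κ 1) x j ∈ Set.Ioo 0 (2 * Real.pi)) :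
    ∃ (m : ℤ) (c : Fin (d + 1) → ℝ), IsConf κ c ∧ ∀ k, x k = xof m (c k) := by
  have hpos := Real.pi_pos
  have hanti : StrictAnti x := Fin.strictAnti_iff_succ_lt.2 fun i => by
    have := (h i.succ).1
    rw [sideU, sideV, if_neg (Fin.succ_ne_zero i), show prv i.succ = i.castSucc from Fin.ext (by simp [prv])] at this
    linarith
  obtain ⟨h0, h0'⟩ := h 0
  rw [sideU, sideV, if_pos rfl, prv_zero] at h0 h0'
  set y := act (ginv (gdiag κ 1)) (x (Fin.last d)) with hy
  have hyx : act (gdiag κ 1) y = x (Fin.last d) := act_act_ginv _ _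
  have hlast := hanti.antitone (Fin.le_last 0)
  -- Applied to -y, so that the resulting interval for y is closed below and open above.
  obtain ⟨n', hn1', hn2'⟩ := exists_int_Ioc (-(2 * Real.pi)) (-y)
  obtain ⟨n, hn1, hn2⟩ : ∃ n : ℤ, n * (2 * Real.pi) ≤ y ∧ y < n * (2 * Real.pi) + 2 * Real.pi :=
    ⟨n', by linarith, by linarith⟩
  -- Over l_big the holonomy moves points by exactly one turn. This would give x_d = y + 2π, whereas
  -- x_d ≤ x_0 < y + 2π.
  have hne : (n : ℝ) * (2 * Real.pi) ≠ y := fun h => by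
    have h1 := act_add_int (gdiag κ 1) 0 n
    rw [zero_add, h, hyx, act_gdiag_zero] at h1
    push_cast at h1; linarith
  have hyc := xof_cof (lt_of_le_of_ne hn1 hne) hn2
  set c := cof n y with hc
  have hxl : x (Fin.last d) = xof (n + 1) (Real.exp (2 * κ) * c) := by rw [← hyx, ← hyc, act_gdiag_xof]
  have hx0 : x 0 < xof (n + 1) c := by rw [xof_add_one, hyc]; linarith
  have hmem : ∀ k, xof (n + 1) (Real.exp (2 * κ) * c) ≤ x k ∧ x k < xof (n + 1) c := fun k =>
    ⟨hxl ▸ hanti.antitone (Fin.le_last k), (hanti.antitone (Fin.zero_le k)).trans_lt hx0⟩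
  have hxk : ∀ k, xof (n + 1) (cof (n + 1) (x k)) = x k := fun k =>
    xof_cof ((xof_mem _ _).1.trans_le (hmem k).1) ((hmem k).2.trans (xof_mem _ _).2)
  -- Here the sheet is forced. Both labels are compared with y + 2π in the cotangent coordinate,
  -- which yields c < e^{2κ}c, and this is possible only for c > 0.
  have hlt := xof_lt_iff.1 ((hmem 0).1.trans_lt (hmem 0).2)
  have hxk0 : c < cof (n + 1) (x 0) := by rw [← xof_lt_iff (m := n + 1), hxk]; exact (hmem 0).2
  have hcl : cof (n + 1) (x (Fin.last d)) = Real.exp (2 * κ) * c := by rw [hxl, cof_xof]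
  have hE := Real.exp_pos (2 * κ)
  have hE1 := Real.one_lt_exp_iff.2 (show 0 < 2 * κ by linarith)
  have hcpos : 0 < c := by
    by_contra h'
    nlinarith
  refine ⟨n + 1, fun k => cof (n + 1) (x k), ⟨hcpos.trans hxk0, fun i j hij => ?_, ?_⟩, fun k => (hxk k).symm⟩
  · rw [← xof_lt_iff (m := n + 1), hxk, hxk]; exact hanti hij
  · simp only [hcl]; exact mul_lt_mul_of_pos_left hxk0 hE

end Conf

theorem act_add_two_pi (D : Cov) (θ : ℝ) : act D (θ + 2 * Real.pi) = act D θ + 2 * Real.pi := by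
  have := act_add_int D θ 1
  rwa [Int.cast_one, one_mul] at this

theorem sub_mem_of_act {g : Cov} {U V : ℝ} (h : act g U - act g V ∈ Set.Ioo 0 (2 * Real.pi)) :
    U - V ∈ Set.Ioo 0 (2 * Real.pi) := by
  have h1 : act g U < act g (V + 2 * Real.pi) := by rw [act_add_two_pi]; linarith [h.2]
  have h2 : act g V < act g U := by linarith [h.1]
  constructor
  · linarith [(act_strictMono g).lt_iff_lt.1 h2]
  · linarith [(act_strictMono g).lt_iff_lt.1 h1]

theorem act_ginv_eq {D : Cov} {θ θ' : ℝ} (h : act D θ = θ') : act (ginv D) θ' = θ := by rw [← h, act_ginv_act]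

/-- The element which sends `U, V` to `l, m`, with a given dilation. -/
def twist (l m U V ρ : ℝ) : Cov := gmul (gmul (gpair l m) (gdiag ρ 0)) (ginv (gpair U V))

theorem act_twist {l m U V : ℝ} (ρ : ℝ) (h : l - m ∈ Set.Ioo 0 (2 * Real.pi))
    (h' : U - V ∈ Set.Ioo 0 (2 * Real.pi)) : act (twist l m U V ρ) U = l ∧ act (twist l m U V ρ) V = m := by
  have hU := act_gpair_pi h'.1 h'.2
  have hV := act_gpair_zero U V
  constructor
  · have h1 : act (ginv (gpair U V)) U = Real.pi := act_ginv_eq hU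
    rw [twist, act_gmul, act_gmul, h1, act_gdiag_zero_pi, act_gpair_pi h.1 h.2]
  · have h1 : act (ginv (gpair U V)) V = 0 := act_ginv_eq hV
    rw [twist, act_gmul, act_gmul, h1, act_gdiag_zero, Int.cast_zero, zero_mul, act_gpair_zero]

/-- After conjugating both pairs of points to π and 0, only an element of their stabiliser is left,
and this is a dilation. So the elements with the given two values form a line. -/
theorem eq_twist {g : Cov} {l m U V : ℝ} (h : l - m ∈ Set.Ioo 0 (2 * Real.pi)) (hU : act g U = l) (hV : act g V = m) :
    g = twist l m U V (gmul (gmul (ginv (gpair l m)) g) (gpair U V)).1.re := by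
  have h' : U - V ∈ Set.Ioo 0 (2 * Real.pi) := sub_mem_of_act (g := g) (by rwa [hU, hV])
  have h1 : act (gmul (gmul (ginv (gpair l m)) g) (gpair U V)) 0 = 0 := by
    rw [act_gmul, act_gpair_zero, act_gmul, hV]
    exact act_ginv_eq (act_gpair_zero l m)
  have h2 : act (gmul (gmul (ginv (gpair l m)) g) (gpair U V)) Real.pi = Real.pi := by
    rw [act_gmul, act_gpair_pi h'.1 h'.2, act_gmul, hU]
    exact act_ginv_eq (act_gpair_pi h.1 h.2)
  rw [twist, ← eq_gdiag_of_act h1 h2, gmul_assoc, gmul_assoc, gmul_ginv, gmul_gone, ← gmul_assoc, gmul_ginv, gone_gmul]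

theorem floor_xof (m : ℤ) (c : ℝ) : ⌊xof m c / (2 * Real.pi)⌋ = m := by
  have h := xof_mem m c
  rw [Int.floor_eq_iff, le_div_iff₀ Real.two_pi_pos, div_lt_iff₀ Real.two_pi_pos]
  constructor <;> linarith

namespace Frames

variable (Fr : Frames S B C)

/-! ### Transport along paths -/

theorem isDev_path {A : ℂ → ℂ →L[ℝ] Lie} {D : ℝ × ℝ → Cov} (hD : IsDev (pullForm S A) S.cover D) {γ : ℝ → ℝ × ℝ}
    (hγ : ContDiffOn ℝ ∞ γ (Set.Icc 0 1)) (hm : Set.MapsTo γ (Set.Icc 0 1) S.cover) {c : ℝ → ℂ}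
    (hc : ∀ t ∈ Set.Icc (0 : ℝ) 1, polar S.ζint (γ t) = c t) :
    IsDev (lineForm (pullPath A c)) (Set.Icc 0 1) fun t => gmul (D (γ t)) (ginv (D (γ 0))) :=
  IsDev.gmul ((hD.comp (c' := fun t => fderivWithin ℝ γ (Set.Icc 0 1) t)
    (fun t ht => (hγ.differentiableOn (by simp) t ht).hasFDerivWithinAt) hm).congr_form fun t ht => by
      rw [pullForm_comp (uniqueDiffOn_Icc zero_lt_one)
        ((hγ.differentiableOn (by simp) t ht).hasFDerivWithinAt) hc ht]
      ext1
      simp [lineForm, pullPath, derivWithin]) _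

theorem isTransport_path {A : ℂ → ℂ →L[ℝ] Lie} {D : ℝ × ℝ → Cov} (hD : IsDev (pullForm S A) S.cover D)
    {γ : ℝ → ℝ × ℝ} (hγ : ContDiffOn ℝ ∞ γ (Set.Icc 0 1)) (hm : Set.MapsTo γ (Set.Icc 0 1) S.cover) {c : ℝ → ℂ}
    (hc : ∀ t ∈ Set.Icc (0 : ℝ) 1, polar S.ζint (γ t) = c t) :
    IsTransport (pullPath A c) (matOf (gmul (D (γ 1)) (ginv (D (γ 0))))) (act (gmul (D (γ 1)) (ginv (D (γ 0))))) := by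
  have hd := isDev_path hD hγ hm hc
  obtain ⟨D', hD'⟩ : ∃ D' : ℝ → Cov, D' = fun t => gmul (D (γ t)) (ginv (D (γ 0))) := ⟨_, rfl⟩
  rw [show gmul (D (γ 1)) (ginv (D (γ 0))) = D' 1 by rw [hD']]
  rw [← hD'] at hd
  exact isTransport_of_dev hd (by rw [hD']; exact gmul_ginv _)

theorem eq_of_isTransport_path (p : Pair S B C) {γ : ℝ → ℝ × ℝ} (hγ : ContDiffOn ℝ ∞ γ (Set.Icc 0 1))
    (hm : Set.MapsTo γ (Set.Icc 0 1) S.cover) {c : ℝ → ℂ} (hc : ∀ t ∈ Set.Icc (0 : ℝ) 1, polar S.ζint (γ t) = c t)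
    {g : Mat} {g' : ℝ → ℝ} (h : IsTransport (pullPath p.A c) g g') :
    g = matOf (gmul (Fr.dev p (γ 1)) (ginv (Fr.dev p (γ 0)))) ∧
      g' = act (gmul (Fr.dev p (γ 1)) (ginv (Fr.dev p (γ 0)))) := by
  have hcs : ContDiffOn ℝ ∞ c (Set.Icc 0 1) :=
    ((contDiff_polar S.ζint).comp_contDiffOn hγ).congr fun t ht => (hc t ht).symm
  have ha : ContinuousOn (pullPath p.A c) (Set.Icc 0 1) :=
    (p.A_smooth.continuousOn.comp hcs.continuousOn fun t ht => hc t ht ▸ S.polar_mem (hm ht)).clm_apply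
      (hcs.continuousOn_derivWithin (uniqueDiffOn_Icc zero_lt_one) (by simp))
  have hd := isDev_path (Fr.isDev_dev p) hγ hm hc
  obtain ⟨D', hD'⟩ : ∃ D' : ℝ → Cov, D' = fun t => gmul (Fr.dev p (γ t)) (ginv (Fr.dev p (γ 0))) := ⟨_, rfl⟩
  rw [show gmul (Fr.dev p (γ 1)) (ginv (Fr.dev p (γ 0))) = D' 1 by rw [hD']]
  rw [← hD'] at hd
  exact h.eq_of_dev ha hd (by rw [hD']; exact gmul_ginv _)

/-! ### Boundary labels -/

/-- The boundary value, transported to the base point. -/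
def xhat (p : Pair S B C) (φ : ℝ) : ℝ := act (ginv (Fr.dev p (1, φ))) (p.lam (bpt φ))

theorem act_xhat (p : Pair S B C) (φ : ℝ) : act (Fr.dev p (1, φ)) (Fr.xhat p φ) = p.lam (bpt φ) := act_act_ginv _ _

theorem continuousOn_xhat (p : Pair S B C) : ContinuousOn (Fr.xhat p) S.bdryAngles := by
  have h1 : ContinuousOn (fun φ : ℝ => Fr.dev p (1, φ)) S.bdryAngles :=
    (Fr.continuousOn_dev p).comp (by fun_prop) fun φ hφ => S.mem_cover_one.2 hφ
  exact ((contDiff_ginv (n := ∞)).continuous.comp_continuousOn h1).act p.lam_smooth.continuousOn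

/-- The boundary condition concerns points of ℝP¹, so it makes the transported value constant modulo
2π. Continuity along the arc does the rest. -/
theorem xhat_eq (p : Pair S B C) {φ₀ φ₁ : ℝ} (h : φ₀ ≤ φ₁) (hs : Set.Icc φ₀ φ₁ ⊆ S.bdryAngles) :
    Fr.xhat p φ₁ = Fr.xhat p φ₀ := by
  have key : ∀ φ ∈ Set.Icc φ₀ φ₁, ∃ n : ℤ, Fr.xhat p φ - Fr.xhat p φ₀ = n * (2 * Real.pi) := fun φ hφ => by
    obtain ⟨g, g', hT, hg⟩ := p.constant φ₀ φ hφ.1 ((Set.Icc_subset_Icc_right hφ.2).trans hs)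
    have hγ : ContDiff ℝ ∞ fun t : ℝ => ((1, (1 - t) * φ₀ + t * φ) : ℝ × ℝ) := by fun_prop
    obtain ⟨rfl, -⟩ := Fr.eq_of_isTransport_path p hγ.contDiffOn (fun t ht => S.mem_cover_one.2 (hs
      ⟨by nlinarith [mul_nonneg ht.1 (sub_nonneg.2 hφ.1)],
        by nlinarith [mul_nonneg (sub_nonneg.2 ht.2) (sub_nonneg.2 hφ.1), hφ.2]⟩)) (c := arc φ₀ φ)
        (fun t _ => polar_one _ _) hT
    obtain ⟨n, hn⟩ := sends_matOf hg
    simp only [sub_zero, one_mul, zero_mul, add_zero, sub_self, zero_add] at hn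
    refine ⟨-n, ?_⟩
    rw [act_gmul, show act (ginv (Fr.dev p (1, φ₀))) (p.lam (bpt φ₀)) = Fr.xhat p φ₀ from rfl, ← Fr.act_xhat p φ,
      ← act_add_int] at hn
    have := act_injective _ hn
    push_cast; linarith
  exact sub_eq_zero.1 (const_of_int_mul (isPreconnected_Icc (a := φ₀) (b := φ₁))
    (((Fr.continuousOn_xhat p).mono hs).sub continuousOn_const) key ⟨le_rfl, h⟩ (sub_self _) φ₁ ⟨h, le_rfl⟩)

/-- Boundary values are unchanged by going around once, whereas the development acquires the
holonomy. -/
theorem xhat_add (p : Pair S B C) {φ : ℝ} (hφ : φ + 2 * Real.pi ∈ S.bdryAngles) :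
    act Fr.H.h (Fr.xhat p φ) = Fr.xhat p (φ + 2 * Real.pi) := by
  have h1 := Fr.dev_sub p (S.mem_cover_one.2 hφ)
  simp only [add_sub_cancel_right] at h1
  rw [CircleFrame.h, ← gmul_gdiag] at h1
  have h2 := bpt_add_int φ 1
  rw [Int.cast_one, one_mul] at h2
  refine act_injective (Fr.dev p (1, φ + 2 * Real.pi)) ?_
  rw [Fr.act_xhat, h2, ← Fr.act_xhat p φ, h1, act_gmul]
  rfl

/-- A point between `α k` and the next puncture. -/
def gapPt (k : Fin (d + 1)) : ℝ := if k = 0 then (Fr.G k (0, 0)).2 else (Fr.G k (0, 1)).2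

theorem gapPt_mem (k : Fin (d + 1)) : Fr.gapPt k ∈ S.gap k := by
  rw [gapPt]
  split_ifs with h
  · subst h
    exact (Fr.G_lift 0).mem_gap_zero (zero_mem_halfLine _)
  · exact (Fr.G_lift k).mem_gap_one (zero_mem_halfLine _) h

/-- The transported boundary values on the boundary components. -/
def label (p : Pair S B C) (k : Fin (d + 1)) : ℝ := Fr.xhat p (Fr.gapPt k)

theorem xhat_gap (p : Pair S B C) {k : Fin (d + 1)} {y : ℝ} (hy : y ∈ S.gap k) : Fr.xhat p y = Fr.label p k := by
  rcases le_total (Fr.gapPt k) y with h | h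
  · exact Fr.xhat_eq p h (((gap_ordConnected k).out (Fr.gapPt_mem k) hy).trans (gap_subset k))
  · exact (Fr.xhat_eq p h (((gap_ordConnected k).out hy (Fr.gapPt_mem k)).trans (gap_subset k))).symm

/-- The labels are compatible with the boundary conditions on the ends. -/
def IsLabelled (g : Fin (d + 1) → Cov) (x : Fin (d + 1) → ℝ) : Prop :=
  ∀ j, act (g j) (sideU x j) = (B j).l0 ∧ act (g j) (sideV Fr.H.h x j) = (Fr.I j).m

theorem G_eq (j : Fin (d + 1)) {s t : ℝ} (hs : s ∈ halfLine j) (ht : t = 0 ∨ t = 1) :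
    Fr.G j (s, t) = (1, (Fr.G j (s, t)).2) :=
  Prod.ext ((Fr.G_lift j).fst_eq_one (mem_stripDom hs (by rcases ht with rfl | rfl <;> simp)) ht) rfl

theorem bpt_G (j : Fin (d + 1)) {s t : ℝ} (hs : s ∈ halfLine j) (ht : t = 0 ∨ t = 1) :
    bpt (Fr.G j (s, t)).2 = S.ε j (s, t) :=
  (Fr.G_lift j).bpt_eq (mem_stripDom hs (by rcases ht with rfl | rfl <;> simp)) ht

/-- On the side t = 1 the development is that of the interval followed from the start of the end.
The endpoint value l1 is the image of m, so the transport along the interval can be cancelled. -/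
theorem isLabelled (p : Pair S B C) : Fr.IsLabelled (Fr.start p) (Fr.label p) := fun j => by
  have h0 := zero_mem_halfLine j
  constructor
  · rw [sideU, ← Fr.xhat_gap p ((Fr.G_lift j).mem_gap_zero h0), start, Fr.G_eq j h0 (.inl rfl), Fr.act_xhat,
      Fr.bpt_G j h0 (.inl rfl), p.ends_lam0 j 0 h0]
  · have h1 : sideV Fr.H.h (Fr.label p) j = Fr.xhat p (Fr.G j (0, 1)).2 := by
      rw [sideV]
      split_ifs with hj
      · subst hj
        have h2 := (Fr.G_lift 0).mem_gap_last h0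
        rw [← Fr.xhat_gap p h2, ← Fr.xhat_add p (gap_subset _ h2), act_ginv_act]
      · exact (Fr.xhat_gap p ((Fr.G_lift j).mem_gap_one h0 hj)).symm
    have h2 := Fr.dev_G p j (mem_stripDom h0 (Set.right_mem_Icc.2 zero_le_one))
    have h3 := Fr.act_xhat p (Fr.G j (0, 1)).2
    rw [← Fr.G_eq j h0 (.inr rfl), h2, act_gmul, Fr.bpt_G j h0 (.inr rfl), p.ends_lam1 j 0 h0, ← (Fr.I j).act_m] at h3
    rw [h1]
    exact act_injective _ h3

variable {Fr} in
theorem IsLabelled.sides {g : Fin (d + 1) → Cov} {x : Fin (d + 1) → ℝ} (h : Fr.IsLabelled g x) (j : Fin (d + 1)) :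
    sideU x j - sideV Fr.H.h x j ∈ Set.Ioo 0 (2 * Real.pi) :=
  sub_mem_of_act (g := g j) (by rw [(h j).1, (h j).2]; exact (Fr.I j).lt)

/-- The sheet of a pair. -/
def sheet (p : Pair S B C) : ℤ := ⌊Fr.label p 0 / (2 * Real.pi)⌋

/-- The configuration of boundary labels, inside the sheet. -/
def conf (p : Pair S B C) (k : Fin (d + 1)) : ℝ := cof (Fr.sheet p) (Fr.label p k)

theorem exists_conf_label (p : Pair S B C) : ∃ c, IsConf Fr.H.κ c ∧ ∀ k, Fr.label p k = xof (Fr.sheet p) (c k) := by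
  obtain ⟨m, c, hc, hx⟩ := exists_conf Fr.H.κ_pos (fun j => (Fr.isLabelled p).sides j)
  have hm : Fr.sheet p = m := by rw [sheet, hx, floor_xof]
  exact ⟨c, hc, by rw [hm]; exact hx⟩

theorem label_eq (p : Pair S B C) (k : Fin (d + 1)) : Fr.label p k = xof (Fr.sheet p) (Fr.conf p k) := by
  obtain ⟨c, -, hx⟩ := Fr.exists_conf_label p
  rw [conf, hx, cof_xof]

theorem isConf_conf (p : Pair S B C) : IsConf Fr.H.κ (Fr.conf p) := by
  obtain ⟨c, hc, hx⟩ := Fr.exists_conf_label p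
  have : Fr.conf p = c := funext fun k => by rw [conf, hx, cof_xof]
  rwa [this]

/-! ### Pairs are determined by their developments and labels -/

theorem op_injective {x y : Lie} (h : ∀ Z, op x Z = op y Z) : x = y := by
  have h1 := h 1
  have hI := h Complex.I
  simp only [op_apply, Complex.ext_iff, Complex.one_re, Complex.one_im, Complex.I_re, Complex.I_im] at h1 hI
  exact Prod.ext (by linarith [h1.1]) (Prod.ext (by simpa using h1.2) (by simpa using hI.1))

theorem form_eq_of_isDev {V : Type} [NormedAddCommGroup V] [NormedSpace ℝ V] {A A' : V → V →L[ℝ] Lie} {X : Set V}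
    (hu : UniqueDiffOn ℝ X) {D : V → Cov} (h : IsDev A X D) (h' : IsDev A' X D) {w : V} (hw : w ∈ X) : A w = A' w := by
  refine ContinuousLinearMap.ext fun v => op_injective fun Y => ?_
  have h1 := UniqueDiffWithinAt.eq (hu w hw) (h.2 (mv (ginv (D w)) Y) w hw) (h'.2 (mv (ginv (D w)) Y) w hw)
  have h2 := congrArg (fun L : V →L[ℝ] ℂ => L v) h1
  simpa [mv_mv_ginv] using h2

/-- The development determines the pulled back form, and `polar` is a local diffeomorphism. Each
boundary value is recovered by applying the development to the label of its component. -/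
theorem ext_pair {p q : Pair S B C} (h : Set.EqOn (Fr.dev p) (Fr.dev q) S.cover) (hl : Fr.label p = Fr.label q) :
    p = q := by
  have hA : p.A = q.A := by
    funext z
    by_cases hz : z ∈ S.carrier
    · obtain ⟨w, hw, rfl⟩ := S.exists_cover hz
      have h1 := form_eq_of_isDev S.uniqueDiffOn_cover (Fr.isDev_dev p)
        ((Fr.isDev_dev q).congr fun w hw => h hw) hw
      obtain ⟨L, hL⟩ := exists_equiv_of_jacobian (jacobian_polar S.ζint_mem hw.1)
      refine ContinuousLinearMap.ext fun v => ?_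
      have h2 := congrArg (fun M : ℝ × ℝ →L[ℝ] Lie => M (L.symm v)) h1
      simpa [pullForm, ← hL] using h2
    · rw [p.A_off z hz, q.A_off z hz]
  have hlam : p.lam = q.lam := by
    funext z
    by_cases hz : z ∈ S.bdry
    · obtain ⟨φ, rfl⟩ := exists_bpt hz.2
      obtain ⟨k, n, hk⟩ := exists_gap (S := S) (φ := φ) hz
      rw [← bpt_add_int φ n, ← Fr.act_xhat, ← Fr.act_xhat, Fr.xhat_gap p hk, Fr.xhat_gap q hk, hl,
        h (S.mem_cover_one.2 (gap_subset k hk))]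
    · rw [p.lam_off z hz, q.lam_off z hz]
  cases p; cases q
  cases hA; cases hlam
  rfl

end Frames

/-! ### Connections with a given development -/

section Form

variable {V : Type} [NormedAddCommGroup V] [NormedSpace ℝ V]

theorem hasFDerivWithinAt_mv {D : V → Cov} {X : Set V} {w : V} {L₁ L₂ : V →L[ℝ] ℂ}
    (h1 : HasFDerivWithinAt (fun w => colOne (D w)) L₁ X w) (h2 : HasFDerivWithinAt (fun w => colI (D w)) L₂ X w)
    (Z : ℂ) : HasFDerivWithinAt (fun w => mv (D w) Z) (Z.re • L₁ + Z.im • L₂) X w := by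
  have := (h1.const_smul Z.re).add (h2.const_smul Z.im)
  refine this.congr (fun w _ => ?_) ?_ <;> simp [mv]

/-- Differentiate the determinant identity `im_conj_mv_mul_mv` for the vectors which D sends to 1
and i at the point w. -/
theorem trace_zero {D : V → Cov} {X : Set V} {w : V} (hu : UniqueDiffWithinAt ℝ X w) {L₁ L₂ : V →L[ℝ] ℂ} {Z₁ Z₂ : ℂ}
    (h1 : HasFDerivWithinAt (fun w => mv (D w) Z₁) L₁ X w) (h2 : HasFDerivWithinAt (fun w => mv (D w) Z₂) L₂ X w)
    (e1 : mv (D w) Z₁ = 1) (e2 : mv (D w) Z₂ = Complex.I) (v : V) : (L₁ v).re + (L₂ v).im = 0 := by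
  have h3 := Complex.imCLM.hasFDerivAt.comp_hasFDerivWithinAt w
    (((Complex.conjCLE : ℂ →L[ℝ] ℂ).hasFDerivAt.comp_hasFDerivWithinAt w h1).mul h2)
  have h4 : HasFDerivWithinAt (fun _ : V => ((starRingEnd ℂ) Z₁ * Z₂).im) (0 : V →L[ℝ] ℝ) X w :=
    hasFDerivWithinAt_const _ _ _
  have h5 := UniqueDiffWithinAt.eq hu h3 (h4.congr (fun w' _ => im_conj_mv_mul_mv _ _ _) (im_conj_mv_mul_mv _ _ _))
  have h6 := congrArg (fun L : V →L[ℝ] ℝ => L v) h5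
  simp [e1, e2] at h6
  linarith

/-- Every smooth map to the universal cover is the development of a connection. -/
theorem exists_form {D : V → Cov} {X : Set V} (hu : UniqueDiffOn ℝ X) (hD : ContDiffOn ℝ ∞ D X) :
    ∃ A : V → V →L[ℝ] Lie, ContDiffOn ℝ ∞ A X ∧ IsDev A X D := by
  have s1 : ContDiffOn ℝ ∞ (fun w => colOne (D w)) X := contDiff_colOne.comp_contDiffOn hD
  have s2 : ContDiffOn ℝ ∞ (fun w => colI (D w)) X := contDiff_colI.comp_contDiffOn hD
  have i1 : ContDiffOn ℝ ∞ (fun w => colOne (ginv (D w))) X := contDiff_colOne.comp_contDiffOn hD.ginv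
  have i2 : ContDiffOn ℝ ∞ (fun w => colI (ginv (D w))) X := contDiff_colI.comp_contDiffOn hD.ginv
  have t1 := s1.fderivWithin hu (m := ∞) (by simp)
  have t2 := s2.fderivWithin hu (m := ∞) (by simp)
  set L₁ := fderivWithin ℝ (fun w => colOne (D w)) X with hL₁
  set L₂ := fderivWithin ℝ (fun w => colI (D w)) X with hL₂
  have hm : ∀ Z, ∀ w ∈ X, HasFDerivWithinAt (fun w => mv (D w) Z) (Z.re • L₁ w + Z.im • L₂ w) X w := fun Z w hw =>
    hasFDerivWithinAt_mv (s1.differentiableOn (by simp) w hw).hasFDerivWithinAt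
      (s2.differentiableOn (by simp) w hw).hasFDerivWithinAt Z
  have hM : ∀ {f : V → ℂ}, ContDiffOn ℝ ∞ f X → ContDiffOn ℝ ∞ (fun w => (f w).re • L₁ w + (f w).im • L₂ w) X :=
    fun hf => ((contDiff_re.comp_contDiffOn hf).smul t1).add ((contDiff_im.comp_contDiffOn hf).smul t2)
  -- The form is dD·D⁻¹. A trace-free matrix (p, q, r) sends 1 to -p + qi and i to r + pi, so P
  -- reads p and q from the image of 1, and Q reads r from the image of i. The second occurrence of
  -- p is consistent by `trace_zero`.
  let P : ℂ →L[ℝ] Lie := (-Complex.reCLM).prod (Complex.imCLM.prod 0)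
  let Q : ℂ →L[ℝ] Lie := (0 : ℂ →L[ℝ] ℝ).prod ((0 : ℂ →L[ℝ] ℝ).prod Complex.reCLM)
  refine ⟨fun w => P.comp ((colOne (ginv (D w))).re • L₁ w + (colOne (ginv (D w))).im • L₂ w) +
    Q.comp ((colI (ginv (D w))).re • L₁ w + (colI (ginv (D w))).im • L₂ w),
    (contDiffOn_const.clm_comp (hM i1)).add (contDiffOn_const.clm_comp (hM i2)), hD.continuousOn, fun Z w hw => ?_⟩
  refine (hm Z w hw).congr_fderiv (ContinuousLinearMap.ext fun v => ?_)
  have htr := trace_zero (hu w hw) (hm (colOne (ginv (D w))) w hw) (hm (colI (ginv (D w))) w hw)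
    (by rw [← mv_one, mv_mv_ginv]) (by rw [← mv_I, mv_mv_ginv]) v
  have hZ : Z = (mv (D w) Z).re * colOne (ginv (D w)) + (mv (D w) Z).im * colI (ginv (D w)) := by
    conv_lhs => rw [← mv_ginv_mv (D w) Z]
    rfl
  have hre := congrArg Complex.re hZ
  have him := congrArg Complex.im hZ
  simp only [Complex.add_re, Complex.add_im, Complex.re_ofReal_mul, Complex.im_ofReal_mul] at hre him
  change (Z.re • L₁ w + Z.im • L₂ w) v =
    op ((P.comp ((colOne (ginv (D w))).re • L₁ w + (colOne (ginv (D w))).im • L₂ w) +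
      Q.comp ((colI (ginv (D w))).re • L₁ w + (colI (ginv (D w))).im • L₂ w)) v) (mv (D w) Z)
  generalize mv (D w) Z = Y at *
  generalize colOne (ginv (D w)) = a at *
  generalize colI (ginv (D w)) = b at *
  simp only [_root_.add_apply, _root_.smul_apply, Complex.add_re, Complex.add_im, Complex.smul_re,
    Complex.smul_im, smul_eq_mul] at htr
  have hA : (P.comp (a.re • L₁ w + a.im • L₂ w) + Q.comp (b.re • L₁ w + b.im • L₂ w)) v =
      (-(a.re * (L₁ w v).re + a.im * (L₂ w v).re), a.re * (L₁ w v).im + a.im * (L₂ w v).im,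
        b.re * (L₁ w v).re + b.im * (L₂ w v).re) := by
    simp [P, Q]
    ring
  rw [hA, op_apply]
  apply Complex.ext
  · simp only [_root_.add_apply, _root_.smul_apply, Complex.add_re, Complex.smul_re, smul_eq_mul]
    rw [hre, him]; ring
  · simp only [_root_.add_apply, _root_.smul_apply, Complex.add_im, Complex.smul_im, smul_eq_mul]
    rw [hre, him]
    linear_combination Y.im * htr

end Form

/-! ### Model developments with prescribed behaviour on the ends. -/

namespace Frames

variable (Fr : Frames S B C)

/-- Developments with prescribed behaviour on the ends, depending smoothly on parameters. -/
theorem exists_model : ∃ M : (Fin (d + 1) → Cov) × (ℝ × ℝ) → Cov,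
    ContDiffOn ℝ ∞ M (Set.univ ×ˢ S.cover) ∧ ∀ g, Fr.IsAdapted (fun w => M (g, w)) g := by
  classical
  have hpi : (2 * Real.pi : ℝ) ≠ 0 := Real.two_pi_pos.ne'
  -- On the interior end, the development gains h when t increases by one, and the angle divided by
  -- 2π loses one. Their combination is periodic, so it is a function on the image of the end and
  -- can be extended.
  obtain ⟨u, hu, hus, hui⟩ := S.exists_extension (F := Cov)
    (φ := fun j p => ((Fr.G j p).2 / (2 * Real.pi)) • Fr.H.h)
    (fun j => ((contDiff_snd.comp_contDiffOn (Fr.G_lift j).smooth).div_const _).smul contDiffOn_const)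
    (φint := fun p => Fr.H.D p.2 + ((Fr.Gi p).2 / (2 * Real.pi)) • Fr.H.h)
    ((Fr.H.smooth.comp contDiff_snd).contDiffOn.add
      (((contDiff_snd.comp_contDiffOn Fr.Gi_smooth).div_const _).smul contDiffOn_const))
    (fun p hp n => by
      have hper : Function.Periodic
          (fun t => Fr.H.D t + ((Fr.Gi (p.1, t)).2 / (2 * Real.pi)) • Fr.H.h) 1 := fun t => by
        simp only []
        rw [Fr.Gi_add_one hp.1, Fr.H.D_add_one, CircleFrame.h, sub_div, div_self hpi, sub_smul, one_smul]
        abel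
      have := (hper.int_mul n) p.2
      rwa [mul_one] at this)
  choose χ hχ hχs hχi using fun j => S.exists_extension (F := ℝ) (φ := fun k _ => if k = j then 1 else 0)
    (fun k => contDiffOn_const) (φint := fun _ => 0) contDiffOn_const (fun _ _ _ => rfl)
  choose Δ hΔ hΔs hΔi using fun j => S.exists_extension (F := Cov)
    (φ := fun k p => if k = j then (Fr.I j).D p.2 else 0)
    (fun k => by
      split_ifs
      · exact (Fr.I j).smooth.comp contDiffOn_snd fun p hp => hp.2
      · exact contDiffOn_const) (φint := fun _ => 0) contDiffOn_const (fun _ _ _ => rfl)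
  have hpol : ContDiffOn ℝ ∞ (fun q : (Fin (d + 1) → Cov) × (ℝ × ℝ) => polar S.ζint q.2) (Set.univ ×ˢ S.cover) :=
    ((contDiff_polar _).comp contDiff_snd).contDiffOn
  have hmp : Set.MapsTo (fun q : (Fin (d + 1) → Cov) × (ℝ × ℝ) => polar S.ζint q.2) (Set.univ ×ˢ S.cover) S.carrier :=
    fun q hq => S.polar_mem hq.2
  -- The last term produces the shift by h. It is cancelled by u on the strips, and changed by u
  -- into the prescribed development on the interior end. The sum makes sense because `Cov` is a
  -- vector space, and by `exists_form` no further condition is needed for a smooth map to be a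
  -- development.
  refine ⟨fun q => ∑ j, χ j (polar S.ζint q.2) • gmul (Δ j (polar S.ζint q.2)) (q.1 j) + u (polar S.ζint q.2) -
    (q.2.2 / (2 * Real.pi)) • Fr.H.h, ?_, fun g => ⟨fun w hw => ?_, fun x hx => ?_, fun j x hx => ?_⟩⟩
  · refine ((ContDiffOn.sum fun j _ => ?_).add (hu.comp hpol hmp)).sub ?_
    · have hg : ContDiff ℝ ∞ fun q : (Fin (d + 1) → Cov) × (ℝ × ℝ) => q.1 j := by fun_prop
      exact ((hχ j).comp hpol hmp).smul (((hΔ j).comp hpol hmp).gmul hg.contDiffOn)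
    · exact ((contDiff_snd.comp contDiff_snd).div_const _).contDiffOn.smul contDiffOn_const
  · have hp : polar S.ζint (w.1, w.2 - 2 * Real.pi) = polar S.ζint w := by
      have := polar_add_int S.ζint w.1 w.2 (-1)
      rw [← this]; congr 2; push_cast; ring
    simp only [hp]
    rw [sub_div, div_self hpi, sub_smul, one_smul]
    abel
  · simp only [Fr.Gi_polar x hx, hχi _ x hx, zero_smul, Finset.sum_const_zero, hui x hx]
    abel
  · simp only [(Fr.G_lift j).polar_eq x hx, hχs _ j x hx, hΔs _ j x hx, hus j x hx]
    rw [Finset.sum_eq_single j (fun k _ hk => by rw [if_neg hk.symm, zero_smul])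
      (fun h => absurd (Finset.mem_univ j) h), if_pos rfl, if_pos rfl, one_smul, add_sub_cancel_right]

end Frames

/-! ### Construction of families of pairs -/

theorem pullForm_branch {A : ℂ → ℂ →L[ℝ] Lie} {U : Set ℂ} (hU : IsOpen U) {g : ℂ → ℝ × ℝ} (hg : ContDiffOn ℝ ∞ g U)
    (hp : ∀ z ∈ U, polar S.ζint (g z) = z) {z : ℂ} (hz : z ∈ U) :
    (pullForm S A (g z)).comp (fderiv ℝ g z) = A z := by
  have h1 := Frames.pullForm_comp (A := A) hU.uniqueDiffOn
    ((hg.differentiableOn (by simp)).differentiableAt (hU.mem_nhds hz)).hasFDerivAt.hasFDerivWithinAt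
    (e := fun z => z) hp hz
  rw [h1, fderivWithin_fun_id (hU.uniqueDiffOn z hz), ContinuousLinearMap.comp_id]

variable (S) in
/-- Periodic forms on the universal cover descend to the surface. -/
theorem exists_pushforward {E : Type} [NormedAddCommGroup E] [NormedSpace ℝ E]
    {A' : E × (ℝ × ℝ) → ℝ × ℝ →L[ℝ] Lie} (hA' : ContDiffOn ℝ ∞ A' (Set.univ ×ˢ S.cover))
    (hper : ∀ ξ, ∀ w ∈ S.cover, ∀ n : ℤ, A' (ξ, (w.1, w.2 + n * (2 * Real.pi))) = A' (ξ, w)) :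
    ∃ A : E → ℂ → ℂ →L[ℝ] Lie, (∀ ξ z, z ∉ S.carrier → A ξ z = 0) ∧
      ContDiffOn ℝ ∞ (fun q : E × ℂ => A q.1 q.2) (Set.univ ×ˢ S.carrier) ∧
      ∀ ξ, ∀ w ∈ S.cover, pullForm S (A ξ) w = A' (ξ, w) := by
  classical
  let A : E → ℂ → ℂ →L[ℝ] Lie := fun ξ z => if h : z ∈ S.carrier then
    (A' (ξ, (S.exists_cover h).choose)).comp (fderiv ℝ (polar S.ζint) (S.exists_cover h).choose).inverse else 0
  have hpull : ∀ ξ, ∀ w ∈ S.cover, pullForm S (A ξ) w = A' (ξ, w) := fun ξ w hw => by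
    have hz := S.polar_mem hw
    obtain ⟨hW, hWp⟩ := (S.exists_cover hz).choose_spec
    have hA : A ξ (polar S.ζint w) = (A' (ξ, (S.exists_cover hz).choose)).comp
      (fderiv ℝ (polar S.ζint) (S.exists_cover hz).choose).inverse := dif_pos hz
    -- The chosen preimage differs from w by a deck transformation, under which both the form and
    -- the derivative of `polar` are invariant.
    obtain ⟨h1, n, h2⟩ := polar_inj S.ζint_mem hW.1 hw.1 hWp
    rw [show (S.exists_cover hz).choose = (w.1, w.2 + n * (2 * Real.pi)) from Prod.ext h1 h2, hper ξ w hw,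
      fderiv_polar_add_int] at hA
    obtain ⟨L, hL⟩ := exists_equiv_of_jacobian (jacobian_polar S.ζint_mem hw.1)
    rw [← hL, ContinuousLinearMap.inverse_equiv] at hA
    rw [pullForm, hA, ← hL]
    ext <;> simp
  refine ⟨A, fun ξ z hz => dif_neg hz, fun q hq => ?_, hpull⟩
  obtain ⟨w, hw, hwq⟩ := S.exists_cover hq.2
  obtain ⟨U, g, hU, hwU, hg, -, hp, hgm⟩ := S.exists_branch hw
  rw [hwq] at hwU
  have hg' : ContDiffOn ℝ ∞ (fderiv ℝ g) U := hg.fderiv_of_isOpen hU (by simp)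
  have h1 : ContDiffOn ℝ ∞ (fun q : E × ℂ => (A' (q.1, g q.2)).comp (fderiv ℝ g q.2)) (Set.univ ×ˢ (S.carrier ∩ U)) :=
    (hA'.comp (f := fun q : E × ℂ => (q.1, g q.2))
      (contDiffOn_fst.prodMk (hg.comp contDiffOn_snd fun q hq => hq.2.2)) fun q hq => ⟨trivial, hgm _ hq.2⟩).clm_comp
      (hg'.comp contDiffOn_snd fun q hq => hq.2.2)
  have hev : ∀ᶠ q in 𝓝[Set.univ ×ˢ S.carrier] q, q ∈ (Set.univ : Set E) ×ˢ (S.carrier ∩ U) := by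
    filter_upwards [self_mem_nhdsWithin, mem_nhdsWithin_of_mem_nhds
      ((hU.preimage continuous_snd).mem_nhds (show q ∈ Prod.snd ⁻¹' U from hwU))] with q hq hqU
    exact ⟨trivial, hq.2, hqU⟩
  refine ((h1 q ⟨trivial, hq.2, hwU⟩).mono_of_mem_nhdsWithin hev).congr_of_eventuallyEq_of_mem ?_ hq
  filter_upwards [hev] with q hq
  rw [← hpull _ _ (hgm _ hq.2), pullForm_branch hU hg hp hq.2.2]

theorem hasPullback_of_lift {A : ℂ → ℂ →L[ℝ] Lie} {D : ℝ × ℝ → Cov} (hD : IsDev (pullForm S A) S.cover D)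
    {X : Set (ℝ × ℝ)} (hu : UniqueDiffOn ℝ X) {G : ℝ × ℝ → ℝ × ℝ} (hG : ContDiffOn ℝ ∞ G X)
    (hm : Set.MapsTo G X S.cover) {e : ℝ × ℝ → ℂ} (he : ∀ x ∈ X, polar S.ζint (G x) = e x) {a : ℝ → Lie}
    {Y : Set ℝ} (hY : Set.MapsTo Prod.snd X Y) {D' : ℝ → Cov} (hD' : IsDev (lineForm a) Y D') {g : Cov}
    (h : ∀ x ∈ X, D (G x) = gmul (D' x.2) g) : HasPullback A e X a := fun x hx => by
  have hd : ∀ x ∈ X, HasFDerivWithinAt G (fderivWithin ℝ G X x) X x := fun x hx =>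
    (hG.differentiableOn (by simp) x hx).hasFDerivWithinAt
  have d2 := (hD'.comp (X' := X) (c := Prod.snd) (c' := fun _ => ContinuousLinearMap.snd ℝ ℝ ℝ)
    (fun x _ => hasFDerivWithinAt_snd) hY).gmul g
  have h1 := Frames.form_eq_of_isDev hu (hD.comp hd hm) (d2.congr h) hx
  rw [Frames.pullForm_comp hu (hd x hx) he hx] at h1
  have h2 := fun v => congrArg (fun L : ℝ × ℝ →L[ℝ] Lie => L v) h1
  exact ⟨by simpa [lineForm] using h2 (1, 0), by simpa [lineForm] using h2 (0, 1)⟩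

theorem act_gmul_ginv_gdiag (D : Cov) (κ : ℝ) : gmul (D + gdiag κ 1) (ginv (gdiag κ 1)) = D := by
  rw [← gmul_gdiag, gmul_assoc, gmul_ginv, gmul_gone]

namespace Frames

variable (Fr : Frames S B C)

theorem gap_add {k : Fin (d + 1)} {y₀ y₁ : ℝ} (hy : y₀ ∈ S.gap k) (h : y₀ ≤ y₁) (hs : Set.Icc y₀ y₁ ⊆ S.bdryAngles) :
    y₁ ∈ S.gap k :=
  Ioc_subset_gap (hy.1.trans_le h) fun y hy' => by
    rcases le_total y y₀ with h1 | h1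
    · exact gap_subset k ⟨hy'.1, h1.trans_lt hy.2.1, fun j hj => h1.trans_lt (hy.2.2 j hj)⟩
    · exact hs ⟨h1, hy'.2⟩

/-- Adapted developments and compatible labels come from pairs, smoothly in parameters. -/
theorem exists_family {n : ℕ} {D : EuclideanSpace ℝ (Fin n) × (ℝ × ℝ) → Cov}
    (hD : ContDiffOn ℝ ∞ D (Set.univ ×ˢ S.cover)) {g : EuclideanSpace ℝ (Fin n) → Fin (d + 1) → Cov}
    (hDg : ∀ ξ, Fr.IsAdapted (fun w => D (ξ, w)) (g ξ)) {x : EuclideanSpace ℝ (Fin n) → Fin (d + 1) → ℝ}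
    (hx : ∀ k, ContDiff ℝ ∞ fun ξ => x ξ k) (hgx : ∀ ξ, Fr.IsLabelled (g ξ) (x ξ)) :
    ∃ F : EuclideanSpace ℝ (Fin n) → Pair S B C, IsSmoothFamily Set.univ F ∧
      ∀ ξ, Set.EqOn (Fr.dev (F ξ)) (fun w => D (ξ, w)) S.cover ∧ Fr.label (F ξ) = x ξ := by
  classical
  -- the connection
  obtain ⟨Â, hÂ, hÂD⟩ := exists_form (uniqueDiffOn_univ.prod S.uniqueDiffOn_cover) hD
  -- The form on the product also has components in the parameter directions; only the directions of
  -- the surface are kept.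
  set A' : EuclideanSpace ℝ (Fin n) × (ℝ × ℝ) → ℝ × ℝ →L[ℝ] Lie := fun q =>
    (Â q).comp (ContinuousLinearMap.inr ℝ (EuclideanSpace ℝ (Fin n)) (ℝ × ℝ)) with hA'
  have hA's : ContDiffOn ℝ ∞ A' (Set.univ ×ˢ S.cover) := hÂ.clm_comp contDiffOn_const
  have hA'D : ∀ ξ, IsDev (fun w => A' (ξ, w)) S.cover fun w => D (ξ, w) := fun ξ =>
    hÂD.comp (c := fun w => (ξ, w)) (c' := fun _ => ContinuousLinearMap.inr ℝ (EuclideanSpace ℝ (Fin n)) (ℝ × ℝ))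
      (fun w _ => (hasFDerivAt_prodMk_right ξ w).hasFDerivWithinAt) fun w hw => ⟨trivial, hw⟩
  have hper : ∀ ξ, ∀ w ∈ S.cover, ∀ n : ℤ, A' (ξ, (w.1, w.2 + n * (2 * Real.pi))) = A' (ξ, w) := fun ξ w hw n => by
    have d1 := (hA'D ξ).comp (X' := S.cover) (c := fun w => (w.1, w.2 + n * (2 * Real.pi)))
      (c' := fun _ => ContinuousLinearMap.id ℝ (ℝ × ℝ))
      (fun w _ => (((hasFDerivAt_id w).add_const ((0, n * (2 * Real.pi)) : ℝ × ℝ)).congr_of_eventuallyEq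
        (.of_forall fun y => by ext <;> simp)).hasFDerivWithinAt) fun w hw => S.cover_add_int n hw
    -- A deck transformation multiplies the development on the right by a constant, which does not
    -- affect the form.
    have := form_eq_of_isDev S.uniqueDiffOn_cover d1
      (((hA'D ξ).gmul (gdiag (-(n * Fr.H.κ)) (-n))).congr fun w hw => (hDg ξ).add_int hw n) hw
    simpa using this
  obtain ⟨A, hA0, hAs, hApull⟩ := exists_pushforward S hA's hper
  have hAD : ∀ ξ, IsDev (pullForm S (A ξ)) S.cover fun w => D (ξ, w) := fun ξ =>
    (hA'D ξ).congr_form fun w hw => (hApull ξ w hw).symm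
  have hAξ : ∀ ξ, ContDiffOn ℝ ∞ (A ξ) S.carrier := fun ξ =>
    hAs.comp (f := fun z => (ξ, z)) (by fun_prop) fun z hz => ⟨trivial, hz⟩
  -- the boundary values
  let lam : EuclideanSpace ℝ (Fin n) → ℂ → ℝ := fun ξ z => if h : ∃ (k : Fin (d + 1)) (y : ℝ), y ∈ S.gap k ∧ bpt y = z then
    act (D (ξ, (1, h.choose_spec.choose))) (x ξ h.choose) else 0
  have hlam : ∀ ξ, ∀ {k : Fin (d + 1)} {y : ℝ}, y ∈ S.gap k → lam ξ (bpt y) = act (D (ξ, (1, y))) (x ξ k) := by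
    intro ξ k y hy
    have h : ∃ (k : Fin (d + 1)) (y' : ℝ), y' ∈ S.gap k ∧ bpt y' = bpt y := ⟨k, y, hy, rfl⟩
    obtain ⟨h1, h2⟩ := h.choose_spec.choose_spec
    obtain ⟨h3, h4⟩ := gap_unique h1 hy h2
    have : lam ξ (bpt y) = act (D (ξ, (1, h.choose_spec.choose))) (x ξ h.choose) := dif_pos h
    rw [this, h4, h3]
  have hlam' : ∀ ξ, ∀ {k : Fin (d + 1)} {φ : ℝ} {m : ℤ}, φ + m * (2 * Real.pi) ∈ S.gap k →
      lam ξ (bpt φ) = act (D (ξ, (1, φ + m * (2 * Real.pi)))) (x ξ k) := fun ξ k φ m h => by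
    rw [← bpt_add_int φ m, hlam ξ h]
  have hlams : ContDiffOn ℝ ∞ (fun q : EuclideanSpace ℝ (Fin n) × ℝ => lam q.1 (bpt q.2))
      (Set.univ ×ˢ S.bdryAngles) := fun q hq => by
    obtain ⟨k, m, hk⟩ := exists_gap hq.2
    have ho : IsOpen {q : EuclideanSpace ℝ (Fin n) × ℝ | q.2 + m * (2 * Real.pi) ∈ S.gap k} :=
      (isOpen_gap k).preimage (by fun_prop)
    have h1 : ContDiffOn ℝ ∞ (fun q : EuclideanSpace ℝ (Fin n) × ℝ => act (D (q.1, (1, q.2 + m * (2 * Real.pi)))) (x q.1 k))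
        {q | q.2 + m * (2 * Real.pi) ∈ S.gap k} :=
      ContDiffOn.act (hD.comp (f := fun q : EuclideanSpace ℝ (Fin n) × ℝ => (q.1, ((1 : ℝ), q.2 + m * (2 * Real.pi))))
        (by fun_prop) fun q hq => ⟨trivial, S.mem_cover_one.2 (gap_subset k hq)⟩)
        ((hx k).comp contDiff_fst).contDiffOn
    refine ((h1.contDiffAt (ho.mem_nhds hk)).congr_of_eventuallyEq ?_).contDiffWithinAt
    filter_upwards [ho.mem_nhds hk] with q hq
    exact hlam' q.1 hq
  have h0 : ∀ j : Fin (d + 1), ∀ s ∈ halfLine j, ((s, (0 : ℝ)) : ℝ × ℝ) ∈ stripDom j := fun j s hs =>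
    mem_stripDom hs ⟨le_rfl, zero_le_one⟩
  have h1 : ∀ j : Fin (d + 1), ∀ s ∈ halfLine j, ((s, (1 : ℝ)) : ℝ × ℝ) ∈ stripDom j := fun j s hs =>
    mem_stripDom hs ⟨zero_le_one, le_rfl⟩
  let F : EuclideanSpace ℝ (Fin n) → Pair S B C := fun ξ =>
    { A := A ξ
      lam := lam ξ
      A_off := hA0 ξ
      lam_off := fun z hz => dif_neg fun ⟨k, y, hy, hyz⟩ => hz (hyz ▸ gap_subset k hy)
      A_smooth := hAξ ξ
      lam_smooth := hlams.comp (f := fun φ => (ξ, φ)) (by fun_prop) fun φ hφ => ⟨trivial, hφ⟩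
      flat := isFlatOn_iff.2 (flatOn_of_dev S.uniqueDiffOn_carrier S.carrier_subset_closure (hAξ ξ) fun z hz => by
        obtain ⟨w, hw, rfl⟩ := S.exists_cover hz
        obtain ⟨U, g, hU, hwU, hg, -, hp, hgm⟩ := S.exists_branch hw
        refine ⟨U, hU, hwU, fun z => D (ξ, g z), ?_, ?_⟩
        · exact hD.comp (f := fun z => (ξ, g z)) (contDiffOn_const.prodMk (hg.mono Set.inter_subset_right))
            fun z hz => ⟨trivial, hgm z hz⟩
        · exact ((hAD ξ).comp (c := g) (c' := fun z => fderiv ℝ g z) (fun z hz =>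
            ((hg.differentiableOn (by simp)).differentiableAt (hU.mem_nhds hz.2)).hasFDerivAt.hasFDerivWithinAt)
            hgm).congr_form fun z hz => pullForm_branch hU hg hp hz.2)
      constant := fun φ₀ φ₁ hφ hs => by
        have hγ : ContDiff ℝ ∞ fun t : ℝ => ((1, (1 - t) * φ₀ + t * φ₁) : ℝ × ℝ) := by fun_prop
        have hT := isTransport_path (hAD ξ) hγ.contDiffOn (fun t ht => S.mem_cover_one.2 (hs
          ⟨by nlinarith [mul_nonneg ht.1 (sub_nonneg.2 hφ)],
            by nlinarith [mul_nonneg (sub_nonneg.2 ht.2) (sub_nonneg.2 hφ)]⟩)) (c := arc φ₀ φ₁)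
          fun t _ => polar_one _ _
        simp only [sub_zero, one_mul, zero_mul, add_zero, sub_self, zero_add] at hT
        refine ⟨_, _, hT, sends_of_act (n := 0) ?_⟩
        have hb0 : φ₀ ∈ S.bdryAngles := hs ⟨le_rfl, hφ⟩
        have hb1 : φ₁ ∈ S.bdryAngles := hs ⟨hφ, le_rfl⟩
        obtain ⟨k, m, hk⟩ := exists_gap hb0
        -- A boundary arc without punctures stays in one gap, so both endpoints are governed by the
        -- same label.
        have hk1 : φ₁ + m * (2 * Real.pi) ∈ S.gap k := gap_add hk (by linarith) fun y hy => by
          have := hs (a := y - m * (2 * Real.pi)) ⟨by linarith [hy.1], by linarith [hy.2]⟩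
          rw [← S.mem_bdryAngles_add_int m] at this
          simpa using this
        rw [hlam' ξ hk, hlam' ξ hk1, (hDg ξ).add_int (S.mem_cover_one.2 hb0) m,
          (hDg ξ).add_int (S.mem_cover_one.2 hb1) m, act_gmul, act_gmul, act_ginv_act, act_gmul]
        simp
      ends_A := fun j => hasPullback_of_lift (hAD ξ) (stripDom_uniqueDiffOn j) (Fr.G_lift j).smooth (Fr.G_lift j).mapsTo
        (Fr.G_lift j).polar_eq (fun x hx => hx.2) (Fr.I j).dev ((hDg ξ).strip j)
      ends_lam0 := fun j s hs => by
        have h2 := (hDg ξ).strip j _ (h0 j s hs)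
        rw [← Fr.bpt_G j hs (.inl rfl), hlam ξ ((Fr.G_lift j).mem_gap_zero hs), ← Fr.G_eq j hs (.inl rfl), h2,
          (Fr.I j).D_zero, gone_gmul]
        exact (hgx ξ j).1
      ends_lam1 := fun j s hs => by
        have h2 := (hDg ξ).strip j _ (h1 j s hs)
        have h3 := (hgx ξ j).2
        rw [← Fr.bpt_G j hs (.inr rfl), ← (Fr.I j).act_m, ← h3, ← act_gmul, ← h2, sideV]
        split_ifs with hj
        · subst hj
          -- The value on this side is read off in the last gap, one turn further on; the resulting
          -- shift by h cancels the inverse in `sideV`.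
          have h4 := (Fr.G_lift 0).mem_gap_last hs
          have h5 := (hDg ξ).shift _ (S.mem_cover_one.2 (gap_subset _ h4))
          rw [add_sub_cancel_right, ← Fr.G_eq 0 hs (.inr rfl), CircleFrame.h] at h5
          have h6 := bpt_add_int (Fr.G 0 (s, 1)).2 1
          rw [Int.cast_one, one_mul] at h6
          rw [h5, CircleFrame.h, ← act_gmul, act_gmul_ginv_gdiag, ← h6, hlam ξ h4]
        · rw [hlam ξ ((Fr.G_lift j).mem_gap_one hs hj), ← Fr.G_eq j hs (.inr rfl)]
      end_int := hasPullback_of_lift (hAD ξ) cylDom_uniqueDiffOn Fr.Gi_smooth Fr.Gi_mapsTo Fr.Gi_polar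
        (Set.mapsTo_univ _ _) Fr.H.dev (g := gone) fun x hx => by rw [gmul_gone]; exact (hDg ξ).int x hx }
  have hdev : ∀ ξ, Set.EqOn (fun w => D (ξ, w)) (Fr.dev (F ξ)) S.cover := fun ξ =>
    Fr.eq_dev (p := F ξ) (hAD ξ) ((hDg ξ).int _ zero_mem_cylDom)
  refine ⟨F, ⟨hAs, hlams⟩, fun ξ => ⟨(hdev ξ).symm, funext fun k => ?_⟩⟩
  rw [label, xhat, ← hdev ξ (S.mem_cover_one.2 (gap_subset k (Fr.gapPt_mem k))),
    show (F ξ).lam = lam ξ from rfl, hlam ξ (Fr.gapPt_mem k), act_ginv_act]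

end Frames

/-! ### Contracting families of pairs -/

theorem contDiffOn_cutoff {V W : Type*} [NormedAddCommGroup V] [NormedSpace ℝ V] [NormedAddCommGroup W]
    [NormedSpace ℝ W] {X : Set V} {b : V → ℝ} {f : V → W} (hb : ContDiffOn ℝ ∞ b X)
    (h : ∀ x ∈ X, b =ᶠ[𝓝[X] x] 0 ∨ ContDiffWithinAt ℝ ∞ f X x) : ContDiffOn ℝ ∞ (fun x => b x • f x) X :=
  fun x hx => by
    rcases h x hx with h | h
    · refine (contDiffWithinAt_const (c := (0 : W))).congr_of_eventuallyEq_of_mem ?_ hx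
      filter_upwards [h] with y hy
      rw [hy, Pi.zero_apply, zero_smul]
    · exact (hb x hx).smul h

/-- A smooth function which vanishes near the origin and is one on the unit sphere. -/
def cutoff {E : Type*} [NormedAddCommGroup E] (ξ : E) : ℝ := Real.smoothTransition (2 * ‖ξ‖ ^ 2 - 1)

section Cutoff

variable {E : Type*} [NormedAddCommGroup E]

theorem cutoff_mem (ξ : E) : 0 ≤ cutoff ξ ∧ cutoff ξ ≤ 1 :=
  ⟨Real.smoothTransition.nonneg _, Real.smoothTransition.le_one _⟩

theorem cutoff_sphere {ξ : E} (h : ‖ξ‖ = 1) : cutoff ξ = 1 :=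
  Real.smoothTransition.one_of_one_le (by rw [h]; norm_num)

theorem cutoff_eventually : (cutoff : E → ℝ) =ᶠ[𝓝 0] 0 := by
  have h : ∀ᶠ ξ in 𝓝 (0 : E), 2 * ‖ξ‖ ^ 2 - 1 < 0 :=
    (by fun_prop : Continuous fun ξ : E => 2 * ‖ξ‖ ^ 2 - 1).continuousAt.eventually_lt continuousAt_const (by simp)
  filter_upwards [h] with ξ hξ
  exact Real.smoothTransition.zero_of_nonpos hξ.le

theorem contDiff_cutoff [InnerProductSpace ℝ E] : ContDiff ℝ ∞ (cutoff : E → ℝ) :=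
  Real.smoothTransition.contDiff.comp ((contDiff_const.mul (contDiff_norm_sq ℝ)).sub contDiff_const)

end Cutoff

theorem _root_.ContDiffOn.twist {V : Type*} [NormedAddCommGroup V] [NormedSpace ℝ V] {X : Set V} {U U' ρ : V → ℝ}
    (l m : ℝ) (hU : ContDiffOn ℝ ∞ U X) (hU' : ContDiffOn ℝ ∞ U' X) (hρ : ContDiffOn ℝ ∞ ρ X)
    (h : ∀ x ∈ X, U x - U' x ∈ Set.Ioo 0 (2 * Real.pi)) : ContDiffOn ℝ ∞ (fun x => twist l m (U x) (U' x) (ρ x)) X :=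
  (ContDiffOn.gmul contDiffOn_const
    ((((contDiff_ofReal.comp_contDiffOn hρ).add contDiffOn_const).prodMk contDiffOn_const))).gmul
    (ContDiffOn.ginv fun x hx => (contDiffAt_gpair (h x hx).1 (h x hx).2).comp_contDiffWithinAt x
      (f := fun x => (U x, U' x)) ((hU x hx).prodMk (hU' x hx)))

theorem contDiffOn_sideU {V : Type*} [NormedAddCommGroup V] [NormedSpace ℝ V] {X : Set V} {x : V → Fin (d + 1) → ℝ}
    (hx : ∀ k, ContDiffOn ℝ ∞ (fun v => x v k) X) (j : Fin (d + 1)) : ContDiffOn ℝ ∞ (fun v => sideU (x v) j) X :=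
  hx _

theorem contDiffOn_sideV {V : Type*} [NormedAddCommGroup V] [NormedSpace ℝ V] {X : Set V} {x : V → Fin (d + 1) → ℝ}
    (h : Cov) (hx : ∀ k, ContDiffOn ℝ ∞ (fun v => x v k) X) (j : Fin (d + 1)) :
    ContDiffOn ℝ ∞ (fun v => sideV h (x v) j) X := by
  unfold sideV
  split_ifs
  · exact contDiffOn_const.act (hx _)
  · exact hx _

namespace Frames

variable (Fr : Frames S B C)

section Family

variable {n : ℕ} {T : Set (EuclideanSpace ℝ (Fin n))} {F : EuclideanSpace ℝ (Fin n) → Pair S B C}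

/-- Smoothness is available over convex parameter sets, and it is enough to use balls, since the
normalised development does not depend on the family. -/
theorem contDiffOn_dev_of_isOpen (hT : IsOpen T) (hF : IsSmoothFamily T F) :
    ContDiffOn ℝ ∞ (fun q : EuclideanSpace ℝ (Fin n) × (ℝ × ℝ) => Fr.dev (F q.1) q.2) (T ×ˢ S.cover) := fun q hq => by
  obtain ⟨ε, hε, hb⟩ := Metric.isOpen_iff.1 hT q.1 hq.1
  have h1 := Fr.contDiffOn_dev (convex_ball q.1 ε) Metric.isOpen_ball.uniqueDiffOn
    (F := F) ⟨hF.1.mono (Set.prod_mono_left hb), hF.2.mono (Set.prod_mono_left hb)⟩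
  refine (h1 q ⟨Metric.mem_ball_self hε, hq.2⟩).mono_of_mem_nhdsWithin ?_
  filter_upwards [self_mem_nhdsWithin, mem_nhdsWithin_of_mem_nhds
    ((Metric.isOpen_ball.preimage continuous_fst).mem_nhds
      (show q ∈ Prod.fst ⁻¹' Metric.ball q.1 ε from Metric.mem_ball_self hε))] with r hr hr'
  exact ⟨hr', hr.2⟩

theorem contDiffOn_dev_apply (hT : IsOpen T) (hF : IsSmoothFamily T F) {w : ℝ × ℝ} (hw : w ∈ S.cover) :
    ContDiffOn ℝ ∞ (fun ξ => Fr.dev (F ξ) w) T :=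
  (Fr.contDiffOn_dev_of_isOpen hT hF).comp (f := fun ξ => (ξ, w)) (by fun_prop) fun ξ hξ => ⟨hξ, hw⟩

theorem contDiffOn_start (hT : IsOpen T) (hF : IsSmoothFamily T F) (j : Fin (d + 1)) :
    ContDiffOn ℝ ∞ (fun ξ => Fr.start (F ξ) j) T :=
  Fr.contDiffOn_dev_apply hT hF ((Fr.G_lift j).mapsTo (zero_mem_stripDom j))

theorem contDiffOn_label (hT : IsOpen T) (hF : IsSmoothFamily T F) (k : Fin (d + 1)) :
    ContDiffOn ℝ ∞ (fun ξ => Fr.label (F ξ) k) T :=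
  have hk := gap_subset k (Fr.gapPt_mem k)
  (Fr.contDiffOn_dev_apply hT hF (S.mem_cover_one.2 hk)).ginv.act
    (hF.2.comp (f := fun ξ => (ξ, Fr.gapPt k)) (by fun_prop) fun ξ hξ => ⟨hξ, hk⟩)

/-- A label is never a multiple of 2π, so both inequalities can be taken strict; this makes the
sheet locally constant in families. -/
theorem sheet_eq_iff (p : Pair S B C) (m : ℤ) :
    Fr.sheet p = m ↔ m * (2 * Real.pi) < Fr.label p 0 ∧ Fr.label p 0 < m * (2 * Real.pi) + 2 * Real.pi := by
  constructor
  · rintro rfl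
    rw [Fr.label_eq]
    exact xof_mem _ _
  · rintro ⟨h1, h2⟩
    rw [sheet, ← xof_cof h1 h2, floor_xof]

theorem continuousOn_sheet (hT : IsOpen T) (hF : IsSmoothFamily T F) : ContinuousOn (fun ξ => Fr.sheet (F ξ)) T :=
  fun ξ hξ => by
    have h1 := (Fr.contDiffOn_label hT hF 0).continuousOn ξ hξ
    have h2 := (Fr.sheet_eq_iff (F ξ) _).1 rfl
    refine (continuousWithinAt_const (b := Fr.sheet (F ξ))).congr_of_eventuallyEq ?_ rfl
    filter_upwards [h1.eventually (isOpen_Ioo.mem_nhds h2)] with η hη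
    exact (Fr.sheet_eq_iff _ _).2 hη

/-- The dilation on an end. -/
def dil (p : Pair S B C) (j : Fin (d + 1)) : ℝ :=
  (gmul (gmul (ginv (gpair (B j).l0 (Fr.I j).m)) (Fr.start p j))
    (gpair (sideU (Fr.label p) j) (sideV Fr.H.h (Fr.label p) j))).1.re

theorem start_eq_twist (p : Pair S B C) (j : Fin (d + 1)) : Fr.start p j =
    twist (B j).l0 (Fr.I j).m (sideU (Fr.label p) j) (sideV Fr.H.h (Fr.label p) j) (Fr.dil p j) :=
  eq_twist (Fr.I j).lt (Fr.isLabelled p j).1 (Fr.isLabelled p j).2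

theorem contDiffOn_dil (hT : IsOpen T) (hF : IsSmoothFamily T F) (j : Fin (d + 1)) :
    ContDiffOn ℝ ∞ (fun ξ => Fr.dil (F ξ) j) T := by
  have hU := contDiffOn_sideU (fun k => Fr.contDiffOn_label hT hF k) j
  have hV := contDiffOn_sideV Fr.H.h (fun k => Fr.contDiffOn_label hT hF k) j
  have h1 : ContDiffOn ℝ ∞ (fun ξ => gpair (sideU (Fr.label (F ξ)) j) (sideV Fr.H.h (Fr.label (F ξ)) j)) T :=
    fun ξ hξ => by
      have h := (Fr.isLabelled (F ξ)).sides j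
      exact (contDiffAt_gpair h.1 h.2).comp_contDiffWithinAt ξ
        (f := fun ξ => (sideU (Fr.label (F ξ)) j, sideV Fr.H.h (Fr.label (F ξ)) j)) ((hU ξ hξ).prodMk (hV ξ hξ))
  exact contDiff_re.comp_contDiffOn (contDiff_fst.comp_contDiffOn
    ((ContDiffOn.gmul contDiffOn_const (Fr.contDiffOn_start hT hF j)).gmul h1))

theorem contDiffOn_conf (hT : IsOpen T) (hF : IsSmoothFamily T F) {m : ℤ} (hm : ∀ ξ ∈ T, Fr.sheet (F ξ) = m)
    (k : Fin (d + 1)) : ContDiffOn ℝ ∞ (fun ξ => Fr.conf (F ξ) k) T := by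
  have h : ContDiffOn ℝ ∞ (fun ξ => cof m (Fr.label (F ξ) k)) T := fun ξ hξ => by
    have h1 := xof_mem m (Fr.conf (F ξ) k)
    rw [← hm ξ hξ, ← Fr.label_eq, hm ξ hξ] at h1
    exact ContDiffAt.comp_contDiffWithinAt (g := cof m) (f := fun ξ => Fr.label (F ξ) k) ξ (contDiffAt_cof h1.1 h1.2)
      (Fr.contDiffOn_label hT hF k ξ hξ)
  exact h.congr fun ξ hξ => by rw [conf, hm ξ hξ]

end Family

/-- The values at the starts of the ends, for given labels and dilations. -/
def starts (m : ℤ) (c ρ : Fin (d + 1) → ℝ) (j : Fin (d + 1)) : Cov :=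
  twist (B j).l0 (Fr.I j).m (sideU (fun k => xof m (c k)) j) (sideV Fr.H.h (fun k => xof m (c k)) j) (ρ j)

theorem starts_conf (p : Pair S B C) : Fr.starts (Fr.sheet p) (Fr.conf p) (Fr.dil p) = Fr.start p := funext fun j => by
  rw [Fr.start_eq_twist, starts, show (fun k => xof (Fr.sheet p) (Fr.conf p k)) = Fr.label p from
    funext fun k => (Fr.label_eq p k).symm]

theorem isLabelled_starts (m : ℤ) {c : Fin (d + 1) → ℝ} (hc : IsConf Fr.H.κ c) (ρ : Fin (d + 1) → ℝ) :
    Fr.IsLabelled (Fr.starts m c ρ) fun k => xof m (c k) := fun j => act_twist _ (Fr.I j).lt (hc.sides m j)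

theorem contDiffOn_starts {V : Type*} [NormedAddCommGroup V] [NormedSpace ℝ V] {X : Set V} (m : ℤ)
    {c ρ : V → Fin (d + 1) → ℝ} (hc : ∀ k, ContDiffOn ℝ ∞ (fun v => c v k) X)
    (hρ : ∀ k, ContDiffOn ℝ ∞ (fun v => ρ v k) X) (hcc : ∀ v ∈ X, IsConf Fr.H.κ (c v)) :
    ContDiffOn ℝ ∞ (fun v => Fr.starts m (c v) (ρ v)) X :=
  contDiffOn_pi.2 fun j => by
    have hx : ∀ k, ContDiffOn ℝ ∞ (fun v => xof m (c v k)) X := fun k => (contDiff_xof m).comp_contDiffOn (hc k)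
    exact ContDiffOn.twist _ _ (contDiffOn_sideU (x := fun v k => xof m (c v k)) hx j)
      (contDiffOn_sideV (x := fun v k => xof m (c v k)) Fr.H.h hx j) (hρ j) fun v hv => (hcc v hv).sides m j

/-- Modifying a model by terms which vanish on the ends. -/
theorem IsAdapted.add {D R : ℝ × ℝ → Cov} {g : Fin (d + 1) → Cov} (h : Fr.IsAdapted D g)
    (h1 : ∀ w ∈ S.cover, R (w.1, w.2 - 2 * Real.pi) = R w) (h2 : ∀ x ∈ cylDom, R (Fr.Gi x) = 0)
    (h3 : ∀ j, ∀ x ∈ stripDom j, R (Fr.G j x) = 0) : Fr.IsAdapted (fun w => D w + R w) g :=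
  ⟨fun w hw => by simp only [h.shift w hw, h1 w hw]; abel, fun x hx => by simp only [h.int x hx, h2 x hx, add_zero],
    fun j x hx => by simp only [h.strip j x hx, h3 j x hx, add_zero]⟩

theorem sheet_of_label {p : Pair S B C} {m : ℤ} {c : Fin (d + 1) → ℝ} (h : Fr.label p = fun k => xof m (c k)) :
    Fr.sheet p = m := by rw [sheet, h, floor_xof]

/-- Any configuration in the given sheet is realised, with all dilations zero, by the model
development; the family has a zero-dimensional parameter space. -/
theorem sheet_surjective : Function.Surjective Fr.sheet := fun m => by
  obtain ⟨M, hM, hMa⟩ := Fr.exists_model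
  obtain ⟨c, hc⟩ := exists_isConf (d := d) Fr.H.κ_pos
  obtain ⟨F, -, hF⟩ := Fr.exists_family (n := 0) (D := fun q => M (Fr.starts m c 0, q.2))
    (g := fun _ => Fr.starts m c 0) (x := fun _ k => xof m (c k))
    (hM.comp (f := fun q : EuclideanSpace ℝ (Fin 0) × (ℝ × ℝ) => (Fr.starts m c 0, q.2))
      (contDiffOn_const.prodMk contDiffOn_snd) fun q hq => ⟨trivial, hq.2⟩)
    (fun _ => hMa _) (fun _ => contDiff_const) fun _ => Fr.isLabelled_starts m hc _
  exact ⟨F 0, Fr.sheet_of_label (hF 0).2⟩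

/-- The radial extension replaces the sphere by an open set of parameters, over which developments
and labels are known to be smooth. -/
theorem isSmoothFamily_radial {n : ℕ} {F : EuclideanSpace ℝ (Fin n) → Pair S B C}
    (hF : IsSmoothFamily (Metric.sphere 0 1) F) : IsSmoothFamily {0}ᶜ fun ξ => F (‖ξ‖⁻¹ • ξ) := by
  have h1 : ContDiffOn ℝ ∞ (fun ξ : EuclideanSpace ℝ (Fin n) => ‖ξ‖⁻¹ • ξ) {0}ᶜ := fun ξ hξ =>
    (((contDiffAt_norm ℝ hξ).inv (norm_ne_zero_iff.2 hξ)).smul contDiffAt_id).contDiffWithinAt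
  have h2 : ∀ ξ ∈ ({0}ᶜ : Set (EuclideanSpace ℝ (Fin n))), ‖ξ‖⁻¹ • ξ ∈ Metric.sphere (0 : EuclideanSpace ℝ (Fin n)) 1 :=
    fun ξ hξ => by
      rw [mem_sphere_zero_iff_norm, norm_smul, norm_inv, norm_norm, inv_mul_cancel₀ (norm_ne_zero_iff.2 hξ)]
  constructor
  · exact hF.1.comp (f := fun q : EuclideanSpace ℝ (Fin n) × ℂ => (‖q.1‖⁻¹ • q.1, q.2))
      ((h1.comp contDiffOn_fst fun q hq => hq.1).prodMk contDiffOn_snd) fun q hq => ⟨h2 _ hq.1, hq.2⟩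
  · exact hF.2.comp (f := fun q : EuclideanSpace ℝ (Fin n) × ℝ => (‖q.1‖⁻¹ • q.1, q.2))
      ((h1.comp contDiffOn_fst fun q hq => hq.1).prodMk contDiffOn_snd) fun q hq => ⟨h2 _ hq.1, hq.2⟩

/-- Families over spheres, inside a sheet, extend to families over balls. -/
theorem exists_filling {n : ℕ} {F : EuclideanSpace ℝ (Fin n) → Pair S B C} (hF : IsSmoothFamily (Metric.sphere 0 1) F)
    {m : ℤ} (hm : ∀ ξ ∈ Metric.sphere (0 : EuclideanSpace ℝ (Fin n)) 1, Fr.sheet (F ξ) = m) :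
    ∃ F' : EuclideanSpace ℝ (Fin n) → Pair S B C, IsSmoothFamily Set.univ F' ∧
      (∀ ξ ∈ Metric.sphere (0 : EuclideanSpace ℝ (Fin n)) 1, F' ξ = F ξ) ∧ ∀ ξ, Fr.sheet (F' ξ) = m := by
  obtain ⟨M, hM, hMa⟩ := Fr.exists_model
  obtain ⟨c₀, hc₀⟩ := exists_isConf (d := d) Fr.H.κ_pos
  have hr := isSmoothFamily_radial hF
  obtain ⟨R, hR⟩ : ∃ R : EuclideanSpace ℝ (Fin n) → Pair S B C, R = fun ξ => F (‖ξ‖⁻¹ • ξ) := ⟨_, rfl⟩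
  rw [← hR] at hr
  have ho : IsOpen ({0}ᶜ : Set (EuclideanSpace ℝ (Fin n))) := isOpen_compl_singleton
  have hRm : ∀ ξ ∈ ({0}ᶜ : Set (EuclideanSpace ℝ (Fin n))), Fr.sheet (R ξ) = m := fun ξ hξ => by
    rw [hR]
    exact hm _ (by rw [mem_sphere_zero_iff_norm, norm_smul, norm_inv, norm_norm,
      inv_mul_cancel₀ (norm_ne_zero_iff.2 hξ)])
  have hRs : ∀ ξ ∈ Metric.sphere (0 : EuclideanSpace ℝ (Fin n)) 1, R ξ = F ξ := fun ξ hξ => by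
    simp only [hR]
    rw [mem_sphere_zero_iff_norm.1 hξ, inv_one, one_smul]
  -- cutting off functions which are smooth away from the origin
  have cut : ∀ {f : EuclideanSpace ℝ (Fin n) → ℝ}, ContDiffOn ℝ ∞ f {0}ᶜ → ContDiff ℝ ∞ fun ξ => cutoff ξ * f ξ := by
    intro f hf
    refine contDiffOn_univ.1 (contDiffOn_cutoff contDiff_cutoff.contDiffOn fun ξ _ => ?_)
    rcases eq_or_ne ξ 0 with rfl | h
    · exact .inl (by rw [nhdsWithin_univ]; exact cutoff_eventually)
    · exact .inr (hf.contDiffAt (ho.mem_nhds h)).contDiffWithinAt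
  -- Configurations are moved to c₀ inside their convex set, and dilations are scaled to zero. Both
  -- are thus constant near the origin, where the radial family is undefined.
  let c : EuclideanSpace ℝ (Fin n) → Fin (d + 1) → ℝ := fun ξ k => cutoff ξ * Fr.conf (R ξ) k + (1 - cutoff ξ) * c₀ k
  let ρ : EuclideanSpace ℝ (Fin n) → Fin (d + 1) → ℝ := fun ξ k => cutoff ξ * Fr.dil (R ξ) k
  have hc : ∀ k, ContDiff ℝ ∞ fun ξ => c ξ k := fun k =>
    (cut (Fr.contDiffOn_conf ho hr hRm k)).add ((contDiff_const.sub contDiff_cutoff).mul contDiff_const)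
  have hρ : ∀ k, ContDiff ℝ ∞ fun ξ => ρ ξ k := fun k => cut (Fr.contDiffOn_dil ho hr k)
  have hcc : ∀ ξ, IsConf Fr.H.κ (c ξ) := fun ξ => by
    obtain ⟨h0, h1⟩ := cutoff_mem ξ
    exact IsConf.convex h0 (sub_nonneg.2 h1) (by ring) (Fr.isConf_conf (R ξ)) hc₀
  have hg : ContDiff ℝ ∞ fun ξ => Fr.starts m (c ξ) (ρ ξ) := contDiffOn_univ.1
    (Fr.contDiffOn_starts m (fun k => (hc k).contDiffOn) (fun k => (hρ k).contDiffOn) fun ξ _ => hcc ξ)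
  have hMg : ∀ {T : Set (EuclideanSpace ℝ (Fin n))} {g : EuclideanSpace ℝ (Fin n) → Fin (d + 1) → Cov},
      ContDiffOn ℝ ∞ g T → ContDiffOn ℝ ∞ (fun q : EuclideanSpace ℝ (Fin n) × (ℝ × ℝ) => M (g q.1, q.2)) (T ×ˢ S.cover) :=
    fun {T g} hg => hM.comp (f := fun q : EuclideanSpace ℝ (Fin n) × (ℝ × ℝ) => (g q.1, q.2))
      ((hg.comp contDiffOn_fst fun q hq => hq.1).prodMk contDiffOn_snd) fun q hq => ⟨trivial, hq.2⟩
  have hdiff : ContDiffOn ℝ ∞ (fun q : EuclideanSpace ℝ (Fin n) × (ℝ × ℝ) =>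
      Fr.dev (R q.1) q.2 - M (Fr.start (R q.1), q.2)) ({0}ᶜ ×ˢ S.cover) :=
    (Fr.contDiffOn_dev_of_isOpen ho hr).sub (hMg (contDiffOn_pi.2 fun j => Fr.contDiffOn_start ho hr j))
  -- The difference between the development and the model with the same starting values is periodic
  -- and vanishes on the ends. Multiplying it by the cutoff keeps these properties, so it can be
  -- added to another model.
  have hN : ContDiffOn ℝ ∞ (fun q : EuclideanSpace ℝ (Fin n) × (ℝ × ℝ) =>
      cutoff q.1 • (Fr.dev (R q.1) q.2 - M (Fr.start (R q.1), q.2))) (Set.univ ×ˢ S.cover) := by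
    refine contDiffOn_cutoff (contDiff_cutoff.comp contDiff_fst).contDiffOn fun q hq => ?_
    rcases eq_or_ne q.1 0 with h | h
    · refine .inl (Filter.Eventually.filter_mono nhdsWithin_le_nhds ?_)
      exact continuous_fst.continuousAt.eventually (h.symm ▸ cutoff_eventually)
    · refine .inr ((hdiff q ⟨h, hq.2⟩).mono_of_mem_nhdsWithin ?_)
      filter_upwards [self_mem_nhdsWithin, mem_nhdsWithin_of_mem_nhds ((ho.preimage continuous_fst).mem_nhds
        (show q ∈ Prod.fst ⁻¹' ({0}ᶜ : Set (EuclideanSpace ℝ (Fin n))) from h))] with r hr hr'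
      exact ⟨hr', hr.2⟩
  obtain ⟨F', hF', hF'd⟩ := Fr.exists_family ((hMg hg.contDiffOn).add hN) (g := fun ξ => Fr.starts m (c ξ) (ρ ξ))
    (x := fun ξ k => xof m (c ξ k)) (fun ξ => (hMa (Fr.starts m (c ξ) (ρ ξ))).add Fr (R := fun w => cutoff ξ •
      (Fr.dev (R ξ) w - M (Fr.start (R ξ), w)))
      (fun w hw => by
        have h1 := (hMa (Fr.start (R ξ))).shift w hw
        rw [h1, Fr.dev_sub _ hw, add_sub_add_right_eq_sub])
      (fun x hx => by
        have h1 := (hMa (Fr.start (R ξ))).int x hx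
        rw [h1, Fr.dev_Gi _ hx, sub_self, smul_zero])
      (fun j x hx => by
        have h1 := (hMa (Fr.start (R ξ))).strip j x hx
        rw [h1, Fr.dev_G _ j hx, sub_self, smul_zero]))
    (fun k => (contDiff_xof m).comp (hc k)) fun ξ => Fr.isLabelled_starts m (hcc ξ) _
  refine ⟨F', hF', fun ξ hξ => ?_, fun ξ => Fr.sheet_of_label (hF'd ξ).2⟩
  -- On the sphere the cutoff is one, so configurations, dilations and remainders are those of the
  -- given family, and `ext_pair` identifies the pairs.
  have h1 := cutoff_sphere (mem_sphere_zero_iff_norm.1 hξ)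
  have h2 : c ξ = Fr.conf (F ξ) := funext fun k => by
    simp only [c]; rw [h1, hRs ξ hξ]; ring
  have h3 : ρ ξ = Fr.dil (F ξ) := funext fun k => by
    simp only [ρ]; rw [h1, hRs ξ hξ, one_mul]
  refine Fr.ext_pair (fun w hw => ?_) ?_
  · rw [(hF'd ξ).1 hw]
    simp only []
    rw [h1, h2, h3, ← hm ξ hξ, Fr.starts_conf, hRs ξ hξ, one_smul, add_sub_cancel]
  · rw [(hF'd ξ).2]
    funext k
    rw [h2, Fr.label_eq, hm ξ hξ]

/-- The sheet, up to a constant, is a weak homotopy equivalence. -/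
theorem isWeakEquivInt {f : Pair S B C → ℤ} {k : ℤ} (hf : ∀ p, f p = Fr.sheet p + k) : IsWeakEquivInt f := by
  obtain rfl : f = fun p => Fr.sheet p + k := funext hf
  refine ⟨fun n U F hU hF => (Fr.continuousOn_sheet hU hF).add continuousOn_const, fun m => ?_, fun m n F hF hm => ?_⟩
  · obtain ⟨p, hp⟩ := Fr.sheet_surjective (m - k)
    exact ⟨p, by simp only [hp]; ring⟩
  · obtain ⟨F', h1, h2, h3⟩ := Fr.exists_filling hF (m := m - k) fun ξ hξ => by
      have := hm ξ hξ
      simp only [] at this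
      omega
    exact ⟨F', ⟨h1.1.mono (Set.prod_mono_left (Set.subset_univ _)), h1.2.mono (Set.prod_mono_left (Set.subset_univ _))⟩,
      h2, fun ξ _ => by simp only [h3]; ring⟩

end Frames

/-! ### The sheet map -/

namespace CircleFrame

variable (H : CircleFrame C)

/-- The points of the preimage of `(l_big, l_small)`. -/
def sheetPt (k : ℤ) (c : Set.Ioi (0 : ℝ)) : sheets C :=
  ⟨act (H.D 0) (xof k c), H.mem_sheets_iff.2 ⟨k, c, c.2, rfl⟩⟩

theorem exists_sheetPt (η : sheets C) : ∃ k c, H.sheetPt k c = η := by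
  have h : act (H.D 0) (act (ginv (H.D 0)) η) = η := act_act_ginv _ _
  obtain ⟨k, c, hc, hk⟩ := H.mem_sheets_iff.1 (h.symm ▸ η.2)
  exact ⟨k, ⟨c, hc⟩, Subtype.ext (by rw [← h, hk]; rfl)⟩

theorem mk_sheetPt (k : ℤ) (c c' : Set.Ioi (0 : ℝ)) :
    ConnectedComponents.mk (H.sheetPt k c) = ConnectedComponents.mk (H.sheetPt k c') := by
  have : PreconnectedSpace (Set.Ioi (0 : ℝ)) := Subtype.preconnectedSpace isPreconnected_Ioi
  have hc : Continuous (H.sheetPt k) :=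
    (continuous_act.comp (continuous_const.prodMk ((continuous_xof k).comp continuous_subtype_val))).subtype_mk _
  exact ConnectedComponents.coe_eq_coe'.2
    ((isPreconnected_range hc).subset_connectedComponent (Set.mem_range_self c') (Set.mem_range_self c))

theorem sheetPt_add_one (k : ℤ) (c : Set.Ioi (0 : ℝ)) :
    (H.sheetPt (k + 1) c : ℝ) = H.sheetPt k c + 2 * Real.pi := by
  simp only [sheetPt, xof_add_one, act_add_two_pi]

/-- Points of the same interval are joined by varying c, and consecutive intervals differ by 2π. So
a compatible labelling of the components is determined by its value on one of them. -/
theorem label_sheetPt (ι : ConnectedComponents (sheets C) ≃ ℤ) (hι : ∀ x y : sheets C, (y : ℝ) = x + 2 * Real.pi →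
    ι (ConnectedComponents.mk y) = ι (ConnectedComponents.mk x) + 1) :
    ∃ k₀ : ℤ, ∀ k c, ι (ConnectedComponents.mk (H.sheetPt k c)) = k + k₀ := by
  refine ⟨ι (ConnectedComponents.mk (H.sheetPt 0 ⟨1, Set.mem_Ioi.2 one_pos⟩)), fun k c => ?_⟩
  rw [H.mk_sheetPt k c ⟨1, Set.mem_Ioi.2 one_pos⟩]
  induction k with
  | zero => simp
  | succ n ih => rw [hι _ _ (H.sheetPt_add_one n _), ih]; ring
  | pred n ih =>
    have := hι _ _ (H.sheetPt_add_one (-n - 1) ⟨1, Set.mem_Ioi.2 one_pos⟩)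
    rw [sub_add_cancel, ih] at this
    omega

/-- The number of full turns, measured in the frame of the holonomy, is locally constant on the
preimage. Its fibres are connected intervals, so it induces a bijection on components. -/
theorem exists_labelling (H : CircleFrame C) : ∃ ι : ConnectedComponents (sheets C) ≃ ℤ, ∀ x y : sheets C, (y : ℝ) = x + 2 * Real.pi →
    ι (ConnectedComponents.mk y) = ι (ConnectedComponents.mk x) + 1 := by
  let f : sheets C → ℤ := fun η => ⌊act (ginv (H.D 0)) η / (2 * Real.pi)⌋
  have hf : ∀ k c, f (H.sheetPt k c) = k := fun k c => by
    simp only [f, sheetPt, act_ginv_act, floor_xof]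
  have hfc : Continuous f := continuous_iff_continuousAt.2 fun η => by
    obtain ⟨k, c, rfl⟩ := H.exists_sheetPt η
    have hc : Continuous fun η : sheets C => act (ginv (H.D 0)) η :=
      continuous_act.comp (continuous_const.prodMk continuous_subtype_val)
    have h1 : act (ginv (H.D 0)) (H.sheetPt k c) ∈ Set.Ioo (k * (2 * Real.pi)) (k * (2 * Real.pi) + 2 * Real.pi) := by
      simp only [sheetPt, act_ginv_act]; exact xof_mem k c
    refine (continuousAt_const (y := k)).congr ?_
    filter_upwards [hc.continuousAt.eventually (isOpen_Ioo.mem_nhds h1)] with η' h'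
    simp only [f]
    rw [← xof_cof h'.1 h'.2, floor_xof]
  have hb : Function.Bijective hfc.connectedComponentsLift := by
    constructor
    · intro x y hxy
      obtain ⟨x, rfl⟩ := ConnectedComponents.surjective_coe x
      obtain ⟨y, rfl⟩ := ConnectedComponents.surjective_coe y
      obtain ⟨k, c, rfl⟩ := H.exists_sheetPt x
      obtain ⟨k', c', rfl⟩ := H.exists_sheetPt y
      rw [hfc.connectedComponentsLift_apply_coe, hfc.connectedComponentsLift_apply_coe, hf, hf] at hxy
      subst hxy
      exact H.mk_sheetPt k c c'
    · exact fun k => ⟨ConnectedComponents.mk (H.sheetPt k ⟨1, Set.mem_Ioi.2 one_pos⟩),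
        (hfc.connectedComponentsLift_apply_coe _).trans (hf _ _)⟩
  refine ⟨Equiv.ofBijective _ hb, fun x y hxy => ?_⟩
  have h1 : f y = f x + 1 := by
    simp only [f, hxy]
    rw [act_add_two_pi, add_div, div_self Real.two_pi_pos.ne', Int.floor_add_one]
  exact (hfc.connectedComponentsLift_apply_coe y).trans (h1.trans
    (congrArg (· + 1) (hfc.connectedComponentsLift_apply_coe x).symm))

end CircleFrame

theorem exists_gap_zero {z : ℂ} (hz : z ∈ S.bdry0) : ∃ φ ∈ S.gap 0, bpt φ = z := by
  obtain ⟨φ, rfl, h1, h2, h3⟩ := hz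
  exact ⟨φ, ⟨h1, h2, fun j hj => h3 j hj.ne'⟩, rfl⟩

theorem mem_bdry0 {φ : ℝ} (h : φ ∈ S.gap 0) : bpt φ ∈ S.bdry0 :=
  ⟨φ, rfl, h.1, h.2.1, fun j hj => h.2.2 j (Fin.pos_iff_ne_zero.2 hj)⟩

/-- The holonomy around the interior end. -/
theorem isTransport_int (p : Pair S B C) {s : ℝ} (hs : 0 ≤ s) {g : Mat} {g' : ℝ → ℝ} (h : IsTransport C.a g g') :
    IsTransport (pullPath p.A fun t => S.εint (s, t)) g g' := by
  refine h.congr fun t ht => ?_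
  have h1 := (S.εint_smooth.differentiableOn (by simp) (s, t) ⟨hs, trivial⟩).hasFDerivWithinAt
  have h2 : HasDerivWithinAt (fun t : ℝ => ((s, t) : ℝ × ℝ)) (0, 1) (Set.Icc 0 1) t :=
    ((hasDerivAt_const t s).prodMk (hasDerivAt_id t)).hasDerivWithinAt
  have h3 : HasDerivWithinAt (fun t => S.εint (s, t)) (fderivWithin ℝ S.εint cylDom (s, t) (0, 1)) (Set.Icc 0 1) t :=
    h1.comp_hasDerivWithinAt t h2 fun t _ => ⟨hs, trivial⟩
  rw [pullPath, h3.derivWithin (uniqueDiffOn_Icc zero_lt_one t ht)]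
  exact ((p.end_int (s, t) ⟨hs, trivial⟩).2).symm

/-! ### Sheet maps for arbitrary choices. -/

namespace Frames

variable (Fr : Frames S B C)

theorem exists_lift_choice (K : SheetChoice S C) : ∃ (γ : ℝ → ℝ × ℝ) (φ : ℝ) (n : ℤ), φ ∈ S.gap 0 ∧ K.c 0 = bpt φ ∧
    ContDiffOn ℝ ∞ γ (Set.Icc 0 1) ∧ Set.MapsTo γ (Set.Icc 0 1) S.cover ∧
    (∀ t ∈ Set.Icc (0 : ℝ) 1, polar S.ζint (γ t) = K.c t) ∧ γ 0 = (1, φ) ∧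
    γ 1 = ((Fr.Gi (K.s, 0)).1, (Fr.Gi (K.s, 0)).2 + n * (2 * Real.pi)) := by
  obtain ⟨φ, hφ, hφc⟩ := exists_gap_zero K.c_zero
  have h0 : (0 : ℝ) ∈ Set.Icc (0 : ℝ) 1 := ⟨le_rfl, zero_le_one⟩
  have h1 : (1 : ℝ) ∈ Set.Icc (0 : ℝ) 1 := ⟨zero_le_one, le_rfl⟩
  obtain ⟨γ, hγ, hm, hp, hγ0⟩ := S.exists_lift ((convex_Icc (0 : ℝ) 1).starConvex h0) h0 K.c_smooth K.c_mem
    (w := (1, φ)) one_pos (by rw [polar_one, hφc])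
  have hs : ((K.s, 0) : ℝ × ℝ) ∈ cylDom := ⟨K.s_nonneg, trivial⟩
  obtain ⟨h2, n, h3⟩ := polar_inj S.ζint_mem (hm h1).1 (Fr.Gi_mapsTo hs).1
    (by rw [hp 1 h1, Fr.Gi_polar _ hs, K.c_one])
  exact ⟨γ, φ, n, hφ, hφc.symm, hγ, hm, hp, hγ0, Prod.ext h2 h3⟩

/-- Lift the path to the universal cover, starting in the gap of index zero. Its endpoint differs by
n turns from the lifted interior end, where the development is the frame of the holonomy times a
diagonal element. The first label is thereby sent to the interval of index sheet - n, with n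
depending only on the path. -/
theorem isSheetMap_iff (K : SheetChoice S C) :
    ∃ k : ℤ, ∀ f : Pair S B C → ℤ, IsSheetMap K f ↔ ∀ p, f p = Fr.sheet p + k := by
  obtain ⟨γ, φ, n, hφ, hφc, hγ, hm, hp, hγ0, hγ1⟩ := Fr.exists_lift_choice K
  obtain ⟨k₀, hk₀⟩ := Fr.H.label_sheetPt K.ι K.ι_shift
  have hs : ((K.s, 0) : ℝ × ℝ) ∈ cylDom := ⟨K.s_nonneg, trivial⟩
  have hpt : ∀ p : Pair S B C, ∃ c, act (gmul (Fr.dev p (γ 1)) (ginv (Fr.dev p (γ 0)))) (p.lam (K.c 0)) =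
      Fr.H.sheetPt (Fr.sheet p - n) c := fun p => by
    refine ⟨⟨Real.exp (2 * -(n * Fr.H.κ)) * Fr.conf p 0, mul_pos (Real.exp_pos _) (Fr.isConf_conf p).1⟩, ?_⟩
    have h1 : act (ginv (Fr.dev p (1, φ))) (p.lam (bpt φ)) = Fr.label p 0 := Fr.xhat_gap p hφ
    rw [act_gmul, hγ0, hφc, h1, hγ1, (Fr.isAdapted_dev p).add_int (Fr.Gi_mapsTo hs) n, Fr.dev_Gi p hs, act_gmul,
      Fr.label_eq, act_gdiag_xof]
    rfl
  have hval : ∀ (p : Pair S B C) (θ : ℝ), θ = act (gmul (Fr.dev p (γ 1)) (ginv (Fr.dev p (γ 0)))) (p.lam (K.c 0)) →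
      ∃ h : θ ∈ sheets C, K.ι (ConnectedComponents.mk ⟨θ, h⟩) = Fr.sheet p + (k₀ - n) := fun p θ hθ => by
    obtain ⟨c, hc⟩ := hpt p
    rw [hc] at hθ
    subst hθ
    exact ⟨Subtype.coe_prop _, (hk₀ _ c).trans (by ring)⟩
  refine ⟨k₀ - n, fun f => forall_congr' fun p => ⟨?_, fun h => ?_⟩⟩
  · rintro ⟨g, g', hT, h, hf⟩
    obtain ⟨-, rfl⟩ := Fr.eq_of_isTransport_path p hγ hm hp hT
    rw [hf]
    exact (hval p _ rfl).2
  · obtain ⟨h1, h2⟩ := hval p _ rfl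
    exact ⟨_, _, isTransport_path (Fr.isDev_dev p) hγ hm hp, h1, h.trans h2.symm⟩

/-- The path is the image of a segment in the cover, from a boundary point to the base point; it
stays in the cover because that is star-shaped about the base point. -/
theorem nonempty_sheetChoice (Fr : Frames S B C) : Nonempty (SheetChoice S C) := by
  obtain ⟨ι, hι⟩ := Fr.H.exists_labelling
  have hw : ((1, Fr.gapPt 0) : ℝ × ℝ) ∈ S.cover := S.mem_cover_one.2 (gap_subset 0 (Fr.gapPt_mem 0))
  exact ⟨{
    s := 0
    s_nonneg := le_rfl
    c := fun t => polar S.ζint (t • Fr.base + (1 - t) • ((1, Fr.gapPt 0) : ℝ × ℝ))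
    c_smooth := ((contDiff_polar _).comp (by fun_prop)).contDiffOn
    c_mem := fun t ht => S.polar_mem (Fr.starConvex hw ht.1 (sub_nonneg.2 ht.2) (by ring))
    c_zero := by
      rw [zero_smul, zero_add, sub_zero, one_smul, polar_one]
      exact mem_bdry0 (Fr.gapPt_mem 0)
    c_one := by
      rw [one_smul, sub_self, zero_smul, add_zero]
      exact Fr.Gi_polar _ zero_mem_cylDom
    ι := ι
    ι_shift := hι }⟩

end Frames

end FlatDisc

end

/-! ### The main theorem. -/

theorem mainTheorem1 (d : ℕ) (S : FlatDisc.PuncturedDisc d)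
    (B : Fin (d + 1) → FlatDisc.IntervalDatum) (τ : ℝ) (hτ : 2 < τ) (C : FlatDisc.CircleDatum τ) :
    -- the space of pairs is weakly homotopy equivalent to the discrete space of integers
    (∃ f : FlatDisc.Pair S B C → ℤ, FlatDisc.IsWeakEquivInt f) ∧
    -- the holonomy around the interior end is hyperbolic, with rotation number one, and is always
    -- that of the connection prescribed there
    (∀ p : FlatDisc.Pair S B C, ∀ s : ℝ, 0 ≤ s → ∃ (g : FlatDisc.Mat) (g' : ℝ → ℝ),
      FlatDisc.IsTransport (FlatDisc.pullPath p.A (fun t => S.εint (s, t))) g g' ∧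
      FlatDisc.IsTransport C.a g g' ∧ |g.trace| = τ ∧ FlatDisc.HasRotationNumber g' 1) ∧
    -- the sheet map is well defined, and is such a weak homotopy equivalence, for all choices
    Nonempty (FlatDisc.SheetChoice S C) ∧
    (∀ K : FlatDisc.SheetChoice S C, ∃! f : FlatDisc.Pair S B C → ℤ, FlatDisc.IsSheetMap K f) ∧
    (∀ (K : FlatDisc.SheetChoice S C) (f : FlatDisc.Pair S B C → ℤ),
      FlatDisc.IsSheetMap K f → FlatDisc.IsWeakEquivInt f) ∧
    -- up to adding a constant, the sheet map does not depend on the choices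
    (∀ (K K' : FlatDisc.SheetChoice S C) (f f' : FlatDisc.Pair S B C → ℤ),
      FlatDisc.IsSheetMap K f → FlatDisc.IsSheetMap K' f' →
      ∃ k : ℤ, ∀ p : FlatDisc.Pair S B C, f' p = f p + k) := by
  obtain ⟨Fr⟩ := FlatDisc.nonempty_frames S B hτ C
  refine ⟨⟨Fr.sheet, Fr.isWeakEquivInt (k := 0) fun p => (add_zero _).symm⟩, fun p s hs => ?_,
    Fr.nonempty_sheetChoice, fun K => ?_, fun K f hf => ?_, fun K K' f f' hf hf' => ?_⟩
  · obtain ⟨g, g', h, htr, hrot⟩ := C.holonomy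
    exact ⟨g, g', FlatDisc.isTransport_int p hs h, h, htr, hrot⟩
  · obtain ⟨k, hk⟩ := Fr.isSheetMap_iff K
    exact ⟨fun p => Fr.sheet p + k, (hk _).2 fun _ => rfl, fun f hf => funext ((hk f).1 hf)⟩
  · obtain ⟨k, hk⟩ := Fr.isSheetMap_iff K
    exact Fr.isWeakEquivInt ((hk f).1 hf)
  · obtain ⟨k, hk⟩ := Fr.isSheetMap_iff K
    obtain ⟨k', hk'⟩ := Fr.isSheetMap_iff K'
    exact ⟨k' - k, fun p => by rw [(hk f).1 hf p, (hk' f').1 hf' p]; ring⟩
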